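/- Let $X$ be a (Hausdorff, $\sigma$-compact, finite-dimensional) complex manifold, $R=C^\infty(X,\mathbb C)$, and $T_{\mathbb C}X=T^{1,0}_X\oplus T^{0,1}_X$. Write $A=\Omega^{0,\bullet}_X=\Gamma(\Lambda^\bullet (T^{0,1}_X)^\vee)$ for the algebra of functions on the dg manifold $(T^{0,1}_X[1],Q)$, $Q=\bar\partial$, let $\mathfrak X$ be the graded $A$-module of its vector fields (graded derivations of $A$), $\mathcal D$ its graded $A$-module of differential operators, and $\Gamma(S\,T)=S_A(\mathfrak X)$ the graded symmetric algebra. (a) Let $\nabla$ be a torsion-free affine connection on the graded manifold $T^{0,1}_X[1]$. There is a unique $A$-linear isomorphism $\mathrm{pbw}:S_A(\mathfrak X)\to\mathcal D$ with $\mathrm{pbw}(1)=1$ and, for homogeneous $X_i\in\mathfrak X$, $$\mathrm{pbw}(X_1\odot\cdots\odot X_n)=\frac1n\sum_{k=1}^n\varepsilon_k\bigl(X_k\cdot \mathrm{pbw}(X^{\{k\}})-\mathrm{pbw}(\nabla_{X_k}X^{\{k\}})\bigr),$$ where $X^{\{k\}}=X_1\odot\cdots\widehat{X_k}\cdots\odot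 X_n$ and $\varepsilon_k=(-1)^{|X_k|(|X_1|+\cdots+|X_{k-1}|)}$. Let $L_Q(D)=QD-(-1)^{|D|}DQ$ on $\mathcal D$, let $\mathrm{pr}_1$ be the projection onto $S^1$, and let $$\lambda_k(X_1,\dots,X_k)=\mathrm{pr}_1\bigl(\mathrm{pbw}^{-1}\circ L_Q\circ\mathrm{pbw}(X_1\odot\cdots\odot X_k)\bigr).$$ Then $(\lambda_k)_{k\ge1}$ is an $L_\infty[1]$ algebra structure on $\mathfrak X$ (the Kapranov $L_\infty[1]$ algebra), with $\lambda_1=[Q,\cdot]$. (b) Let $\mathcal D(X)$ be the algebra of linear differential operators on $R$ and $\mathcal D(B)=\mathcal D(X)/\mathcal D(X)\Gamma(T^{0,1}_X)$, a $T^{0,1}_X$-module by $v\cdot[u]=[v\circ u]$; let $d$ be the corresponding Chevalley–Eilenberg differential on $\Omega^{0,\bullet}_X\otimes_R\mathcal D(B)$. Let $\nabla^{1,0}$ be a torsion-free $T^{1,0}_X$-connection on $T^{1,0}_X$. There is a unique $R$-linear isomorphism $\overline{\mathrm{pbw}}:\Gamma(S\,T^{1,0}_X)\to\mathcal D(B)$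 with $\overline{\mathrm{pbw}}(1)=[1]$ and $$\overline{\mathrm{pbw}}(b_1\odot\cdots\odot b_n)=\frac1n\sum_{k=1}^n\bigl(b_k\cdot \overline{\mathrm{pbw}}(b^{\{k\}})-\overline{\mathrm{pbw}}(\nabla^{1,0}_{b_k}b^{\{k\}})\bigr),$$ where $b\cdot[u]=[b\circ u]$. The maps $$\bar\lambda_k(\omega_1,\dots,\omega_k)=\mathrm{pr}_1\bigl(\overline{\mathrm{pbw}}^{-1}\circ d\circ\overline{\mathrm{pbw}}(\omega_1\odot\cdots\odot\omega_k)\bigr)$$ ($\overline{\mathrm{pbw}}$ extended $\Omega^{0,\bullet}_X$-linearly) form an $L_\infty[1]$ algebra structure on the Dolbeault complex $\Omega^{0,\bullet}_X(T^{1,0}_X)$, with $\bar\lambda_1=\bar\partial$. (c) Let $\pi:T^{0,1}_X[1]\to X$ be the projection and, for $D\in\mathcal D$, let $\pi_*D\in\Omega^{0,\bullet}_X\otimes_R\mathcal D(X)$ be determined by $(\pi_*D)(f)=D(\pi^*f)$ for $f\in R$. For $k\ge1$ put $$\varphi_k(X_1,\dots,X_k)=\mathrm{pr}_1\bigl(\overline{\mathrm{pbw}}^{-1}[\pi_*\,\mathrm{pbw}(X_1\odot\cdots\odot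 X_k)]\bigr)\in\Omega^{0,\bullet}_X(T^{1,0}_X).$$ Then $(\varphi_k)_{k\ge1}$ is a quasi-isomorphism of $L_\infty[1]$ algebras from $(\mathfrak X,(\lambda_k))$ to $(\Omega^{0,\bullet}_X(T^{1,0}_X),(\bar\lambda_k))$, i.e. a morphism of $L_\infty[1]$ algebras whose linear part $\varphi_1$ induces an isomorphism $H(\mathfrak X,\lambda_1)\cong H(\Omega^{0,\bullet}_X(T^{1,0}_X),\bar\lambda_1)$. All $\varphi_k$ are $\Omega^{0,\bullet}_X$-multilinear (with Koszul signs), and $\varphi_1$ is the composite of $\pi_*:\mathfrak X\to\Omega^{0,\bullet}_X(T_{\mathbb C}X)$ with the projection $T_{\mathbb C}X\to T^{1,0}_X$. -/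

import Mathlib

set_option linter.unusedSectionVars false

noncomputable section

namespace KapranovDolbeault

/-! ### Differential forms along an involutive distribution -/

section Cochains

variable {R : Type*} [CommRing R] [Algebra ℂ R]
  {F : LieRinehartSubalgebra R (Derivation ℂ R R)}
  {M : Type*} [AddCommGroup M] [Module R M]

/-- The contraction `ι_v ω = ω(v, …)` of a function of tuples of sections. -/
def contract (v : F) (ω : List F → M) : List F → M := fun l => ω (v :: l)

/-- The parity involution `ω ↦ (-1)^k ω` on functions of `k` sections. -/
def parity (ω : List F → M) : List F → M := fun l => (-1 : ℤ) ^ l.length • ω l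

/-- A differential form along `F` with values in `M`, viewed as the family of its homogeneous
components: an alternating `R`-multilinear function of tuples of sections of `F`. (The family is
finite when `F` is the module of sections of a vector bundle of finite rank, since alternating
functions of more sections than the rank vanish.) -/
structure IsForm (ω : List F → M) : Prop where
  map_add : ∀ l₁ (v w : F) l₂,
    ω (l₁ ++ (v + w) :: l₂) = ω (l₁ ++ v :: l₂) + ω (l₁ ++ w :: l₂)
  map_smul : ∀ l₁ (f : R) (v : F) l₂, ω (l₁ ++ (f • v) :: l₂) = f • ω (l₁ ++ v :: l₂)
  alt : ∀ l₁ (v : F) l₂, ω (l₁ ++ v :: v :: l₂) = 0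

variable (F M) in
/-- The `R`-module of forms along `F` with values in `M`. -/
def formSubmodule : Submodule R (List F → M) where
  carrier := {ω | IsForm ω}
  zero_mem' := ⟨by simp, by simp, by simp⟩
  add_mem' := by
    rintro a b ha hb
    refine ⟨fun l₁ v w l₂ => ?_, fun l₁ f v l₂ => ?_, fun l₁ v l₂ => ?_⟩
    · simp only [Pi.add_apply, ha.map_add, hb.map_add]; abel
    · simp only [Pi.add_apply, ha.map_smul, hb.map_smul, smul_add]
    · simp only [Pi.add_apply, ha.alt, hb.alt, add_zero]
  smul_mem' := by
    rintro c a ha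
    refine ⟨fun l₁ v w l₂ => ?_, fun l₁ f v l₂ => ?_, fun l₁ v l₂ => ?_⟩
    · simp only [Pi.smul_apply, ha.map_add, smul_add]
    · simp only [Pi.smul_apply, ha.map_smul, smul_comm c f]
    · simp only [Pi.smul_apply, ha.alt, smul_zero]

variable (F M) in
/-- `Ω_F(M)`: forms along `F` with values in `M`. -/
def Form : Type _ := formSubmodule F M

instance : AddCommGroup (Form F M) := inferInstanceAs (AddCommGroup (formSubmodule F M))
instance : Module R (Form F M) := inferInstanceAs (Module R (formSubmodule F M))
instance : Module ℂ (Form F M) := Module.compHom _ (algebraMap ℂ R)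
instance : CoeFun (Form F M) (fun _ => List F → M) := ⟨fun ω => ω.1⟩

theorem Form.isForm (ω : Form F M) : IsForm (ω : List F → M) := ω.2

@[ext] theorem Form.ext {ω η : Form F M} (h : ∀ l, ω l = η l) : ω = η :=
  Subtype.ext (funext h)

@[simp] theorem Form.add_apply (ω η : Form F M) (l : List F) : (ω + η) l = ω l + η l := rfl
@[simp] theorem Form.zero_apply (l : List F) : (0 : Form F M) l = 0 := rfl
@[simp] theorem Form.neg_apply (ω : Form F M) (l : List F) : (-ω) l = -ω l := rfl
@[simp] theorem Form.sub_apply (ω η : Form F M) (l : List F) : (ω - η) l = ω l - η l := rfl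
@[simp] theorem Form.smul_apply (f : R) (ω : Form F M) (l : List F) : (f • ω) l = f • ω l := rfl
theorem Form.csmul_apply (c : ℂ) (ω : Form F M) (l : List F) :
    (c • ω) l = algebraMap ℂ R c • ω l := rfl

variable (F M) in
/-- Forms of degree `k`. -/
def formDeg (k : ℤ) : Submodule ℂ (Form F M) where
  carrier := {ω | ∀ l, (l.length : ℤ) ≠ k → ω l = 0}
  zero_mem' := by intro l _; rfl
  add_mem' := by intro a b ha hb l hl; simp [ha l hl, hb l hl]
  smul_mem' := by intro c a ha l hl; simp [Form.csmul_apply, ha l hl]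

theorem contract_add (v : F) (ω η : List F → M) :
    contract v (ω + η) = contract v ω + contract v η := rfl

theorem contract_parity (v : F) (ω : List F → M) :
    contract v (parity ω) = -parity (contract v ω) := by
  funext l
  simp [contract, parity, pow_succ]

theorem parity_contract (v : F) (ω : List F → M) :
    parity (contract v ω) = -contract v (parity ω) := by
  rw [contract_parity, neg_neg]

theorem parity_parity (ω : List F → M) : parity (parity ω) = ω := by
  funext l
  simp [parity, smul_smul, ← pow_add, ← two_mul]

theorem parity_add (ω η : List F → M) : parity (ω + η) = parity ω + parity η := by
  funext l; simp [parity]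

theorem parity_neg (ω : List F → M) : parity (-ω) = -parity ω := by
  funext l; simp [parity]

theorem IsForm.contract {ω : List F → M} (h : IsForm ω) (v : F) :
    IsForm (contract v ω) := by
  exact ⟨fun l₁ => h.map_add (v :: l₁), fun l₁ => h.map_smul (v :: l₁), fun l₁ => h.alt (v :: l₁)⟩

theorem IsForm.parity {ω : List F → M} (h : IsForm ω) : IsForm (parity ω) := by
  refine ⟨fun l₁ v w l₂ => ?_, fun l₁ f v l₂ => ?_, fun l₁ v l₂ => ?_⟩
  · simp [KapranovDolbeault.parity, h.map_add]
  · simp only [KapranovDolbeault.parity, h.map_smul]; rw [smul_comm f]; simp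
  · simp [KapranovDolbeault.parity, h.alt]

theorem IsForm.contract_add_arg {ω : List F → M} (h : IsForm ω) (v w : F) :
    KapranovDolbeault.contract (v + w) ω
      = KapranovDolbeault.contract v ω + KapranovDolbeault.contract w ω :=
  funext fun l => h.map_add [] v w l

theorem IsForm.contract_smul_arg {ω : List F → M} (h : IsForm ω) (f : R) (v : F) :
    KapranovDolbeault.contract (f • v) ω = f • KapranovDolbeault.contract v ω :=
  funext fun l => h.map_smul [] f v l

theorem IsForm.contract_self {ω : List F → M} (h : IsForm ω) (v : F) :
    KapranovDolbeault.contract v (KapranovDolbeault.contract v ω) = 0 :=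
  funext fun l => h.alt [] v l

theorem IsForm.swap {ω : List F → M} (h : IsForm ω) (v w : F) (l : List F) :
    ω (v :: w :: l) = -ω (w :: v :: l) := by
  have h1 := h.alt [] (v + w) l
  have h2 := h.map_add [] v w ((v + w) :: l)
  have h3 := h.map_add [v] v w l
  have h4 := h.map_add [w] v w l
  have h5 := h.alt [] v l
  have h6 := h.alt [] w l
  simp only [List.nil_append, List.cons_append] at *
  rw [h1, h3, h4, h5, h6] at h2
  rw [zero_add, add_zero] at h2
  exact eq_neg_of_add_eq_zero_left h2.symm

/-- The parity involution on forms. -/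
def Form.parity : Form F M →ₗ[ℂ] Form F M where
  toFun ω := ⟨KapranovDolbeault.parity ω, ω.isForm.parity⟩
  map_add' ω η := Subtype.ext (parity_add _ _)
  map_smul' c ω := by
    ext l
    change (-1 : ℤ) ^ l.length • (algebraMap ℂ R c • ω l)
      = algebraMap ℂ R c • ((-1 : ℤ) ^ l.length • ω l)
    rw [smul_comm]

/-- Post-composition of forms with an `R`-linear map of coefficients. -/
def Form.map {N : Type*} [AddCommGroup N] [Module R N] (g : M →ₗ[R] N) :
    Form F M →ₗ[ℂ] Form F N where
  toFun ω := ⟨fun l => g (ω l), by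
    exact ⟨fun l₁ v w l₂ => by rw [ω.isForm.map_add, _root_.map_add],
      fun l₁ f v l₂ => by rw [ω.isForm.map_smul, _root_.map_smul],
      fun l₁ v l₂ => by rw [ω.isForm.alt, map_zero]⟩⟩
  map_add' ω η := by ext l; exact _root_.map_add g _ _
  map_smul' c ω := by ext l; exact _root_.map_smul g _ _

end Cochains

/-! ### Wedge product -/

section Wedge

variable {R : Type*} [CommRing R] [Algebra ℂ R]
  {F : LieRinehartSubalgebra R (Derivation ℂ R R)}
  {M₁ M₂ M₃ M₄ M₁₂ M₂₃ : Type*} [AddCommGroup M₁] [Module R M₁] [AddCommGroup M₂] [Module R M₂]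
  [AddCommGroup M₃] [Module R M₃] [AddCommGroup M₄] [Module R M₄] [AddCommGroup M₁₂] [Module R M₁₂]
  [AddCommGroup M₂₃] [Module R M₂₃]

/-- The wedge product of forms along a bilinear pairing of coefficients, determined by
`ι_v (α ∧ β) = ι_v α ∧ β + (-1)^{|α|} α ∧ ι_v β`. Unfolded: the sum over all ways of splitting
a tuple into two subtuples, with the sign of the corresponding shuffle. -/
def wedge (B : M₁ →ₗ[R] M₂ →ₗ[R] M₃) : (List F → M₁) → (List F → M₂) → List F → M₃
  | α, β, [] => B (α []) (β [])
  | α, β, v :: l => wedge B (contract v α) β l + wedge B (parity α) (contract v β) l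

theorem contract_wedge (B : M₁ →ₗ[R] M₂ →ₗ[R] M₃) (v : F) (α : List F → M₁) (β : List F → M₂) :
    contract v (wedge B α β) = wedge B (contract v α) β + wedge B (parity α) (contract v β) := rfl

variable (B : M₁ →ₗ[R] M₂ →ₗ[R] M₃)

theorem wedge_add_left (α α' : List F → M₁) (β : List F → M₂) :
    wedge B (α + α') β = wedge B α β + wedge B α' β := by
  funext l
  induction l generalizing α α' β with
  | nil => simp [wedge]
  | cons v l ih =>
    simp only [wedge, contract_add, parity_add, ih, Pi.add_apply]; abel

theorem wedge_add_right (α : List F → M₁) (β β' : List F → M₂) :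
    wedge B α (β + β') = wedge B α β + wedge B α β' := by
  funext l
  induction l generalizing α β β' with
  | nil => simp [wedge]
  | cons v l ih =>
    simp only [wedge, contract_add, ih, Pi.add_apply]; abel

theorem wedge_smul_left (f : R) (α : List F → M₁) (β : List F → M₂) :
    wedge B (f • α) β = f • wedge B α β := by
  funext l
  induction l generalizing α β with
  | nil => simp [wedge]
  | cons v l ih =>
    have h1 : contract v (f • α) = f • contract v α := rfl
    have h2 : parity (f • α) = f • parity α := by
      funext l; simp only [parity, Pi.smul_apply]; rw [smul_comm]
    simp only [wedge, h1, h2, ih, Pi.smul_apply, smul_add]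

theorem wedge_smul_right (f : R) (α : List F → M₁) (β : List F → M₂) :
    wedge B α (f • β) = f • wedge B α β := by
  funext l
  induction l generalizing α β with
  | nil => simp [wedge]
  | cons v l ih =>
    have h1 : contract v (f • β) = f • contract v β := rfl
    simp only [wedge, h1, ih, Pi.smul_apply, smul_add]

theorem wedge_zero_left (β : List F → M₂) : wedge B (0 : List F → M₁) β = 0 := by
  simpa using wedge_smul_left B (0 : R) 0 β

theorem wedge_zero_right (α : List F → M₁) : wedge B α (0 : List F → M₂) = 0 := by
  simpa using wedge_smul_right B (0 : R) α 0

theorem wedge_neg_left (α : List F → M₁) (β : List F → M₂) :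
    wedge B (-α) β = -wedge B α β := by
  simpa using wedge_smul_left B (-1 : R) α β

theorem wedge_neg_right (α : List F → M₁) (β : List F → M₂) :
    wedge B α (-β) = -wedge B α β := by
  simpa using wedge_smul_right B (-1 : R) α β

theorem parity_wedge (α : List F → M₁) (β : List F → M₂) :
    parity (wedge B α β) = wedge B (parity α) (parity β) := by
  funext l
  induction l generalizing α β with
  | nil => simp [wedge, parity]
  | cons v l ih =>
    have h : parity (wedge B α β) (v :: l) = -parity (contract v (wedge B α β)) l := by
      simp [parity, contract, pow_succ]
    rw [h, contract_wedge, parity_add, wedge]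
    simp only [Pi.add_apply, ih, contract_parity, wedge_neg_left, wedge_neg_right, Pi.neg_apply]
    abel

theorem IsForm.wedge {α : List F → M₁} {β : List F → M₂} (hα : IsForm α) (hβ : IsForm β) :
    IsForm (wedge B α β) where
  map_add l₁ v w l₂ := by
    induction l₁ generalizing α β with
    | nil =>
      simp only [List.nil_append, KapranovDolbeault.wedge, hα.contract_add_arg,
        hβ.contract_add_arg, wedge_add_left, wedge_add_right, Pi.add_apply]
      abel
    | cons u l₁ ih =>
      simp only [List.cons_append, KapranovDolbeault.wedge]
      rw [ih (hα.contract u) hβ, ih hα.parity (hβ.contract u)]; abel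
  map_smul l₁ f v l₂ := by
    induction l₁ generalizing α β with
    | nil =>
      simp only [List.nil_append, KapranovDolbeault.wedge, hα.contract_smul_arg,
        hβ.contract_smul_arg, wedge_smul_left, wedge_smul_right, Pi.smul_apply, smul_add]
    | cons u l₁ ih =>
      simp only [List.cons_append, KapranovDolbeault.wedge]
      rw [ih (hα.contract u) hβ, ih hα.parity (hβ.contract u), smul_add]
  alt l₁ v l₂ := by
    induction l₁ generalizing α β with
    | nil =>
      simp only [List.nil_append, KapranovDolbeault.wedge, hα.contract_self, hβ.contract_self,
        contract_parity, parity_parity, wedge_neg_left, wedge_zero_left, wedge_zero_right,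
        Pi.zero_apply, Pi.neg_apply]
      abel
    | cons u l₁ ih =>
      simp only [List.cons_append, KapranovDolbeault.wedge]
      rw [ih (hα.contract u) hβ, ih hα.parity (hβ.contract u), add_zero]

theorem wedge_assoc (B₁ : M₁ →ₗ[R] M₂ →ₗ[R] M₁₂) (B₂ : M₁₂ →ₗ[R] M₃ →ₗ[R] M₄)
    (B₃ : M₂ →ₗ[R] M₃ →ₗ[R] M₂₃) (B₄ : M₁ →ₗ[R] M₂₃ →ₗ[R] M₄)
    (hB : ∀ x y z, B₂ (B₁ x y) z = B₄ x (B₃ y z))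
    (α : List F → M₁) (β : List F → M₂) (γ : List F → M₃) :
    wedge B₂ (wedge B₁ α β) γ = wedge B₄ α (wedge B₃ β γ) := by
  funext l
  induction l generalizing α β γ with
  | nil => simp [wedge, hB]
  | cons v l ih =>
    rw [wedge, wedge, contract_wedge, contract_wedge, parity_wedge, wedge_add_left,
      wedge_add_right]
    simp only [Pi.add_apply, ih]
    abel

/-- The function of tuples that is `m` on the empty tuple and zero otherwise. -/
def const (m : M₁) : List F → M₁
  | [] => m
  | _ :: _ => 0

theorem contract_const (v : F) (m : M₁) : contract v (const m : List F → M₁) = 0 := rfl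

theorem parity_const (m : M₁) : parity (const m : List F → M₁) = const m := by
  funext l
  cases l <;> simp [parity, const]

theorem isForm_const (m : M₁) : IsForm (const m : List F → M₁) := by
  refine ⟨?_, ?_, ?_⟩
  · intro l₁ v w l₂; cases l₁ <;> simp [const]
  · intro l₁ v w l₂; cases l₁ <;> simp [const]
  · intro l₁ v l₂; cases l₁ <;> simp [const]

theorem wedge_const_left (m : M₁) (β : List F → M₂) (l : List F) :
    wedge B (const m) β l = B m (β l) := by
  induction l generalizing β with
  | nil => rfl
  | cons v l ih =>
    rw [wedge, contract_const, wedge_zero_left, parity_const, ih]; simp [contract]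

theorem wedge_const_right (α : List F → M₁) (m : M₂) (l : List F) :
    wedge B α (const m) l = B (α l) m := by
  induction l generalizing α with
  | nil => rfl
  | cons v l ih =>
    rw [wedge, contract_const, wedge_zero_right, ih]; simp [contract]

/-- Forms of degree zero. -/
def Form.const (m : M₁) : Form F M₁ := ⟨KapranovDolbeault.const m, isForm_const m⟩

end Wedge

/-! ### The algebra of forms -/

section Algebra

variable {R : Type*} [CommRing R] [Algebra ℂ R]
  {F : LieRinehartSubalgebra R (Derivation ℂ R R)}
  {M : Type*} [AddCommGroup M] [Module R M]
  {C : Type*} [CommRing C] [Algebra R C]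

instance : Mul (Form F C) := ⟨fun α β => ⟨wedge (LinearMap.mul R C) α β, α.isForm.wedge _ β.isForm⟩⟩
instance : One (Form F C) := ⟨Form.const 1⟩

theorem Form.mul_val (α β : Form F C) :
    ((α * β : Form F C) : List F → C) = wedge (LinearMap.mul R C) α β := rfl

/-- Forms with values in a commutative `R`-algebra form a ring under the wedge product. -/
instance : Ring (Form F C) where
  __ := (inferInstance : AddCommGroup (Form F C))
  mul := (· * ·)
  one := 1
  left_distrib a b c := Subtype.ext (wedge_add_right _ _ _ _)
  right_distrib a b c := Subtype.ext (wedge_add_left _ _ _ _)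
  zero_mul a := Subtype.ext (wedge_zero_left _ _)
  mul_zero a := Subtype.ext (wedge_zero_right _ _)
  mul_assoc a b c := Subtype.ext (wedge_assoc _ _ _ _ (fun x y z => mul_assoc x y z) _ _ _)
  one_mul a := Form.ext fun l => (wedge_const_left _ _ _ _).trans (one_mul _)
  mul_one a := Form.ext fun l => (wedge_const_right _ _ _ _).trans (mul_one _)

instance : Algebra ℂ (Form F C) :=
  Algebra.ofModule
    (fun c _ _ => Subtype.ext (wedge_smul_left _ (algebraMap ℂ R c) _ _))
    (fun c _ _ => Subtype.ext (wedge_smul_right _ (algebraMap ℂ R c) _ _))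

instance : SMulCommClass ℂ (Form F C) (Form F C) := Algebra.to_smulCommClass
instance : IsScalarTower ℂ (Form F C) (Form F C) := IsScalarTower.right

/-- The wedge product `a ∧ ω` of a scalar form and a form with values in a module. -/
def Form.act (a : Form F R) (ω : Form F M) : Form F M :=
  ⟨wedge (LinearMap.lsmul R M) a ω, a.isForm.wedge _ ω.isForm⟩

end Algebra

/-! ### The Chevalley–Eilenberg differential -/

section Differential

variable {R : Type*} [CommRing R] [Algebra ℂ R]
  {F : LieRinehartSubalgebra R (Derivation ℂ R R)}

/-- An `F`-module structure on `M`: a flat `F`-connection. -/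
structure FModule (F : LieRinehartSubalgebra R (Derivation ℂ R R)) (M : Type*)
    [AddCommGroup M] [Module R M] where
  act : F → M → M
  act_add : ∀ v m m', act v (m + m') = act v m + act v m'
  add_act : ∀ v w m, act (v + w) m = act v m + act w m
  smul_act : ∀ (f : R) v m, act (f • v) m = f • act v m
  leibniz : ∀ v (f : R) m, act v (f • m) = ⁅v, f⁆ • m + f • act v m
  flat : ∀ v w m, act ⁅v, w⁆ m = act v (act w m) - act w (act v m)

variable {M : Type*} [AddCommGroup M] [Module R M]

theorem FModule.act_zero (ρ : FModule F M) (v : F) : ρ.act v 0 = 0 := by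
  simpa using ρ.act_add v 0 0

theorem FModule.act_neg (ρ : FModule F M) (v : F) (m : M) : ρ.act v (-m) = -ρ.act v m := by
  have := ρ.act_add v m (-m)
  rw [add_neg_cancel, ρ.act_zero] at this
  exact (neg_eq_of_add_eq_zero_right this.symm).symm

theorem lie_algebraMap (v : F) (c : ℂ) : ⁅v, algebraMap ℂ R c⁆ = 0 :=
  Derivation.map_algebraMap (v : Derivation ℂ R R) c

/-- The Lie derivative of forms:
`(L_v ω)(w₁, …, w_k) = v · ω(w₁, …, w_k) - ∑ ω(w₁, …, [v, w_j], …, w_k)`. -/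
def lieDer (ρ : FModule F M) (v : F) : (List F → M) → List F → M
  | ω, [] => ρ.act v (ω [])
  | ω, w :: l => lieDer ρ v (contract w ω) l - ω (⁅v, w⁆ :: l)

/-- The Chevalley–Eilenberg differential, determined by Cartan's formula
`ι_v d = L_v - d ι_v`. Unfolded this is the usual formula
`(dω)(v₀, …, v_k) = ∑ᵢ (-1)ⁱ vᵢ · ω(…, v̂ᵢ, …)
  + ∑_{i<j} (-1)^{i+j} ω([vᵢ, vⱼ], …, v̂ᵢ, …, v̂ⱼ, …)`. -/
def ceDiff (ρ : FModule F M) : (List F → M) → List F → M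
  | _, [] => 0
  | ω, v :: l => lieDer ρ v ω l - ceDiff ρ (contract v ω) l

/-- The product `df ∧ ω`. -/
def dWedge (f : R) : (List F → M) → List F → M
  | _, [] => 0
  | ω, v :: l => ⁅v, f⁆ • ω l - dWedge f (contract v ω) l

variable (ρ : FModule F M)

theorem lieDer_add (v : F) (ω η : List F → M) :
    lieDer ρ v (ω + η) = lieDer ρ v ω + lieDer ρ v η := by
  funext l
  induction l generalizing ω η with
  | nil => simp [lieDer, ρ.act_add]
  | cons w l ih => simp only [lieDer, contract_add, ih, Pi.add_apply]; abel

theorem lieDer_smul (v : F) (f : R) (ω : List F → M) :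
    lieDer ρ v (f • ω) = ⁅v, f⁆ • ω + f • lieDer ρ v ω := by
  funext l
  induction l generalizing ω with
  | nil => simp [lieDer, ρ.leibniz]
  | cons w l ih =>
    have h1 : contract w (f • ω) = f • contract w ω := rfl
    simp only [lieDer, h1, ih, Pi.add_apply, Pi.smul_apply, smul_sub, contract]; abel

theorem lieDer_zero (v : F) : lieDer ρ v (0 : List F → M) = 0 := by
  simpa using lieDer_add ρ v 0 0

theorem lieDer_neg (v : F) (ω : List F → M) : lieDer ρ v (-ω) = -lieDer ρ v ω := by
  have h := lieDer_add ρ v ω (-ω)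
  rw [add_neg_cancel, lieDer_zero] at h
  exact (neg_eq_of_add_eq_zero_right h.symm).symm

theorem contract_lieDer (v w : F) (ω : List F → M) :
    contract w (lieDer ρ v ω) = lieDer ρ v (contract w ω) - contract ⁅v, w⁆ ω := rfl

theorem IsForm.lieDer {ω : List F → M} (h : IsForm ω) (u : F) : IsForm (lieDer ρ u ω) where
  map_add l₁ v w l₂ := by
    induction l₁ generalizing ω with
    | nil =>
      simp only [List.nil_append, KapranovDolbeault.lieDer, h.contract_add_arg, lieDer_add,
        Pi.add_apply, lie_add]
      have := h.map_add [] ⁅u, v⁆ ⁅u, w⁆ l₂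
      simp only [List.nil_append] at this
      rw [this]; abel
    | cons x l₁ ih =>
      simp only [List.cons_append, KapranovDolbeault.lieDer]
      rw [ih (h.contract x)]
      have := h.map_add (⁅u, x⁆ :: l₁) v w l₂
      simp only [List.cons_append] at this
      rw [this]; abel
  map_smul l₁ f v l₂ := by
    induction l₁ generalizing ω with
    | nil =>
      simp only [List.nil_append, KapranovDolbeault.lieDer, h.contract_smul_arg, lieDer_smul,
        Pi.add_apply, Pi.smul_apply, LieRinehartRing.leibniz_smul_right]
      have h1 := h.map_add [] (f • ⁅u, v⁆) (⁅u, f⁆ • v) l₂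
      have h2 := h.map_smul [] f ⁅u, v⁆ l₂
      have h3 := h.map_smul [] ⁅u, f⁆ v l₂
      simp only [List.nil_append] at h1 h2 h3
      rw [h1, h2, h3, smul_sub]; simp only [KapranovDolbeault.contract]; abel
    | cons x l₁ ih =>
      simp only [List.cons_append, KapranovDolbeault.lieDer]
      rw [ih (h.contract x)]
      have := h.map_smul (⁅u, x⁆ :: l₁) f v l₂
      simp only [List.cons_append] at this
      rw [this, smul_sub]
  alt l₁ v l₂ := by
    induction l₁ generalizing ω with
    | nil =>
      simp only [List.nil_append, KapranovDolbeault.lieDer, h.contract_self, lieDer_zero,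
        KapranovDolbeault.contract, Pi.zero_apply]
      rw [h.swap v]; abel
    | cons x l₁ ih =>
      simp only [List.cons_append, KapranovDolbeault.lieDer]
      rw [ih (h.contract x)]
      have := h.alt (⁅u, x⁆ :: l₁) v l₂
      simp only [List.cons_append] at this
      rw [this, sub_zero]

theorem ceDiff_add (ω η : List F → M) : ceDiff ρ (ω + η) = ceDiff ρ ω + ceDiff ρ η := by
  funext l
  induction l generalizing ω η with
  | nil => simp [ceDiff]
  | cons v l ih => simp only [ceDiff, contract_add, lieDer_add, ih, Pi.add_apply]; abel

theorem ceDiff_zero : ceDiff ρ (0 : List F → M) = 0 := by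
  simpa using ceDiff_add ρ 0 0

theorem ceDiff_neg (ω : List F → M) : ceDiff ρ (-ω) = -ceDiff ρ ω := by
  have h := ceDiff_add ρ ω (-ω)
  rw [add_neg_cancel, ceDiff_zero] at h
  exact (neg_eq_of_add_eq_zero_right h.symm).symm

theorem dWedge_neg (f : R) (ω : List F → M) : dWedge f (-ω) = -dWedge f ω := by
  funext l
  induction l generalizing ω with
  | nil => simp [dWedge]
  | cons v l ih =>
    have h1 : contract v (-ω) = -contract v ω := rfl
    simp only [dWedge, h1, ih, Pi.neg_apply, smul_neg]; abel

theorem ceDiff_smul (f : R) (ω : List F → M) :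
    ceDiff ρ (f • ω) = dWedge f ω + f • ceDiff ρ ω := by
  funext l
  induction l generalizing ω with
  | nil => simp [ceDiff, dWedge]
  | cons v l ih =>
    have h1 : contract v (f • ω) = f • contract v ω := rfl
    simp only [ceDiff, dWedge, h1, lieDer_smul, ih, Pi.add_apply, Pi.smul_apply, smul_sub]
    abel

theorem lieDer_smul_arg {ω : List F → M} (h : IsForm ω) (f : R) (v : F) :
    lieDer ρ (f • v) ω = f • lieDer ρ v ω + dWedge f (contract v ω) := by
  funext l
  induction l generalizing ω with
  | nil => simp [lieDer, dWedge, ρ.smul_act]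
  | cons w l ih =>
    have hsw : contract v (contract w ω) = -contract w (contract v ω) :=
      funext fun l => h.swap w v l
    have hb : ⁅f • v, w⁆ = f • ⁅v, w⁆ + (-⁅w, f⁆) • v := by
      rw [← lie_skew (f • v) w, LieRinehartRing.leibniz_smul_right, ← lie_skew v w]
      simp only [smul_neg, neg_add, neg_smul]
    have h1 := h.map_add [] (f • ⁅v, w⁆) ((-⁅w, f⁆) • v) l
    have h2 := h.map_smul [] f ⁅v, w⁆ l
    have h3 := h.map_smul [] (-⁅w, f⁆) v l
    simp only [List.nil_append] at h1 h2 h3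
    have h4 : ω (⁅f • v, w⁆ :: l) = f • ω (⁅v, w⁆ :: l) - ⁅w, f⁆ • ω (v :: l) := by
      rw [hb, h1, h2, h3, neg_smul, ← sub_eq_add_neg]
    simp only [lieDer, dWedge, ih (h.contract w), h4, hsw, dWedge_neg, Pi.add_apply,
      Pi.smul_apply, Pi.neg_apply, smul_sub]
    simp only [contract]
    abel

theorem IsForm.lieDer_add_arg {ω : List F → M} (h : IsForm ω) (v w : F) :
    KapranovDolbeault.lieDer ρ (v + w) ω
      = KapranovDolbeault.lieDer ρ v ω + KapranovDolbeault.lieDer ρ w ω := by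
  funext l
  induction l generalizing ω with
  | nil => simp [KapranovDolbeault.lieDer, ρ.add_act]
  | cons x l ih =>
    have h1 := h.map_add [] ⁅v, x⁆ ⁅w, x⁆ l
    simp only [List.nil_append] at h1
    simp only [KapranovDolbeault.lieDer, ih (h.contract x), add_lie, h1, Pi.add_apply]
    abel

theorem IsForm.ceDiff {ω : List F → M} (h : IsForm ω) : IsForm (ceDiff ρ ω) where
  map_add l₁ v w l₂ := by
    induction l₁ generalizing ω with
    | nil =>
      simp only [List.nil_append, KapranovDolbeault.ceDiff, h.contract_add_arg,
        h.lieDer_add_arg, ceDiff_add, Pi.add_apply]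
      abel
    | cons x l₁ ih =>
      simp only [List.cons_append, KapranovDolbeault.ceDiff]
      rw [ih (h.contract x), (h.lieDer ρ x).map_add]; abel
  map_smul l₁ f v l₂ := by
    induction l₁ generalizing ω with
    | nil =>
      simp only [List.nil_append, KapranovDolbeault.ceDiff, h.contract_smul_arg,
        lieDer_smul_arg ρ h, ceDiff_smul, Pi.add_apply, Pi.smul_apply, smul_sub]
      abel
    | cons x l₁ ih =>
      simp only [List.cons_append, KapranovDolbeault.ceDiff]
      rw [ih (h.contract x), (h.lieDer ρ x).map_smul, smul_sub]
  alt l₁ v l₂ := by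
    induction l₁ generalizing ω with
    | nil =>
      have h1 := h.map_smul [] (0 : R) 0 l₂
      simp only [List.nil_append, zero_smul] at h1
      simp only [List.nil_append, KapranovDolbeault.ceDiff, KapranovDolbeault.lieDer,
        h.contract_self, ceDiff_zero, lie_self, Pi.zero_apply, h1]
      abel
    | cons x l₁ ih =>
      simp only [List.cons_append, KapranovDolbeault.ceDiff]
      rw [ih (h.contract x), (h.lieDer ρ x).alt, sub_zero]

theorem dWedge_const (c : ℂ) (ω : List F → M) : dWedge (algebraMap ℂ R c) ω = 0 := by
  funext l
  induction l generalizing ω with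
  | nil => rfl
  | cons v l ih => rw [dWedge, lie_algebraMap, ih]; simp

/-- The Chevalley–Eilenberg differential on `Ω_F(M)`. -/
def FModule.d : Form F M →ₗ[ℂ] Form F M where
  toFun ω := ⟨ceDiff ρ ω, ω.isForm.ceDiff ρ⟩
  map_add' ω η := Subtype.ext (ceDiff_add ρ _ _)
  map_smul' c ω := Subtype.ext (by
    change ceDiff ρ (algebraMap ℂ R c • (ω : List F → M)) = _
    rw [ceDiff_smul, dWedge_const, zero_add]; rfl)

variable (F) in
/-- The tautological action of `F` on functions. -/
def FModule.functions : FModule F R where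
  act v f := ⁅v, f⁆
  act_add v := lie_add v
  add_act v w m := add_lie v w m
  smul_act f v m := LieRinehartRing.lie_smul_eq_mul f m v
  leibniz v f m := by
    have := LieRinehartRing.leibniz_mul_right v f m
    simp only [smul_eq_mul] at this ⊢
    rw [this, add_comm]
  flat v w m := lie_lie v w m

theorem parity_lieDer (v : F) (ω : List F → M) :
    lieDer ρ v (parity ω) = parity (lieDer ρ v ω) := by
  funext l
  induction l generalizing ω with
  | nil => simp [lieDer, parity]
  | cons w l ih =>
    have h : parity (lieDer ρ v ω) (w :: l) = -parity (contract w (lieDer ρ v ω)) l := by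
      simp [parity, contract, pow_succ]
    rw [h, contract_lieDer, lieDer, contract_parity, lieDer_neg, Pi.neg_apply, ih]
    simp [parity, contract, pow_succ, smul_sub]
    abel

theorem parity_ceDiff (ω : List F → M) :
    ceDiff ρ (parity ω) = -parity (ceDiff ρ ω) := by
  funext l
  induction l generalizing ω with
  | nil => simp [ceDiff, parity]
  | cons w l ih =>
    rw [ceDiff, contract_parity, parity_lieDer, ceDiff_neg, Pi.neg_apply, ih]
    simp only [parity, ceDiff, Pi.neg_apply, List.length_cons, pow_succ, smul_sub]
    simp
    abel

/-- The Lie derivative is a derivation of the wedge product of scalar forms. -/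
theorem lieDer_wedge (v : F) (α β : List F → R) :
    lieDer (.functions F) v (wedge (LinearMap.mul R R) α β)
      = wedge (LinearMap.mul R R) (lieDer (.functions F) v α) β
        + wedge (LinearMap.mul R R) α (lieDer (.functions F) v β) := by
  funext l
  induction l generalizing α β with
  | nil =>
    have := LieRinehartRing.leibniz_mul_right v (α []) (β [])
    simp only [smul_eq_mul] at this
    simp only [lieDer, wedge, FModule.functions, LinearMap.mul_apply', Pi.add_apply, this]
    rw [add_comm]
  | cons w l ih =>
    simp only [lieDer, contract_wedge, lieDer_add, Pi.add_apply, ih, contract_lieDer, wedge,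
      parity_lieDer, sub_eq_add_neg, wedge_add_left, wedge_add_right, wedge_neg_left,
      wedge_neg_right, Pi.neg_apply]
    abel

/-- The differential is an antiderivation of the wedge product of scalar forms. -/
theorem ceDiff_wedge (α β : List F → R) :
    ceDiff (.functions F) (wedge (LinearMap.mul R R) α β)
      = wedge (LinearMap.mul R R) (ceDiff (.functions F) α) β
        + wedge (LinearMap.mul R R) (parity α) (ceDiff (.functions F) β) := by
  funext l
  induction l generalizing α β with
  | nil => simp [ceDiff, wedge]
  | cons v l ih =>
    have hc : ∀ γ : List F → R, contract v (ceDiff (.functions F) γ)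
        = lieDer (.functions F) v γ - ceDiff (.functions F) (contract v γ) := fun _ => rfl
    simp only [ceDiff, contract_wedge, lieDer_wedge, ceDiff_add, Pi.add_apply, ih, wedge, hc,
      contract_parity, parity_ceDiff, parity_parity, sub_eq_add_neg, wedge_add_left,
      wedge_add_right, wedge_neg_left, wedge_neg_right, Pi.neg_apply]
    abel

end Differential

/-! ### The dg manifold `(F[1], d_F)`: its functions are the scalar forms -/

section GradedManifold

variable {R : Type*} [CommRing R] [Algebra ℂ R]

theorem csmul_mul {F : LieRinehartSubalgebra R (Derivation ℂ R R)} (t : ℂ) (a b : Form F R) :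
    t • a * b = t • (a * b) := smul_mul_assoc t a b

theorem mul_csmul {F : LieRinehartSubalgebra R (Derivation ℂ R R)} (t : ℂ) (a b : Form F R) :
    a * t • b = t • (a * b) := mul_smul_comm t a b

/-- The sign `(-1)^n`. -/
def sgn (n : ℤ) : ℤ := (n.negOnePow : ℤ)

variable {F : LieRinehartSubalgebra R (Derivation ℂ R R)}

theorem sgn_eq (n : ℕ) : sgn (n : ℤ) = (-1) ^ n := by
  simp [sgn, Int.negOnePow_def]

theorem sgn_add (m n : ℤ) : sgn (m + n) = sgn m * sgn n := by
  simp [sgn, Int.negOnePow_add]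

theorem sgn_mul_self (n : ℤ) : sgn n * sgn n = 1 := by
  rw [sgn, ← Units.val_mul, ← Int.negOnePow_add, Int.negOnePow_even _ ⟨n, rfl⟩, Units.val_one]

theorem parity_of_mem {k : ℤ} {a : Form F R} (ha : a ∈ formDeg F R k) :
    Form.parity a = sgn k • a := by
  ext l
  change (-1 : ℤ) ^ l.length • a l = sgn k • a l
  by_cases h : (l.length : ℤ) = k
  · rw [← h, sgn_eq]
  · rw [ha l h]; simp

theorem parity_mul (a b : Form F R) :
    Form.parity (a * b) = Form.parity a * Form.parity b :=
  Subtype.ext (parity_wedge _ _ _)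

theorem parity_parity_form (a : Form F R) : Form.parity (Form.parity a) = a :=
  Subtype.ext (parity_parity _)

theorem parity_mem {k : ℤ} {a : Form F R} (ha : a ∈ formDeg F R k) :
    Form.parity a ∈ formDeg F R k := by
  intro l hl
  change (-1 : ℤ) ^ l.length • a l = 0
  rw [ha l hl, smul_zero]

variable (F) in
/-- The homological vector field `d_F`. -/
def dF : Module.End ℂ (Form F R) := (FModule.functions F).d

theorem dF_mul (a b : Form F R) : dF F (a * b) = dF F a * b + Form.parity a * dF F b :=
  Subtype.ext (ceDiff_wedge _ _)

theorem dF_parity (a : Form F R) : dF F (Form.parity a) = -Form.parity (dF F a) :=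
  Subtype.ext (parity_ceDiff _ _)

variable (F) in
/-- The operator `ω ↦ (-1)^{d|ω|} ω`. -/
def parityPow (d : ℤ) : Module.End ℂ (Form F R) := if Even d then LinearMap.id else Form.parity

theorem parityPow_of_mem (d : ℤ) {k : ℤ} {a : Form F R} (ha : a ∈ formDeg F R k) :
    parityPow F d a = sgn (d * k) • a := by
  unfold parityPow
  split_ifs with h
  · rw [sgn, Int.negOnePow_even _ (h.mul_right k)]; simp
  · have hk : sgn (d * k) = sgn k := by
      obtain ⟨m, rfl⟩ := Int.not_even_iff_odd.mp h
      rw [show (2 * m + 1) * k = m * k + m * k + k by ring, sgn_add, sgn_add, sgn_mul_self, one_mul]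
    rw [hk, parity_of_mem ha]

variable (F)

/-- Graded derivations of degree `d` of the algebra of functions, that is operators of degree `d`
with `X(ab) = X(a) b + (-1)^{d|a|} a X(b)`: the vector fields of degree `d` on `F[1]`. -/
def derDeg (d : ℤ) : Submodule ℂ (Module.End ℂ (Form F R)) where
  carrier := {X | (∀ k, ∀ a ∈ formDeg F R k, X a ∈ formDeg F R (d + k)) ∧
    ∀ a b, X (a * b) = X a * b + parityPow F d a * X b}
  zero_mem' := ⟨fun _ _ _ => Submodule.zero_mem _, fun _ _ => by simp⟩
  add_mem' := by
    rintro X Y ⟨h1, h2⟩ ⟨h3, h4⟩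
    refine ⟨fun k a ha => Submodule.add_mem _ (h1 k a ha) (h3 k a ha), fun a b => ?_⟩
    simp only [LinearMap.add_apply, h2 a b, h4 a b, add_mul, mul_add]; abel
  smul_mem' := by
    rintro c X ⟨h1, h2⟩
    refine ⟨fun k a ha => Submodule.smul_mem _ c (h1 k a ha), fun a b => ?_⟩
    simp only [LinearMap.smul_apply, h2 a b, smul_add, csmul_mul, mul_csmul]

/-- The module `𝔛(F[1])` of vector fields: finite sums of homogeneous graded derivations. -/
def vectorFields : Submodule (Form F R) (Module.End ℂ (Form F R)) :=
  Submodule.span (Form F R) {X | ∃ d, X ∈ derDeg F d}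

/-- The type of vector fields on `F[1]`. -/
abbrev VF : Type _ := vectorFields F

/-- Vector fields of degree `d`. -/
def vfDeg (d : ℤ) : Submodule ℂ (VF F) :=
  (derDeg F d).comap ((vectorFields F).subtype.restrictScalars ℂ)

variable {F}

/-! #### Symmetric powers of the tangent bundle -/

variable (F) in
/-- The relations defining the graded symmetric algebra over the graded commutative algebra of
functions of the module of vector fields. -/
inductive SymRel : TensorAlgebra ℂ (Form F R × VF F) → TensorAlgebra ℂ (Form F R × VF F) → Prop
  | one : SymRel (TensorAlgebra.ι ℂ (1, 0)) 1
  | mul (a b : Form F R) : SymRel (TensorAlgebra.ι ℂ (a, 0) * TensorAlgebra.ι ℂ (b, 0))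
      (TensorAlgebra.ι ℂ (a * b, 0))
  | smul (a : Form F R) (X : VF F) :
      SymRel (TensorAlgebra.ι ℂ (a, 0) * TensorAlgebra.ι ℂ (0, X)) (TensorAlgebra.ι ℂ (0, a • X))
  | comm_fun (d k : ℤ) (X : VF F) (a : Form F R) (hX : X ∈ vfDeg F d) (ha : a ∈ formDeg F R k) :
      SymRel (TensorAlgebra.ι ℂ (0, X) * TensorAlgebra.ι ℂ (a, 0))
        (sgn (d * k) • (TensorAlgebra.ι ℂ (a, 0) * TensorAlgebra.ι ℂ (0, X)))
  | comm (d e : ℤ) (X Y : VF F) (hX : X ∈ vfDeg F d) (hY : Y ∈ vfDeg F e) :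
      SymRel (TensorAlgebra.ι ℂ (0, X) * TensorAlgebra.ι ℂ (0, Y))
        (sgn (d * e) • (TensorAlgebra.ι ℂ (0, Y) * TensorAlgebra.ι ℂ (0, X)))

variable (F) in
/-- `Γ(S(T_{F[1]}))`: the graded symmetric algebra of `𝔛(F[1])` over the functions on `F[1]`. -/
def SymVF : Type _ := RingQuot (SymRel F)

instance : Ring (SymVF F) := inferInstanceAs (Ring (RingQuot (SymRel F)))
instance : Algebra ℂ (SymVF F) := inferInstanceAs (Algebra ℂ (RingQuot (SymRel F)))

/-- The generators of the symmetric algebra. -/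
def SymVF.gen : Form F R × VF F →ₗ[ℂ] SymVF F :=
  (RingQuot.mkAlgHom ℂ (SymRel F)).toLinearMap ∘ₗ TensorAlgebra.ι ℂ

/-- Functions in the symmetric algebra. -/
def SymVF.ofFun : Form F R →ₗ[ℂ] SymVF F := SymVF.gen ∘ₗ LinearMap.inl ℂ _ _

/-- Vector fields in the symmetric algebra. -/
def SymVF.ofVF : VF F →ₗ[ℂ] SymVF F := SymVF.gen ∘ₗ LinearMap.inr ℂ _ _

theorem rightMul_mem (X : VF F) (b : Form F R) :
    (X : Module.End ℂ (Form F R)) * LinearMap.mulLeft ℂ b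
      - LinearMap.mulLeft ℂ ((X : Module.End ℂ (Form F R)) b) ∈ vectorFields F := by
  obtain ⟨X, hX⟩ := X
  change X * LinearMap.mulLeft ℂ b - LinearMap.mulLeft ℂ (X b) ∈ vectorFields F
  induction hX using Submodule.span_induction with
  | zero =>
    have : (0 : Module.End ℂ (Form F R)) * LinearMap.mulLeft ℂ b
        - LinearMap.mulLeft ℂ ((0 : Module.End ℂ (Form F R)) b) = 0 := by ext; simp
    rw [this]; exact Submodule.zero_mem _
  | add X Y _ _ hX hY =>
    have : (X + Y) * LinearMap.mulLeft ℂ b - LinearMap.mulLeft ℂ ((X + Y) b)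
        = (X * LinearMap.mulLeft ℂ b - LinearMap.mulLeft ℂ (X b))
          + (Y * LinearMap.mulLeft ℂ b - LinearMap.mulLeft ℂ (Y b)) := by
      ext1 c; simp [add_mul]; abel
    rw [this]; exact Submodule.add_mem _ hX hY
  | smul a X _ hX =>
    have : (a • X) * LinearMap.mulLeft ℂ b - LinearMap.mulLeft ℂ ((a • X) b)
        = a • (X * LinearMap.mulLeft ℂ b - LinearMap.mulLeft ℂ (X b)) := by
      ext1 c; simp [mul_sub]
    rw [this]; exact Submodule.smul_mem _ _ hX
  | mem X hX =>
    obtain ⟨d, hd⟩ := hX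
    have : X * LinearMap.mulLeft ℂ b - LinearMap.mulLeft ℂ (X b) = parityPow F d b • X := by
      ext1 c; simp [hd.2 b c]
    rw [this]; exact Submodule.smul_mem _ _ (Submodule.subset_span ⟨d, hd⟩)

/-- The graded right multiplication `X · b = (-1)^{|X||b|} b X` of a vector field by a function. -/
def rightMul (X : VF F) (b : Form F R) : VF F := ⟨_, rightMul_mem X b⟩

theorem rightMul_val (X : VF F) (b : Form F R) :
    (rightMul X b : Module.End ℂ (Form F R)) = (X : Module.End ℂ (Form F R)) * LinearMap.mulLeft ℂ b
      - LinearMap.mulLeft ℂ ((X : Module.End ℂ (Form F R)) b) := rfl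

/-- The action of the generators of the symmetric algebra on its quotient
`S^{≤ 1} = C^∞ ⊕ 𝔛`. -/
def genAct : Form F R × VF F →ₗ[ℂ] Module.End ℂ (Form F R × VF F) :=
  LinearMap.mk₂ ℂ (fun g m => (g.1 * m.1, g.1 • m.2 + rightMul g.2 m.1))
    (by
      intro g g' m
      refine Prod.ext (add_mul _ _ _) (Subtype.ext (LinearMap.ext fun c => ?_))
      simp [rightMul_val, add_mul]; abel)
    (by
      intro t g m
      refine Prod.ext (smul_mul_assoc _ _ _) (Subtype.ext (LinearMap.ext fun c => ?_))
      simp [rightMul_val, smul_sub, csmul_mul])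
    (by
      intro g m m'
      refine Prod.ext (mul_add _ _ _) (Subtype.ext (LinearMap.ext fun c => ?_))
      simp [rightMul_val, add_mul]; abel)
    (by
      intro t g m
      refine Prod.ext (mul_smul_comm _ _ _) (Subtype.ext (LinearMap.ext fun c => ?_))
      simp [rightMul_val, smul_sub, csmul_mul, mul_csmul])

theorem genAct_apply (g m : Form F R × VF F) :
    genAct g m = (g.1 * m.1, g.1 • m.2 + rightMul g.2 m.1) := rfl

/-- The action of the symmetric algebra on its quotient `S^{≤ 1} = C^∞ ⊕ 𝔛`. -/
def SymVF.act : SymVF F →ₐ[ℂ] Module.End ℂ (Form F R × VF F) :=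
  RingQuot.liftAlgHom ℂ ⟨TensorAlgebra.lift ℂ genAct, by
    intro x y h
    induction h with
    | one =>
      refine LinearMap.ext fun m => ?_
      simp only [TensorAlgebra.lift_ι_apply, map_one, genAct_apply, Module.End.one_apply]
      refine Prod.ext (one_mul _) (Subtype.ext (LinearMap.ext fun c => ?_))
      simp [rightMul_val]
    | mul a b =>
      refine LinearMap.ext fun m => ?_
      simp only [TensorAlgebra.lift_ι_apply, map_mul, genAct_apply, Module.End.mul_apply]
      refine Prod.ext (mul_assoc _ _ _).symm (Subtype.ext (LinearMap.ext fun c => ?_))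
      simp [rightMul_val, mul_assoc]
    | smul a X =>
      refine LinearMap.ext fun m => ?_
      simp only [TensorAlgebra.lift_ι_apply, map_mul, genAct_apply, Module.End.mul_apply]
      refine Prod.ext (by simp) (Subtype.ext (LinearMap.ext fun c => ?_))
      simp [rightMul_val, mul_sub]
    | comm_fun d k X a hX ha =>
      refine LinearMap.ext fun m => ?_
      simp only [TensorAlgebra.lift_ι_apply, map_mul, map_zsmul, genAct_apply,
        Module.End.mul_apply, LinearMap.smul_apply]
      refine Prod.ext (by simp) (Subtype.ext (LinearMap.ext fun c => ?_))
      have h := fun b => hX.2 a b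
      simp only [LinearMap.coe_restrictScalars, Submodule.subtype_apply] at h
      simp [rightMul_val, h, parityPow_of_mem d ha, mul_assoc, add_mul, smul_sub]
    | comm d e X Y hX hY =>
      refine LinearMap.ext fun m => ?_
      simp only [TensorAlgebra.lift_ι_apply, map_mul, map_zsmul, genAct_apply,
        Module.End.mul_apply, LinearMap.smul_apply]
      refine Prod.ext (by simp) (Subtype.ext (LinearMap.ext fun c => ?_))
      simp [rightMul_val]⟩

/-- The projection `pr₁` of the symmetric algebra onto its component `S¹ = 𝔛(F[1])`. -/
def SymVF.pr : SymVF F →ₗ[ℂ] VF F :=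
  LinearMap.snd ℂ _ _ ∘ₗ LinearMap.applyₗ (R := ℂ) (1, 0) ∘ₗ SymVF.act.toLinearMap

theorem SymVF.act_gen (g : Form F R × VF F) : SymVF.act (SymVF.gen g) = genAct g :=
  (RingQuot.liftAlgHom_mkAlgHom_apply ℂ _ _ _).trans (TensorAlgebra.lift_ι_apply _ _)

theorem rightMul_one (X : VF F) : rightMul X 1 = X := by
  obtain ⟨X, hX⟩ := X
  refine Subtype.ext ?_
  rw [rightMul_val]
  have h1 : X 1 = 0 := by
    induction hX using Submodule.span_induction with
    | zero => rfl
    | add X Y _ _ h h' => rw [LinearMap.add_apply, h, h', add_zero]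
    | smul a X _ h => rw [LinearMap.smul_apply, h, smul_zero]
    | mem X hX =>
      obtain ⟨d, hd⟩ := hX
      have h1 : parityPow F d (1 : Form F R) = 1 := by
        unfold parityPow
        split_ifs
        · rfl
        · exact Subtype.ext (parity_const 1)
      have := hd.2 1 1
      rw [h1] at this
      simpa using this
  ext1 c
  simp [h1]

theorem SymVF.pr_ofVF (X : VF F) : SymVF.pr (SymVF.ofVF (F := F) X) = X := by
  change (SymVF.act (SymVF.gen (0, X)) (1, 0)).2 = X
  rw [SymVF.act_gen, genAct_apply]
  simp [rightMul_one]

theorem SymVF.pr_ofFun (a : Form F R) : SymVF.pr (SymVF.ofFun (F := F) a) = 0 := by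
  change (SymVF.act (SymVF.gen (a, 0)) (1, 0)).2 = 0
  rw [SymVF.act_gen, genAct_apply]
  refine Subtype.ext (LinearMap.ext fun c => ?_)
  simp [rightMul_val]

theorem SymVF.pr_mul_mul (X Y : VF F) (s : SymVF F) :
    SymVF.pr (SymVF.ofVF (F := F) X * (SymVF.ofVF (F := F) Y * s)) = 0 := by
  change (SymVF.act (SymVF.gen (0, X) * (SymVF.gen (0, Y) * s)) (1, 0)).2 = 0
  rw [map_mul, map_mul, SymVF.act_gen, SymVF.act_gen, Module.End.mul_apply, Module.End.mul_apply,
    genAct_apply, genAct_apply]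
  refine Subtype.ext (LinearMap.ext fun c => ?_)
  simp [rightMul_val]

theorem SymVF.pr_ofFun_mul (a : Form F R) (s : SymVF F) :
    SymVF.pr (SymVF.ofFun (F := F) a * s) = a • SymVF.pr s := by
  change (SymVF.act (SymVF.gen (a, 0) * s) (1, 0)).2 = a • (SymVF.act s (1, 0)).2
  rw [map_mul, SymVF.act_gen, Module.End.mul_apply, genAct_apply]
  refine Subtype.ext (LinearMap.ext fun c => ?_)
  simp [rightMul_val]

end GradedManifold

/-! ### Differential operators on `F[1]` -/

section GradedOperators

variable {R : Type*} [CommRing R] [Algebra ℂ R]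
  {F : LieRinehartSubalgebra R (Derivation ℂ R R)}

/-- Graded commutativity of the wedge product of scalar forms. -/
theorem wedge_comm (k : ℕ) (α β : List F → R) (hα : ∀ l, l.length ≠ k → α l = 0) :
    wedge (LinearMap.mul R R) β α = wedge (LinearMap.mul R R) α (parity^[k] β) := by
  funext l
  induction l generalizing k α β with
  | nil =>
    have h : ∀ k, (parity^[k] β) [] = β [] := by
      intro k
      induction k with
      | zero => rfl
      | succ k ih => rw [Function.iterate_succ_apply']; simp [parity, ih]
    simp [wedge, h, mul_comm]
  | cons v l ih =>
    have hc : ∀ k, contract v (parity^[k] β) = (-1 : R) ^ k • parity^[k] (contract v β) := by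
      intro k
      induction k with
      | zero => simp
      | succ k ih =>
        have hs : ∀ (c : R) (γ : List F → R), parity (c • γ) = c • parity γ := fun c γ => by
          funext l; simp only [parity, Pi.smul_apply]; rw [smul_comm]
        rw [Function.iterate_succ_apply', Function.iterate_succ_apply', contract_parity, ih, hs,
          pow_succ, mul_neg_one, neg_smul]
    have hp : parity α = (-1 : R) ^ k • α := by
      funext l
      by_cases h : l.length = k
      · simp [parity, h]
      · simp [parity, hα l h]
    have h1 : wedge (LinearMap.mul R R) (parity β) (contract v α) l
        = wedge (LinearMap.mul R R) (contract v α) (parity^[k] β) l := by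
      cases k with
      | zero =>
        have : contract v α = 0 := funext fun l => hα _ (by simp)
        rw [this, wedge_zero_left, wedge_zero_right]
      | succ k =>
        rw [ih k (contract v α) (parity β) (fun l hl => hα (v :: l) (by simpa using hl)), ← Function.iterate_succ_apply]
    have h2 : wedge (LinearMap.mul R R) (contract v β) α l
        = wedge (LinearMap.mul R R) (parity α) (contract v (parity^[k] β)) l := by
      rw [ih k α (contract v β) hα, hp, hc, wedge_smul_left, wedge_smul_right, smul_smul,
        ← mul_pow]
      simp
    rw [wedge, wedge, h1, h2, add_comm]

theorem form_mul_comm (k : ℕ) {a : Form F R} (ha : a ∈ formDeg F R k) (b : Form F R) :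
    b * a = a * (Form.parity ^ k) b := by
  have h : ∀ k : ℕ, (((Form.parity ^ k) b : Form F R) : List F → R)
      = parity^[k] (b : List F → R) := by
    intro k
    induction k with
    | zero => rfl
    | succ k ih => rw [Function.iterate_succ_apply', pow_succ', ← ih]; rfl
  refine Subtype.ext ?_
  rw [Form.mul_val, Form.mul_val, h]
  exact wedge_comm k _ _ fun l hl => ha l (by exact_mod_cast hl)

theorem parity_sq : (Form.parity * Form.parity : Module.End ℂ (Form F R)) = 1 :=
  LinearMap.ext parity_parity_form

variable (F) in
/-- The parity involution `D ↦ (-1)^{|D|} D` on operators. -/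
def opParity : Module.End ℂ (Form F R) →ₐ[ℂ] Module.End ℂ (Form F R) :=
  AlgHom.ofLinearMap
    (LinearMap.mulLeft ℂ (Form.parity : Module.End ℂ (Form F R)) ∘ₗ
      LinearMap.mulRight ℂ (Form.parity : Module.End ℂ (Form F R)))
    (by simp [parity_sq])
    (fun x y => by
      have h := parity_sq (F := F)
      simp only [LinearMap.comp_apply, LinearMap.mulLeft_apply, LinearMap.mulRight_apply]
      calc _ = Form.parity * (x * (1 * (y * Form.parity))) := by simp only [mul_assoc, one_mul]
        _ = _ := by rw [← h]; simp only [mul_assoc])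

theorem opParity_apply (D : Module.End ℂ (Form F R)) :
    opParity F D = Form.parity * (D * Form.parity) := rfl

/-- The graded commutator `[D, a] = D a - (-1)^{|D| k} a D` with a function of degree `k`. -/
def gcomm (k : ℕ) (a : Form F R) : Module.End ℂ (Form F R) →ₗ[ℂ] Module.End ℂ (Form F R) :=
  LinearMap.mulRight ℂ (LinearMap.mulLeft ℂ a : Module.End ℂ (Form F R))
    - LinearMap.mulLeft ℂ (LinearMap.mulLeft ℂ a : Module.End ℂ (Form F R)) ∘ₗ
      (opParity F ^ k).toLinearMap

theorem gcomm_apply (k : ℕ) (a : Form F R) (D : Module.End ℂ (Form F R)) :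
    gcomm k a D = D * LinearMap.mulLeft ℂ a - LinearMap.mulLeft ℂ a * (opParity F ^ k) D := rfl

variable (F) in
/-- Differential operators of order less than `n` on `F[1]` (in the sense of Grothendieck):
the graded commutator with every homogeneous function has order less than `n - 1`. -/
def diffOpLT : ℕ → Submodule ℂ (Module.End ℂ (Form F R))
  | 0 => ⊥
  | n + 1 => ⨅ (k : ℕ) (a : formDeg F R k), (diffOpLT n).comap (gcomm k (a : Form F R))

theorem mem_diffOpLT_succ {n : ℕ} {D : Module.End ℂ (Form F R)} :
    D ∈ diffOpLT F (n + 1) ↔ ∀ (k : ℕ) (a : Form F R), a ∈ formDeg F R k →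
      gcomm k a D ∈ diffOpLT F n := by
  simp [diffOpLT]

theorem diffOpLT_succ_le (n : ℕ) : diffOpLT F n ≤ diffOpLT F (n + 1) := by
  induction n with
  | zero => exact bot_le
  | succ n ih =>
    intro D hD
    rw [mem_diffOpLT_succ] at hD ⊢
    exact fun k a ha => ih (hD k a ha)

theorem diffOpLT_mono : Monotone (diffOpLT F) := monotone_nat_of_le_succ diffOpLT_succ_le

theorem opParity_mulLeft (a : Form F R) :
    opParity F (LinearMap.mulLeft ℂ a) = LinearMap.mulLeft ℂ (Form.parity a) := by
  refine LinearMap.ext fun b => ?_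
  change Form.parity (a * Form.parity b) = Form.parity a * b
  rw [parity_mul, parity_parity_form]

theorem opParity_opParity (D : Module.End ℂ (Form F R)) : opParity F (opParity F D) = D := by
  refine LinearMap.ext fun b => ?_
  change Form.parity (Form.parity (D (Form.parity (Form.parity b)))) = D b
  rw [parity_parity_form, parity_parity_form]

theorem opParity_mem {n : ℕ} {D : Module.End ℂ (Form F R)} (hD : D ∈ diffOpLT F n) :
    opParity F D ∈ diffOpLT F n := by
  induction n generalizing D with
  | zero =>
    have : D = 0 := hD
    rw [this, map_zero]; exact Submodule.zero_mem _
  | succ n ih =>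
    rw [mem_diffOpLT_succ] at hD ⊢
    intro k a ha
    have h : gcomm k a (opParity F D) = opParity F (gcomm k (Form.parity a) D) := by
      have hc : opParity F ((opParity F ^ k) D) = (opParity F ^ k) (opParity F D) := by
        change (opParity F * opParity F ^ k) D = (opParity F ^ k * opParity F) D
        rw [← pow_succ', pow_succ]
      rw [gcomm_apply, gcomm_apply, map_sub, map_mul, map_mul, opParity_mulLeft,
        parity_parity_form, hc]
    rw [h]
    exact ih (hD k _ (parity_mem ha))

theorem opParity_pow_mem {n : ℕ} {D : Module.End ℂ (Form F R)} (hD : D ∈ diffOpLT F n) (k : ℕ) :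
    (opParity F ^ k) D ∈ diffOpLT F n := by
  induction k with
  | zero => exact hD
  | succ k ih => rw [pow_succ']; exact opParity_mem ih

theorem diffOpLT_mul {m n : ℕ} {P D : Module.End ℂ (Form F R)} (hP : P ∈ diffOpLT F m)
    (hD : D ∈ diffOpLT F n) : P * D ∈ diffOpLT F (m + n) := by
  induction m generalizing n P D with
  | zero =>
    have : P = 0 := hP
    rw [this, zero_mul]; exact Submodule.zero_mem _
  | succ m ih =>
    induction n generalizing D with
    | zero =>
      have : D = 0 := hD
      rw [this, mul_zero]; exact Submodule.zero_mem _
    | succ n ih' =>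
      rw [← add_assoc, mem_diffOpLT_succ]
      intro k a ha
      have h : gcomm k a (P * D) = P * gcomm k a D + gcomm k a P * (opParity F ^ k) D := by
        simp only [gcomm_apply, map_mul, mul_sub, sub_mul, mul_assoc]; abel
      rw [h]
      refine Submodule.add_mem _ (ih' (mem_diffOpLT_succ.mp hD k a ha)) ?_
      rw [add_right_comm]
      exact ih (mem_diffOpLT_succ.mp hP k a ha) (opParity_pow_mem hD k)

variable (F) in
/-- `𝒟(F[1])`: the differential operators on `F[1]`. -/
def GrDiffOp : Submodule ℂ (Module.End ℂ (Form F R)) := ⨆ n, diffOpLT F n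

theorem mem_grDiffOp {D : Module.End ℂ (Form F R)} :
    D ∈ GrDiffOp F ↔ ∃ n, D ∈ diffOpLT F n :=
  Submodule.mem_iSup_of_directed _ diffOpLT_mono.directed_le

theorem mulLeft_mem (c : Form F R) :
    (LinearMap.mulLeft ℂ c : Module.End ℂ (Form F R)) ∈ diffOpLT F 1 := by
  rw [mem_diffOpLT_succ]
  intro k a ha
  have h : ∀ k : ℕ, (opParity F ^ k) (LinearMap.mulLeft ℂ c)
      = LinearMap.mulLeft ℂ ((Form.parity ^ k) c) := by
    intro k
    induction k with
    | zero => rfl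
    | succ k ih =>
      rw [pow_succ', pow_succ']
      change opParity F ((opParity F ^ k) _) = LinearMap.mulLeft ℂ (Form.parity ((Form.parity ^ k) c))
      rw [ih, opParity_mulLeft]
  have h0 : gcomm k a (LinearMap.mulLeft ℂ c) = 0 := by
    rw [gcomm_apply, h]
    refine LinearMap.ext fun b => ?_
    change c * (a * b) - a * ((Form.parity ^ k) c * b) = 0
    rw [← mul_assoc, ← mul_assoc, form_mul_comm k ha c, sub_self]
  rw [h0]; exact Submodule.zero_mem _

theorem opParity_dF : opParity F (dF F) = -dF F := by
  refine LinearMap.ext fun b => ?_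
  change Form.parity (dF F (Form.parity b)) = -dF F b
  rw [dF_parity, map_neg, parity_parity_form]

theorem dF_mem : dF F ∈ diffOpLT F 2 := by
  rw [mem_diffOpLT_succ]
  intro k a ha
  have h : ∀ k : ℕ, (opParity F ^ k) (dF F) = sgn (k : ℤ) • dF F := by
    intro k
    induction k with
    | zero => rw [sgn_eq, pow_zero, pow_zero, one_smul]; rfl
    | succ k ih =>
      rw [pow_succ']
      change opParity F ((opParity F ^ k) _) = _
      rw [ih, map_zsmul, opParity_dF, sgn_eq, sgn_eq, pow_succ]; simp
  have h0 : gcomm k a (dF F) = LinearMap.mulLeft ℂ (dF F a) := by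
    rw [gcomm_apply, h]
    refine LinearMap.ext fun b => ?_
    change dF F (a * b) - a * (sgn (k : ℤ) • dF F b) = dF F a * b
    rw [dF_mul, parity_of_mem ha, mul_smul_comm, smul_mul_assoc]; abel
  rw [h0]; exact mulLeft_mem _

/-- The differential `L_Q(D) = Q D - (-1)^{|D|} D Q` on differential operators, `Q = d_F`. -/
def adQ : GrDiffOp F →ₗ[ℂ] GrDiffOp F :=
  (LinearMap.mulLeft ℂ (dF F)
      - LinearMap.mulRight ℂ (dF F) ∘ₗ (opParity F).toLinearMap).restrict
    (by
      intro D hD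
      obtain ⟨n, hn⟩ := mem_grDiffOp.mp hD
      exact Submodule.sub_mem _ (mem_grDiffOp.mpr ⟨_, diffOpLT_mul dF_mem hn⟩)
        (mem_grDiffOp.mpr ⟨_, diffOpLT_mul (opParity_mem hn) dF_mem⟩))

end GradedOperators

/-! ### Differential operators on the base and transversal differential operators -/

section BaseOperators

variable {R : Type*} [CommRing R] [Algebra ℂ R]

/-- The commutator `[D, f]` of an operator with a function. -/
def commFun (f : R) : Module.End ℂ R →ₗ[R] Module.End ℂ R where
  toFun D := D * LinearMap.mulLeft ℂ f - LinearMap.mulLeft ℂ f * D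
  map_add' D D' := by rw [add_mul, mul_add]; abel
  map_smul' g D := by
    refine LinearMap.ext fun x => ?_
    change g * D (f * x) - f * (g * D x) = g * (D (f * x) - f * D x)
    ring

theorem commFun_apply (f : R) (D : Module.End ℂ R) (x : R) :
    commFun f D x = D (f * x) - f * D x := rfl

variable (R) in
/-- Differential operators of order less than `n` on the base (in the sense of Grothendieck). -/
def baseDiffOpLT : ℕ → Submodule R (Module.End ℂ R)
  | 0 => ⊥
  | n + 1 => ⨅ f : R, (baseDiffOpLT n).comap (commFun f)

theorem mem_baseDiffOpLT_succ {n : ℕ} {D : Module.End ℂ R} :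
    D ∈ baseDiffOpLT R (n + 1) ↔ ∀ f : R, commFun f D ∈ baseDiffOpLT R n := by
  simp [baseDiffOpLT]

theorem baseDiffOpLT_mono : Monotone (baseDiffOpLT R) := by
  refine monotone_nat_of_le_succ fun n => ?_
  induction n with
  | zero => exact bot_le
  | succ n ih =>
    intro D hD
    rw [mem_baseDiffOpLT_succ] at hD ⊢
    exact fun f => ih (hD f)

variable (R) in
/-- `𝒟(M)`: the differential operators on the base, as a module over the functions by
multiplication from the left. -/
def baseDiffOp : Submodule R (Module.End ℂ R) := ⨆ n, baseDiffOpLT R n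

instance : AddCommGroup (baseDiffOp R) := Submodule.addCommGroup _

theorem mem_baseDiffOp {D : Module.End ℂ R} :
    D ∈ baseDiffOp R ↔ ∃ n, D ∈ baseDiffOpLT R n :=
  Submodule.mem_iSup_of_directed _ baseDiffOpLT_mono.directed_le

theorem derivation_mul_mem (X : Derivation ℂ R R) {n : ℕ} {D : Module.End ℂ R}
    (hD : D ∈ baseDiffOpLT R n) :
    (X : R →ₗ[ℂ] R) * D ∈ baseDiffOpLT R (n + 1) := by
  induction n generalizing D with
  | zero =>
    have : D = 0 := hD
    rw [this, mul_zero]; exact Submodule.zero_mem _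
  | succ n ih =>
    rw [mem_baseDiffOpLT_succ]
    intro f
    have h : commFun f ((X : R →ₗ[ℂ] R) * D) = (X : R →ₗ[ℂ] R) * commFun f D + X f • D := by
      refine LinearMap.ext fun x => ?_
      change X (D (f * x)) - f * X (D x) = X (D (f * x) - f * D x) + X f * D x
      rw [map_sub, Derivation.leibniz, smul_eq_mul, smul_eq_mul]; ring
    rw [h]
    exact Submodule.add_mem _ (ih (mem_baseDiffOpLT_succ.mp hD f)) (Submodule.smul_mem _ _ hD)

/-- Composition with a vector field from the left. -/
def derMul (X : Derivation ℂ R R) (D : baseDiffOp R) : baseDiffOp R :=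
  ⟨(X : R →ₗ[ℂ] R) * D, by
    obtain ⟨n, hn⟩ := mem_baseDiffOp.mp D.2
    exact mem_baseDiffOp.mpr ⟨n + 1, derivation_mul_mem X hn⟩⟩

theorem one_mem_baseDiffOp : (1 : Module.End ℂ R) ∈ baseDiffOp R := by
  refine mem_baseDiffOp.mpr ⟨1, mem_baseDiffOpLT_succ.mpr fun f => ?_⟩
  have : commFun f (1 : Module.End ℂ R) = 0 :=
    LinearMap.ext fun x => by rw [commFun_apply]; exact sub_self _
  rw [this]; exact Submodule.zero_mem _

variable (F : LieRinehartSubalgebra R (Derivation ℂ R R))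

/-- The left ideal `𝒟(M) Γ(F)` of the operators vanishing along the leaves of `F`. -/
def leafIdeal : Submodule R (baseDiffOp R) :=
  Submodule.span R {D | ∃ w ∈ baseDiffOp R, ∃ X : F,
    (D : Module.End ℂ R) = w * ((X : Derivation ℂ R R) : R →ₗ[ℂ] R)}

/-- The transversal differential operators `𝒟(M) / 𝒟(M) Γ(F)`. -/
abbrev TransDiffOp : Type _ := baseDiffOp R ⧸ leafIdeal F

variable {F}

theorem derMul_mem (X : Derivation ℂ R R) {D : baseDiffOp R} (hD : D ∈ leafIdeal F) :
    derMul X D ∈ leafIdeal F := by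
  induction hD using Submodule.span_induction with
  | zero =>
    have : derMul X (0 : baseDiffOp R) = 0 := Subtype.ext (mul_zero _)
    rw [this]; exact Submodule.zero_mem _
  | add D D' _ _ h h' =>
    have : derMul X (D + D') = derMul X D + derMul X D' := Subtype.ext (mul_add _ _ _)
    rw [this]; exact Submodule.add_mem _ h h'
  | smul f D hD h =>
    have : derMul X (f • D) = X f • D + f • derMul X D := by
      refine Subtype.ext (LinearMap.ext fun x => ?_)
      change X (f * (D : Module.End ℂ R) x)
        = X f * (D : Module.End ℂ R) x + f * X ((D : Module.End ℂ R) x)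
      rw [Derivation.leibniz, smul_eq_mul, smul_eq_mul]; ring
    rw [this]; exact Submodule.add_mem _ (Submodule.smul_mem _ _ hD) (Submodule.smul_mem _ _ h)
  | mem D hD =>
    obtain ⟨w, hw, Y, h⟩ := hD
    refine Submodule.subset_span ⟨(X : R →ₗ[ℂ] R) * w, (derMul X ⟨w, hw⟩).2, Y, ?_⟩
    change (X : R →ₗ[ℂ] R) * (D : Module.End ℂ R) = _
    rw [h, mul_assoc]

/-- The action of vector fields on transversal differential operators, `X · [D] = [X ∘ D]`. -/
def transAct (X : Derivation ℂ R R) : TransDiffOp F → TransDiffOp F :=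
  Quotient.map' (derMul X) fun D D' h => by
    rw [Submodule.quotientRel_def] at h ⊢
    have : derMul X D - derMul X D' = derMul X (D - D') := Subtype.ext (mul_sub _ _ _).symm
    rw [this]; exact derMul_mem X h

theorem transAct_mk (X : Derivation ℂ R R) (D : baseDiffOp R) :
    transAct X ((leafIdeal F).mkQ D) = (leafIdeal F).mkQ (derMul X D) := rfl

variable (F) in
/-- The `F`-module structure of the transversal differential operators. -/
def FModule.trans : FModule F (TransDiffOp F) where
  act v := transAct v
  act_add v m m' := by
    induction m using Submodule.Quotient.induction_on with | _ D
    induction m' using Submodule.Quotient.induction_on with | _ D'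
    exact congrArg (leafIdeal F).mkQ (Subtype.ext (mul_add _ _ _))
  add_act v w m := by
    induction m using Submodule.Quotient.induction_on with | _ D
    exact congrArg (leafIdeal F).mkQ (Subtype.ext (add_mul _ _ _))
  smul_act f v m := by
    induction m using Submodule.Quotient.induction_on with | _ D
    exact congrArg (leafIdeal F).mkQ (Subtype.ext (LinearMap.ext fun x => rfl))
  leibniz v f m := by
    induction m using Submodule.Quotient.induction_on with | _ D
    refine congrArg (leafIdeal F).mkQ (Subtype.ext (LinearMap.ext fun x => ?_))
    change (v : Derivation ℂ R R) (f * (D : Module.End ℂ R) x)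
      = (v : Derivation ℂ R R) f * (D : Module.End ℂ R) x
        + f * (v : Derivation ℂ R R) ((D : Module.End ℂ R) x)
    rw [Derivation.leibniz, smul_eq_mul, smul_eq_mul]; ring
  flat v w m := by
    induction m using Submodule.Quotient.induction_on with | _ D
    refine congrArg (leafIdeal F).mkQ (Subtype.ext (LinearMap.ext fun x => ?_))
    change ((⁅v, w⁆ : F) : Derivation ℂ R R) ((D : Module.End ℂ R) x) = _
    exact Derivation.commutator_apply _

variable (F) in
/-- The normal bundle `T_M / F`. -/
abbrev NormalBundle : Type _ := Derivation ℂ R R ⧸ F.toSubmodule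

/-- The bracket `[v, X]` of a section of `F` and a section of the normal bundle. -/
def bottAct (v : F) : NormalBundle F → NormalBundle F :=
  Quotient.map' (fun X => ⁅(v : Derivation ℂ R R), X⁆) fun X Y h => by
    rw [Submodule.quotientRel_def] at h ⊢
    rw [← lie_sub]
    exact (⁅v, (⟨X - Y, h⟩ : F)⁆ : F).2

variable (F) in
/-- The Bott representation of `F` on the normal bundle `T_M / F`: `v · [X] = [[v, X]]`. -/
def FModule.bott : FModule F (NormalBundle F) where
  act := bottAct
  act_add v m m' := by
    induction m using Submodule.Quotient.induction_on with | _ X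
    induction m' using Submodule.Quotient.induction_on with | _ Y
    exact congrArg F.toSubmodule.mkQ (lie_add _ _ _)
  add_act v w m := by
    induction m using Submodule.Quotient.induction_on with | _ X
    exact congrArg F.toSubmodule.mkQ (add_lie _ _ _)
  smul_act f v m := by
    induction m using Submodule.Quotient.induction_on with | _ X
    refine (Submodule.Quotient.eq _).mpr ?_
    have : ⁅((f • v : F) : Derivation ℂ R R), X⁆ - f • ⁅(v : Derivation ℂ R R), X⁆
        = -(X f • (v : Derivation ℂ R R)) := by
      ext x
      simp [Derivation.commutator_apply]
      ring
    rw [this]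
    exact Submodule.neg_mem _ (Submodule.smul_mem _ _ v.2)
  leibniz v f m := by
    induction m using Submodule.Quotient.induction_on with | _ X
    refine congrArg F.toSubmodule.mkQ ?_
    ext x
    change ⁅(v : Derivation ℂ R R), f • X⁆ x
      = ((v : Derivation ℂ R R) f • X + f • ⁅(v : Derivation ℂ R R), X⁆) x
    simp [Derivation.commutator_apply]
    ring
  flat v w m := by
    induction m using Submodule.Quotient.induction_on with | _ X
    exact congrArg F.toSubmodule.mkQ (lie_lie _ _ _)

end BaseOperators

/-! ### `L∞[1]` algebras -/

section LInfty

/-- The sum, with Koszul signs, of `G S T` over all `(S, T)`-unshuffles of a list of elements with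
degrees. -/
def unshuffleSum {ι W : Type*} [AddCommGroup W] (deg : ι → ℤ) :
    List ι → (List ι → List ι → W) → W
  | [], G => G [] []
  | x :: l, G => unshuffleSum deg l (fun S T => G (x :: S) T)
      + unshuffleSum deg l (fun S T => sgn (deg x * (S.map deg).sum) • G S (x :: T))

/-- The sum, with Koszul signs, of `G [g S₁, …, g Sₘ]` over all unshuffles of a list into
`m` ordered (possibly empty) blocks `S₁, …, Sₘ`. -/
def blockSum {ι V W : Type*} [AddCommGroup W] (deg : ι → ℤ) (g : List ι → V) :
    ℕ → List ι → (List V → W) → W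
  | 0, [], G => G []
  | 0, _ :: _, _ => 0
  | m + 1, l, G => unshuffleSum deg l
      (fun S T => blockSum deg g m T (fun ws => G (g S :: ws)))

/-- A family of multilinear maps, one of each arity. -/
abbrev Brackets (V W : Type*) [AddCommGroup V] [Module ℂ V] [AddCommGroup W] [Module ℂ W] :
    Type _ :=
  ∀ k : ℕ, MultilinearMap ℂ (fun _ : Fin k => V) W

variable {V W : Type*} [AddCommGroup V] [Module ℂ V] [AddCommGroup W] [Module ℂ W]

/-- The value of a family of multilinear maps on a list. -/
def Brackets.ev (lam : Brackets V W) (l : List V) : W := lam l.length l.get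

/-- Homogeneous elements of a graded vector space. -/
abbrev Homog (𝒱 : ℤ → Submodule ℂ V) : Type _ := Σ d : ℤ, 𝒱 d

/-- The underlying element of a homogeneous element. -/
def Homog.val {𝒱 : ℤ → Submodule ℂ V} (x : Homog 𝒱) : V := x.2

/-- The degree of a homogeneous element. -/
def Homog.deg {𝒱 : ℤ → Submodule ℂ V} (x : Homog 𝒱) : ℤ := x.1

/-- The family `lam` is graded symmetric. -/
def Brackets.GradedSymm (𝒱 : ℤ → Submodule ℂ V) (lam : Brackets V W) : Prop :=
  ∀ (l₁ : List (Homog 𝒱)) (x y : Homog 𝒱) (l₂ : List (Homog 𝒱)),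
    lam.ev ((l₁ ++ x :: y :: l₂).map Homog.val)
      = sgn (x.deg * y.deg) • lam.ev ((l₁ ++ y :: x :: l₂).map Homog.val)

/-- The family `lam` is homogeneous of degree `e`. -/
def Brackets.HasDegree (e : ℤ) (𝒱 : ℤ → Submodule ℂ V) (𝒲 : ℤ → Submodule ℂ W)
    (lam : Brackets V W) : Prop :=
  ∀ l : List (Homog 𝒱), lam.ev (l.map Homog.val) ∈ 𝒲 (e + (l.map Homog.deg).sum)

/-- The brackets `lam` make the graded vector space `V = ⨁ 𝒱 d` into an `L∞[1]` algebra: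
they are graded symmetric of degree `1` and satisfy the generalized Jacobi identities
`∑ ε λ(λ(x_{σ(1)}, …, x_{σ(i)}), x_{σ(i+1)}, …, x_{σ(n)}) = 0`. -/
structure IsLInfty (𝒱 : ℤ → Submodule ℂ V) (lam : Brackets V V) : Prop where
  internal : DirectSum.IsInternal 𝒱
  zero : lam 0 = 0
  degree : lam.HasDegree 1 𝒱 𝒱
  symm : lam.GradedSymm 𝒱
  jacobi : ∀ l : List (Homog 𝒱), unshuffleSum Homog.deg l
    (fun S T => lam.ev (lam.ev (S.map Homog.val) :: T.map Homog.val)) = 0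

/-- The family `phi` is a morphism of `L∞[1]` algebras. -/
structure IsLInftyHom (𝒱 : ℤ → Submodule ℂ V) (𝒲 : ℤ → Submodule ℂ W) (lam : Brackets V V)
    (mu : Brackets W W) (phi : Brackets V W) : Prop where
  zero : phi 0 = 0
  degree : phi.HasDegree 0 𝒱 𝒲
  symm : phi.GradedSymm 𝒱
  hom : ∀ l : List (Homog 𝒱), unshuffleSum Homog.deg l
      (fun S T => phi.ev (lam.ev (S.map Homog.val) :: T.map Homog.val))
    = ∑ m ∈ Finset.range (l.length + 1), ((m.factorial : ℂ)⁻¹) •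
        blockSum Homog.deg (fun S => phi.ev (S.map Homog.val)) m l mu.ev

/-- The linear part of `phi` induces an isomorphism in cohomology. -/
structure IsQuasiIso (lam : Brackets V V) (mu : Brackets W W) (phi : Brackets V W) : Prop where
  injective : ∀ v, lam.ev [v] = 0 → (∃ w, phi.ev [v] = mu.ev [w]) → ∃ u, v = lam.ev [u]
  surjective : ∀ w, mu.ev [w] = 0 → ∃ v, lam.ev [v] = 0 ∧ ∃ u, phi.ev [v] - w = mu.ev [u]

end LInfty

/-! ### Connections, PBW maps and the induced brackets -/

section Kapranov

variable {R : Type*} [CommRing R] [Algebra ℂ R]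
  (F : LieRinehartSubalgebra R (Derivation ℂ R R))

/-- An affine connection on `F[1]`, of degree zero. -/
structure AffineConnection where
  nabla : VF F →ₗ[ℂ] VF F →ₗ[ℂ] VF F
  smul_left : ∀ (a : Form F R) (X Y : VF F), nabla (a • X) Y = a • nabla X Y
  leibniz : ∀ (d k : ℤ) (X Y : VF F) (a : Form F R), X ∈ vfDeg F d → a ∈ formDeg F R k →
    nabla X (a • Y) = (X : Module.End ℂ (Form F R)) a • Y + sgn (d * k) • a • nabla X Y
  degree : ∀ (d e : ℤ) (X Y : VF F), X ∈ vfDeg F d → Y ∈ vfDeg F e →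
    nabla X Y ∈ vfDeg F (d + e)

variable {F}

/-- The torsion `∇_X Y - (-1)^{|X||Y|} ∇_Y X - [X, Y]` vanishes. -/
def AffineConnection.TorsionFree (C : AffineConnection F) : Prop :=
  ∀ (d e : ℤ) (X Y : VF F), X ∈ vfDeg F d → Y ∈ vfDeg F e →
    ((C.nabla X Y - sgn (d * e) • C.nabla Y X : VF F) : Module.End ℂ (Form F R))
      = (X : Module.End ℂ (Form F R)) * (Y : Module.End ℂ (Form F R))
        - sgn (d * e) • ((Y : Module.End ℂ (Form F R)) * (X : Module.End ℂ (Form F R)))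

/-- The product `X₁ ⊙ ⋯ ⊙ Xₙ` of homogeneous vector fields. -/
def symProd (l : List (Homog (vfDeg F))) : SymVF F := (l.map fun X => SymVF.ofVF X.val).prod

/-- The covariant derivative `∇_X (Y₁ ⊙ ⋯ ⊙ Yₙ)`, extending `∇_X` as a graded derivation. -/
def AffineConnection.nablaProd (C : AffineConnection F) (X : Homog (vfDeg F)) :
    List (Homog (vfDeg F)) → SymVF F
  | [] => 0
  | Y :: l => SymVF.ofVF (C.nabla X.val Y.val) * symProd l
      + sgn (X.deg * Y.deg) • (SymVF.ofVF Y.val * C.nablaProd X l)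

/-- The Poincaré–Birkhoff–Witt isomorphism of an affine connection on `F[1]`, determined by
`pbw(a s) = a pbw(s)`, `pbw(1) = 1` and
`pbw(X₁ ⊙ ⋯ ⊙ Xₙ) = (1/n) ∑ₖ εₖ (Xₖ · pbw(X^{k}) - pbw(∇_{Xₖ} X^{k}))`, where
`X^{k} = X₁ ⊙ ⋯ X̂ₖ ⋯ ⊙ Xₙ` and `εₖ = (-1)^{|Xₖ|(|X₁| + ⋯ + |X_{k-1}|)}`. -/
structure IsPBW (C : AffineConnection F) (p : SymVF F ≃ₗ[ℂ] GrDiffOp F) : Prop where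
  one : (p 1 : Module.End ℂ (Form F R)) = 1
  fun_mul : ∀ (a : Form F R) (s : SymVF F),
    (p (SymVF.ofFun (F := F) a * s) : Module.End ℂ (Form F R))
      = LinearMap.mulLeft ℂ a * (p s : Module.End ℂ (Form F R))
  recursion : ∀ l : List (Homog (vfDeg F)),
    l.length • (p (symProd l) : Module.End ℂ (Form F R)) = ∑ k : Fin l.length,
      sgn ((l.get k).deg * ((l.take k).map Homog.deg).sum) •
        (((l.get k).val : Module.End ℂ (Form F R)) *
            (p (symProd (l.eraseIdx k)) : Module.End ℂ (Form F R))
          - (p (C.nablaProd (l.get k) (l.eraseIdx k)) : Module.End ℂ (Form F R)))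

/-- The differential `pbw⁻¹ ∘ L_Q ∘ pbw` on the symmetric algebra. -/
def kapranovDelta (p : SymVF F ≃ₗ[ℂ] GrDiffOp F) : SymVF F →ₗ[ℂ] SymVF F :=
  p.symm.toLinearMap ∘ₗ adQ ∘ₗ p.toLinearMap

/-- The Kapranov brackets `λₖ(X₁, …, Xₖ) = pr₁(pbw⁻¹ ∘ L_Q ∘ pbw (X₁ ⊙ ⋯ ⊙ Xₖ))`
on `𝔛(F[1])`. -/
def kapranovBrackets (p : SymVF F ≃ₗ[ℂ] GrDiffOp F) : Brackets (VF F) (VF F) := fun k =>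
  (SymVF.pr ∘ₗ kapranovDelta p).compMultilinearMap
    ((MultilinearMap.mkPiAlgebraFin ℂ k (SymVF F)).compLinearMap fun _ => SymVF.ofVF)

/-- A `B`-connection on a module `B` of vector fields. -/
structure BaseConnection (B : Submodule R (Derivation ℂ R R)) where
  nabla : B → B → B
  add_left : ∀ X Y Z, nabla (X + Y) Z = nabla X Z + nabla Y Z
  add_right : ∀ X Y Z, nabla X (Y + Z) = nabla X Y + nabla X Z
  smul_left : ∀ (f : R) X Y, nabla (f • X) Y = f • nabla X Y
  leibniz : ∀ (f : R) X Y, nabla X (f • Y) = (X : Derivation ℂ R R) f • Y + f • nabla X Y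

variable {B : Submodule R (Derivation ℂ R R)}

/-- The torsion `∇_X Y - ∇_Y X - [X, Y]` vanishes. -/
def BaseConnection.TorsionFree (C : BaseConnection B) : Prop :=
  ∀ X Y : B, ((C.nabla X Y - C.nabla Y X : B) : Derivation ℂ R R)
    = ⁅(X : Derivation ℂ R R), (Y : Derivation ℂ R R)⁆

/-- The product `b₁ ⊙ ⋯ ⊙ bₙ`. -/
def baseProd (l : List B) : SymmetricAlgebra R B := (l.map (SymmetricAlgebra.ι R B)).prod

/-- The covariant derivative `∇_X (b₁ ⊙ ⋯ ⊙ bₙ)`, extending `∇_X` as a derivation. -/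
def BaseConnection.nablaProd (C : BaseConnection B) (X : B) : List B → SymmetricAlgebra R B
  | [] => 0
  | Y :: l => SymmetricAlgebra.ι R B (C.nabla X Y) * baseProd l
      + SymmetricAlgebra.ι R B Y * C.nablaProd X l

/-- The Poincaré–Birkhoff–Witt isomorphism onto the transversal differential operators, for a
complement `B` of `F` and a `B`-connection on `B`, determined by
`pbw(b₁ ⊙ ⋯ ⊙ bₙ) = (1/n) ∑ₖ (bₖ · pbw(b^{k}) - pbw(∇_{bₖ} b^{k}))` and `pbw(1) = [1]`. -/
structure IsBasePBW (C : BaseConnection B) (p : SymmetricAlgebra R B ≃ₗ[R] TransDiffOp F) :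
    Prop where
  one : p 1 = (leafIdeal F).mkQ ⟨1, one_mem_baseDiffOp⟩
  recursion : ∀ l : List B, l.length • p (baseProd l) = ∑ k : Fin l.length,
    (transAct (l.get k : Derivation ℂ R R) (p (baseProd (l.eraseIdx k)))
      - p (C.nablaProd (l.get k) (l.eraseIdx k)))

variable (B) in
/-- The projection `pr₁` of the symmetric algebra of `B` onto its component `S¹ = B`. -/
def basePr : SymmetricAlgebra R B →ₗ[R] B :=
  TrivSqZeroExt.sndHom R B ∘ₗ
    (SymmetricAlgebra.lift (TrivSqZeroExt.inrHom R B) :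
      SymmetricAlgebra R B →ₐ[R] TrivSqZeroExt R B).toLinearMap

theorem basePr_ι (b : B) : basePr B (SymmetricAlgebra.ι R B b) = b := by
  change (SymmetricAlgebra.lift (TrivSqZeroExt.inrHom R B) (SymmetricAlgebra.ι R B b)).snd = b
  simp

theorem basePr_one : basePr B 1 = 0 := by
  change (SymmetricAlgebra.lift (TrivSqZeroExt.inrHom R B) 1).snd = 0
  simp

theorem basePr_mul (b c : B) (s : SymmetricAlgebra R B) :
    basePr B (SymmetricAlgebra.ι R B b * (SymmetricAlgebra.ι R B c * s)) = 0 := by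
  change (SymmetricAlgebra.lift (TrivSqZeroExt.inrHom R B)
    (SymmetricAlgebra.ι R B b * (SymmetricAlgebra.ι R B c * s))).snd = 0
  simp

/-- The differential `pbw⁻¹ ∘ d_F ∘ pbw` on `Ω_F(S B)`, where `d_F` is the Chevalley–Eilenberg
differential with coefficients in the transversal differential operators. -/
def dolbeaultDelta (p : SymmetricAlgebra R B ≃ₗ[R] TransDiffOp F) :
    Form F (SymmetricAlgebra R B) →ₗ[ℂ] Form F (SymmetricAlgebra R B) :=
  Form.map p.symm.toLinearMap ∘ₗ (FModule.trans F).d ∘ₗ Form.map p.toLinearMap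

/-- The brackets `λₖ(ω₁, …, ωₖ) = pr₁(pbw⁻¹ ∘ d_F ∘ pbw (ω₁ ⊙ ⋯ ⊙ ωₖ))` on `Ω_F(B)`. -/
def dolbeaultBrackets (p : SymmetricAlgebra R B ≃ₗ[R] TransDiffOp F) :
    Brackets (Form F B) (Form F B) := fun k =>
  (Form.map (basePr B) ∘ₗ dolbeaultDelta p).compMultilinearMap
    ((MultilinearMap.mkPiAlgebraFin ℂ k (Form F (SymmetricAlgebra R B))).compLinearMap
      fun _ => Form.map (SymmetricAlgebra.ι R B))

/-! #### The comparison map -/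

variable (F) in
/-- Functions on the base as functions on `F[1]`, via the projection `π : F[1] → M`. -/
def pullback : R →ₗ[ℂ] Form F R where
  toFun f := Form.const f
  map_add' f g := Form.ext fun l => by
    cases l with
    | nil => rfl
    | cons v l => exact (add_zero (0 : R)).symm
  map_smul' c f := Form.ext fun l => by
    cases l with
    | nil => exact Algebra.smul_def c f
    | cons v l => exact (mul_zero (algebraMap ℂ R c)).symm

theorem pullback_mul (f : R) (a : Form F R) (l : List F) : (pullback F f * a) l = f * a l :=
  wedge_const_left (LinearMap.mul R R) f a l

/-- The operator `f ↦ D(π^* f)(v₁, …, vₖ)` on functions on the base. -/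
def evalOp (l : List F) : Module.End ℂ (Form F R) →ₗ[ℂ] Module.End ℂ R where
  toFun D :=
    { toFun := fun f => D (pullback F f) l
      map_add' := fun f g => by rw [map_add, map_add, Form.add_apply]
      map_smul' := fun c f => by
        rw [map_smul, map_smul, Form.csmul_apply, RingHom.id_apply, smul_eq_mul, Algebra.smul_def] }
  map_add' D D' := rfl
  map_smul' c D := LinearMap.ext fun f => by
    change (c • D (pullback F f)) l = c • D (pullback F f) l
    rw [Form.csmul_apply, smul_eq_mul, Algebra.smul_def]

theorem evalOp_apply (l : List F) (D : Module.End ℂ (Form F R)) (f : R) :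
    evalOp l D f = D (pullback F f) l := rfl

theorem pullback_mul_pullback (f g : R) : pullback F (f * g) = pullback F f * pullback F g :=
  Form.ext fun l => by
    rw [pullback_mul]
    cases l with
    | nil => rfl
    | cons v l => exact (mul_zero f).symm

theorem pullback_mem (f : R) : pullback F f ∈ formDeg F R (0 : ℕ) := by
  intro l hl
  cases l with
  | nil => simp at hl
  | cons => rfl

theorem evalOp_mem {n : ℕ} {D : Module.End ℂ (Form F R)} (hD : D ∈ diffOpLT F n) (l : List F) :
    evalOp l D ∈ baseDiffOpLT R n := by
  induction n generalizing D with
  | zero =>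
    have : D = 0 := hD
    rw [this, map_zero]; exact Submodule.zero_mem _
  | succ n ih =>
    rw [mem_baseDiffOpLT_succ]
    intro f
    have h : commFun f (evalOp l D) = evalOp l (gcomm 0 (pullback F f) D) := by
      refine LinearMap.ext fun g => ?_
      rw [commFun_apply, evalOp_apply, evalOp_apply, evalOp_apply, pullback_mul_pullback,
        ← pullback_mul]
      rfl
    rw [h]
    exact ih (mem_diffOpLT_succ.mp hD 0 _ (pullback_mem f))

/-- The push-forward `π_* D` of a differential operator `D` on `F[1]`: the form with values in
the differential operators on the base such that `π_* D (f) = D (π^* f)`. -/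
def pushforward : GrDiffOp F →ₗ[ℂ] Form F (baseDiffOp R) where
  toFun D := ⟨fun l => ⟨evalOp l D, by
      obtain ⟨n, hn⟩ := mem_grDiffOp.mp D.2
      exact mem_baseDiffOp.mpr ⟨n, evalOp_mem hn l⟩⟩,
    { map_add := fun l₁ v w l₂ => Subtype.ext (LinearMap.ext fun f =>
        ((D : Module.End ℂ (Form F R)) (pullback F f)).isForm.map_add l₁ v w l₂)
      map_smul := fun l₁ g v l₂ => Subtype.ext (LinearMap.ext fun f =>
        ((D : Module.End ℂ (Form F R)) (pullback F f)).isForm.map_smul l₁ g v l₂)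
      alt := fun l₁ v l₂ => Subtype.ext (LinearMap.ext fun f =>
        ((D : Module.End ℂ (Form F R)) (pullback F f)).isForm.alt l₁ v l₂) }⟩
  map_add' D D' := Form.ext fun l => Subtype.ext (map_add (evalOp l) _ _)
  map_smul' c D := Form.ext fun l => Subtype.ext (LinearMap.ext fun f => rfl)

theorem vf_leibniz (X : VF F) (f : R) (b : Form F R) :
    (X : Module.End ℂ (Form F R)) (pullback F f * b)
      = (X : Module.End ℂ (Form F R)) (pullback F f) * b
        + pullback F f * (X : Module.End ℂ (Form F R)) b := by
  obtain ⟨X, hX⟩ := X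
  change X (pullback F f * b) = X (pullback F f) * b + pullback F f * X b
  induction hX using Submodule.span_induction with
  | zero => simp
  | add X Y _ _ h h' => simp only [LinearMap.add_apply, h, h', add_mul, mul_add]; abel
  | smul a X _ h =>
    have hc : a * pullback F f = pullback F f * a := form_mul_comm 0 (pullback_mem f) a
    change a * X (pullback F f * b) = a * X (pullback F f) * b + pullback F f * (a * X b)
    rw [h, mul_add, ← mul_assoc, ← mul_assoc, hc, mul_assoc, mul_assoc]
  | mem X hX =>
    obtain ⟨d, hd⟩ := hX
    rw [hd.2, parityPow_of_mem d (pullback_mem f), Nat.cast_zero, mul_zero]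
    simp [sgn]

/-- The push-forward `π_* X` of a vector field `X` on `F[1]`: the form with values in the vector
fields on the base such that `π_* X (f) = X (π^* f)`. -/
def pushforwardVF (X : VF F) : Form F (Derivation ℂ R R) :=
  ⟨fun l => Derivation.mk' (evalOp l X) fun f g => by
      rw [evalOp_apply, pullback_mul_pullback, vf_leibniz, Form.add_apply, pullback_mul, add_comm]
      refine congrArg _ ?_
      rw [smul_eq_mul, mul_comm]
      exact wedge_const_right (LinearMap.mul R R) _ g l,
    { map_add := fun l₁ v w l₂ => Derivation.ext fun f =>
        ((X : Module.End ℂ (Form F R)) (pullback F f)).isForm.map_add l₁ v w l₂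
      map_smul := fun l₁ g v l₂ => Derivation.ext fun f =>
        ((X : Module.End ℂ (Form F R)) (pullback F f)).isForm.map_smul l₁ g v l₂
      alt := fun l₁ v l₂ => Derivation.ext fun f =>
        ((X : Module.End ℂ (Form F R)) (pullback F f)).isForm.alt l₁ v l₂ }⟩

/-- The map `pbw⁻¹ ∘ π_* ∘ pbw : S(𝔛(F[1])) → Ω_F(S B)`. -/
def comparison (p : SymVF F ≃ₗ[ℂ] GrDiffOp F) (q : SymmetricAlgebra R B ≃ₗ[R] TransDiffOp F) :
    SymVF F →ₗ[ℂ] Form F (SymmetricAlgebra R B) :=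
  Form.map q.symm.toLinearMap ∘ₗ Form.map (leafIdeal F).mkQ ∘ₗ pushforward ∘ₗ p.toLinearMap

/-- The multilinear maps `φₖ(X₁, …, Xₖ) = pr₁(pbw⁻¹ ∘ π_* ∘ pbw (X₁ ⊙ ⋯ ⊙ Xₖ))`. -/
def comparisonMaps (p : SymVF F ≃ₗ[ℂ] GrDiffOp F)
    (q : SymmetricAlgebra R B ≃ₗ[R] TransDiffOp F) : Brackets (VF F) (Form F B) := fun k =>
  (Form.map (basePr B) ∘ₗ comparison p q).compMultilinearMap
    ((MultilinearMap.mkPiAlgebraFin ℂ k (SymVF F)).compLinearMap fun _ => SymVF.ofVF)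

/-- The maps `phi` are multilinear over the algebra of scalar forms, with Koszul signs:
`φ(X₁, …, a Xᵢ, …, Xₖ) = (-1)^{|a|(|X₁| + ⋯ + |X_{i-1}|)} a φ(X₁, …, Xₖ)`. -/
def IsFormMultilinear {M : Type*} [AddCommGroup M] [Module R M]
    (phi : Brackets (VF F) (Form F M)) : Prop :=
  ∀ (k : ℤ) (a : Form F R), a ∈ formDeg F R k →
    ∀ (l₁ : List (Homog (vfDeg F))) (X : VF F) (l₂ : List (VF F)),
      phi.ev (l₁.map Homog.val ++ (a • X) :: l₂)
        = sgn (k * (l₁.map Homog.deg).sum) •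
          Form.act a (phi.ev (l₁.map Homog.val ++ X :: l₂))

end Kapranov

/-! ### Complex manifolds -/

open scoped Manifold ContDiff Topology

section Manifold

variable (E : Type*) [NormedAddCommGroup E] [NormedSpace ℂ E]
  (X : Type*) [TopologicalSpace X] [ChartedSpace E X]

/-- The algebra `C^∞(X, ℂ)` of smooth complex-valued functions. -/
def smoothSubalgebra : Subalgebra ℂ (X → ℂ) where
  carrier := {f | ContMDiff 𝓘(ℝ, E) 𝓘(ℝ, ℂ) ∞ f}
  mul_mem' hf hg :=
    (contDiff_mul (𝕜 := ℝ) (𝔸 := ℂ)).comp_contMDiff (hf.prodMk_space hg)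
  add_mem' hf hg := hf.add hg
  algebraMap_mem' _ := contMDiff_const

/-- The type of smooth complex-valued functions on `X`. -/
def SmoothFun : Type _ := smoothSubalgebra E X

instance : CommRing (SmoothFun E X) := inferInstanceAs (CommRing (smoothSubalgebra E X))
instance : Algebra ℂ (SmoothFun E X) := inferInstanceAs (Algebra ℂ (smoothSubalgebra E X))
instance : CoeFun (SmoothFun E X) (fun _ => X → ℂ) := ⟨fun f => f.1⟩

variable {E X}

/-- The function `f` is holomorphic near `x`. -/
def HolomorphicNear (f : X → ℂ) (x : X) : Prop :=
  ∀ᶠ y in 𝓝 x, MDifferentiableAt 𝓘(ℂ, E) 𝓘(ℂ, ℂ) f y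

variable (E X)

/-- Complex vector fields on `X` of type `(0,1)`: those annihilating local holomorphic functions.
Complex vector fields are derivations of the algebra of smooth complex-valued functions. -/
def T01 : LieRinehartSubalgebra (SmoothFun E X)
    (Derivation ℂ (SmoothFun E X) (SmoothFun E X)) where
  carrier := {D | ∀ (f : SmoothFun E X) (x : X),
    HolomorphicNear (E := E) f x → (D f) x = 0}
  zero_mem' := fun f x _ => rfl
  add_mem' := by
    intro D D' h h' f x hf
    change (D f) x + (D' f) x = 0
    rw [h f x hf, h' f x hf, add_zero]
  smul_mem' := by
    intro g D h f x hf
    change g x * (D f) x = 0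
    rw [h f x hf, mul_zero]
  lie_mem' := by
    intro D D' h h' f x hf
    have key : ∀ D D' : Derivation ℂ (SmoothFun E X) (SmoothFun E X),
        (∀ (f : SmoothFun E X) (x : X),
          HolomorphicNear (E := E) f x → (D f) x = 0) →
        (∀ (f : SmoothFun E X) (x : X),
          HolomorphicNear (E := E) f x → (D' f) x = 0) →
        (D (D' f)) x = 0 := by
      intro D D' h h'
      refine h _ x ?_
      have h1 : ∀ᶠ y in 𝓝 x, (D' f) y = 0 := by
        filter_upwards [eventually_eventually_nhds.mpr hf] with y hy
        exact h' f y hy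
      filter_upwards [eventually_eventually_nhds.mpr h1] with y hy
      exact (mdifferentiableAt_const (c := (0 : ℂ))).congr_of_eventuallyEq hy
    change ((⁅D, D'⁆ : Derivation ℂ (SmoothFun E X) (SmoothFun E X)) f : X → ℂ) x = 0
    rw [Derivation.commutator_apply]
    change (D (D' f)) x - (D' (D f)) x = 0
    rw [key D D' h h', key D' D h' h, sub_zero]

/-- Complex vector fields on `X` of type `(1,0)`: those annihilating local antiholomorphic
functions. -/
def T10 : Submodule (SmoothFun E X) (Derivation ℂ (SmoothFun E X) (SmoothFun E X)) where
  carrier := {D | ∀ (f : SmoothFun E X) (x : X),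
    HolomorphicNear (E := E) (fun y => starRingEnd ℂ (f y)) x → (D f) x = 0}
  zero_mem' := fun f x _ => rfl
  add_mem' := by
    intro D D' h h' f x hf
    change (D f) x + (D' f) x = 0
    rw [h f x hf, h' f x hf, add_zero]
  smul_mem' := by
    intro g D h f x hf
    change g x * (D f) x = 0
    rw [h f x hf, mul_zero]

/-- The natural map from `T^{1,0}` to the normal bundle `T_ℂ / T^{0,1}`. -/
def toNormal : T10 E X →ₗ[SmoothFun E X] NormalBundle (T01 E X) :=
  (T01 E X).toSubmodule.mkQ ∘ₗ (T10 E X).subtype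

end Manifold

end KapranovDolbeault

end

open KapranovDolbeault
open scoped Manifold ContDiff

noncomputable section

namespace KapranovDolbeault

/-- The endomorphisms of the algebra of forms. -/
notation:max "FormEnd" F:max R:max => Module.End ℂ (Form F R)

namespace InstanceShortcuts

variable {R : Type*} [CommRing R] [Algebra ℂ R] {F : LieRinehartSubalgebra R (Derivation ℂ R R)}
  {M : Type*} [AddCommGroup M] [Module R M]

scoped instance : Module ℂ R := inferInstance
scoped instance : Module R (Derivation ℂ R R) := inferInstance
scoped instance : AddCommMonoid (Form F M) := inferInstance
scoped instance : MulAction ℂ (Form F R) := inferInstance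
scoped instance : Semiring (Form F R) := inferInstance
scoped instance : AddCommGroup (VF F) := inferInstance
scoped instance : AddGroup (VF F) := inferInstance
scoped instance : AddCommMonoid (VF F) := inferInstance
scoped instance : Module ℂ (VF F) := inferInstance
scoped instance : Semiring (SymVF F) := inferInstance
scoped instance : AddCommMonoid (SymVF F) := inferInstance
scoped instance : Module ℂ (SymVF F) := inferInstance
scoped instance : AddCommMonoid (SymmetricAlgebra R M) := inferInstance
scoped instance : Module R (SymmetricAlgebra R M) := inferInstance
scoped instance : Semiring (FormEnd F R) := inferInstance
scoped instance : Semigroup (FormEnd F R) := inferInstance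
scoped instance : NonAssocRing (FormEnd F R) := inferInstance
scoped instance : AddCommGroup (FormEnd F R) := inferInstance
scoped instance : Module ℂ (FormEnd F R) := inferInstance

end InstanceShortcuts

open InstanceShortcuts

/-! ### Signs -/

section Signs

theorem sgn_zero : sgn 0 = 1 := by simp [sgn]

theorem sgn_two_mul (n : ℤ) : sgn (2 * n) = 1 := by
  rw [two_mul, sgn_add, sgn_mul_self]

theorem sgn_congr {m n : ℤ} (k : ℤ) (h : m = n + 2 * k) : sgn m = sgn n := by
  rw [h, sgn_add, sgn_two_mul, mul_one]

theorem sgn_smul_smul {W : Type*} [AddCommGroup W] (m n : ℤ) (w : W) :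
    sgn m • sgn n • w = sgn (m + n) • w := by
  rw [smul_smul, sgn_add]

theorem sgn_smul_sgn_smul {W : Type*} [AddCommGroup W] (n : ℤ) (w : W) :
    sgn n • sgn n • w = w := by
  rw [smul_smul, sgn_mul_self, one_smul]

end Signs

/-! ### Sums over unshuffles -/

section Unshuffle

variable {ι W W' : Type*} [AddCommGroup W] [AddCommGroup W'] (deg : ι → ℤ)

theorem unshuffleSum_nil (G : List ι → List ι → W) : unshuffleSum deg [] G = G [] [] := rfl

theorem unshuffleSum_cons (x : ι) (l : List ι) (G : List ι → List ι → W) :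
    unshuffleSum deg (x :: l) G = unshuffleSum deg l (fun S T => G (x :: S) T)
      + unshuffleSum deg l (fun S T => sgn (deg x * (S.map deg).sum) • G S (x :: T)) := rfl

theorem unshuffleSum_congr {l : List ι} {G H : List ι → List ι → W}
    (h : ∀ S T, S.length + T.length = l.length →
      (S.map deg).sum + (T.map deg).sum = (l.map deg).sum → G S T = H S T) :
    unshuffleSum deg l G = unshuffleSum deg l H := by
  induction l generalizing G H with
  | nil => exact h [] [] rfl (by simp)
  | cons x l ih =>
    rw [unshuffleSum_cons, unshuffleSum_cons]
    congr 1
    · refine ih fun S T h1 h2 => h _ _ ?_ ?_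
      · simp only [List.length_cons]; omega
      · simp only [List.map_cons, List.sum_cons]; omega
    · refine ih fun S T h1 h2 => congrArg _ (h _ _ ?_ ?_)
      · simp only [List.length_cons]; omega
      · simp only [List.map_cons, List.sum_cons]; omega

theorem unshuffleSum_congr' {l : List ι} {G H : List ι → List ι → W} (h : ∀ S T, G S T = H S T) :
    unshuffleSum deg l G = unshuffleSum deg l H :=
  unshuffleSum_congr deg fun S T _ _ => h S T

theorem unshuffleSum_add (l : List ι) (G H : List ι → List ι → W) :
    unshuffleSum deg l (fun S T => G S T + H S T)
      = unshuffleSum deg l G + unshuffleSum deg l H := by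
  induction l generalizing G H with
  | nil => rfl
  | cons x l ih => simp only [unshuffleSum_cons, smul_add, ih]; abel

theorem map_unshuffleSum {Φ : Type*} [FunLike Φ W W'] [AddMonoidHomClass Φ W W'] (φ : Φ)
    (l : List ι) (G : List ι → List ι → W) :
    φ (unshuffleSum deg l G) = unshuffleSum deg l (fun S T => φ (G S T)) := by
  induction l generalizing G with
  | nil => rfl
  | cons x l ih => simp only [unshuffleSum_cons, map_add, ih, map_zsmul]

theorem unshuffleSum_zero (l : List ι) : unshuffleSum deg l (fun _ _ => (0 : W)) = 0 :=
  (map_unshuffleSum deg (0 : W →+ W) l (fun _ _ => 0)).symm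

theorem unshuffleSum_zsmul (l : List ι) (n : ℤ) (G : List ι → List ι → W) :
    unshuffleSum deg l (fun S T => n • G S T) = n • unshuffleSum deg l G :=
  (map_unshuffleSum deg (zsmulAddGroupHom n : W →+ W) l G).symm

theorem unshuffleSum_nsmul (l : List ι) (n : ℕ) (G : List ι → List ι → W) :
    unshuffleSum deg l (fun S T => n • G S T) = n • unshuffleSum deg l G :=
  (map_unshuffleSum deg (nsmulAddMonoidHom n : W →+ W) l G).symm

theorem unshuffleSum_neg (l : List ι) (G : List ι → List ι → W) :
    unshuffleSum deg l (fun S T => -G S T) = -unshuffleSum deg l G :=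
  (map_unshuffleSum deg (negAddMonoidHom : W →+ W) l G).symm

theorem unshuffleSum_sub (l : List ι) (G H : List ι → List ι → W) :
    unshuffleSum deg l (fun S T => G S T - H S T)
      = unshuffleSum deg l G - unshuffleSum deg l H := by
  simp only [sub_eq_add_neg, unshuffleSum_add, unshuffleSum_neg]

theorem unshuffleSum_eq_left (l : List ι) (G : List ι → List ι → W)
    (hG : ∀ S T, T ≠ [] → G S T = 0) : unshuffleSum deg l G = G l [] := by
  induction l generalizing G with
  | nil => rfl
  | cons x l ih =>
    rw [unshuffleSum_cons, ih _ fun S T hT => hG _ _ hT,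
      unshuffleSum_congr' deg (H := fun _ _ => 0), unshuffleSum_zero, add_zero]
    intro S T
    rw [hG _ _ (by simp), smul_zero]

theorem unshuffleSum_eq_right (l : List ι) (G : List ι → List ι → W)
    (hG : ∀ S T, S ≠ [] → G S T = 0) : unshuffleSum deg l G = G [] l := by
  induction l generalizing G with
  | nil => rfl
  | cons x l ih =>
    rw [unshuffleSum_cons, unshuffleSum_congr' deg (H := fun _ _ => 0) fun S T => hG _ _ (by simp),
      unshuffleSum_zero, zero_add, ih _ fun S T hT => by rw [hG _ _ hT, smul_zero]]
    simp [sgn_zero]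

/-- Unshuffles into three blocks, formed in two ways. -/
theorem unshuffleSum_assoc (l : List ι) (G : List ι → List ι → List ι → W) :
    unshuffleSum deg l (fun U V => unshuffleSum deg U fun S T => G S T V)
      = unshuffleSum deg l (fun S U => unshuffleSum deg U fun T V => G S T V) := by
  induction l generalizing G with
  | nil => rfl
  | cons x l ih =>
    simp only [unshuffleSum_cons, unshuffleSum_add]
    rw [ih fun S T V => G (x :: S) T V,
      ih fun S T V => sgn (deg x * (S.map deg).sum) • G S (x :: T) V,
      add_assoc]
    simp only [smul_add, unshuffleSum_add]
    refine congrArg₂ _ rfl (congrArg₂ _ ?_ ?_)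
    · simp only [unshuffleSum_zsmul]
    · rw [← unshuffleSum_congr' deg fun U V => unshuffleSum_zsmul deg U _ _]
      rw [unshuffleSum_congr deg (H := fun U V => unshuffleSum deg U fun S T =>
        sgn (deg x * (S.map deg).sum) • sgn (deg x * (T.map deg).sum) • G S T (x :: V)), ih]
      · simp only [unshuffleSum_zsmul]
      · intro U V _ _
        refine unshuffleSum_congr deg fun S T _ h => ?_
        rw [sgn_smul_smul, ← h, mul_add]

/-- Graded cocommutativity of unshuffles. -/
theorem unshuffleSum_comm (l : List ι) (G : List ι → List ι → W) :
    unshuffleSum deg l G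
      = unshuffleSum deg l fun S T => sgn ((S.map deg).sum * (T.map deg).sum) • G T S := by
  induction l generalizing G with
  | nil => simp [unshuffleSum_nil, sgn_zero]
  | cons x l ih =>
    rw [unshuffleSum_cons, unshuffleSum_cons, ih fun S T => G (x :: S) T,
      ih fun S T => sgn (deg x * (S.map deg).sum) • G S (x :: T), add_comm]
    refine congrArg₂ _ (unshuffleSum_congr' deg fun S T => ?_)
      (unshuffleSum_congr' deg fun S T => ?_)
    · rw [sgn_smul_smul]
      exact congrArg (· • _) (sgn_congr 0 (by simp only [List.map_cons, List.sum_cons]; ring))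
    · rw [sgn_smul_smul]
      exact congrArg (· • _) (sgn_congr (-(deg x * (S.map deg).sum))
        (by simp only [List.map_cons, List.sum_cons]; ring))

/-- Exchange of the first two blocks of an unshuffle into three blocks. -/
theorem unshuffleSum_left_comm (l : List ι) (G : List ι → List ι → List ι → W) :
    unshuffleSum deg l (fun S U => unshuffleSum deg U fun T V => G S T V)
      = unshuffleSum deg l (fun T U => unshuffleSum deg U fun S V =>
        sgn ((S.map deg).sum * (T.map deg).sum) • G S T V) := by
  rw [← unshuffleSum_assoc, ← unshuffleSum_assoc]
  refine unshuffleSum_congr' deg fun U V => ?_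
  rw [unshuffleSum_comm]
  exact unshuffleSum_congr' deg fun S T => by rw [mul_comm]

/-- The sum, with Koszul signs, over all ways of moving one element of a list to the front. -/
def pickSum : List ι → (ι → List ι → W) → W
  | [], _ => 0
  | x :: l, G => G x l + pickSum l fun y t => sgn (deg x * deg y) • G y (x :: t)

theorem pickSum_cons (x : ι) (l : List ι) (G : ι → List ι → W) :
    pickSum deg (x :: l) G = G x l + pickSum deg l fun y t => sgn (deg x * deg y) • G y (x :: t) :=
  rfl

theorem pickSum_congr {l : List ι} {G H : ι → List ι → W}
    (h : ∀ y t, t.length + 1 = l.length → deg y + (t.map deg).sum = (l.map deg).sum →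
      G y t = H y t) : pickSum deg l G = pickSum deg l H := by
  induction l generalizing G H with
  | nil => rfl
  | cons x l ih =>
    rw [pickSum_cons, pickSum_cons, h x l rfl (by simp)]
    refine congrArg _ (ih fun y t h1 h2 => congrArg _ (h _ _ (by simp [h1]) ?_))
    simp only [List.map_cons, List.sum_cons, ← h2]; ring

theorem map_pickSum {Φ : Type*} [FunLike Φ W W'] [AddMonoidHomClass Φ W W'] (φ : Φ)
    (l : List ι) (G : ι → List ι → W) :
    φ (pickSum deg l G) = pickSum deg l fun y t => φ (G y t) := by
  induction l generalizing G with
  | nil => exact map_zero φ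
  | cons x l ih => simp only [pickSum_cons, map_add, ih, map_zsmul]

theorem pickSum_add (l : List ι) (G H : ι → List ι → W) :
    pickSum deg l (fun y t => G y t + H y t) = pickSum deg l G + pickSum deg l H := by
  induction l generalizing G H with
  | nil => exact (add_zero _).symm
  | cons x l ih => simp only [pickSum_cons, smul_add, ih]; abel

theorem pickSum_zsmul (l : List ι) (n : ℤ) (G : ι → List ι → W) :
    pickSum deg l (fun y t => n • G y t) = n • pickSum deg l G :=
  (map_pickSum deg (zsmulAddGroupHom n : W →+ W) l G).symm

theorem pickSum_neg (l : List ι) (G : ι → List ι → W) :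
    pickSum deg l (fun y t => -G y t) = -pickSum deg l G :=
  (map_pickSum deg (negAddMonoidHom : W →+ W) l G).symm

theorem pickSum_sub (l : List ι) (G H : ι → List ι → W) :
    pickSum deg l (fun y t => G y t - H y t) = pickSum deg l G - pickSum deg l H := by
  simp only [sub_eq_add_neg, pickSum_add, pickSum_neg]

theorem pickSum_finsetSum {J : Type*} (s : Finset J) (l : List ι) (G : J → ι → List ι → W) :
    pickSum deg l (fun y t => ∑ j ∈ s, G j y t) = ∑ j ∈ s, pickSum deg l (G j) := by
  classical
  induction s using Finset.induction_on with
  | empty =>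
    simp only [Finset.sum_empty]
    exact (map_pickSum deg (0 : W →+ W) l (fun _ _ => 0)).symm
  | insert j s hj ih => simp only [Finset.sum_insert hj, pickSum_add, ih]

/-- Picking from a list and then unshuffling, or unshuffling and picking from the left block. -/
theorem pickSum_unshuffleSum_left (l : List ι) (G : ι → List ι → List ι → W) :
    pickSum deg l (fun y t => unshuffleSum deg t (G y))
      = unshuffleSum deg l (fun S T => pickSum deg S fun y S' => G y S' T) := by
  induction l generalizing G with
  | nil => rfl
  | cons x l ih =>
    simp only [unshuffleSum_cons, pickSum_cons, unshuffleSum_add, smul_add, pickSum_add, add_assoc]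
    rw [← ih fun y S' T => sgn (deg x * deg y) • G y (x :: S') T]
    simp only [unshuffleSum_zsmul]
    refine congrArg _ (congrArg _ ?_)
    rw [unshuffleSum_congr deg (H := fun S T => pickSum deg S fun y S' =>
      sgn (deg x * (deg y + (S'.map deg).sum)) • G y S' (x :: T)), ← ih]
    · refine pickSum_congr deg fun y t _ _ => ?_
      rw [← unshuffleSum_zsmul]
      exact unshuffleSum_congr' deg fun S T => by rw [sgn_smul_smul, mul_add]
    · intro S T _ _
      rw [← pickSum_zsmul]
      exact pickSum_congr deg fun y t _ h => by rw [h]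

theorem pickSum_unshuffleSum_right (l : List ι) (G : ι → List ι → List ι → W) :
    pickSum deg l (fun y t => unshuffleSum deg t fun S T =>
        sgn (deg y * (S.map deg).sum) • G y S T)
      = unshuffleSum deg l (fun S T => pickSum deg T fun y T' => G y S T') := by
  rw [unshuffleSum_comm, unshuffleSum_congr deg (H := fun S T => pickSum deg S fun y S' =>
    sgn ((deg y + (S'.map deg).sum) * (T.map deg).sum) • G y T S'), ← pickSum_unshuffleSum_left]
  · refine pickSum_congr deg fun y t _ _ => ?_
    rw [unshuffleSum_comm]
    refine unshuffleSum_congr' deg fun S T => ?_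
    rw [sgn_smul_smul]
    exact congrArg (· • _) (sgn_congr 0 (by ring))
  · intro S T _ _
    rw [← pickSum_zsmul]
    exact pickSum_congr deg fun y t _ h => by rw [h]

/-- The extension of a map `D` of degree `e` on the entries of a list as a graded derivation. -/
def derSum (e : ℤ) (D : ι → ι) : List ι → (List ι → W) → W
  | [], _ => 0
  | y :: l, G => G (D y :: l) + sgn (e * deg y) • derSum e D l fun t => G (y :: t)

theorem derSum_cons (e : ℤ) (D : ι → ι) (y : ι) (l : List ι) (G : List ι → W) :
    derSum deg e D (y :: l) G
      = G (D y :: l) + sgn (e * deg y) • derSum deg e D l fun t => G (y :: t) := rfl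

variable {deg} in
theorem derSum_congr {e : ℤ} {D : ι → ι} (hD : ∀ y, deg (D y) = e + deg y) {l : List ι}
    {G H : List ι → W}
    (h : ∀ t, t.length = l.length → (t.map deg).sum = e + (l.map deg).sum → G t = H t) :
    derSum deg e D l G = derSum deg e D l H := by
  induction l generalizing G H with
  | nil => rfl
  | cons x l ih =>
    rw [derSum_cons, derSum_cons, h _ (by simp) (by simp [hD, add_assoc])]
    refine congrArg _ (congrArg _ (ih fun t h1 h2 => h _ (by simp [h1]) ?_))
    simp only [List.map_cons, List.sum_cons, h2]; ring

theorem derSum_add (e : ℤ) (D : ι → ι) (l : List ι) (G H : List ι → W) :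
    derSum deg e D l (fun t => G t + H t) = derSum deg e D l G + derSum deg e D l H := by
  induction l generalizing G H with
  | nil => exact (add_zero _).symm
  | cons x l ih => simp only [derSum_cons, smul_add, ih]; abel

theorem map_derSum {Φ : Type*} [FunLike Φ W W'] [AddMonoidHomClass Φ W W'] (φ : Φ)
    (e : ℤ) (D : ι → ι) (l : List ι) (G : List ι → W) :
    φ (derSum deg e D l G) = derSum deg e D l fun t => φ (G t) := by
  induction l generalizing G with
  | nil => exact map_zero φ
  | cons x l ih => simp only [derSum_cons, map_add, ih, map_zsmul]

theorem derSum_zsmul (e : ℤ) (D : ι → ι) (l : List ι) (n : ℤ) (G : List ι → W) :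
    derSum deg e D l (fun t => n • G t) = n • derSum deg e D l G :=
  (map_derSum deg (zsmulAddGroupHom n : W →+ W) e D l G).symm

variable {deg} in
/-- The extension of a map as a derivation is compatible with unshuffles. -/
theorem derSum_unshuffleSum {e : ℤ} {D : ι → ι} (hD : ∀ y, deg (D y) = e + deg y) (l : List ι)
    (G : List ι → List ι → W) :
    derSum deg e D l (fun t => unshuffleSum deg t G)
      = unshuffleSum deg l (fun S T => derSum deg e D S (fun S' => G S' T)
          + sgn (e * (S.map deg).sum) • derSum deg e D T (fun T' => G S T')) := by
  induction l generalizing G with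
  | nil => simp [unshuffleSum_nil, derSum]
  | cons x l ih =>
    simp only [unshuffleSum_cons, derSum_cons, derSum_add, smul_add]
    rw [ih fun S T => G (x :: S) T, ih fun S T => sgn (deg x * (S.map deg).sum) • G S (x :: T)]
    simp only [unshuffleSum_add, smul_add, ← unshuffleSum_zsmul]
    have h1 : unshuffleSum deg l (fun S T => sgn (deg (D x) * (S.map deg).sum) • G S (D x :: T))
        = unshuffleSum deg l fun S T => sgn (deg x * (S.map deg).sum) •
          sgn (e * (S.map deg).sum) • G S (D x :: T) := unshuffleSum_congr' deg fun S T => by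
      rw [sgn_smul_smul, hD]
      exact congrArg (· • _) (sgn_congr 0 (by ring))
    have h2 : unshuffleSum deg l (fun S T => sgn (e * deg x) • derSum deg e D S fun S' =>
          sgn (deg x * (S'.map deg).sum) • G S' (x :: T))
        = unshuffleSum deg l fun S T => sgn (deg x * (S.map deg).sum) •
          derSum deg e D S fun S' => G S' (x :: T) := unshuffleSum_congr' deg fun S T => by
      rw [← derSum_zsmul, ← derSum_zsmul]
      refine derSum_congr hD fun t _ h => ?_
      rw [sgn_smul_smul, h]
      exact congrArg (· • _) (sgn_congr (e * deg x) (by ring))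
    have h3 : unshuffleSum deg l (fun S T => sgn (e * deg x) • sgn (e * (S.map deg).sum) •
          derSum deg e D T fun T' => G (x :: S) T')
        = unshuffleSum deg l fun S T => sgn (e * ((x :: S).map deg).sum) •
          derSum deg e D T fun T' => G (x :: S) T' := unshuffleSum_congr' deg fun S T => by
      rw [sgn_smul_smul, List.map_cons, List.sum_cons, mul_add]
    have h4 : unshuffleSum deg l (fun S T => sgn (e * deg x) • sgn (e * (S.map deg).sum) •
          derSum deg e D T fun T' => sgn (deg x * (S.map deg).sum) • G S (x :: T'))
        = unshuffleSum deg l fun S T => sgn (deg x * (S.map deg).sum) •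
          sgn (e * (S.map deg).sum) • sgn (e * deg x) • derSum deg e D T fun T' => G S (x :: T') :=
      unshuffleSum_congr' deg fun S T => by
        rw [derSum_zsmul, sgn_smul_smul, sgn_smul_smul, sgn_smul_smul, sgn_smul_smul]
        exact congrArg (· • _) (sgn_congr 0 (by ring))
    rw [h1, h2, h3, h4]
    abel

end Unshuffle

section Convolution

variable {ι 𝒜 : Type*} [Ring 𝒜] {deg : ι → ℤ}

theorem unshuffleSum_mul (l : List ι) (G : List ι → List ι → 𝒜) (c : 𝒜) :
    unshuffleSum deg l G * c = unshuffleSum deg l fun S T => G S T * c :=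
  map_unshuffleSum deg (AddMonoidHom.mulRight c) l G

theorem mul_unshuffleSum (l : List ι) (G : List ι → List ι → 𝒜) (c : 𝒜) :
    c * unshuffleSum deg l G = unshuffleSum deg l fun S T => c * G S T :=
  map_unshuffleSum deg (AddMonoidHom.mulLeft c) l G

theorem pickSum_mul (l : List ι) (G : ι → List ι → 𝒜) (c : 𝒜) :
    pickSum deg l G * c = pickSum deg l fun y t => G y t * c :=
  map_pickSum deg (AddMonoidHom.mulRight c) l G

theorem mul_pickSum (l : List ι) (G : ι → List ι → 𝒜) (c : 𝒜) :
    c * pickSum deg l G = pickSum deg l fun y t => c * G y t :=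
  map_pickSum deg (AddMonoidHom.mulLeft c) l G

theorem derSum_mul (e : ℤ) (D : ι → ι) (l : List ι) (G : List ι → 𝒜) (c : 𝒜) :
    derSum deg e D l G * c = derSum deg e D l fun t => G t * c :=
  map_derSum deg (AddMonoidHom.mulRight c) e D l G

theorem mul_derSum (e : ℤ) (D : ι → ι) (l : List ι) (G : List ι → 𝒜) (c : 𝒜) :
    c * derSum deg e D l G = derSum deg e D l fun t => c * G t :=
  map_derSum deg (AddMonoidHom.mulLeft c) e D l G

/-- The sum over the positions of a list is the sum over the ways of picking an element. -/
theorem sum_fin_eq_pickSum {W : Type*} [AddCommGroup W] (deg : ι → ℤ) (l : List ι)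
    (G : ι → List ι → W) :
    ∑ k : Fin l.length, sgn (deg (l.get k) * ((l.take k).map deg).sum) • G (l.get k) (l.eraseIdx k)
      = pickSum deg l G := by
  induction l generalizing G with
  | nil => rfl
  | cons x l ih =>
    rw [pickSum_cons, ← ih]
    refine (Fin.sum_univ_succ (n := l.length) _).trans ?_
    congr 1
    · simp [sgn_zero]
    · refine Finset.sum_congr rfl fun k _ => ?_
      simp only [Fin.val_succ, List.take_succ_cons, List.eraseIdx_cons_succ,
        List.map_cons, List.sum_cons]
      rw [sgn_smul_smul, show (x :: l).get k.succ = l.get k from rfl]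
      exact congrArg (· • _) (sgn_congr 0 (by ring))

theorem pickSum_const {W : Type*} [AddCommGroup W] {l : List ι} {G : ι → List ι → W} {w : W}
    (deg : ι → ℤ) (h : ∀ l₁ y l₂, l = l₁ ++ y :: l₂ →
      G y (l₁ ++ l₂) = sgn (deg y * (l₁.map deg).sum) • w) :
    pickSum deg l G = l.length • w := by
  induction l generalizing G with
  | nil => exact (zero_smul ℕ w).symm
  | cons x l ih =>
    rw [pickSum_cons, ih, List.length_cons, succ_nsmul']
    · refine congrArg (· + _) ?_
      simpa [sgn_zero] using h [] x l rfl
    · rintro l₁ y l₂ rfl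
      have := h (x :: l₁) y l₂ rfl
      rw [List.cons_append] at this
      rw [this, sgn_smul_smul]
      exact congrArg (· • _) (sgn_congr (deg x * deg y)
        (by simp only [List.map_cons, List.sum_cons]; ring))

/-- A function of lists is determined by its value on the empty list and a recursion over the
choice of an element. -/
theorem eq_of_pickSum_recursion [IsAddTorsionFree 𝒜] {act : ι → 𝒜 → 𝒜} {D : ι → ι → ι}
    {p p' : List ι → 𝒜}
    (hp : ∀ l, l.length • p l = pickSum deg l fun y t => act y (p t) - derSum deg (deg y) (D y) t p)
    (hp' : ∀ l, l.length • p' l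
      = pickSum deg l fun y t => act y (p' t) - derSum deg (deg y) (D y) t p')
    (hD : ∀ x y, deg (D x y) = deg x + deg y)
    (h0 : p [] = p' []) (l : List ι) : p l = p' l := by
  induction hn : l.length generalizing l with
  | zero => rw [List.length_eq_zero_iff.mp hn, h0]
  | succ n ih =>
    refine nsmul_right_injective (n := l.length) (by omega) ?_
    change l.length • p l = l.length • p' l
    rw [hp, hp']
    refine pickSum_congr deg fun y t ht _ => ?_
    rw [ih t (by omega)]
    exact congrArg _ (derSum_congr (hD y) fun t' ht' _ => ih t' (by omega))

/-- Functions of lists which satisfy the recursion of the Poincaré–Birkhoff–Witt map are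
multiplicative along unshuffles. -/
theorem unshuffleSum_mul_of_recursion [IsAddTorsionFree 𝒜] {κ : ℤ} {act : ι → 𝒜 →+ 𝒜}
    {D : ι → ι → ι} (hD : ∀ x y, deg (D x y) = deg x + deg y) {p q r : List ι → 𝒜}
    (hact : ∀ y S b, act y (p S * b)
      = act y (p S) * b + sgn (deg y * (κ + (S.map deg).sum)) • (p S * act y b))
    (hp : ∀ l, l.length • p l = pickSum deg l fun y t => act y (p t) - derSum deg (deg y) (D y) t p)
    (hq : ∀ l, l.length • q l = pickSum deg l fun y t => act y (q t) - derSum deg (deg y) (D y) t q)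
    (hr : ∀ l, l.length • r l = pickSum deg l fun y t => act y (r t) - derSum deg (deg y) (D y) t r)
    (h0 : r [] = p [] * q []) (l : List ι) :
    r l = unshuffleSum deg l fun S T => sgn (κ * (T.map deg).sum) • (p S * q T) := by
  refine eq_of_pickSum_recursion (deg := deg) (act := fun y => act y) (D := D)
    (p' := fun l => unshuffleSum deg l fun S T => sgn (κ * (T.map deg).sum) • (p S * q T))
    hr (fun l => ?_) hD (by simp [unshuffleSum_nil, h0, sgn_zero]) l
  have hl : ∀ l : List ι, l.length • unshuffleSum deg l
        (fun S T => sgn (κ * (T.map deg).sum) • (p S * q T))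
      = unshuffleSum deg l (fun S T => sgn (κ * (T.map deg).sum) • ((S.length • p S) * q T))
        + unshuffleSum deg l (fun S T => sgn (κ * (T.map deg).sum) • (p S * (T.length • q T))) := by
    intro l
    rw [← unshuffleSum_add, ← unshuffleSum_nsmul]
    refine unshuffleSum_congr deg fun S T h _ => ?_
    rw [← h, smul_mul_assoc, mul_smul_comm, ← smul_add, ← add_smul, smul_comm]
  rw [hl, pickSum_sub]
  have h1 : unshuffleSum deg l (fun S T => sgn (κ * (T.map deg).sum) • ((S.length • p S) * q T))
      = pickSum deg l fun y t => unshuffleSum deg t fun S T => sgn (κ * (T.map deg).sum) •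
        ((act y (p S) - derSum deg (deg y) (D y) S p) * q T) := by
    rw [pickSum_unshuffleSum_left]
    refine unshuffleSum_congr' deg fun S T => ?_
    rw [hp, pickSum_mul, ← pickSum_zsmul]
  have h2 : unshuffleSum deg l (fun S T => sgn (κ * (T.map deg).sum) • (p S * (T.length • q T)))
      = pickSum deg l fun y t => unshuffleSum deg t fun S T => sgn (deg y * (S.map deg).sum) •
        sgn (κ * (deg y + (T.map deg).sum)) •
          (p S * (act y (q T) - derSum deg (deg y) (D y) T q)) := by
    rw [pickSum_unshuffleSum_right]
    refine unshuffleSum_congr' deg fun S T => ?_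
    rw [hq, mul_pickSum, ← pickSum_zsmul]
    exact pickSum_congr deg fun y t _ h => by rw [h]
  rw [h1, h2, ← pickSum_add, ← pickSum_sub]
  refine pickSum_congr deg fun y t _ _ => ?_
  rw [map_unshuffleSum, derSum_unshuffleSum (hD y), ← unshuffleSum_add, ← unshuffleSum_sub]
  refine unshuffleSum_congr' deg fun S T => ?_
  have h3 : derSum deg (deg y) (D y) S (fun S' => sgn (κ * (T.map deg).sum) • (p S' * q T))
      = sgn (κ * (T.map deg).sum) • (derSum deg (deg y) (D y) S p * q T) := by
    rw [derSum_zsmul, derSum_mul]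
  have h4 : derSum deg (deg y) (D y) T (fun T' => sgn (κ * (T'.map deg).sum) • (p S * q T'))
      = sgn (κ * (deg y + (T.map deg).sum)) • (p S * derSum deg (deg y) (D y) T q) := by
    rw [derSum_congr (hD y) (H := fun T' => sgn (κ * (deg y + (T.map deg).sum)) • (p S * q T')),
      derSum_zsmul, mul_derSum]
    intro t _ h; rw [h]
  rw [h3, h4, map_zsmul, hact, sub_mul, mul_sub]
  simp only [smul_sub, smul_add, sgn_smul_smul]
  rw [show sgn (deg y * (S.map deg).sum + κ * (deg y + (T.map deg).sum))
    = sgn (κ * (T.map deg).sum + deg y * (κ + (S.map deg).sum)) from sgn_congr 0 (by ring)]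
  abel

/-- Inserting a degree one function of blocks into a multiplicative function of lists is a
coderivation. -/
theorem unshuffleSum_insert {κ : ℤ} {p q r : List ι → 𝒜} {lam : List ι → ι}
    (hlam : ∀ S, deg (lam S) = 1 + (S.map deg).sum)
    (hr : ∀ l, r l = unshuffleSum deg l fun S T => sgn (κ * (T.map deg).sum) • (p S * q T))
    (l : List ι) :
    unshuffleSum deg l (fun S T => r (lam S :: T))
      = unshuffleSum deg l fun S T =>
        sgn (κ * (T.map deg).sum) • (unshuffleSum deg S (fun S₁ S₂ => p (lam S₁ :: S₂)) * q T)
        + sgn (κ * (1 + (T.map deg).sum) + (S.map deg).sum) •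
          (p S * unshuffleSum deg T (fun T₁ T₂ => q (lam T₁ :: T₂))) := by
  simp only [hr, unshuffleSum_cons, unshuffleSum_add]
  congr 1
  · rw [← unshuffleSum_assoc]
    refine unshuffleSum_congr' deg fun S T => ?_
    rw [unshuffleSum_zsmul, unshuffleSum_mul]
  · rw [unshuffleSum_left_comm]
    refine unshuffleSum_congr deg fun S T _ _ => ?_
    rw [mul_unshuffleSum, ← unshuffleSum_zsmul]
    refine unshuffleSum_congr deg fun T₁ T₂ _ h => ?_
    simp only [sgn_smul_smul, List.map_cons, List.sum_cons, hlam]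
    refine congrArg (· • _) (sgn_congr ((T₁.map deg).sum * (S.map deg).sum) ?_)
    rw [← h]; ring

/-! #### Convolution exponentials -/

/-- The convolution exponential of a function of lists. -/
def convExp (deg : ι → ℤ) (u : List ι → 𝒜) : List ι → 𝒜
  | [] => 1
  | x :: l => unshuffleSum deg l fun S T => u (x :: S) *
      (if T.length ≤ l.length then convExp deg u T else 0)
termination_by l => l.length

theorem convExp_nil (u : List ι → 𝒜) : convExp deg u [] = 1 := by
  rw [convExp]

theorem convExp_cons (u : List ι → 𝒜) (x : ι) (l : List ι) :
    convExp deg u (x :: l) = unshuffleSum deg l fun S T => u (x :: S) * convExp deg u T := by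
  rw [convExp]
  refine unshuffleSum_congr deg fun S T h _ => ?_
  rw [if_pos (by omega)]

theorem map_convExp {ℬ Φ : Type*} [Ring ℬ] [FunLike Φ 𝒜 ℬ] [RingHomClass Φ 𝒜 ℬ] (φ : Φ)
    (u : List ι → 𝒜) (l : List ι) :
    φ (convExp deg u l) = convExp deg (fun S => φ (u S)) l := by
  induction hn : l.length using Nat.strong_induction_on generalizing l with
  | _ n ih =>
    cases l with
    | nil => rw [convExp_nil, convExp_nil, map_one]
    | cons x l =>
      rw [convExp_cons, convExp_cons, map_unshuffleSum]
      refine unshuffleSum_congr deg fun S T h _ => ?_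
      rw [map_mul, ih T.length (by simp at hn; omega) T rfl]

theorem convExp_commute {u w : List ι → 𝒜}
    (h : ∀ S T, u S * w T = sgn ((S.map deg).sum * (T.map deg).sum) • (w T * u S))
    (S T : List ι) : convExp deg u S * w T
      = sgn ((S.map deg).sum * (T.map deg).sum) • (w T * convExp deg u S) := by
  induction hn : S.length using Nat.strong_induction_on generalizing S with
  | _ n ih =>
    cases S with
    | nil => simp [convExp_nil, sgn_zero]
    | cons x l =>
      rw [convExp_cons, unshuffleSum_mul,
        mul_unshuffleSum, ← unshuffleSum_zsmul]
      refine unshuffleSum_congr deg fun S₁ S₂ h1 h2 => ?_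
      rw [mul_assoc, ih S₂.length (by simp at hn; omega) S₂ rfl, mul_smul_comm, ← mul_assoc, h,
        smul_mul_assoc, mul_assoc, sgn_smul_smul]
      refine congrArg (· • _) (sgn_congr 0 ?_)
      simp only [List.map_cons, List.sum_cons, ← h2]; ring

/-- The exponential of a sum is the product of the exponentials. -/
theorem convExp_add {u w : List ι → 𝒜}
    (h : ∀ S T, u S * w T = sgn ((S.map deg).sum * (T.map deg).sum) • (w T * u S)) (l : List ι) :
    convExp deg (fun S => u S + w S) l
      = unshuffleSum deg l fun S T => convExp deg u S * convExp deg w T := by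
  induction hn : l.length using Nat.strong_induction_on generalizing l with
  | _ n ih =>
    cases l with
    | nil => simp [convExp_nil, unshuffleSum_nil]
    | cons x l =>
      rw [convExp_cons, unshuffleSum_cons]
      have h1 : unshuffleSum deg l (fun S T => (u (x :: S) + w (x :: S)) *
            convExp deg (fun S => u S + w S) T)
          = unshuffleSum deg l (fun S T => unshuffleSum deg T fun T₁ T₂ =>
              u (x :: S) * (convExp deg u T₁ * convExp deg w T₂))
            + unshuffleSum deg l (fun S T => unshuffleSum deg T fun T₁ T₂ =>
              w (x :: S) * (convExp deg u T₁ * convExp deg w T₂)) := by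
        rw [← unshuffleSum_add]
        refine unshuffleSum_congr deg fun S T hS _ => ?_
        rw [ih T.length (by simp at hn; omega) T rfl, add_mul, mul_unshuffleSum, mul_unshuffleSum]
      rw [h1, ← unshuffleSum_assoc, unshuffleSum_left_comm deg l fun S T₁ T₂ =>
        w (x :: S) * (convExp deg u T₁ * convExp deg w T₂)]
      congr 1
      · refine unshuffleSum_congr' deg fun S T => ?_
        rw [convExp_cons, unshuffleSum_mul]
        exact unshuffleSum_congr' deg fun S₁ S₂ => (mul_assoc _ _ _).symm
      · refine unshuffleSum_congr' deg fun S T => ?_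
        rw [convExp_cons, mul_unshuffleSum, ← unshuffleSum_zsmul]
        refine unshuffleSum_congr' deg fun T₁ T₂ => ?_
        rw [← mul_assoc, ← mul_assoc, convExp_commute h,
          smul_mul_assoc, sgn_smul_smul]
        refine congrArg (· • _) (sgn_congr (-(deg x * (S.map deg).sum)) ?_)
        simp only [List.map_cons, List.sum_cons]; ring

theorem unshuffleSum_prod_add {u w : ι → 𝒜}
    (h : ∀ x y, u x * w y = sgn (deg x * deg y) • (w y * u x)) (l : List ι) :
    (l.map fun x => u x + w x).prod
      = unshuffleSum deg l fun S T => (S.map u).prod * (T.map w).prod := by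
  have hc : ∀ (S : List ι) (y : ι), (S.map u).prod * w y
      = sgn (deg y * (S.map deg).sum) • (w y * (S.map u).prod) := by
    intro S y
    induction S with
    | nil => simp [sgn_zero]
    | cons x S ih =>
      simp only [List.map_cons, List.prod_cons, List.sum_cons]
      rw [mul_assoc, ih, mul_smul_comm, ← mul_assoc, h, smul_mul_assoc, mul_assoc, sgn_smul_smul]
      exact congrArg (· • _) (sgn_congr 0 (by ring))
  induction l with
  | nil => simp [unshuffleSum_nil]
  | cons x l ih =>
    rw [List.map_cons, List.prod_cons, ih, unshuffleSum_cons, add_mul]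
    congr 1
    · rw [mul_unshuffleSum]
      exact unshuffleSum_congr' deg fun S T => by simp [mul_assoc]
    · rw [mul_unshuffleSum]
      refine unshuffleSum_congr' deg fun S T => ?_
      rw [List.map_cons, List.prod_cons, ← mul_assoc _ (w x), hc, smul_mul_assoc,
        sgn_smul_sgn_smul, mul_assoc]

/-- The `m`-th convolution power of a function of lists. -/
def convPow (deg : ι → ℤ) (u : List ι → 𝒜) : ℕ → List ι → 𝒜
  | 0, [] => 1
  | 0, _ :: _ => 0
  | m + 1, l => unshuffleSum deg l fun S T => u S * convPow deg u m T

theorem convPow_succ_cons {u : List ι → 𝒜}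
    (h : ∀ S T, u S * u T = sgn ((S.map deg).sum * (T.map deg).sum) • (u T * u S))
    (m : ℕ) (x : ι) (l : List ι) :
    convPow deg u (m + 1) (x :: l)
      = (m + 1) • unshuffleSum deg l fun S T => u (x :: S) * convPow deg u m T := by
  induction m generalizing l with
  | zero =>
    rw [zero_add, one_smul, convPow, unshuffleSum_cons]
    refine (congrArg _ ?_).trans (add_zero _)
    rw [← unshuffleSum_zero (W := 𝒜) deg l]
    exact unshuffleSum_congr' deg fun S T => by simp [convPow]
  | succ m ih =>
    rw [convPow, unshuffleSum_cons, succ_nsmul' _ (m + 1)]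
    refine congrArg _ ?_
    have h1 : unshuffleSum deg l (fun S T => sgn (deg x * (S.map deg).sum) •
          (u S * convPow deg u (m + 1) (x :: T)))
        = (m + 1) • unshuffleSum deg l fun S T => unshuffleSum deg T fun T₁ T₂ =>
          sgn (deg x * (S.map deg).sum) • (u S * (u (x :: T₁) * convPow deg u m T₂)) := by
      rw [← unshuffleSum_nsmul]
      refine unshuffleSum_congr' deg fun S T => ?_
      rw [ih, mul_smul_comm, smul_comm, mul_unshuffleSum,
        ← unshuffleSum_zsmul]
    rw [h1, unshuffleSum_left_comm]
    refine congrArg _ (unshuffleSum_congr' deg fun S T => ?_)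
    rw [convPow, mul_unshuffleSum]
    refine unshuffleSum_congr' deg fun T₁ T₂ => ?_
    rw [← mul_assoc, h, smul_mul_assoc, sgn_smul_smul, sgn_smul_smul, mul_assoc]
    refine (congrArg (· • _) ((sgn_congr (deg x * (T₁.map deg).sum
      + (T₁.map deg).sum * (S.map deg).sum) ?_).trans sgn_zero)).trans (one_smul ℤ _)
    simp only [List.map_cons, List.sum_cons]; ring

theorem convPow_eq_zero {u : List ι → 𝒜} (h0 : u [] = 0) (m : ℕ) (l : List ι)
    (hl : l.length < m) : convPow deg u m l = 0 := by
  induction m generalizing l with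
  | zero => omega
  | succ m ih =>
    rw [convPow, ← unshuffleSum_zero (W := 𝒜) deg l]
    refine unshuffleSum_congr deg fun S T h _ => ?_
    cases S with
    | nil => rw [h0, zero_mul]
    | cons x S => rw [ih T (by simp at h; omega), mul_zero]

variable [Algebra ℂ 𝒜]

/-- The convolution exponential as a sum of convolution powers. -/
theorem sum_convPow {u : List ι → 𝒜} (h0 : u [] = 0)
    (h : ∀ S T, u S * u T = sgn ((S.map deg).sum * (T.map deg).sum) • (u T * u S))
    (M : ℕ) (l : List ι) (hM : l.length ≤ M) :
    ∑ m ∈ Finset.range (M + 1), ((m.factorial : ℂ)⁻¹) • convPow deg u m l = convExp deg u l := by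
  induction M generalizing l with
  | zero => simp [List.length_eq_zero_iff.mp (Nat.le_zero.mp hM), convPow, convExp_nil]
  | succ M ih =>
    rw [Finset.sum_range_succ']
    cases l with
    | nil =>
      rw [convExp_nil, Finset.sum_eq_zero]
      · simp [convPow]
      · intro m _
        rw [convPow_eq_zero h0 _ _ (by simp), smul_zero]
    | cons x l =>
      have h1 : convPow deg u 0 (x :: l) = 0 := by rw [convPow]
      rw [h1, smul_zero, add_zero, convExp_cons]
      have h2 : ∀ m ∈ Finset.range (M + 1),
          (((m + 1).factorial : ℂ)⁻¹) • convPow deg u (m + 1) (x :: l)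
          = unshuffleSum deg l fun S T => u (x :: S) * ((m.factorial : ℂ)⁻¹ • convPow deg u m T) := by
        intro m _
        rw [convPow_succ_cons h, ← Nat.cast_smul_eq_nsmul ℂ, smul_smul, Nat.factorial_succ]
        have : (((m + 1) * m.factorial : ℕ) : ℂ)⁻¹ * ((m + 1 : ℕ) : ℂ) = (m.factorial : ℂ)⁻¹ := by
          push_cast
          have h3 : (m : ℂ) + 1 ≠ 0 := Nat.cast_add_one_ne_zero m
          field_simp
        rw [this]
        change DistribSMul.toAddMonoidHom 𝒜 ((m.factorial : ℂ)⁻¹) _ = _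
        rw [map_unshuffleSum]
        exact unshuffleSum_congr' deg fun S T => (mul_smul_comm _ _ _).symm
      rw [Finset.sum_congr rfl h2]
      have h3 : ∀ s : Finset ℕ, ∑ m ∈ s, unshuffleSum deg l (fun S T => u (x :: S) *
          ((m.factorial : ℂ)⁻¹ • convPow deg u m T)) = unshuffleSum deg l fun S T =>
            u (x :: S) * ∑ m ∈ s, ((m.factorial : ℂ)⁻¹ • convPow deg u m T) := by
        intro s
        induction s using Finset.induction_on with
        | empty => simp [unshuffleSum_zero]
        | insert j s hj ih => simp only [Finset.sum_insert hj, ih, mul_add, unshuffleSum_add]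
      rw [h3]
      refine unshuffleSum_congr deg fun S T hS _ => ?_
      rw [ih T (by simp at hM; omega)]

/-- Sums over blocks of a function of the product of the blocks are convolution powers. -/
theorem blockSum_eq_convPow {V W : Type*} [AddCommGroup W] (g : List ι → V) (j : V → 𝒜)
    (G : List V → W) (L : 𝒜 →+ W) (hG : ∀ ws, G ws = L (ws.map j).prod) (m : ℕ) (l : List ι) :
    blockSum deg g m l G = L (convPow deg (fun S => j (g S)) m l) := by
  have key : ∀ (m : ℕ) (l : List ι) (c : 𝒜), blockSum deg g m l (fun ws => L (c * (ws.map j).prod))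
      = L (c * convPow deg (fun S => j (g S)) m l) := by
    intro m
    induction m with
    | zero =>
      intro l c
      cases l with
      | nil => simp [blockSum, convPow]
      | cons x l => simp [blockSum, convPow]
    | succ m ih =>
      intro l c
      rw [blockSum, convPow, mul_unshuffleSum, map_unshuffleSum]
      refine unshuffleSum_congr' deg fun S T => ?_
      rw [← mul_assoc, ← ih]
      simp only [List.map_cons, List.prod_cons, mul_assoc]
  have := key m l 1
  simp only [one_mul] at this
  rw [← this]
  exact congrArg _ (funext hG)

end Convolution

/-! ### The Chevalley–Eilenberg complex -/

section Complex

variable {R : Type*} [CommRing R] [Algebra ℂ R]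
  {F : LieRinehartSubalgebra R (Derivation ℂ R R)}
  {M N : Type*} [AddCommGroup M] [Module R M] [AddCommGroup N] [Module R N]

theorem lieDer_sub (ρ : FModule F M) (v : F) (τ η : List F → M) :
    lieDer ρ v (τ - η) = lieDer ρ v τ - lieDer ρ v η := by
  rw [sub_eq_add_neg, lieDer_add, lieDer_neg, sub_eq_add_neg]

theorem ceDiff_sub (ρ : FModule F M) (τ η : List F → M) :
    ceDiff ρ (τ - η) = ceDiff ρ τ - ceDiff ρ η := by
  rw [sub_eq_add_neg, ceDiff_add, ceDiff_neg, sub_eq_add_neg]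

theorem contract_ceDiff (ρ : FModule F M) (v : F) (τ : List F → M) :
    contract v (ceDiff ρ τ) = lieDer ρ v τ - ceDiff ρ (contract v τ) := rfl

theorem IsForm.lieDer_lie {τ : List F → M} (h : IsForm τ) (ρ : FModule F M) (v w : F) :
    KapranovDolbeault.lieDer ρ ⁅v, w⁆ τ
      = KapranovDolbeault.lieDer ρ v (KapranovDolbeault.lieDer ρ w τ)
        - KapranovDolbeault.lieDer ρ w (KapranovDolbeault.lieDer ρ v τ) := by
  funext l
  induction l generalizing τ with
  | nil => exact ρ.flat v w _
  | cons u l ih =>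
    have h1 := congrFun (h.contract_add_arg ⁅⁅v, w⁆, u⁆ ⁅w, ⁅v, u⁆⁆) l
    rw [show ⁅⁅v, w⁆, u⁆ + ⁅w, ⁅v, u⁆⁆ = ⁅v, ⁅w, u⁆⁆ from (leibniz_lie v w u).symm] at h1
    simp only [KapranovDolbeault.contract, Pi.add_apply] at h1
    simp only [KapranovDolbeault.lieDer, Pi.sub_apply, contract_lieDer, lieDer_sub,
      ih (h.contract u)]
    rw [h1]
    abel

theorem IsForm.lieDer_ceDiff {τ : List F → M} (h : IsForm τ) (ρ : FModule F M) (v : F) :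
    KapranovDolbeault.lieDer ρ v (KapranovDolbeault.ceDiff ρ τ)
      = KapranovDolbeault.ceDiff ρ (KapranovDolbeault.lieDer ρ v τ) := by
  funext l
  induction l generalizing τ with
  | nil => exact ρ.act_zero v
  | cons w l ih =>
    have h2 : ∀ (a : F) (l : List F), KapranovDolbeault.ceDiff ρ τ (a :: l)
        = KapranovDolbeault.lieDer ρ a τ l
          - KapranovDolbeault.ceDiff ρ (KapranovDolbeault.contract a τ) l := fun _ _ => rfl
    have h3 := congrFun (h.lieDer_lie ρ v w) l
    simp only [Pi.sub_apply] at h3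
    simp only [KapranovDolbeault.lieDer, contract_ceDiff, lieDer_sub, Pi.sub_apply, h2, h3,
      ih (h.contract w)]
    rw [KapranovDolbeault.ceDiff, contract_lieDer, ceDiff_sub, Pi.sub_apply]
    abel

theorem IsForm.ceDiff_ceDiff {τ : List F → M} (h : IsForm τ) (ρ : FModule F M) :
    KapranovDolbeault.ceDiff ρ (KapranovDolbeault.ceDiff ρ τ) = 0 := by
  funext l
  induction l generalizing τ with
  | nil => rfl
  | cons v l ih =>
    rw [KapranovDolbeault.ceDiff, contract_ceDiff, ceDiff_sub, Pi.sub_apply, h.lieDer_ceDiff,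
      ih (h.contract v), Pi.zero_apply, sub_zero, sub_self]
    rfl

theorem FModule.d_d (ρ : FModule F M) (τ : Form F M) : ρ.d (ρ.d τ) = 0 :=
  Subtype.ext (τ.isForm.ceDiff_ceDiff ρ)

/-- The Chevalley–Eilenberg differential commutes with morphisms of `F`-modules. -/
theorem ceDiff_comp {ρ : FModule F M} {ρ' : FModule F N} (g : M →+ N)
    (hg : ∀ v m, g (ρ.act v m) = ρ'.act v (g m)) (τ : List F → M) (l : List F) :
    ceDiff ρ' (fun l => g (τ l)) l = g (ceDiff ρ τ l) := by
  have hL : ∀ (v : F) (τ : List F → M) (l : List F),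
      lieDer ρ' v (fun l => g (τ l)) l = g (lieDer ρ v τ l) := by
    intro v τ l
    induction l generalizing τ with
    | nil => exact (hg _ _).symm
    | cons w l ih => rw [lieDer, lieDer, map_sub, ← ih]; rfl
  induction l generalizing τ with
  | nil => exact (map_zero g).symm
  | cons v l ih => rw [ceDiff, ceDiff, map_sub, ← hL, ← ih]; rfl

theorem ceDiff_deg (ρ : FModule F M) {k : ℤ} {τ : List F → M}
    (h : ∀ l : List F, (l.length : ℤ) ≠ k → τ l = 0) (l : List F) (hl : (l.length : ℤ) ≠ 1 + k) :
    ceDiff ρ τ l = 0 := by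
  have hL : ∀ (v : F) (k : ℤ) (τ : List F → M)
      (_ : ∀ l : List F, (l.length : ℤ) ≠ k → τ l = 0) (l : List F)
      (_ : (l.length : ℤ) ≠ k), lieDer ρ v τ l = 0 := by
    intro v k τ h l hl
    induction l generalizing τ k with
    | nil => rw [lieDer, h _ hl, ρ.act_zero]
    | cons w l ih =>
      rw [lieDer, ih (k - 1) (contract w τ) (fun l hl => h _ (by simp at *; omega))
        (by simp at hl; omega), h _ (by simp at *; omega), sub_zero]
  induction l generalizing τ k with
  | nil => rfl
  | cons v l ih =>
    rw [ceDiff, hL v k τ h l (by simp at hl; omega),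
      ih (k := k - 1) (τ := contract v τ) (fun l hl => h _ (by simp at *; omega))
        (by simp at hl; omega), sub_zero]

theorem FModule.d_mem (ρ : FModule F M) {k : ℤ} {τ : Form F M} (h : τ ∈ formDeg F M k) :
    ρ.d τ ∈ formDeg F M (1 + k) :=
  fun l hl => ceDiff_deg ρ h l hl

theorem Form.map_apply (g : M →ₗ[R] N) (τ : Form F M) (l : List F) : Form.map g τ l = g (τ l) :=
  rfl

theorem Form.map_mem (g : M →ₗ[R] N) {k : ℤ} {τ : Form F M} (h : τ ∈ formDeg F M k) :
    Form.map g τ ∈ formDeg F N k := fun l hl => by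
  rw [Form.map_apply, h l hl, map_zero]

theorem FModule.d_map {ρ : FModule F M} {ρ' : FModule F N} (g : M →ₗ[R] N)
    (hg : ∀ v m, g (ρ.act v m) = ρ'.act v (g m)) (τ : Form F M) :
    ρ'.d (Form.map g τ) = Form.map g (ρ.d τ) :=
  Form.ext fun l => ceDiff_comp g.toAddMonoidHom hg τ l

end Complex

/-! ### Grading of forms -/

section Grading

variable {R : Type*} [CommRing R] [Algebra ℂ R]
  {F : LieRinehartSubalgebra R (Derivation ℂ R R)}
  {M M₁ M₂ M₃ N₁ N₂ N₃ : Type*} [AddCommGroup M] [Module R M] [AddCommGroup M₁] [Module R M₁]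
  [AddCommGroup M₂] [Module R M₂] [AddCommGroup M₃] [Module R M₃]
  [AddCommGroup N₁] [Module R N₁] [AddCommGroup N₂] [Module R N₂] [AddCommGroup N₃] [Module R N₃]

theorem map_wedge {B : M₁ →ₗ[R] M₂ →ₗ[R] M₃} {B' : N₁ →ₗ[R] N₂ →ₗ[R] N₃} {g₁ : M₁ → N₁}
    {g₂ : M₂ → N₂} (g₃ : M₃ →+ N₃) (hg₁ : ∀ (n : ℤ) m, g₁ (n • m) = n • g₁ m)
    (h : ∀ x y, B' (g₁ x) (g₂ y) = g₃ (B x y)) (α : List F → M₁) (β : List F → M₂) (l : List F) :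
    wedge B' (fun l => g₁ (α l)) (fun l => g₂ (β l)) l = g₃ (wedge B α β l) := by
  induction l generalizing α β with
  | nil => exact h _ _
  | cons v l ih =>
    rw [wedge, wedge, map_add, ← ih, ← ih]
    refine congrArg₂ _ rfl (congrArg (fun γ => wedge B' γ (fun l => g₂ (contract v β l)) l) ?_)
    funext l
    exact (hg₁ _ _).symm

theorem parity_of_deg {k : ℤ} {α : List F → M} (h : ∀ l : List F, (l.length : ℤ) ≠ k → α l = 0) :
    parity α = sgn k • α := by
  funext l
  change (-1 : ℤ) ^ l.length • α l = sgn k • α l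
  by_cases hl : (l.length : ℤ) = k
  · rw [← hl, sgn_eq]
  · rw [h l hl, smul_zero, smul_zero]

theorem wedge_zsmul_left (B : M₁ →ₗ[R] M₂ →ₗ[R] M₃) (n : ℤ) (α : List F → M₁) (β : List F → M₂) :
    wedge B (n • α) β = n • wedge B α β := by
  rw [← Int.cast_smul_eq_zsmul R, wedge_smul_left, Int.cast_smul_eq_zsmul]

theorem wedge_comm_deg (B : M₁ →ₗ[R] M₂ →ₗ[R] M₃) {k m : ℤ} {α : List F → M₁} {β : List F → M₂}
    (hα : ∀ l : List F, (l.length : ℤ) ≠ k → α l = 0)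
    (hβ : ∀ l : List F, (l.length : ℤ) ≠ m → β l = 0) (l : List F) :
    wedge B α β l = sgn (k * m) • wedge B.flip β α l := by
  induction l generalizing α β k m with
  | nil =>
    simp only [wedge, LinearMap.flip_apply]
    by_cases hk : k = 0
    · simp [hk, sgn_zero]
    · rw [hα [] (by simpa using fun h => hk h.symm)]; simp
  | cons v l ih =>
    rw [wedge, wedge, parity_of_deg hα, parity_of_deg hβ, wedge_zsmul_left, wedge_zsmul_left,
      Pi.smul_apply, Pi.smul_apply,
      ih (k := k - 1) (m := m) (α := contract v α)
        (fun l hl => hα _ (by simp at *; omega)) hβ,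
      ih (k := k) (m := m - 1) (β := contract v β) hα
        (fun l hl => hβ _ (by simp at *; omega)),
      smul_add, sgn_smul_smul, sgn_smul_smul, add_comm]
    refine congrArg₂ _ (congrArg (· • _) (sgn_congr 0 (by ring)))
      (congrArg (· • _) (sgn_congr (-m) (by ring)))

theorem wedge_deg (B : M₁ →ₗ[R] M₂ →ₗ[R] M₃) {k m : ℤ} {α : List F → M₁} {β : List F → M₂}
    (hα : ∀ l : List F, (l.length : ℤ) ≠ k → α l = 0)
    (hβ : ∀ l : List F, (l.length : ℤ) ≠ m → β l = 0) (l : List F)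
    (hl : (l.length : ℤ) ≠ k + m) : wedge B α β l = 0 := by
  induction l generalizing α β k m with
  | nil =>
    rw [wedge]
    by_cases hk : k = 0
    · rw [hβ [] (by simpa [hk] using hl)]; simp
    · rw [hα [] (by simpa using fun h => hk h.symm)]; simp
  | cons v l ih =>
    rw [wedge, parity_of_deg hα, wedge_zsmul_left, Pi.smul_apply,
      ih (k := k - 1) (m := m) (α := contract v α) (fun l hl => hα _ (by simp at *; omega)) hβ
        (by simp at hl; omega),
      ih (k := k) (m := m - 1) (β := contract v β) hα (fun l hl => hβ _ (by simp at *; omega))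
        (by simp at hl; omega), smul_zero, add_zero]

section Ring

variable {C C' : Type*} [CommRing C] [Algebra R C] [CommRing C'] [Algebra R C']

theorem Form.mul_mem {k m : ℤ} {a b : Form F C} (ha : a ∈ formDeg F C k) (hb : b ∈ formDeg F C m) :
    a * b ∈ formDeg F C (k + m) :=
  fun l hl => wedge_deg (LinearMap.mul R C) ha hb l hl

theorem Form.one_mem : (1 : Form F C) ∈ formDeg F C 0 := fun l hl => by
  cases l with
  | nil => simp at hl
  | cons => rfl

/-- Graded commutativity of the wedge product. -/
theorem Form.mul_comm_of_mem {k m : ℤ} {a b : Form F C} (ha : a ∈ formDeg F C k)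
    (hb : b ∈ formDeg F C m) : a * b = sgn (k * m) • (b * a) := by
  refine Form.ext fun l => ?_
  refine (wedge_comm_deg (LinearMap.mul R C) ha hb l).trans ?_
  rw [show (LinearMap.mul R C).flip = LinearMap.mul R C from
    LinearMap.ext fun x => LinearMap.ext fun y => mul_comm y x]
  rfl

/-- The homomorphism of algebras of forms induced by a homomorphism of coefficients. -/
def Form.mapRingHom (g : C →ₐ[R] C') : Form F C →+* Form F C' where
  toFun := Form.map g.toLinearMap
  map_one' := Form.ext fun l => by
    cases l with
    | nil => exact map_one g
    | cons v l => exact map_zero g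
  map_mul' a b := Form.ext fun l =>
    (map_wedge (B := LinearMap.mul R C) (B' := LinearMap.mul R C') g.toLinearMap.toAddMonoidHom
      (fun n m => map_zsmul g n m) (fun x y => (map_mul g x y).symm) a b l).symm
  map_zero' := map_zero _
  map_add' := map_add _

end Ring

theorem Form.map_act (g : M₁ →ₗ[R] M₂) (a : Form F R) (τ : Form F M₁) :
    Form.map g (Form.act a τ) = Form.act a (Form.map g τ) :=
  Form.ext fun l => (map_wedge (B := LinearMap.lsmul R M₁) (B' := LinearMap.lsmul R M₂)
    (g₁ := fun r => r) g.toAddMonoidHom (fun _ _ => rfl) (fun x y => (map_smul g x y).symm)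
    a τ l).symm

theorem Form.sum_apply {J : Type*} (s : Finset J) (τ : J → Form F M) (l : List F) :
    (∑ j ∈ s, τ j) l = ∑ j ∈ s, τ j l := by
  induction s using Finset.cons_induction with
  | empty => rfl
  | cons j s hj ih => rw [Finset.sum_cons, Finset.sum_cons, Form.add_apply, ih]

variable (F M) in
/-- The homogeneous component of degree `k` of a form. -/
def Form.component (k : ℕ) : Form F M →ₗ[ℂ] Form F M where
  toFun τ := ⟨fun l => if l.length = k then τ l else 0, by
    refine ⟨fun l₁ v w l₂ => ?_, fun l₁ f v l₂ => ?_, fun l₁ v l₂ => ?_⟩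
    · rw [τ.isForm.map_add]
      simp only [List.length_append, List.length_cons]
      split_ifs <;> simp
    · rw [τ.isForm.map_smul]
      simp only [List.length_append, List.length_cons]
      split_ifs <;> simp
    · rw [τ.isForm.alt, ite_self]⟩
  map_add' τ η := Form.ext fun l => by
    change (if _ then _ else _) = (if _ then _ else _) + (if _ then _ else (0 : M))
    split_ifs <;> simp
  map_smul' c τ := Form.ext fun l => by
    change (if _ then _ else _) = algebraMap ℂ R c • (if _ then _ else (0 : M))
    split_ifs <;> simp [Form.csmul_apply]

theorem Form.component_apply (k : ℕ) (τ : Form F M) (l : List F) :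
    Form.component F M k τ l = if l.length = k then τ l else 0 := rfl

theorem Form.component_mem (k : ℕ) (τ : Form F M) : Form.component F M k τ ∈ formDeg F M k :=
  fun l hl => by rw [Form.component_apply, if_neg (by exact_mod_cast hl)]

theorem eq_zero_of_mem_formDeg_neg {k : ℤ} (hk : k < 0) {τ : Form F M} (h : τ ∈ formDeg F M k) :
    τ = 0 := Form.ext fun l => h l (by omega)

theorem Form.sum_component {n : ℕ} {τ : Form F M} (h : ∀ l : List F, n < l.length → τ l = 0) :
    τ = ∑ k ∈ Finset.range (n + 1), Form.component F M k τ := by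
  refine Form.ext fun l => ?_
  rw [Form.sum_apply]
  simp only [Form.component_apply]
  rw [Finset.sum_ite_eq]
  split_ifs with hl
  · rfl
  · exact h l (by simp at hl; omega)

end Grading

/-! ### Frames -/

section Frames

variable {R : Type*} [CommRing R] [Algebra ℂ R]

/-- Functions `x i` whose differentials generate all differentials: every vector field is
determined by its values on these functions, compatibly with a splitting into an involutive
distribution `F` and a complement `B`. -/
structure Frame (F : LieRinehartSubalgebra R (Derivation ℂ R R))
    (B : Submodule R (Derivation ℂ R R)) (n : ℕ) where
  x : Fin n → R
  e : Fin n → F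
  b : Fin n → B
  expand : ∀ X : Derivation ℂ R R, X = ∑ i, X (x i) • ((e i : Derivation ℂ R R) + b i)
  expand_left : ∀ v : F, v = ∑ i, (v : Derivation ℂ R R) (x i) • e i
  expand_right : ∀ v : B, v = ∑ i, (v : Derivation ℂ R R) (x i) • b i
  disjoint : ∀ X : Derivation ℂ R R, X ∈ F → X ∈ B → X = 0

variable {F : LieRinehartSubalgebra R (Derivation ℂ R R)} {B : Submodule R (Derivation ℂ R R)}
  {n : ℕ} (φ : Frame F B n)
  {M : Type*} [AddCommGroup M] [Module R M]


theorem IsForm.map_sum {τ : List F → M} (h : IsForm τ) {J : Type*} (s : Finset J) (c : J → R)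
    (v : J → F) (l₁ l₂ : List F) :
    τ (l₁ ++ (∑ j ∈ s, c j • v j) :: l₂) = ∑ j ∈ s, c j • τ (l₁ ++ v j :: l₂) := by
  induction s using Finset.cons_induction with
  | empty =>
    have := h.map_smul l₁ (0 : R) 0 l₂
    simpa using this
  | cons j s hj ih => rw [Finset.sum_cons, Finset.sum_cons, h.map_add, h.map_smul, ih]

theorem IsForm.swap_at {τ : List F → M} (h : IsForm τ) (l₁ : List F) (v w : F) (l₂ : List F) :
    τ (l₁ ++ v :: w :: l₂) = -τ (l₁ ++ w :: v :: l₂) := by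
  induction l₁ generalizing τ with
  | nil => exact h.swap v w l₂
  | cons u l₁ ih => exact ih (h.contract u)

theorem IsForm.eq_zero_of_mem {τ : List F → M} (h : IsForm τ) (v : F) (l : List F) (hv : v ∈ l)
    (l₁ : List F) : τ (l₁ ++ v :: l) = 0 := by
  induction l generalizing l₁ with
  | nil => simp at hv
  | cons w l ih =>
    rcases List.mem_cons.mp hv with rfl | hv
    · exact h.alt l₁ v l
    · rw [h.swap_at, neg_eq_zero]
      simpa using ih hv (l₁ ++ [w])

theorem IsForm.eq_zero_of_not_nodup {τ : List F → M} (h : IsForm τ) {l : List F} (hl : ¬ l.Nodup) :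
    τ l = 0 := by
  induction l generalizing τ with
  | nil => exact absurd List.nodup_nil hl
  | cons v l ih =>
    by_cases hv : v ∈ l
    · exact h.eq_zero_of_mem v l hv []
    · exact ih (h.contract v) fun hn => hl (List.nodup_cons.mpr ⟨hv, hn⟩)

/-- Forms of degree larger than the size of a frame vanish. -/
theorem Frame.form_eq_zero (φ : Frame F B n) (τ : Form F M) (l : List F) (hl : n < l.length) :
    τ l = 0 := by
  have key : ∀ (l₂ : List F) (I : List (Fin n)), n < I.length + l₂.length →
      τ (I.map φ.e ++ l₂) = 0 := by
    intro l₂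
    induction l₂ with
    | nil =>
      intro I hI
      refine τ.isForm.eq_zero_of_not_nodup fun hn => ?_
      rw [List.append_nil] at hn
      have := (hn.of_map).length_le_card
      simp at this hI
      omega
    | cons v l₂ ih =>
      intro I hI
      rw [φ.expand_left v, τ.isForm.map_sum]
      refine Finset.sum_eq_zero fun i _ => ?_
      have := ih (I ++ [i]) (by simp at hI ⊢; omega)
      rw [List.map_append, List.append_assoc] at this
      change τ (I.map φ.e ++ φ.e i :: l₂) = 0 at this
      rw [this, smul_zero]
  exact key l [] (by simpa using hl)

/-- Induction on homogeneous components. -/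
theorem Frame.form_induction (φ : Frame F B n) {p : Form F M → Prop} (h0 : p 0)
    (hadd : ∀ a b, p a → p b → p (a + b)) (h : ∀ (k : ℕ), ∀ a ∈ formDeg F M k, p a)
    (a : Form F M) : p a := by
  rw [Form.sum_component (φ.form_eq_zero a)]
  generalize Finset.range (n + 1) = s
  induction s using Finset.cons_induction with
  | empty => exact h0
  | cons j s hj ih => rw [Finset.sum_cons]; exact hadd _ _ (h j _ (Form.component_mem _ _)) ih

theorem Frame.isInternal_formDeg (φ : Frame F B n) : DirectSum.IsInternal (formDeg F M) := by
  classical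
  rw [DirectSum.isInternal_submodule_iff_iSupIndep_and_iSup_eq_top]
  constructor
  · rw [iSupIndep_def]
    intro k
    rw [Submodule.disjoint_def]
    intro τ h1 h2
    refine Form.ext fun l => ?_
    by_cases hl : (l.length : ℤ) = k
    · have : ∀ η ∈ ⨆ j, ⨆ (_ : j ≠ k), formDeg F M j, η l = 0 := by
        intro η hη
        induction hη using Submodule.iSup_induction' with
        | mem j η hη =>
          by_cases hj : j = k
          · simp [hj] at hη; rw [hη]; rfl
          · simp only [ne_eq, hj, not_false_eq_true, iSup_pos] at hη
            exact hη l (by rw [hl]; exact fun h => hj h.symm)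
        | zero => rfl
        | add x y _ _ hx hy => rw [Form.add_apply, hx, hy, add_zero]
      exact this τ h2
    · exact h1 l hl
  · rw [eq_top_iff]
    rintro τ -
    exact φ.form_induction (p := fun τ => τ ∈ ⨆ k, formDeg F M k) (Submodule.zero_mem _)
      (fun a b => Submodule.add_mem _) (fun k a ha => Submodule.mem_iSup_of_mem (k : ℤ) ha) τ

end Frames

/-! ### Graded derivations of the algebra of forms -/

section Derivations

variable {R : Type*} [CommRing R] [Algebra ℂ R]
  {F : LieRinehartSubalgebra R (Derivation ℂ R R)}

theorem derivation_sum_apply {J : Type*} (s : Finset J) (D : J → Derivation ℂ R R) (f : R) :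
    (∑ j ∈ s, D j) f = ∑ j ∈ s, D j f :=
  map_sum (AddMonoidHom.mk' (fun D : Derivation ℂ R R => D f) fun _ _ => rfl) D s

theorem Form.ext_contract {M : Type*} [AddCommGroup M] [Module R M] {τ η : Form F M}
    (h0 : τ [] = η []) (h : ∀ v : F, contract v τ = contract v η) : τ = η :=
  Form.ext fun l => by
    cases l with
    | nil => exact h0
    | cons v l => exact congrFun (h v) l

/-- The contraction `ι_v` with a section of `F`, as an operator on forms. -/
def iota (v : F) : FormEnd F R where
  toFun a := ⟨contract v a, a.isForm.contract v⟩
  map_add' _ _ := rfl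
  map_smul' _ _ := rfl

theorem iota_val (v : F) (a : Form F R) : ((iota v a : Form F R) : List F → R) = contract v a := rfl

theorem iota_mul (v : F) (a b : Form F R) :
    iota v (a * b) = iota v a * b + Form.parity a * iota v b := rfl

theorem iota_apply_mem (v : F) {k : ℤ} {a : Form F R} (ha : a ∈ formDeg F R k) :
    iota v a ∈ formDeg F R (k - 1) := fun l hl => ha (v :: l) (by
  rw [List.length_cons]; push_cast; omega)

theorem iota_mem_derDeg (v : F) : iota v ∈ derDeg F (-1) := by
  refine ⟨fun k a ha => ?_, fun a b => ?_⟩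
  · rw [neg_add_eq_sub]; exact iota_apply_mem v ha
  · rw [parityPow, if_neg (by decide), iota_mul]

theorem iota_pullback (v : F) (f : R) : iota v (pullback F f) = 0 := rfl

theorem mul_pullback (f : R) (a : Form F R) : a * pullback F f = pullback F f * a :=
  form_mul_comm 0 (pullback_mem f) a

theorem eq_pullback_of_mem {a : Form F R} (ha : a ∈ formDeg F R 0) : a = pullback F (a []) :=
  Form.ext fun l => by
    cases l with
    | nil => rfl
    | cons v l => exact ha _ (by simp; omega)

theorem dF_pullback_nil (f : R) : dF F (pullback F f) [] = 0 := rfl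

theorem iota_dF_pullback (v : F) (f : R) :
    iota v (dF F (pullback F f)) = pullback F ((v : Derivation ℂ R R) f) := by
  refine Form.ext fun l => ?_
  change lieDer (.functions F) v (const f) l - ceDiff (.functions F) (0 : List F → R) l = _
  rw [ceDiff_zero, Pi.zero_apply, sub_zero]
  cases l with
  | nil => rfl
  | cons w l =>
    change lieDer (.functions F) v (0 : List F → R) l - 0 = 0
    rw [lieDer_zero, Pi.zero_apply, sub_zero]

theorem dF_pullback_mem (f : R) : dF F (pullback F f) ∈ formDeg F R 1 :=
  (FModule.functions F).d_mem (pullback_mem f)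

theorem dF_dF (a : Form F R) : dF F (dF F a) = 0 := FModule.d_d _ a

/-- Operators of degree `d` on forms. -/
def HasDegree (d : ℤ) (X : FormEnd F R) : Prop :=
  ∀ k, ∀ a ∈ formDeg F R k, X a ∈ formDeg F R (d + k)

theorem dF_hasDegree : HasDegree 1 (dF F) := fun _ _ ha => (FModule.functions F).d_mem ha

theorem HasDegree.mul {d e : ℤ} {X Y : FormEnd F R} (hX : HasDegree d X)
    (hY : HasDegree e Y) : HasDegree (d + e) (X * Y) := fun k a ha => by
  rw [add_assoc]; exact hX _ _ (hY k a ha)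

theorem HasDegree.add {d : ℤ} {X Y : FormEnd F R} (hX : HasDegree d X)
    (hY : HasDegree d Y) : HasDegree d (X + Y) := fun k a ha =>
  Submodule.add_mem _ (hX k a ha) (hY k a ha)

theorem HasDegree.zsmul {d : ℤ} {X : FormEnd F R} (hX : HasDegree d X) (n : ℤ) :
    HasDegree d (n • X) := fun k a ha => zsmul_mem (hX k a ha) n

theorem HasDegree.sub {d : ℤ} {X Y : FormEnd F R} (hX : HasDegree d X)
    (hY : HasDegree d Y) : HasDegree d (X - Y) := fun k a ha =>
  Submodule.sub_mem _ (hX k a ha) (hY k a ha)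

theorem mulLeft_hasDegree {k : ℤ} {a : Form F R} (ha : a ∈ formDeg F R k) :
    HasDegree k (LinearMap.mulLeft ℂ a) := fun _ _ hb => Form.mul_mem ha hb

theorem parityPow_mem (d : ℤ) {k : ℤ} {a : Form F R} (ha : a ∈ formDeg F R k) :
    parityPow F d a ∈ formDeg F R k := by
  rw [parityPow_of_mem d ha]; exact zsmul_mem ha _

theorem parityPow_natCast (k : ℕ) : parityPow F k = Form.parity ^ k := by
  unfold parityPow
  have h2 : (Form.parity : FormEnd F R) ^ 2 = 1 := by rw [pow_two, parity_sq]
  split_ifs with h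
  · obtain ⟨m, rfl⟩ := (Int.even_coe_nat k).mp h
    rw [← two_mul, pow_mul, h2, one_pow]; rfl
  · obtain ⟨m, rfl⟩ := Nat.not_even_iff_odd.mp fun h' => h ((Int.even_coe_nat k).mpr h')
    rw [pow_succ, pow_mul, h2, one_pow, one_mul]

theorem mul_comm_of_mem (k : ℕ) {a : Form F R} (ha : a ∈ formDeg F R k) (b : Form F R) :
    b * a = a * parityPow F k b := by
  rw [parityPow_natCast]; exact form_mul_comm k ha b

theorem parityPow_mul (d : ℤ) (a b : Form F R) :
    parityPow F d (a * b) = parityPow F d a * parityPow F d b := by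
  unfold parityPow
  split_ifs
  · rfl
  · exact parity_mul a b

theorem parityPow_parityPow (d : ℤ) (a : Form F R) : parityPow F d (parityPow F d a) = a := by
  unfold parityPow
  split_ifs
  · rfl
  · exact parity_parity_form a

/-- The involution `D ↦ (-1)^{d|D|} D` on operators. -/
def opParityPow (d : ℤ) (X : FormEnd F R) : FormEnd F R :=
  parityPow F d * X * parityPow F d

theorem opParity_pow (k : ℕ) (X : FormEnd F R) :
    (opParity F ^ k) X = opParityPow (k : ℤ) X := by
  rw [opParityPow, parityPow_natCast]
  induction k generalizing X with
  | zero => rw [pow_zero, pow_zero, one_mul, mul_one]; rfl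
  | succ k ih =>
    rw [pow_succ]
    change (opParity F ^ k) (opParity F X) = _
    rw [ih, opParity_apply]
    nth_rewrite 2 [pow_succ']
    rw [pow_succ]
    simp only [mul_assoc]

theorem opParityPow_apply (d : ℤ) (X : FormEnd F R) (a : Form F R) :
    opParityPow d X a = parityPow F d (X (parityPow F d a)) := rfl

theorem opParityPow_mulLeft_mul (d : ℤ) (c : Form F R) (X : FormEnd F R) :
    opParityPow d (LinearMap.mulLeft ℂ c * X)
      = LinearMap.mulLeft ℂ (parityPow F d c) * opParityPow d X :=
  LinearMap.ext fun _ => parityPow_mul d c _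

theorem opParityPow_opParityPow (d : ℤ) (X : FormEnd F R) :
    opParityPow d (opParityPow d X) = X := LinearMap.ext fun a => by
  simp only [opParityPow_apply, parityPow_parityPow]

theorem opParityPow_add (d : ℤ) (X Y : FormEnd F R) :
    opParityPow d (X + Y) = opParityPow d X + opParityPow d Y := by
  simp only [opParityPow, mul_add, add_mul]

theorem opParityPow_sub (d : ℤ) (X Y : FormEnd F R) :
    opParityPow d (X - Y) = opParityPow d X - opParityPow d Y := by
  simp only [opParityPow, mul_sub, sub_mul]

theorem opParityPow_mul (d : ℤ) (X Y : FormEnd F R) :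
    opParityPow d (X * Y) = opParityPow d X * opParityPow d Y :=
  LinearMap.ext fun a => by
    simp only [opParityPow_apply, Module.End.mul_apply, parityPow_parityPow]

theorem opParity_eq_opParityPow (X : FormEnd F R) :
    opParity F X = opParityPow 1 X := by
  rw [← Nat.cast_one, ← opParity_pow, pow_one]

/-- Graded derivations of the algebra of forms, not necessarily homogeneous. -/
def IsGrDer (X : FormEnd F R) : Prop :=
  ∀ (k : ℕ), ∀ a ∈ formDeg F R k, ∀ b, X (a * b) = X a * b + a * opParityPow (k : ℤ) X b

theorem IsGrDer.sub {X Y : FormEnd F R} (hX : IsGrDer X) (hY : IsGrDer Y) :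
    IsGrDer (X - Y) := fun k a ha b => by
  rw [opParityPow_sub]
  simp only [LinearMap.sub_apply, hX k a ha b, hY k a ha b, sub_mul, mul_sub]; abel

theorem IsGrDer.add {X Y : FormEnd F R} (hX : IsGrDer X) (hY : IsGrDer Y) :
    IsGrDer (X + Y) := fun k a ha b => by
  rw [opParityPow_add]
  simp only [LinearMap.add_apply, hX k a ha b, hY k a ha b, add_mul, mul_add]; abel

theorem IsGrDer.zero : IsGrDer (0 : FormEnd F R) := fun k a _ b => by
  simp [opParityPow]

theorem IsGrDer.mulLeft_mul {X : FormEnd F R} (hX : IsGrDer X) (c : Form F R) :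
    IsGrDer (LinearMap.mulLeft ℂ c * X) := fun k a ha b => by
  rw [opParityPow_mulLeft_mul]
  change c * X (a * b) = c * X a * b + a * (parityPow F k c * opParityPow (k : ℤ) X b)
  rw [hX k a ha b, mul_add, ← mul_assoc, ← mul_assoc, ← mul_assoc, mul_comm_of_mem k ha c]

theorem IsGrDer.sum {J : Type*} (s : Finset J) {X : J → FormEnd F R}
    (h : ∀ j ∈ s, IsGrDer (X j)) : IsGrDer (∑ j ∈ s, X j) := by
  induction s using Finset.cons_induction with
  | empty => exact IsGrDer.zero
  | cons j s hj ih =>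
    rw [Finset.sum_cons]
    exact (h j (by simp)).add (ih fun i hi => h i (by simp [hi]))

variable {B : Submodule R (Derivation ℂ R R)} {n : ℕ} (φ : Frame F B n)

namespace Frame

include φ in
theorem op_ext {X Y : FormEnd F R}
    (h : ∀ (k : ℕ), ∀ a ∈ formDeg F R k, X a = Y a) : X = Y :=
  LinearMap.ext fun a => φ.form_induction (p := fun a => X a = Y a) (by simp)
    (fun a b ha hb => by rw [map_add, map_add, ha, hb]) h a

include φ in
theorem opParityPow_of_hasDegree {d : ℤ} {X : FormEnd F R} (hX : HasDegree d X)
    (k : ℤ) : opParityPow k X = sgn (d * k) • X := by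
  refine φ.op_ext fun m a ha => ?_
  rw [opParityPow_apply, parityPow_of_mem k ha, map_zsmul, map_zsmul,
    parityPow_of_mem k (hX _ _ ha), sgn_smul_smul, LinearMap.smul_apply]
  exact congrArg (· • _) (sgn_congr (k * m) (by ring))

include φ in
theorem isGrDer_of_mem_derDeg {d : ℤ} {X : FormEnd F R} (hX : X ∈ derDeg F d) :
    IsGrDer X := fun k a ha b => by
  rw [φ.opParityPow_of_hasDegree hX.1, hX.2, parityPow_of_mem d ha, LinearMap.smul_apply,
    mul_smul_comm, smul_mul_assoc]

include φ in
theorem isGrDer (X : VF F) : IsGrDer (X : FormEnd F R) := by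
  obtain ⟨X, hX⟩ := X
  change IsGrDer X
  induction hX using Submodule.span_induction with
  | zero => exact IsGrDer.zero
  | add X Y _ _ h h' => exact h.add h'
  | smul a X _ h => exact h.mulLeft_mul a
  | mem X hX => exact φ.isGrDer_of_mem_derDeg hX.choose_spec

include φ in
theorem mem_derDeg {d : ℤ} {X : FormEnd F R} (h : HasDegree d X) (hX : IsGrDer X) :
    X ∈ derDeg F d := by
  refine ⟨h, fun a b => ?_⟩
  refine φ.form_induction (p := fun a => X (a * b) = X a * b + parityPow F d a * X b) (by simp)
    (fun a a' ha ha' => ?_) (fun k a ha => ?_) a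
  · rw [add_mul, map_add, ha, ha', map_add, map_add, add_mul, add_mul]; abel
  · rw [hX k a ha, φ.opParityPow_of_hasDegree h, parityPow_of_mem d ha, LinearMap.smul_apply,
      mul_smul_comm, smul_mul_assoc]

theorem contract_eq_sum {M : Type*} [AddCommGroup M] [Module R M] (v : F) (τ : Form F M) :
    contract v τ = ∑ i, (v : Derivation ℂ R R) (φ.x i) • contract (φ.e i) (τ : List F → M) := by
  funext l
  have := τ.isForm.map_sum Finset.univ (fun i => (v : Derivation ℂ R R) (φ.x i)) φ.e [] l
  rw [← φ.expand_left v] at this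
  rw [Finset.sum_apply]
  exact this

/-- The differential of a function of the frame along `F`. -/
def theta (i : Fin n) : Form F R := dF F (pullback F (φ.x i))

theorem theta_mem (i : Fin n) : φ.theta i ∈ formDeg F R 1 := dF_pullback_mem _

theorem iota_theta (v : F) (i : Fin n) :
    iota v (φ.theta i) = pullback F ((v : Derivation ℂ R R) (φ.x i)) := iota_dF_pullback v _

theorem theta_mul_nil (i : Fin n) (a : Form F R) : (φ.theta i * a) [] = 0 :=
  (congrArg (· * a []) (dF_pullback_nil (F := F) (φ.x i))).trans (zero_mul _)

theorem iota_eq_sum (v : F) (a : Form F R) :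
    iota v a = ∑ i, pullback F ((v : Derivation ℂ R R) (φ.x i)) * iota (φ.e i) a := by
  refine Subtype.ext ?_
  rw [iota_val, φ.contract_eq_sum]
  funext l
  rw [Form.sum_apply, Finset.sum_apply]
  exact Finset.sum_congr rfl fun i _ =>
    (pullback_mul ((v : Derivation ℂ R R) (φ.x i)) (iota (φ.e i) a) l).symm

theorem dF_pullback (f : R) : dF F (pullback F f)
    = ∑ i, φ.theta i * pullback F ((φ.e i : Derivation ℂ R R) f) := by
  refine Form.ext_contract ?_ fun v => ?_
  · rw [Form.sum_apply]
    exact (Finset.sum_eq_zero fun i _ => φ.theta_mul_nil i _).symm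
  · rw [← iota_val, ← iota_val, iota_dF_pullback, map_sum]
    simp only [iota_mul, iota_pullback, mul_zero, add_zero, φ.iota_theta, ← pullback_mul_pullback]
    rw [← map_sum]
    conv_lhs => rw [φ.expand_left v]
    refine congrArg (fun f => ((pullback F f : Form F R) : List F → R)) ?_
    have h : ((∑ i, (v : Derivation ℂ R R) (φ.x i) • φ.e i : F) : Derivation ℂ R R)
        = ∑ i, (v : Derivation ℂ R R) (φ.x i) • (φ.e i : Derivation ℂ R R) :=
      map_sum F.toSubmodule.subtype _ _
    rw [h, derivation_sum_apply]
    rfl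

/-- Euler's formula for forms. -/
theorem sum_theta_mul_iota (a : Form F R) (l : List F) :
    (∑ i, φ.theta i * iota (φ.e i) a) l = l.length • a l := by
  induction l generalizing a with
  | nil =>
    rw [Form.sum_apply]
    exact (Finset.sum_eq_zero fun i _ => φ.theta_mul_nil i _).trans (zero_smul ℕ _).symm
  | cons v l ih =>
    have h : iota v (∑ i, φ.theta i * iota (φ.e i) a)
        = iota v a + ∑ i, φ.theta i * iota (φ.e i) (iota v a) := by
      rw [map_sum, φ.iota_eq_sum v a, ← Finset.sum_add_distrib]
      refine Finset.sum_congr rfl fun i _ => ?_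
      rw [iota_mul, φ.iota_theta, parity_of_mem (φ.theta_mem i), ← φ.iota_eq_sum]
      have h1 : iota v (iota (φ.e i) a) = -iota (φ.e i) (iota v a) :=
        Form.ext fun l => a.isForm.swap _ _ l
      rw [h1]
      simp only [sgn, Int.negOnePow_one, Units.val_neg, Units.val_one, neg_smul, one_smul]
      exact congrArg (_ + ·) (neg_mul_neg (φ.theta i) _)
    have := congrArg (fun b : Form F R => b l) h
    simp only [Form.add_apply, ih] at this
    rw [List.length_cons, succ_nsmul']
    exact this

theorem nsmul_eq_sum {k : ℕ} {a : Form F R} (ha : a ∈ formDeg F R k) :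
    k • a = ∑ i, φ.theta i * iota (φ.e i) a := by
  refine Form.ext fun l => ?_
  rw [φ.sum_theta_mul_iota]
  change (k • (a : List F → R)) l = _
  rw [Pi.smul_apply]
  by_cases hl : l.length = k
  · rw [hl]
  · rw [ha l (by exact_mod_cast hl), smul_zero, smul_zero]

/-- A graded derivation which kills the functions on the base and their differentials vanishes. -/
theorem eq_zero_of_isGrDer {X : FormEnd F R} (hX : IsGrDer X)
    (h0 : ∀ f, X (pullback F f) = 0) (h1 : ∀ i, X (φ.theta i) = 0) : X = 0 := by
  refine φ.op_ext fun k => ?_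
  induction k with
  | zero =>
    intro a ha
    rw [eq_pullback_of_mem ha, h0, LinearMap.zero_apply]
  | succ k ih =>
    intro a ha
    have h : ((k + 1 : ℕ) : ℂ) • X a = 0 := by
      rw [← map_smul, Nat.cast_smul_eq_nsmul, φ.nsmul_eq_sum ha, map_sum]
      refine Finset.sum_eq_zero fun i _ => ?_
      rw [hX 1 _ (φ.theta_mem i), h1, zero_mul, zero_add, opParityPow_apply,
        ih _ (parityPow_mem _ ?_), LinearMap.zero_apply, map_zero, mul_zero]
      have := iota_apply_mem (φ.e i) ha
      rwa [Nat.cast_succ, add_sub_cancel_right] at this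
    exact (smul_eq_zero.mp h).resolve_left (Nat.cast_ne_zero.mpr k.succ_ne_zero)

/-! #### Lifts of vector fields -/

/-- The lift of a derivation of the base to functions of tuples, constant along the frame. -/
def liftDer (D : Derivation ℂ R R) : (List F → R) → List F → R
  | τ, [] => D (τ [])
  | τ, v :: l => ∑ i, (v : Derivation ℂ R R) (φ.x i) * liftDer D (contract (φ.e i) τ) l

variable (D : Derivation ℂ R R)

theorem liftDer_cons (τ : List F → R) (v : F) (l : List F) : φ.liftDer D τ (v :: l)
    = ∑ i, (v : Derivation ℂ R R) (φ.x i) * φ.liftDer D (contract (φ.e i) τ) l := rfl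

theorem liftDer_add (τ η : List F → R) :
    φ.liftDer D (τ + η) = φ.liftDer D τ + φ.liftDer D η := by
  funext l
  induction l generalizing τ η with
  | nil => exact map_add D _ _
  | cons v l ih =>
    simp only [liftDer_cons, contract_add, ih, Pi.add_apply, mul_add, Finset.sum_add_distrib]

theorem liftDer_zero : φ.liftDer D 0 = 0 := by
  have := φ.liftDer_add D 0 0
  rwa [add_zero, left_eq_add] at this

theorem liftDer_neg (τ : List F → R) : φ.liftDer D (-τ) = -φ.liftDer D τ := by
  have := φ.liftDer_add D τ (-τ)
  rw [add_neg_cancel, liftDer_zero] at this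
  exact (neg_eq_of_add_eq_zero_right this.symm).symm

theorem liftDer_csmul (c : ℂ) (τ : List F → R) :
    φ.liftDer D (algebraMap ℂ R c • τ) = algebraMap ℂ R c • φ.liftDer D τ := by
  funext l
  induction l generalizing τ with
  | nil =>
    change D (algebraMap ℂ R c * τ []) = algebraMap ℂ R c * D (τ [])
    rw [Derivation.leibniz, Derivation.map_algebraMap]; simp
  | cons v l ih =>
    have h : ∀ i, contract (φ.e i) (algebraMap ℂ R c • τ)
        = algebraMap ℂ R c • contract (φ.e i) τ := fun _ => rfl
    simp only [liftDer_cons, h, ih, Pi.smul_apply, smul_eq_mul, Finset.mul_sum]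
    exact Finset.sum_congr rfl fun i _ => by ring

theorem parity_liftDer (τ : List F → R) :
    φ.liftDer D (parity τ) = parity (φ.liftDer D τ) := by
  funext l
  induction l generalizing τ with
  | nil => simp [liftDer, parity]
  | cons v l ih =>
    have h : parity (φ.liftDer D τ) (v :: l) = -((-1 : ℤ) ^ l.length • φ.liftDer D τ (v :: l)) := by
      simp [parity, pow_succ]
    simp only [h, liftDer_cons, contract_parity, liftDer_neg, Pi.neg_apply, ih]
    simp only [parity, Finset.smul_sum, mul_neg, Finset.sum_neg_distrib, mul_smul_comm]

theorem liftDer_deg {k : ℤ} {τ : List F → R} (h : ∀ l : List F, (l.length : ℤ) ≠ k → τ l = 0)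
    (l : List F) (hl : (l.length : ℤ) ≠ k) : φ.liftDer D τ l = 0 := by
  induction l generalizing τ k with
  | nil => rw [liftDer, h _ hl, map_zero]
  | cons v l ih =>
    rw [liftDer_cons]
    refine Finset.sum_eq_zero fun i _ => ?_
    rw [ih (k := k - 1) (τ := contract (φ.e i) τ) (fun l hl => h _ ?_) (by rw [List.length_cons] at hl; push_cast at hl; omega),
      mul_zero]
    rw [List.length_cons]; push_cast; omega

theorem isForm_liftDer {τ : List F → R} (h : IsForm τ) : IsForm (φ.liftDer D τ) where
  map_add l₁ v w l₂ := by
    induction l₁ generalizing τ with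
    | nil =>
      simp only [List.nil_append, liftDer_cons, ← Finset.sum_add_distrib]
      exact Finset.sum_congr rfl fun i _ => add_mul _ _ _
    | cons u l₁ ih =>
      simp only [List.cons_append, liftDer_cons, ← Finset.sum_add_distrib]
      exact Finset.sum_congr rfl fun i _ => by rw [ih (h.contract _), mul_add]
  map_smul l₁ f v l₂ := by
    induction l₁ generalizing τ with
    | nil =>
      simp only [List.nil_append, liftDer_cons, Finset.smul_sum]
      exact Finset.sum_congr rfl fun i _ => mul_assoc f _ _
    | cons u l₁ ih =>
      simp only [List.cons_append, liftDer_cons, Finset.smul_sum]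
      exact Finset.sum_congr rfl fun i _ => by rw [ih (h.contract _), mul_smul_comm]
  alt l₁ v l₂ := by
    induction l₁ generalizing τ with
    | nil =>
      simp only [List.nil_append, liftDer_cons, Finset.mul_sum]
      have hs : ∀ i j, φ.liftDer D (contract (φ.e j) (contract (φ.e i) τ)) l₂
          = -φ.liftDer D (contract (φ.e i) (contract (φ.e j) τ)) l₂ := fun i j => by
        rw [← Pi.neg_apply, ← liftDer_neg]
        exact congrArg (φ.liftDer D · l₂) (funext fun l => h.swap _ _ l)
      set S := ∑ i, ∑ j, (v : Derivation ℂ R R) (φ.x i) * ((v : Derivation ℂ R R) (φ.x j) *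
        φ.liftDer D (contract (φ.e j) (contract (φ.e i) τ)) l₂) with hS
      have h2 : S = -S := by
        conv_lhs => rw [hS, Finset.sum_comm]
        rw [hS, ← Finset.sum_neg_distrib]
        refine Finset.sum_congr rfl fun i _ => ?_
        rw [← Finset.sum_neg_distrib]
        refine Finset.sum_congr rfl fun j _ => ?_
        rw [hs j i]; ring
      have h3 : (2 : ℂ) • S = 0 := by
        rw [two_smul]; nth_rewrite 1 [h2]; exact neg_add_cancel S
      exact (smul_eq_zero.mp h3).resolve_left two_ne_zero
    | cons u l₁ ih =>
      simp only [List.cons_append, liftDer_cons]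
      exact Finset.sum_eq_zero fun i _ => by rw [ih (h.contract _), mul_zero]

theorem liftDer_wedge (a b : Form F R) :
    φ.liftDer D (wedge (LinearMap.mul R R) a b)
      = wedge (LinearMap.mul R R) (φ.liftDer D a) b
        + wedge (LinearMap.mul R R) a (φ.liftDer D b) := by
  funext l
  induction l generalizing a b with
  | nil =>
    change D (a [] * b []) = D (a []) * b [] + a [] * D (b [])
    rw [Derivation.leibniz, smul_eq_mul, smul_eq_mul]; ring
  | cons v l ih =>
    have hs : ∀ (s : Finset (Fin n)) (c : Fin n → R) (α : Fin n → List F → R) (β : List F → R),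
        wedge (LinearMap.mul R R) (∑ i ∈ s, c i • α i) β l
          = ∑ i ∈ s, c i * wedge (LinearMap.mul R R) (α i) β l := by
      intro s c α β
      induction s using Finset.cons_induction with
      | empty => rw [Finset.sum_empty, wedge_zero_left]; rfl
      | cons j s hj ih =>
        rw [Finset.sum_cons, Finset.sum_cons, wedge_add_left, wedge_smul_left, Pi.add_apply, ih]
        rfl
    have hs' : ∀ (s : Finset (Fin n)) (c : Fin n → R) (α : Fin n → List F → R) (β : List F → R),
        wedge (LinearMap.mul R R) β (∑ i ∈ s, c i • α i) l
          = ∑ i ∈ s, c i * wedge (LinearMap.mul R R) β (α i) l := by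
      intro s c α β
      induction s using Finset.cons_induction with
      | empty => rw [Finset.sum_empty, wedge_zero_right]; rfl
      | cons j s hj ih =>
        rw [Finset.sum_cons, Finset.sum_cons, wedge_add_right, wedge_smul_right, Pi.add_apply, ih]
        rfl
    have hc : ∀ τ : List F → R, contract v (φ.liftDer D τ)
        = ∑ i, (v : Derivation ℂ R R) (φ.x i) • φ.liftDer D (contract (φ.e i) τ) := fun τ => by
      funext l; rw [Finset.sum_apply]; rfl
    rw [liftDer_cons, Pi.add_apply, wedge, wedge, hc, hc, φ.contract_eq_sum v a,
      φ.contract_eq_sum v b, hs, hs, hs', hs', ← Finset.sum_add_distrib, ← Finset.sum_add_distrib,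
      ← Finset.sum_add_distrib]
    refine Finset.sum_congr rfl fun i _ => ?_
    have h1 := ih (iota (φ.e i) a) b
    have h2 := ih (Form.parity a) (iota (φ.e i) b)
    rw [contract_wedge, liftDer_add, Pi.add_apply]
    change _ * (φ.liftDer D (wedge _ (iota (φ.e i) a : List F → R) b) l
      + φ.liftDer D (wedge _ (Form.parity a : List F → R) (iota (φ.e i) b)) l) = _
    rw [h1, h2, Pi.add_apply, Pi.add_apply]
    change _ * (wedge _ (φ.liftDer D (contract (φ.e i) a)) b l
      + wedge _ (contract (φ.e i) a) (φ.liftDer D b) l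
      + (wedge _ (φ.liftDer D (parity a)) (contract (φ.e i) b) l
      + wedge _ (parity a) (φ.liftDer D (contract (φ.e i) b)) l)) = _
    rw [parity_liftDer]
    ring

/-- The lift of a derivation of the base to a derivation of degree zero of the forms. -/
def lift : FormEnd F R where
  toFun a := ⟨φ.liftDer D a, φ.isForm_liftDer D a.isForm⟩
  map_add' a b := Subtype.ext (φ.liftDer_add D a b)
  map_smul' c a := Subtype.ext (φ.liftDer_csmul D c a)

theorem lift_mem_derDeg : φ.lift D ∈ derDeg F 0 := by
  refine ⟨fun k a ha l hl => φ.liftDer_deg D ha l (by rwa [zero_add] at hl), fun a b => ?_⟩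
  rw [parityPow, if_pos (by decide)]
  exact Subtype.ext (φ.liftDer_wedge D a b)

theorem lift_pullback (f : R) : φ.lift D (pullback F f) = pullback F (D f) := by
  refine Form.ext fun l => ?_
  cases l with
  | nil => rfl
  | cons v l =>
    change ∑ i, (v : Derivation ℂ R R) (φ.x i) * φ.liftDer D (0 : List F → R) l = 0
    refine Finset.sum_eq_zero fun i _ => ?_
    rw [liftDer_zero, Pi.zero_apply, mul_zero]

/-! #### A dual basis of the vector fields -/

/-- Coordinates on `F[1]`: the functions of the frame and their differentials. -/
def coord : Fin n ⊕ Fin n → Form F R := Sum.elim (fun i => pullback F (φ.x i)) φ.theta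

variable (n) in
/-- The degree of a coordinate on `F[1]`. -/
def cdeg : Fin n ⊕ Fin n → ℕ := Sum.elim (fun _ => 0) fun _ => 1

theorem coord_mem (j : Fin n ⊕ Fin n) : φ.coord j ∈ formDeg F R (cdeg n j) := by
  cases j with
  | inl i => exact pullback_mem _
  | inr i => exact φ.theta_mem i

/-- The derivations dual to the coordinates. -/
def partialOp : Fin n ⊕ Fin n → FormEnd F R :=
  Sum.elim (fun i => φ.lift (φ.e i + φ.b i : Derivation ℂ R R) -
    ∑ j, LinearMap.mulLeft ℂ (φ.lift (φ.e i + φ.b i : Derivation ℂ R R) (φ.theta j)) *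
      iota (φ.e j)) fun i => iota (φ.e i)

theorem partialOp_mem_derDeg (j : Fin n ⊕ Fin n) : φ.partialOp j ∈ derDeg F (-(cdeg n j : ℤ)) := by
  cases j with
  | inr i => exact iota_mem_derDeg _
  | inl i =>
    refine Submodule.sub_mem _ (φ.lift_mem_derDeg _) (Submodule.sum_mem _ fun j _ => ?_)
    refine φ.mem_derDeg ?_ ((φ.isGrDer_of_mem_derDeg (iota_mem_derDeg _)).mulLeft_mul _)
    have h1 := mulLeft_hasDegree ((φ.lift_mem_derDeg (φ.e i + φ.b i : Derivation ℂ R R)).1 1 _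
      (φ.theta_mem j))
    exact h1.mul (iota_mem_derDeg (φ.e j)).1

/-- The vector fields dual to the coordinates. -/
def partialVF (j : Fin n ⊕ Fin n) : VF F :=
  ⟨φ.partialOp j, Submodule.subset_span ⟨_, φ.partialOp_mem_derDeg j⟩⟩

theorem partialVF_mem (j : Fin n ⊕ Fin n) : φ.partialVF j ∈ vfDeg F (-(cdeg n j : ℤ)) :=
  φ.partialOp_mem_derDeg j

theorem theta_eq_sum (k : Fin n) :
    φ.theta k = ∑ j, pullback F ((φ.e j : Derivation ℂ R R) (φ.x k)) * φ.theta j := by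
  rw [theta, φ.dF_pullback]
  exact Finset.sum_congr rfl fun j _ => mul_pullback _ _

theorem IsGrDer_pullback_mul {X : FormEnd F R} (hX : IsGrDer X) (f : R)
    (a : Form F R) : X (pullback F f * a) = X (pullback F f) * a + pullback F f * X a := by
  rw [hX 0 _ (pullback_mem f)]
  rfl

/-- A graded derivation restricted to functions on the base, in terms of the frame. -/
theorem isGrDer_apply_pullback {X : FormEnd F R} (hX : IsGrDer X) (f : R) :
    X (pullback F f) = ∑ i, X (pullback F (φ.x i)) *
      pullback F ((φ.e i + φ.b i : Derivation ℂ R R) f) := by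
  refine Form.ext fun l => ?_
  let Xl : Derivation ℂ R R := Derivation.mk' (evalOp l X) fun f g => by
    rw [evalOp_apply, pullback_mul_pullback, IsGrDer_pullback_mul hX, Form.add_apply, pullback_mul,
      add_comm]
    refine congrArg _ ?_
    rw [smul_eq_mul, mul_comm]
    exact wedge_const_right (LinearMap.mul R R) _ g l
  have h : Xl f = ∑ i, Xl (φ.x i) * (φ.e i + φ.b i : Derivation ℂ R R) f := by
    conv_lhs => rw [φ.expand Xl]
    rw [derivation_sum_apply]
    rfl
  rw [Form.sum_apply]
  refine h.trans (Finset.sum_congr rfl fun i _ => ?_)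
  exact (wedge_const_right (LinearMap.mul R R) _ _ l).symm

/-- Expansion of a graded derivation in the dual basis. -/
theorem eq_sum_partialOp {X : FormEnd F R} (hX : IsGrDer X) :
    X = ∑ j, LinearMap.mulLeft ℂ (X (φ.coord j)) * φ.partialOp j := by
  rw [← sub_eq_zero]
  have hp : ∀ j, IsGrDer (φ.partialOp j) := fun j =>
    φ.isGrDer_of_mem_derDeg (φ.partialOp_mem_derDeg j)
  have hl : ∀ D, IsGrDer (φ.lift D) := fun D => φ.isGrDer_of_mem_derDeg (φ.lift_mem_derDeg D)
  have hv : ∀ a, (∑ j, LinearMap.mulLeft ℂ (X (φ.coord j)) * φ.partialOp j) a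
      = ∑ i, X (pullback F (φ.x i)) * φ.partialOp (.inl i) a
        + ∑ i, X (φ.theta i) * iota (φ.e i) a := by
    intro a
    rw [LinearMap.sum_apply, Fintype.sum_sum_type]
    rfl
  have hi : ∀ i a, φ.partialOp (.inl i) a = φ.lift (φ.e i + φ.b i : Derivation ℂ R R) a
      - ∑ j, φ.lift (φ.e i + φ.b i : Derivation ℂ R R) (φ.theta j) * iota (φ.e j) a := by
    intro i a
    change (φ.lift (φ.e i + φ.b i : Derivation ℂ R R) - ∑ j,
      LinearMap.mulLeft ℂ (φ.lift (φ.e i + φ.b i : Derivation ℂ R R) (φ.theta j)) *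
      iota (φ.e j)) a = _
    rw [LinearMap.sub_apply, LinearMap.sum_apply]; rfl
  refine φ.eq_zero_of_isGrDer (hX.sub (IsGrDer.sum _ fun j _ => (hp j).mulLeft_mul _))
    (fun f => ?_) fun k => ?_
  · rw [LinearMap.sub_apply, hv]
    simp only [hi, iota_pullback, mul_zero, Finset.sum_const_zero, sub_zero, add_zero,
      lift_pullback]
    rw [← φ.isGrDer_apply_pullback hX, sub_self]
  · have hθ : ∀ {Y : FormEnd F R}, IsGrDer Y →
        ∑ j, Y (φ.theta j) * pullback F ((φ.e j : Derivation ℂ R R) (φ.x k))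
          = Y (φ.theta k)
            - ∑ j, Y (pullback F ((φ.e j : Derivation ℂ R R) (φ.x k))) * φ.theta j := by
      intro Y hY
      conv_rhs => rw [φ.theta_eq_sum k]
      rw [map_sum, ← Finset.sum_sub_distrib]
      refine Finset.sum_congr rfl fun j _ => ?_
      rw [IsGrDer_pullback_mul hY, mul_pullback, add_sub_cancel_left]
    rw [LinearMap.sub_apply, hv]
    simp only [hi, φ.iota_theta]
    simp only [hθ (hl _), hθ hX, lift_pullback, sub_sub_cancel, Finset.mul_sum]
    rw [Finset.sum_comm]
    simp only [← mul_assoc, ← Finset.sum_mul, ← φ.isGrDer_apply_pullback hX]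
    abel

theorem vf_eq_sum (X : VF F) :
    X = ∑ j, (X : FormEnd F R) (φ.coord j) • φ.partialVF j := by
  refine Subtype.ext ?_
  rw [Submodule.coe_sum]
  exact φ.eq_sum_partialOp (φ.isGrDer X)

end Frame

end Derivations

/-! ### The graded symmetric algebra of the vector fields -/

section Symmetric

variable {R : Type*} [CommRing R] [Algebra ℂ R]
  {F : LieRinehartSubalgebra R (Derivation ℂ R R)}

theorem parityPow_neg (d : ℤ) : parityPow F (-d) = parityPow F d := by
  simp only [parityPow, even_neg]

theorem one_mem_formDeg : (1 : Form F R) ∈ formDeg F R 0 := fun l hl => by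
  cases l with
  | nil => simp at hl
  | cons => rfl

theorem parityPow_one (d : ℤ) : parityPow F d (1 : Form F R) = 1 := by
  rw [parityPow_of_mem d one_mem_formDeg, mul_zero, sgn_zero, one_smul]

theorem vf_apply_mem {d k : ℤ} {X : VF F} {a : Form F R} (hX : X ∈ vfDeg F d)
    (ha : a ∈ formDeg F R k) : (X : FormEnd F R) a ∈ formDeg F R (d + k) :=
  hX.1 k a ha

theorem vf_mul {d : ℤ} {X : VF F} (hX : X ∈ vfDeg F d) (a b : Form F R) :
    (X : FormEnd F R) (a * b)
      = (X : FormEnd F R) a * b + parityPow F d a * (X : FormEnd F R) b :=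
  hX.2 a b

theorem smul_mem_vfDeg {k d : ℤ} {a : Form F R} {X : VF F} (ha : a ∈ formDeg F R k)
    (hX : X ∈ vfDeg F d) : a • X ∈ vfDeg F (k + d) := by
  refine ⟨fun m b hb => ?_, fun b c => ?_⟩
  · rw [add_assoc]; exact Form.mul_mem ha (hX.1 m b hb)
  · have hb : a * parityPow F d b = parityPow F (k + d) b * a := by
      have h1 : ∀ b : Form F R, a * b = parityPow F k b * a := by
        intro b
        by_cases hk : k < 0
        · rw [eq_zero_of_mem_formDeg_neg hk ha, zero_mul, mul_zero]
        · lift k to ℕ using not_lt.mp hk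
          rw [mul_comm_of_mem k ha, parityPow_parityPow]
      rw [h1]
      congr 1
      simp only [parityPow, Int.even_add]
      by_cases h : Even k <;> by_cases h' : Even d <;> simp [h, h', parity_parity_form]
    have h2 : (X : FormEnd F R) (b * c)
        = (X : FormEnd F R) b * c + parityPow F d b * (X : FormEnd F R) c :=
      hX.2 b c
    change a * (X : FormEnd F R) (b * c)
      = a * (X : FormEnd F R) b * c
        + parityPow F (k + d) b * (a * (X : FormEnd F R) c)
    rw [h2, mul_add, ← mul_assoc, ← mul_assoc, hb, mul_assoc (parityPow F (k + d) b)]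

/-- The involution `X ↦ (-1)^{d|X|} X` on vector fields. -/
def vfParity (d : ℤ) : VF F →ₗ[ℂ] VF F where
  toFun X := ⟨opParityPow d X, by
    obtain ⟨X, hX⟩ := X
    change opParityPow d X ∈ _
    induction hX using Submodule.span_induction with
    | zero => rw [opParityPow, mul_zero, zero_mul]; exact Submodule.zero_mem _
    | add X Y _ _ h h' => rw [opParityPow_add]; exact Submodule.add_mem _ h h'
    | smul a X _ h =>
      exact (opParityPow_mulLeft_mul d a X).symm ▸ Submodule.smul_mem _ (parityPow F d a) h
    | mem X hX =>
      obtain ⟨e, he⟩ := hX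
      refine Submodule.subset_span ⟨e, fun k a ha => parityPow_mem d (he.1 k _
        (parityPow_mem d ha)), fun a b => ?_⟩
      have hc : ∀ a : Form F R, parityPow F d (parityPow F e a)
          = parityPow F e (parityPow F d a) := fun a => by
        unfold parityPow; split_ifs <;> rfl
      rw [opParityPow_apply, parityPow_mul, he.2, map_add, parityPow_mul, parityPow_mul,
        parityPow_parityPow, hc, parityPow_parityPow]
      rfl⟩
  map_add' X Y := Subtype.ext (opParityPow_add d _ _)
  map_smul' c X := Subtype.ext (LinearMap.ext fun a => map_smul (parityPow F d) c _)

theorem vfParity_smul (d : ℤ) (a : Form F R) (X : VF F) :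
    vfParity d (a • X) = parityPow F d a • vfParity d X :=
  Subtype.ext (opParityPow_mulLeft_mul d a X)

theorem vfParity_mem (d : ℤ) {e : ℤ} {X : VF F} (he : X ∈ vfDeg F e) :
    vfParity d X ∈ vfDeg F e := by
  refine ⟨fun k a ha => parityPow_mem d (he.1 k _ (parityPow_mem d ha)), fun a b => ?_⟩
  have hc : ∀ a : Form F R, parityPow F d (parityPow F e a)
      = parityPow F e (parityPow F d a) := fun a => by
    unfold parityPow; split_ifs <;> rfl
  have h2 : ∀ b c : Form F R, (X : FormEnd F R) (b * c)
      = (X : FormEnd F R) b * c + parityPow F e b * (X : FormEnd F R) c :=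
    he.2
  change opParityPow d (X : FormEnd F R) _
    = opParityPow d (X : FormEnd F R) a * b
      + parityPow F e a * opParityPow d (X : FormEnd F R) b
  simp only [opParityPow_apply]
  rw [parityPow_mul, h2, map_add, parityPow_mul, parityPow_mul, parityPow_parityPow, hc,
    parityPow_parityPow]

variable {B : Submodule R (Derivation ℂ R R)} {n : ℕ} (φ : Frame F B n)

include φ in
theorem Frame.vfParity_of_mem (d : ℤ) {e : ℤ} {X : VF F} (hX : X ∈ vfDeg F e) :
    vfParity d X = sgn (e * d) • X :=
  Subtype.ext (φ.opParityPow_of_hasDegree hX.1 d)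

namespace SymVF

theorem ofFun_one : ofFun (F := F) (1 : Form F R) = 1 :=
  (RingQuot.mkAlgHom_rel ℂ SymRel.one).trans (map_one _)

theorem ofFun_mul (a b : Form F R) : ofFun (F := F) (a * b) = ofFun (F := F) a * ofFun (F := F) b :=
  (RingQuot.mkAlgHom_rel ℂ (SymRel.mul a b)).symm.trans (map_mul (RingQuot.mkAlgHom ℂ (SymRel F)) _ _)

theorem ofFun_mul_ofVF (a : Form F R) (X : VF F) :
    ofFun (F := F) a * ofVF (F := F) X = ofVF (F := F) (a • X) :=
  (map_mul (RingQuot.mkAlgHom ℂ (SymRel F)) _ _).symm.trans (RingQuot.mkAlgHom_rel ℂ (SymRel.smul a X))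

theorem ofVF_mul_ofFun {d k : ℤ} {X : VF F} {a : Form F R} (hX : X ∈ vfDeg F d)
    (ha : a ∈ formDeg F R k) :
    ofVF (F := F) X * ofFun (F := F) a = sgn (d * k) • (ofFun (F := F) a * ofVF (F := F) X) :=
  (map_mul (RingQuot.mkAlgHom ℂ (SymRel F)) _ _).symm.trans ((RingQuot.mkAlgHom_rel ℂ (SymRel.comm_fun d k X a hX ha)).trans
    ((map_zsmul _ _ _).trans (congrArg _ (map_mul (RingQuot.mkAlgHom ℂ (SymRel F)) _ _))))

theorem ofVF_mul_ofVF {d e : ℤ} {X Y : VF F} (hX : X ∈ vfDeg F d) (hY : Y ∈ vfDeg F e) :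
    ofVF (F := F) X * ofVF (F := F) Y = sgn (d * e) • (ofVF (F := F) Y * ofVF (F := F) X) :=
  (map_mul (RingQuot.mkAlgHom ℂ (SymRel F)) _ _).symm.trans ((RingQuot.mkAlgHom_rel ℂ (SymRel.comm d e X Y hX hY)).trans
    ((map_zsmul _ _ _).trans (congrArg _ (map_mul (RingQuot.mkAlgHom ℂ (SymRel F)) _ _))))

theorem ofFun_mul_ofFun {k m : ℤ} {a b : Form F R} (ha : a ∈ formDeg F R k)
    (hb : b ∈ formDeg F R m) :
    ofFun (F := F) a * ofFun (F := F) b = sgn (k * m) • (ofFun (F := F) b * ofFun (F := F) a) := by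
  rw [← ofFun_mul, ← ofFun_mul, Form.mul_comm_of_mem ha hb, map_zsmul]

theorem induction {p : SymVF F → Prop} (hf : ∀ a : Form F R, p (ofFun (F := F) a)) (hv : ∀ X, p (ofVF (F := F) X))
    (hadd : ∀ s t, p s → p t → p (s + t)) (hmul : ∀ s t, p s → p t → p (s * t)) (s : SymVF F) :
    p s := by
  obtain ⟨t, rfl⟩ := RingQuot.mkAlgHom_surjective ℂ (SymRel F) s
  induction t using TensorAlgebra.induction with
  | algebraMap c =>
    have : RingQuot.mkAlgHom ℂ (SymRel F) (algebraMap ℂ _ c) = ofFun (F := F) (c • (1 : Form F R)) := by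
      rw [map_smul, ofFun_one, AlgHom.commutes]; exact Algebra.algebraMap_eq_smul_one c
    rw [this]; exact hf _
  | ι g =>
    have : RingQuot.mkAlgHom ℂ (SymRel F) (TensorAlgebra.ι ℂ g)
        = ofFun (F := F) g.1 + ofVF (F := F) g.2 := by
      change gen g = gen (g.1, 0) + gen (0, g.2)
      rw [← map_add]; simp
    rw [this]; exact hadd _ _ (hf _) (hv _)
  | mul s t hs ht => rw [map_mul]; exact hmul _ _ hs ht
  | add s t hs ht => rw [map_add]; exact hadd _ _ hs ht

/-- Data defining an algebra homomorphism on the symmetric algebra. -/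
structure LiftData (F : LieRinehartSubalgebra R (Derivation ℂ R R)) (𝒜 : Type*) [Ring 𝒜]
    [Algebra ℂ 𝒜] where
  u : Form F R →ₗ[ℂ] 𝒜
  w : VF F →ₗ[ℂ] 𝒜
  one : u 1 = 1
  mul : ∀ a b, u (a * b) = u a * u b
  smul : ∀ a X, u a * w X = w (a • X)
  comm_fun : ∀ (d k : ℤ) (X : VF F) (a : Form F R), X ∈ vfDeg F d → a ∈ formDeg F R k →
    w X * u a = sgn (d * k) • (u a * w X)
  comm : ∀ (d e : ℤ) (X Y : VF F), X ∈ vfDeg F d → Y ∈ vfDeg F e →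
    w X * w Y = sgn (d * e) • (w Y * w X)

variable {𝒜 : Type*} [Ring 𝒜] [Algebra ℂ 𝒜]

/-- The algebra homomorphism with given values on the generators. -/
def LiftData.hom (L : LiftData F 𝒜) : SymVF F →ₐ[ℂ] 𝒜 :=
  RingQuot.liftAlgHom ℂ ⟨TensorAlgebra.lift ℂ (L.u.coprod L.w), by
    intro x y h
    induction h with
    | one => simp [L.one]
    | mul a b => simp [L.mul]
    | smul a X => simp [L.smul]
    | comm_fun d k X a hX ha => simp [L.comm_fun d k X a hX ha]
    | comm d e X Y hX hY => simp [L.comm d e X Y hX hY]⟩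

theorem LiftData.hom_gen (L : LiftData F 𝒜) (g : Form F R × VF F) :
    L.hom (gen g) = L.u g.1 + L.w g.2 :=
  (RingQuot.liftAlgHom_mkAlgHom_apply ℂ _ _ _).trans (TensorAlgebra.lift_ι_apply _ _)

@[simp] theorem LiftData.hom_ofFun (L : LiftData F 𝒜) (a : Form F R) :
    L.hom (ofFun (F := F) a) = L.u a :=
  (L.hom_gen _).trans ((congrArg _ (map_zero L.w)).trans (add_zero _))

@[simp] theorem LiftData.hom_ofVF (L : LiftData F 𝒜) (X : VF F) :
    L.hom (ofVF (F := F) X) = L.w X :=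
  (L.hom_gen _).trans ((congrArg (· + _) (map_zero L.u)).trans (zero_add _))

end SymVF

/-- The involution `s ↦ (-1)^{d|s|} s` on the symmetric algebra. -/
def twist (d : ℤ) : SymVF F →ₐ[ℂ] SymVF F :=
  SymVF.LiftData.hom
    { u := SymVF.ofFun ∘ₗ parityPow F d
      w := SymVF.ofVF ∘ₗ vfParity d
      one := (congrArg (SymVF.ofFun (F := F)) (parityPow_one d)).trans SymVF.ofFun_one
      mul := fun a b => (congrArg (SymVF.ofFun (F := F)) (parityPow_mul d a b)).trans
        (SymVF.ofFun_mul _ _)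
      smul := fun a X => (SymVF.ofFun_mul_ofVF _ _).trans
        (congrArg (SymVF.ofVF (F := F)) (vfParity_smul d a X).symm)
      comm_fun := fun _ _ _ _ hX ha =>
        SymVF.ofVF_mul_ofFun (vfParity_mem d hX) (parityPow_mem d ha)
      comm := fun _ _ _ _ hX hY => SymVF.ofVF_mul_ofVF (vfParity_mem d hX) (vfParity_mem d hY) }

theorem twist_ofFun (d : ℤ) (a : Form F R) :
    twist d (SymVF.ofFun (F := F) a) = SymVF.ofFun (F := F) (parityPow F d a) := SymVF.LiftData.hom_ofFun _ _

theorem twist_ofVF (d : ℤ) (X : VF F) :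
    twist d (SymVF.ofVF (F := F) X) = SymVF.ofVF (F := F) (vfParity d X) := SymVF.LiftData.hom_ofVF _ _

/-- Data defining a graded derivation of degree `e` of the symmetric algebra. -/
structure DerData (F : LieRinehartSubalgebra R (Derivation ℂ R R)) (e : ℤ) where
  u : Form F R →ₗ[ℂ] Form F R
  w : VF F →ₗ[ℂ] SymVF F
  mul : ∀ a b, u (a * b) = u a * b + parityPow F e a * u b
  deg : ∀ (k : ℤ), ∀ a ∈ formDeg F R k, u a ∈ formDeg F R (e + k)
  smul : ∀ a X, w (a • X)
    = SymVF.ofFun (F := F) (u a) * SymVF.ofVF (F := F) X + SymVF.ofFun (F := F) (parityPow F e a) * w X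
  comm_fun : ∀ (d k : ℤ) (X : VF F) (a : Form F R), X ∈ vfDeg F d → a ∈ formDeg F R k →
    w X * SymVF.ofFun (F := F) a = sgn ((e + d) * k) • (SymVF.ofFun (F := F) a * w X)
  comm : ∀ (d d' : ℤ) (X Y : VF F), X ∈ vfDeg F d → Y ∈ vfDeg F d' →
    w X * SymVF.ofVF (F := F) Y = sgn ((e + d) * d') • (SymVF.ofVF (F := F) Y * w X)

/-- Upper triangular two by two matrices over an algebra, as operators. -/
def triangular (S : Type*) [Ring S] [Algebra ℂ S] : S × S × S →ₗ[ℂ] Module.End ℂ (S × S) :=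
  LinearMap.mk₂ ℂ (fun m x => (m.1 * x.1 + m.2.1 * x.2, m.2.2 * x.2))
    (fun m m' x => by simp only [Prod.fst_add, Prod.snd_add, add_mul, Prod.mk_add_mk]; abel_nf)
    (fun c m x => by simp)
    (fun m x x' => by simp only [Prod.fst_add, Prod.snd_add, mul_add, Prod.mk_add_mk]; abel_nf)
    (fun c m x => by simp)

theorem triangular_apply {S : Type*} [Ring S] [Algebra ℂ S] (m : S × S × S) (x : S × S) :
    triangular S m x = (m.1 * x.1 + m.2.1 * x.2, m.2.2 * x.2) := rfl

theorem triangular_apply_zero_one {S : Type*} [Ring S] [Algebra ℂ S] (m : S × S × S) :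
    (triangular S m (0, 1)).1 = m.2.1 := by
  rw [triangular_apply, mul_zero, zero_add, mul_one]

theorem triangular_mul {S : Type*} [Ring S] [Algebra ℂ S] (m m' : S × S × S) :
    triangular S m * triangular S m'
      = triangular S (m.1 * m'.1, m.1 * m'.2.1 + m.2.1 * m'.2.2, m.2.2 * m'.2.2) :=
  LinearMap.ext fun x => by
    simp only [Module.End.mul_apply, triangular_apply, mul_add, add_mul, mul_assoc, add_assoc]

namespace DerData

variable {e : ℤ} (δ : DerData F e)

theorem u_one : δ.u 1 = 0 := by
  have h := δ.mul 1 1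
  rw [parityPow_one, mul_one, one_mul, mul_one] at h
  exact left_eq_add.mp h

/-- The homomorphism to triangular matrices of a graded derivation. -/
def matrixHom : SymVF F →ₐ[ℂ] Module.End ℂ (SymVF F × SymVF F) :=
  SymVF.LiftData.hom
    { u := triangular (SymVF F) ∘ₗ ((twist e).toLinearMap ∘ₗ SymVF.ofFun).prod
        ((SymVF.ofFun ∘ₗ δ.u).prod SymVF.ofFun)
      w := triangular (SymVF F) ∘ₗ ((twist e).toLinearMap ∘ₗ SymVF.ofVF).prod
        (δ.w.prod SymVF.ofVF)
      one := by
        refine LinearMap.ext fun x => ?_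
        change triangular _ (twist e (SymVF.ofFun (F := F) 1), SymVF.ofFun (F := F) (δ.u 1), SymVF.ofFun (F := F) 1) x = x
        rw [δ.u_one, SymVF.ofFun_one, map_one, map_zero, triangular_apply]
        simp
      mul := fun a b => by
        change triangular _ (twist e (SymVF.ofFun (F := F) _), SymVF.ofFun (F := F) (δ.u _), SymVF.ofFun (F := F) _)
          = triangular _ (twist e (SymVF.ofFun (F := F) _), SymVF.ofFun (F := F) (δ.u _), SymVF.ofFun (F := F) _)
            * triangular _ (twist e (SymVF.ofFun (F := F) _), SymVF.ofFun (F := F) (δ.u _), SymVF.ofFun (F := F) _)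
        rw [triangular_mul, δ.mul, map_add, SymVF.ofFun_mul, SymVF.ofFun_mul, SymVF.ofFun_mul,
          map_mul, ← twist_ofFun, add_comm (SymVF.ofFun (F := F) (δ.u a) * _)]
      smul := fun a X => by
        change triangular _ (twist e (SymVF.ofFun (F := F) _), SymVF.ofFun (F := F) (δ.u _), SymVF.ofFun (F := F) _)
            * triangular _ (twist e (SymVF.ofVF (F := F) _), δ.w _, SymVF.ofVF (F := F) _)
          = triangular _ (twist e (SymVF.ofVF (F := F) _), δ.w _, SymVF.ofVF (F := F) _)
        rw [triangular_mul, δ.smul, ← SymVF.ofFun_mul_ofVF, map_mul, ← twist_ofFun,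
          add_comm (SymVF.ofFun (F := F) (δ.u a) * _)]
      comm_fun := fun d k X a hX ha => by
        change triangular _ (twist e (SymVF.ofVF (F := F) _), δ.w _, SymVF.ofVF (F := F) _)
            * triangular _ (twist e (SymVF.ofFun (F := F) _), SymVF.ofFun (F := F) (δ.u _), SymVF.ofFun (F := F) _)
          = _ • (triangular _ (twist e (SymVF.ofFun (F := F) _), SymVF.ofFun (F := F) (δ.u _), SymVF.ofFun (F := F) _)
            * triangular _ (twist e (SymVF.ofVF (F := F) _), δ.w _, SymVF.ofVF (F := F) _))
        rw [triangular_mul, triangular_mul, ← map_zsmul]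
        refine congrArg _ (Prod.ext ?_ (Prod.ext ?_ (SymVF.ofVF_mul_ofFun hX ha)))
        · rw [Prod.smul_fst]
          change twist e (SymVF.ofVF (F := F) X) * twist e (SymVF.ofFun (F := F) a) = sgn (d * k) • (twist e (SymVF.ofFun (F := F) a) * twist e (SymVF.ofVF (F := F) X))
          rw [← map_mul, ← map_mul, ← map_zsmul, SymVF.ofVF_mul_ofFun hX ha]
        · rw [Prod.smul_snd, Prod.smul_fst]
          change twist e (SymVF.ofVF (F := F) X) * SymVF.ofFun (F := F) (δ.u a) + δ.w X * SymVF.ofFun (F := F) a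
            = sgn (d * k) • (twist e (SymVF.ofFun (F := F) a) * δ.w X + SymVF.ofFun (F := F) (δ.u a) * SymVF.ofVF (F := F) X)
          rw [twist_ofVF, twist_ofFun, φ.vfParity_of_mem e hX, parityPow_of_mem e ha,
            δ.comm_fun d k X a hX ha, map_zsmul, map_zsmul, smul_mul_assoc, smul_mul_assoc,
            SymVF.ofVF_mul_ofFun hX (δ.deg k a ha), smul_add]
          simp only [sgn_smul_smul]
          rw [add_comm]
          exact congrArg₂ _ (congrArg (· • _) (sgn_congr 0 (by ring)))
            (congrArg (· • _) (sgn_congr (d * e) (by ring)))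
      comm := fun d d' X Y hX hY => by
        change triangular _ (twist e (SymVF.ofVF (F := F) _), δ.w _, SymVF.ofVF (F := F) _)
            * triangular _ (twist e (SymVF.ofVF (F := F) _), δ.w _, SymVF.ofVF (F := F) _)
          = _ • (triangular _ (twist e (SymVF.ofVF (F := F) _), δ.w _, SymVF.ofVF (F := F) _)
            * triangular _ (twist e (SymVF.ofVF (F := F) _), δ.w _, SymVF.ofVF (F := F) _))
        rw [triangular_mul, triangular_mul, ← map_zsmul]
        refine congrArg _ (Prod.ext ?_ (Prod.ext ?_ (SymVF.ofVF_mul_ofVF hX hY)))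
        · rw [Prod.smul_fst]
          change twist e (SymVF.ofVF (F := F) X) * twist e (SymVF.ofVF (F := F) Y) = sgn (d * d') • (twist e (SymVF.ofVF (F := F) Y) * twist e (SymVF.ofVF (F := F) X))
          rw [← map_mul (twist e), ← map_mul (twist e), ← map_zsmul (twist e), SymVF.ofVF_mul_ofVF hX hY]
        · rw [Prod.smul_snd, Prod.smul_fst]
          change twist e (SymVF.ofVF (F := F) X) * δ.w Y + δ.w X * SymVF.ofVF (F := F) Y
            = sgn (d * d') • (twist e (SymVF.ofVF (F := F) Y) * δ.w X + δ.w Y * SymVF.ofVF (F := F) X)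
          rw [twist_ofVF, twist_ofVF, φ.vfParity_of_mem e hX, φ.vfParity_of_mem e hY,
            δ.comm d d' X Y hX hY, map_zsmul, map_zsmul, smul_mul_assoc, smul_mul_assoc,
            δ.comm d' d Y X hY hX, smul_add]
          simp only [sgn_smul_smul]
          rw [add_comm]
          exact congrArg₂ _ (congrArg (· • _) (sgn_congr 0 (by ring)))
            (congrArg (· • _) (sgn_congr (-(d * d')) (by ring))) }

/-- The graded derivation of the symmetric algebra with given values on the generators. -/
def toLin : SymVF F →ₗ[ℂ] SymVF F :=
  LinearMap.fst ℂ _ _ ∘ₗ LinearMap.applyₗ (R := ℂ) (0, 1) ∘ₗ (δ.matrixHom φ).toLinearMap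

theorem matrixHom_eq (s : SymVF F) :
    δ.matrixHom φ s = triangular (SymVF F) (twist e s, δ.toLin φ s, s) := by
  suffices h : ∃ q, δ.matrixHom φ s = triangular (SymVF F) (twist e s, q, s) by
    obtain ⟨q, hq⟩ := h
    have : δ.toLin φ s = q := by
      change (δ.matrixHom φ s (0, 1)).1 = q
      rw [hq, triangular_apply_zero_one]
    rw [this, hq]
  induction s using SymVF.induction with
  | hf a => exact ⟨_, SymVF.LiftData.hom_ofFun _ a⟩
  | hv X => exact ⟨_, SymVF.LiftData.hom_ofVF _ X⟩
  | hadd s t hs ht =>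
    obtain ⟨q, hq⟩ := hs
    obtain ⟨q', hq'⟩ := ht
    exact ⟨q + q', by
      rw [map_add, hq, hq', ← map_add]
      exact congrArg (triangular _) (Prod.ext (map_add (twist e) s t).symm rfl)⟩
  | hmul s t hs ht =>
    obtain ⟨q, hq⟩ := hs
    obtain ⟨q', hq'⟩ := ht
    exact ⟨_, by rw [map_mul, hq, hq', triangular_mul, map_mul]⟩

theorem toLin_ofFun (a : Form F R) : δ.toLin φ (SymVF.ofFun (F := F) a) = SymVF.ofFun (F := F) (δ.u a) := by
  change (δ.matrixHom φ _ (0, 1)).1 = _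
  rw [matrixHom, SymVF.LiftData.hom_ofFun]
  exact triangular_apply_zero_one _

theorem toLin_ofVF (X : VF F) : δ.toLin φ (SymVF.ofVF (F := F) X) = δ.w X := by
  change (δ.matrixHom φ _ (0, 1)).1 = _
  rw [matrixHom, SymVF.LiftData.hom_ofVF]
  exact triangular_apply_zero_one _

theorem toLin_mul (s t : SymVF F) :
    δ.toLin φ (s * t) = δ.toLin φ s * t + twist e s * δ.toLin φ t := by
  change (δ.matrixHom φ (s * t) (0, 1)).1 = _
  rw [map_mul, matrixHom_eq, matrixHom_eq, triangular_mul, triangular_apply, mul_zero, zero_add,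
    mul_one, add_comm]

theorem toLin_ofFun_mul (a : Form F R) (s : SymVF F) : δ.toLin φ (SymVF.ofFun (F := F) a * s)
    = SymVF.ofFun (F := F) (δ.u a) * s + SymVF.ofFun (F := F) (parityPow F e a) * δ.toLin φ s := by
  rw [toLin_mul, toLin_ofFun, twist_ofFun]

theorem toLin_ofVF_mul {d : ℤ} {X : VF F} (hX : X ∈ vfDeg F d) (s : SymVF F) :
    δ.toLin φ (SymVF.ofVF (F := F) X * s)
      = δ.w X * s + sgn (e * d) • (SymVF.ofVF (F := F) X * δ.toLin φ s) := by
  rw [toLin_mul, toLin_ofVF, twist_ofVF, φ.vfParity_of_mem e hX, map_zsmul, smul_mul_assoc,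
    mul_comm d e]

/-- Contraction with the differential of a function on `F[1]`. -/
def contraction {k : ℤ} {f : Form F R} (hf : f ∈ formDeg F R k) : DerData F k where
  u := 0
  w := SymVF.ofFun ∘ₗ parityPow F k ∘ₗ LinearMap.applyₗ (R := ℂ) f ∘ₗ
    (vectorFields F).subtype.restrictScalars ℂ
  mul a b := by simp
  deg m a ha := Submodule.zero_mem _
  smul a X := by
    change SymVF.ofFun (F := F) (parityPow F k (a * (X : FormEnd F R) f)) = _
    rw [parityPow_mul, SymVF.ofFun_mul, LinearMap.zero_apply, map_zero, zero_mul, zero_add]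
    rfl
  comm_fun d m X a hX ha := by
    rw [add_comm k d]
    exact SymVF.ofFun_mul_ofFun (parityPow_mem k (hX.1 k f hf)) ha
  comm d d' X Y hX hY := by
    have := SymVF.ofVF_mul_ofFun hY (parityPow_mem k (hX.1 k f hf))
    change SymVF.ofFun (F := F) (parityPow F k _) * _ = _ • (_ * SymVF.ofFun (F := F) (parityPow F k _))
    refine Eq.symm ((congrArg _ this).trans ?_)
    rw [sgn_smul_smul, show sgn ((k + d) * d' + d' * (d + k)) = sgn 0 from
      sgn_congr (d' * (d + k)) (by ring), sgn_zero, one_smul]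
    rfl

include φ in
theorem _root_.KapranovDolbeault.Frame.nabla_smul (C : AffineConnection F) {d : ℤ} {Z : VF F}
    (hZ : Z ∈ vfDeg F d) (a : Form F R) (Y : VF F) :
    C.nabla Z (a • Y) = (Z : FormEnd F R) a • Y + parityPow F d a • C.nabla Z Y := by
  have h0 : ∀ X : VF F, (0 : Form F R) • X = 0 := fun X =>
    Subtype.ext (LinearMap.ext fun c => zero_mul _)
  refine φ.form_induction (p := fun a => C.nabla Z (a • Y)
    = (Z : FormEnd F R) a • Y + parityPow F d a • C.nabla Z Y)
    (by rw [map_zero, map_zero, h0, h0, map_zero, add_zero])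
    (fun a b ha hb => ?_) (fun k a ha => ?_) a
  · rw [add_smul, map_add, ha, hb, map_add, map_add, add_smul, add_smul]; abel
  · rw [C.leibniz d k Z Y a hZ ha, parityPow_of_mem d ha, smul_assoc]

/-- Covariant derivatives. -/
def covariant (C : AffineConnection F) {e : ℤ} {Z : VF F} (hZ : Z ∈ vfDeg F e) : DerData F e where
  u := Z
  w := SymVF.ofVF ∘ₗ C.nabla Z
  mul a b := hZ.2 a b
  deg k a ha := hZ.1 k a ha
  smul a X := by
    rw [LinearMap.comp_apply, φ.nabla_smul C hZ, map_add, SymVF.ofFun_mul_ofVF,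
      LinearMap.comp_apply, SymVF.ofFun_mul_ofVF]
  comm_fun d k X a hX ha := SymVF.ofVF_mul_ofFun (C.degree e d Z X hZ hX) ha
  comm d d' X Y hX hY := SymVF.ofVF_mul_ofVF (C.degree e d Z X hZ hX) hY

end DerData

/-! #### Products of homogeneous vector fields -/

theorem symProd_nil : symProd ([] : List (Homog (vfDeg F))) = 1 := rfl

theorem symProd_cons (Y : Homog (vfDeg F)) (l : List (Homog (vfDeg F))) :
    symProd (Y :: l) = SymVF.ofVF (F := F) Y.val * symProd l := List.prod_cons

theorem Homog.val_mem {V : Type*} [AddCommGroup V] [Module ℂ V] {𝒱 : ℤ → Submodule ℂ V}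
    (x : Homog 𝒱) : x.val ∈ 𝒱 x.deg := x.2.2

/-- A homogeneous element with its degree. -/
def Homog.mk {V : Type*} [AddCommGroup V] [Module ℂ V] {𝒱 : ℤ → Submodule ℂ V} {d : ℤ} {x : V}
    (h : x ∈ 𝒱 d) : Homog 𝒱 := ⟨d, x, h⟩

theorem Homog.mk_val {V : Type*} [AddCommGroup V] [Module ℂ V] {𝒱 : ℤ → Submodule ℂ V} {d : ℤ}
    {x : V} (h : x ∈ 𝒱 d) : (Homog.mk h).val = x := rfl

theorem symProd_mul_ofFun {k : ℤ} {a : Form F R} (ha : a ∈ formDeg F R k)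
    (l : List (Homog (vfDeg F))) :
    symProd l * SymVF.ofFun (F := F) a = sgn ((l.map Homog.deg).sum * k) • (SymVF.ofFun (F := F) a * symProd l) := by
  induction l with
  | nil => simp [symProd_nil, sgn_zero]
  | cons Y l ih =>
    rw [symProd_cons, mul_assoc, ih, mul_smul_comm, ← mul_assoc,
      SymVF.ofVF_mul_ofFun Y.val_mem ha, smul_mul_assoc, sgn_smul_smul, mul_assoc]
    exact congrArg (· • _) (sgn_congr 0 (by simp only [List.map_cons, List.sum_cons]; ring))

theorem symProd_swap (l₁ : List (Homog (vfDeg F))) (x y : Homog (vfDeg F))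
    (l₂ : List (Homog (vfDeg F))) :
    symProd (l₁ ++ x :: y :: l₂) = sgn (x.deg * y.deg) • symProd (l₁ ++ y :: x :: l₂) := by
  induction l₁ with
  | nil =>
    simp only [List.nil_append, symProd_cons, ← mul_assoc]
    rw [SymVF.ofVF_mul_ofVF x.val_mem y.val_mem, smul_mul_assoc]
  | cons z l ih => rw [List.cons_append, symProd_cons, ih, List.cons_append, symProd_cons,
      mul_smul_comm]

theorem contraction_symProd {k : ℤ} {f : Form F R} (hf : f ∈ formDeg F R k)
    (l : List (Homog (vfDeg F))) :
    (DerData.contraction hf).toLin φ (symProd l) = pickSum Homog.deg l fun y t =>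
      SymVF.ofFun (F := F) (parityPow F k ((y.val : FormEnd F R) f)) * symProd t := by
  induction l with
  | nil =>
    rw [symProd_nil, ← SymVF.ofFun_one, DerData.toLin_ofFun]
    exact map_zero _
  | cons Y l ih =>
    rw [symProd_cons, DerData.toLin_ofVF_mul φ _ Y.val_mem, ih, mul_pickSum, ← pickSum_zsmul,
      pickSum_cons]
    refine congrArg₂ _ rfl (pickSum_congr _ fun y t _ _ => ?_)
    rw [← mul_assoc, SymVF.ofVF_mul_ofFun Y.val_mem (parityPow_mem k (vf_apply_mem y.val_mem hf)),
      smul_mul_assoc, sgn_smul_smul, mul_assoc, ← symProd_cons]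
    exact congrArg (· • _) (sgn_congr (k * Y.deg) (by ring))

include φ in
/-- The products of vector fields span the symmetric algebra over the functions. -/
theorem SymVF.span_induction {p : SymVF F → Prop} (hz : p 0) (hadd : ∀ s t, p s → p t → p (s + t))
    (h : ∀ (a : Form F R) (l : List (Homog (vfDeg F))), p (ofFun (F := F) a * symProd l)) (s : SymVF F) :
    p s := by
  let M : AddSubmonoid (SymVF F) := AddSubmonoid.closure
    {s | ∃ (a : Form F R) (l : List (Homog (vfDeg F))), s = ofFun (F := F) a * symProd l}
  have hM : ∀ s ∈ M, p s := fun s hs => by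
    induction hs using AddSubmonoid.closure_induction with
    | mem s hs => obtain ⟨a, l, rfl⟩ := hs; exact h a l
    | zero => exact hz
    | add s t _ _ hs ht => exact hadd s t hs ht
  have hgen : ∀ (a : Form F R) l, ofFun (F := F) a * symProd l ∈ M := fun a l =>
    AddSubmonoid.subset_closure ⟨a, l, rfl⟩
  have hfun : ∀ (b : Form F R), ∀ s ∈ M, ofFun (F := F) b * s ∈ M := fun b s hs => by
    induction hs using AddSubmonoid.closure_induction with
    | mem s hs => obtain ⟨a, l, rfl⟩ := hs; rw [← mul_assoc, ← ofFun_mul]; exact hgen _ _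
    | zero => rw [mul_zero]; exact M.zero_mem
    | add s t _ _ hs ht => rw [mul_add]; exact M.add_mem hs ht
  have hhom : ∀ (Y : Homog (vfDeg F)) (a : Form F R) l, ofVF (F := F) Y.val * (ofFun (F := F) a * symProd l) ∈ M := by
    intro Y a l
    refine φ.form_induction (p := fun a => ofVF (F := F) Y.val * (ofFun (F := F) a * symProd l) ∈ M)
      (by rw [map_zero, zero_mul, mul_zero]; exact M.zero_mem)
      (fun a b ha hb => by rw [map_add, add_mul, mul_add]; exact M.add_mem ha hb)
      (fun k a ha => ?_) a
    rw [← mul_assoc, ofVF_mul_ofFun Y.val_mem ha, ← smul_mul_assoc, ← map_zsmul, mul_assoc,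
      ← symProd_cons]
    exact hgen _ _
  have hvf : ∀ X, ∀ s ∈ M, ofVF (F := F) X * s ∈ M := fun X s hs => by
    induction hs using AddSubmonoid.closure_induction with
    | mem s hs =>
      obtain ⟨a, l, rfl⟩ := hs
      rw [φ.vf_eq_sum X, map_sum, Finset.sum_mul]
      refine M.sum_mem fun j _ => ?_
      rw [← ofFun_mul_ofVF, mul_assoc]
      exact hfun _ _ (hhom (Homog.mk (φ.partialVF_mem j)) a l)
    | zero => rw [mul_zero]; exact M.zero_mem
    | add s t _ _ hs ht => rw [mul_add]; exact M.add_mem hs ht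
  have hall : ∀ s : SymVF F, ∀ t ∈ M, s * t ∈ M := fun s => by
    induction s using SymVF.induction with
    | hf a => exact hfun a
    | hv X => exact hvf X
    | hadd s t hs ht => intro r hr; rw [add_mul]; exact M.add_mem (hs r hr) (ht r hr)
    | hmul s t hs ht => intro r hr; rw [mul_assoc]; exact hs _ (ht r hr)
  refine hM s ?_
  rw [← mul_one s]
  refine hall s _ ?_
  have := hgen 1 []
  rwa [ofFun_one, one_mul, symProd_nil] at this

end Symmetric

/-! ### The Poincaré–Birkhoff–Witt map -/

section Membership

variable {ι W : Type*} [AddCommGroup W] {deg : ι → ℤ} {H : AddSubgroup W}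

theorem pickSum_mem {l : List ι} {G : ι → List ι → W}
    (h : ∀ y t, t.length + 1 = l.length → deg y + (t.map deg).sum = (l.map deg).sum → G y t ∈ H) :
    pickSum deg l G ∈ H := by
  induction l generalizing G with
  | nil => exact H.zero_mem
  | cons x l ih =>
    refine H.add_mem (h x l rfl rfl) (ih fun y t ht hd => H.zsmul_mem (h y _ ?_ ?_) _)
    · simpa using ht
    · simp only [List.map_cons, List.sum_cons, ← hd]; ring

theorem derSum_mem {e : ℤ} {D : ι → ι} (hD : ∀ y, deg (D y) = e + deg y) {l : List ι}
    {G : List ι → W} (h : ∀ t, t.length = l.length → (t.map deg).sum = e + (l.map deg).sum →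
      G t ∈ H) : derSum deg e D l G ∈ H := by
  induction l generalizing G with
  | nil => exact H.zero_mem
  | cons x l ih =>
    refine H.add_mem (h _ rfl (by simp only [List.map_cons, List.sum_cons, hD]; ring))
      (H.zsmul_mem (ih fun t ht hd => h _ (by simpa using ht) ?_) _)
    simp only [List.map_cons, List.sum_cons, hd]; ring

theorem unshuffleSum_mem {l : List ι} {G : List ι → List ι → W}
    (h : ∀ S T, S.length + T.length = l.length →
      (S.map deg).sum + (T.map deg).sum = (l.map deg).sum → G S T ∈ H) :
    unshuffleSum deg l G ∈ H := by
  induction l generalizing G with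
  | nil => exact h [] [] rfl rfl
  | cons x l ih =>
    refine H.add_mem (ih fun S T hl hd => h _ _ ?_ ?_)
      (ih fun S T hl hd => H.zsmul_mem (h _ _ ?_ ?_) _)
    · simp only [List.length_cons]; omega
    · simp only [List.map_cons, List.sum_cons, ← hd]; ring
    · simp only [List.length_cons]; omega
    · simp only [List.map_cons, List.sum_cons, ← hd]; ring

theorem isAddTorsionFree_of_module (V : Type*) [AddCommGroup V] [Module ℂ V] :
    IsAddTorsionFree V where
  nsmul_right_injective n hn a b h := by
    have h' : (n : ℂ) • a = (n : ℂ) • b := by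
      rw [Nat.cast_smul_eq_nsmul, Nat.cast_smul_eq_nsmul]; exact h
    exact smul_right_injective V (Nat.cast_ne_zero.mpr hn) h'

theorem mem_of_nsmul_mem {V : Type*} [AddCommGroup V] [Module ℂ V] {H : Submodule ℂ V} {m : ℕ}
    (hm : m ≠ 0) {v : V} (h : m • v ∈ H) : v ∈ H := by
  have := H.smul_mem ((m : ℂ)⁻¹) h
  rwa [← Nat.cast_smul_eq_nsmul ℂ, smul_smul, inv_mul_cancel₀ (Nat.cast_ne_zero.mpr hm),
    one_smul] at this

end Membership

section Construction

variable {R : Type*} [CommRing R] [Algebra ℂ R]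
  {F : LieRinehartSubalgebra R (Derivation ℂ R R)}

namespace SymVF

/-- The projection of the symmetric algebra onto the functions. -/
def counit : SymVF F →ₗ[ℂ] Form F R :=
  LinearMap.fst ℂ _ _ ∘ₗ LinearMap.applyₗ (R := ℂ) (1, 0) ∘ₗ SymVF.act.toLinearMap

theorem counit_one : counit (F := F) (1 : SymVF F) = 1 := by
  change (SymVF.act (1 : SymVF F) (1, 0)).1 = 1
  rw [map_one]; rfl

theorem counit_ofFun_mul (a : Form F R) (s : SymVF F) :
    counit (F := F) (ofFun (F := F) a * s) = a * counit (F := F) s := by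
  change (SymVF.act (gen (a, 0) * s) (1, 0)).1 = a * (SymVF.act s (1, 0)).1
  rw [map_mul, act_gen, Module.End.mul_apply, genAct_apply]

/-- The algebra homomorphism recording the number of vector fields in a product. -/
def grade : SymVF F →ₐ[ℂ] Polynomial (SymVF F) :=
  LiftData.hom
    { u := (Polynomial.monomial 0).restrictScalars ℂ ∘ₗ ofFun (F := F)
      w := (Polynomial.monomial 1).restrictScalars ℂ ∘ₗ ofVF (F := F)
      one := by
        change Polynomial.monomial 0 (ofFun (F := F) 1) = 1
        rw [ofFun_one]; rfl
      mul := fun a b => by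
        change Polynomial.monomial 0 (ofFun (F := F) (a * b)) = Polynomial.monomial 0 _ *
          Polynomial.monomial 0 _
        rw [Polynomial.monomial_mul_monomial, ofFun_mul]
      smul := fun a X => by
        change Polynomial.monomial 0 _ * Polynomial.monomial 1 _ =
          Polynomial.monomial 1 (ofVF (F := F) (a • X))
        rw [Polynomial.monomial_mul_monomial, ofFun_mul_ofVF]
      comm_fun := fun d k X a hX ha => by
        change Polynomial.monomial 1 _ * Polynomial.monomial 0 _ =
          _ • (Polynomial.monomial 0 _ * Polynomial.monomial 1 _)
        rw [Polynomial.monomial_mul_monomial, Polynomial.monomial_mul_monomial,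
          ofVF_mul_ofFun hX ha, map_zsmul]
      comm := fun d e X Y hX hY => by
        change Polynomial.monomial 1 _ * Polynomial.monomial 1 _ =
          _ • (Polynomial.monomial 1 _ * Polynomial.monomial 1 _)
        rw [Polynomial.monomial_mul_monomial, Polynomial.monomial_mul_monomial,
          ofVF_mul_ofVF hX hY, map_zsmul] }

theorem grade_ofFun (a : Form F R) :
    grade (ofFun (F := F) a) = Polynomial.monomial 0 (ofFun (F := F) a) := LiftData.hom_ofFun _ _

theorem grade_ofVF (X : VF F) :
    grade (ofVF (F := F) X) = Polynomial.monomial 1 (ofVF (F := F) X) := LiftData.hom_ofVF _ _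

theorem grade_symProd (l : List (Homog (vfDeg F))) :
    grade (symProd l) = Polynomial.monomial l.length (symProd l) := by
  induction l with
  | nil => rw [symProd_nil, map_one]; rfl
  | cons Y l ih =>
    rw [symProd_cons, map_mul, ih, grade_ofVF, Polynomial.monomial_mul_monomial, List.length_cons,
      add_comm]

theorem grade_ofFun_mul {a : Form F R} {s : SymVF F} {m : ℕ}
    (h : grade s = Polynomial.monomial m s) :
    grade (ofFun (F := F) a * s) = Polynomial.monomial m (ofFun (F := F) a * s) := by
  rw [map_mul, h, grade_ofFun, Polynomial.monomial_mul_monomial, zero_add]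

end SymVF

/-- The covariant derivative of a homogeneous vector field. -/
def AffineConnection.homNabla (C : AffineConnection F) (X Y : Homog (vfDeg F)) :
    Homog (vfDeg F) := Homog.mk (C.degree _ _ _ _ X.val_mem Y.val_mem)

theorem AffineConnection.homNabla_deg (C : AffineConnection F) (X Y : Homog (vfDeg F)) :
    (C.homNabla X Y).deg = X.deg + Y.deg := rfl

theorem AffineConnection.nablaProd_eq (C : AffineConnection F) (X : Homog (vfDeg F))
    (l : List (Homog (vfDeg F))) :
    C.nablaProd X l = derSum Homog.deg X.deg (C.homNabla X) l symProd := by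
  induction l with
  | nil => rfl
  | cons Y l ih =>
    rw [nablaProd, ih, derSum_cons, mul_derSum]
    simp only [← symProd_cons]
    rfl

theorem AffineConnection.grade_nablaProd (C : AffineConnection F) (X : Homog (vfDeg F))
    (l : List (Homog (vfDeg F))) :
    SymVF.grade (C.nablaProd X l) = Polynomial.monomial l.length (C.nablaProd X l) := by
  rw [C.nablaProd_eq, map_derSum, map_derSum]
  exact derSum_congr (C.homNabla_deg X) fun t ht _ => by rw [SymVF.grade_symProd, ht]

variable {B : Submodule R (Derivation ℂ R R)} {n : ℕ} (φ : Frame F B n) (C : AffineConnection F)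

namespace Frame

/-- Contraction with the differential of a coordinate. -/
def jac (j : Fin n ⊕ Fin n) : SymVF F →ₗ[ℂ] SymVF F :=
  (DerData.contraction (φ.coord_mem j)).toLin φ

/-- The covariant derivative along the dual basis. -/
def cov (j : Fin n ⊕ Fin n) : SymVF F →ₗ[ℂ] SymVF F :=
  (DerData.covariant φ C (φ.partialVF_mem j)).toLin φ

theorem jac_ofFun_mul (j : Fin n ⊕ Fin n) (a : Form F R) (s : SymVF F) :
    φ.jac j (SymVF.ofFun (F := F) a * s)
      = SymVF.ofFun (F := F) (parityPow F (cdeg n j) a) * φ.jac j s := by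
  rw [jac, DerData.toLin_ofFun_mul]
  have : SymVF.ofFun (F := F) ((DerData.contraction (φ.coord_mem j)).u a) = 0 :=
    map_zero (SymVF.ofFun (F := F))
  rw [this, zero_mul, zero_add]

theorem jac_symProd (j : Fin n ⊕ Fin n) (l : List (Homog (vfDeg F))) :
    φ.jac j (symProd l) = pickSum Homog.deg l fun y t =>
      SymVF.ofFun (F := F) (parityPow F (cdeg n j)
        ((y.val : FormEnd F R) (φ.coord j))) * symProd t :=
  contraction_symProd φ _ l

theorem sum_ofFun_mul_cov (y : Homog (vfDeg F)) (t : List (Homog (vfDeg F))) :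
    ∑ j, SymVF.ofFun (F := F) ((y.val : FormEnd F R) (φ.coord j)) *
      φ.cov C j (symProd t) = C.nablaProd y t := by
  induction t with
  | nil =>
    refine Finset.sum_eq_zero fun j _ => ?_
    rw [symProd_nil, ← SymVF.ofFun_one, cov, DerData.toLin_ofFun, DerData.u_one, map_zero, mul_zero]
  | cons Y t ih =>
    have h1 : ∀ j, SymVF.ofFun (F := F) ((y.val : FormEnd F R) (φ.coord j)) *
        φ.cov C j (symProd (Y :: t))
        = SymVF.ofVF (F := F) ((y.val : FormEnd F R) (φ.coord j) •
            C.nabla (φ.partialVF j) Y.val) * symProd t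
          + sgn (y.deg * Y.deg) • (SymVF.ofVF (F := F) Y.val *
            (SymVF.ofFun (F := F) ((y.val : FormEnd F R) (φ.coord j)) *
              φ.cov C j (symProd t))) := by
      intro j
      rw [symProd_cons, cov, DerData.toLin_ofVF_mul φ _ Y.val_mem, mul_add, ← mul_assoc]
      refine congrArg₂ _ (congrArg (· * _) (SymVF.ofFun_mul_ofVF _ _)) ?_
      rw [← mul_assoc (SymVF.ofVF (F := F) Y.val),
        SymVF.ofVF_mul_ofFun Y.val_mem (vf_apply_mem y.val_mem (φ.coord_mem j)),
        smul_mul_assoc, sgn_smul_smul, mul_smul_comm, mul_assoc]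
      exact congrArg (· • _) (sgn_congr (-(y.deg * Y.deg) - (cdeg n j) * Y.deg) (by ring))
    simp only [h1]
    rw [Finset.sum_add_distrib, ← Finset.smul_sum, ← Finset.mul_sum, ih, ← Finset.sum_mul,
      ← map_sum, AffineConnection.nablaProd]
    refine congrArg (fun Z => SymVF.ofVF (F := F) Z * symProd t + _) ?_
    conv_rhs => rw [φ.vf_eq_sum y.val]
    rw [map_sum, LinearMap.sum_apply]
    exact Finset.sum_congr rfl fun j _ => (C.smul_left _ _ _).symm

/-- The operator `∂ⱼ q(s) - q(∇ⱼ s)`. -/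
def covStep (q : SymVF F →ₗ[ℂ] FormEnd F R) (j : Fin n ⊕ Fin n) :
    SymVF F →ₗ[ℂ] FormEnd F R :=
  LinearMap.mulLeft ℂ (φ.partialOp j) ∘ₗ q - q ∘ₗ φ.cov C j

theorem covStep_apply (q : SymVF F →ₗ[ℂ] FormEnd F R) (j : Fin n ⊕ Fin n)
    (s : SymVF F) : φ.covStep C q j s = φ.partialOp j * q s - q (φ.cov C j s) := rfl

theorem partialOp_mulLeft (j : Fin n ⊕ Fin n) (c : Form F R) :
    φ.partialOp j * LinearMap.mulLeft ℂ c = LinearMap.mulLeft ℂ (φ.partialOp j c)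
      + LinearMap.mulLeft ℂ (parityPow F (cdeg n j) c) * φ.partialOp j :=
  LinearMap.ext fun b => by
    have := (φ.partialOp_mem_derDeg j).2 c b
    rwa [parityPow_neg] at this

theorem covStep_ofFun_mul {q : SymVF F →ₗ[ℂ] FormEnd F R}
    (hq : ∀ (a : Form F R) s, q (SymVF.ofFun (F := F) a * s) = LinearMap.mulLeft ℂ a * q s)
    (j : Fin n ⊕ Fin n) (c : Form F R) (s : SymVF F) :
    φ.covStep C q j (SymVF.ofFun (F := F) (parityPow F (cdeg n j) c) * s)
      = LinearMap.mulLeft ℂ c * φ.covStep C q j s := by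
  have h : φ.cov C j (SymVF.ofFun (F := F) (parityPow F (cdeg n j) c) * s)
      = SymVF.ofFun (F := F) (φ.partialOp j (parityPow F (cdeg n j) c)) * s
        + SymVF.ofFun (F := F) c * φ.cov C j s := by
    rw [cov, DerData.toLin_ofFun_mul, parityPow_neg, parityPow_parityPow]; rfl
  rw [covStep_apply, covStep_apply, h, map_add, hq, hq, hq, ← mul_assoc, partialOp_mulLeft,
    parityPow_parityPow, add_mul, mul_sub, mul_assoc]
  abel

/-- The Poincaré–Birkhoff–Witt map on the symmetric powers. -/
def pbwAux : ℕ → SymVF F →ₗ[ℂ] FormEnd F R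
  | 0 => LinearMap.mul ℂ (Form F R) ∘ₗ SymVF.counit (F := F)
  | m + 1 => ((m + 1 : ℕ) : ℂ)⁻¹ • ∑ j, φ.covStep C (pbwAux m) j ∘ₗ φ.jac j

theorem pbwAux_succ (m : ℕ) (s : SymVF F) :
    (m + 1) • φ.pbwAux C (m + 1) s = ∑ j, φ.covStep C (φ.pbwAux C m) j (φ.jac j s) := by
  rw [pbwAux, LinearMap.smul_apply, ← Nat.cast_smul_eq_nsmul ℂ, smul_smul,
    mul_inv_cancel₀ (Nat.cast_ne_zero.mpr m.succ_ne_zero), one_smul, LinearMap.sum_apply]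
  rfl

theorem pbwAux_ofFun_mul (m : ℕ) (a : Form F R) (s : SymVF F) :
    φ.pbwAux C m (SymVF.ofFun (F := F) a * s) = LinearMap.mulLeft ℂ a * φ.pbwAux C m s := by
  induction m generalizing a s with
  | zero =>
    change LinearMap.mulLeft ℂ (SymVF.counit (F := F) (SymVF.ofFun (F := F) a * s)) = _
    rw [SymVF.counit_ofFun_mul, LinearMap.mulLeft_mul]
    rfl
  | succ m ih =>
    refine smul_right_injective (R := ℂ) _ (Nat.cast_ne_zero.mpr m.succ_ne_zero) ?_
    change ((m + 1 : ℕ) : ℂ) • φ.pbwAux C (m + 1) _ = ((m + 1 : ℕ) : ℂ) • _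
    rw [Nat.cast_smul_eq_nsmul, Nat.cast_smul_eq_nsmul, pbwAux_succ, ← mul_smul_comm, pbwAux_succ,
      Finset.mul_sum]
    refine Finset.sum_congr rfl fun j _ => ?_
    rw [jac_ofFun_mul, φ.covStep_ofFun_mul C ih]

/-- The Poincaré–Birkhoff–Witt map. -/
def pbw : SymVF F →ₗ[ℂ] FormEnd F R :=
  Polynomial.lsum (fun m => φ.pbwAux C m) ∘ₗ SymVF.grade.toLinearMap

theorem pbw_of_grade {s : SymVF F} {m : ℕ} (h : SymVF.grade s = Polynomial.monomial m s) :
    φ.pbw C s = φ.pbwAux C m s := by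
  change (SymVF.grade s).sum _ = _
  rw [h]
  exact Polynomial.sum_monomial_index _ _ (map_zero _)

theorem pbw_ofFun_mul (a : Form F R) (s : SymVF F) :
    φ.pbw C (SymVF.ofFun (F := F) a * s) = LinearMap.mulLeft ℂ a * φ.pbw C s := by
  refine SymVF.span_induction φ (p := fun s => φ.pbw C (SymVF.ofFun (F := F) a * s)
    = LinearMap.mulLeft ℂ a * φ.pbw C s) (by rw [mul_zero, map_zero, mul_zero])
    (fun s t hs ht => by rw [mul_add, map_add, hs, ht, map_add, mul_add]) (fun b l => ?_) s
  rw [φ.pbw_of_grade C (SymVF.grade_ofFun_mul (SymVF.grade_ofFun_mul (SymVF.grade_symProd l))),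
    φ.pbw_of_grade C (SymVF.grade_ofFun_mul (SymVF.grade_symProd l)), pbwAux_ofFun_mul]

theorem pbw_one : φ.pbw C 1 = 1 := by
  rw [φ.pbw_of_grade C (m := 0) (map_one _)]
  change LinearMap.mulLeft ℂ (SymVF.counit (F := F) (1 : SymVF F)) = 1
  rw [SymVF.counit_one, LinearMap.mulLeft_one]
  rfl

theorem pbw_recursion (l : List (Homog (vfDeg F))) :
    l.length • φ.pbw C (symProd l) = pickSum Homog.deg l fun y t =>
      (y.val : FormEnd F R) * φ.pbw C (symProd t) - φ.pbw C (C.nablaProd y t) := by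
  rw [φ.pbw_of_grade C (SymVF.grade_symProd l)]
  cases hl : l.length with
  | zero =>
    rw [List.length_eq_zero_iff.mp hl, zero_smul]; rfl
  | succ m =>
    rw [pbwAux_succ]
    simp only [jac_symProd, map_pickSum]
    rw [← pickSum_finsetSum]
    refine pickSum_congr _ fun y t ht _ => ?_
    have ht' : t.length = m := by omega
    simp only [φ.covStep_ofFun_mul C (φ.pbwAux_ofFun_mul C m), covStep_apply, mul_sub,
      Finset.sum_sub_distrib, ← pbwAux_ofFun_mul, ← mul_assoc]
    rw [← Finset.sum_mul, ← φ.eq_sum_partialOp (φ.isGrDer y.val), ← map_sum, sum_ofFun_mul_cov,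
      φ.pbw_of_grade C (SymVF.grade_symProd t), φ.pbw_of_grade C (C.grade_nablaProd y t), ht']

/-- The image of a product of vector fields under the Poincaré–Birkhoff–Witt map. -/
def pbwProd (l : List (Homog (vfDeg F))) : FormEnd F R := φ.pbw C (symProd l)

theorem pbwProd_nil : φ.pbwProd C [] = 1 := φ.pbw_one C

theorem pbwProd_recursion (l : List (Homog (vfDeg F))) :
    l.length • φ.pbwProd C l = pickSum Homog.deg l fun y t =>
      (y.val : FormEnd F R) * φ.pbwProd C t
        - derSum Homog.deg y.deg (C.homNabla y) t (φ.pbwProd C) := by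
  refine (φ.pbw_recursion C l).trans (pickSum_congr _ fun y t _ _ => ?_)
  rw [C.nablaProd_eq, map_derSum]
  rfl

theorem pbwProd_singleton (X : Homog (vfDeg F)) : φ.pbwProd C [X] = X.val := by
  have := φ.pbwProd_recursion C [X]
  rw [List.length_singleton, one_smul] at this
  rw [this, pickSum_cons, pbwProd_nil]
  change _ * 1 - 0 + 0 = _
  rw [mul_one, sub_zero, add_zero]

variable (F) in
/-- The operators of degree `d`. -/
def _root_.KapranovDolbeault.degreeOps (d : ℤ) : Submodule ℂ (FormEnd F R) where
  carrier := {X | HasDegree d X}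
  zero_mem' := fun _ _ _ => Submodule.zero_mem _
  add_mem' := fun h h' => h.add h'
  smul_mem' := fun c _ h k a ha => Submodule.smul_mem _ c (h k a ha)

theorem pbwProd_hasDegree (l : List (Homog (vfDeg F))) :
    HasDegree (l.map Homog.deg).sum (φ.pbwProd C l) := by
  induction hl : l.length generalizing l with
  | zero =>
    rw [List.length_eq_zero_iff.mp hl, pbwProd_nil]
    intro k a ha
    simpa using ha
  | succ m ih =>
    refine mem_of_nsmul_mem (H := degreeOps F _) (m := l.length) (by omega) ?_
    rw [pbwProd_recursion]
    refine pickSum_mem (H := (degreeOps F _).toAddSubgroup) fun y t ht hd => ?_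
    rw [← hd]
    refine AddSubgroup.sub_mem _ (HasDegree.mul y.val_mem.1 (ih t (by omega))) ?_
    exact derSum_mem (C.homNabla_deg y) fun t' ht' hd' => hd' ▸ ih t' (by omega)

/-- The Poincaré–Birkhoff–Witt map is a morphism of coalgebras. -/
theorem pbwProd_mul {k : ℤ} {a : Form F R} (ha : a ∈ formDeg F R k) (b : Form F R)
    (l : List (Homog (vfDeg F))) :
    φ.pbwProd C l (a * b) = unshuffleSum Homog.deg l fun S T =>
      sgn (k * (T.map Homog.deg).sum) • (φ.pbwProd C S a * φ.pbwProd C T b) := by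
  have := isAddTorsionFree_of_module (Form F R)
  have hrec : ∀ (c : Form F R) (l : List (Homog (vfDeg F))),
      l.length • φ.pbwProd C l c = pickSum Homog.deg l fun y t =>
        (LinearMap.toAddMonoidHom (y.val : FormEnd F R)) (φ.pbwProd C t c)
          - derSum Homog.deg y.deg (C.homNabla y) t fun t => φ.pbwProd C t c := by
    intro c l
    have := congrArg (LinearMap.applyₗ (R := ℂ) c) (φ.pbwProd_recursion C l)
    rw [map_pickSum] at this
    refine this.trans (pickSum_congr _ fun y t _ _ => ?_)
    rw [map_sub, map_derSum]
    rfl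
  refine unshuffleSum_mul_of_recursion (p := fun l => φ.pbwProd C l a)
    (q := fun l => φ.pbwProd C l b) (r := fun l => φ.pbwProd C l (a * b))
    C.homNabla_deg (fun y S c => ?_) (hrec a) (hrec b) (hrec (a * b)) ?_ l
  · change (y.val : FormEnd F R) _ = _
    rw [vf_mul y.val_mem, parityPow_of_mem _ (φ.pbwProd_hasDegree C S k a ha), smul_mul_assoc,
      add_comm k]
    rfl
  · simp only [pbwProd_nil, Module.End.one_apply]

end Frame

end Construction

/-! ### Bijectivity of the Poincaré–Birkhoff–Witt map -/

section Bijectivity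

variable {R : Type*} [CommRing R] [Algebra ℂ R]
  {F : LieRinehartSubalgebra R (Derivation ℂ R R)}
  {B : Submodule R (Derivation ℂ R R)} {n : ℕ} (φ : Frame F B n) (C : AffineConnection F)

theorem gcomm_eq (k : ℕ) (a : Form F R) (D : FormEnd F R) :
    gcomm k a D = D * LinearMap.mulLeft ℂ a - LinearMap.mulLeft ℂ a * opParityPow k D := by
  rw [gcomm_apply, opParity_pow]

theorem opParityPow_mulLeft (d : ℤ) (c : Form F R) :
    opParityPow d (LinearMap.mulLeft ℂ c) = LinearMap.mulLeft ℂ (parityPow F d c) := by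
  have := opParityPow_mulLeft_mul d c 1
  rwa [mul_one, show opParityPow d (1 : FormEnd F R) = 1 from
    LinearMap.ext fun a => parityPow_parityPow d a, mul_one] at this

theorem opParityPow_comm (d e : ℤ) (X : FormEnd F R) :
    opParityPow d (opParityPow e X) = opParityPow e (opParityPow d X) := by
  have hc : ∀ a : Form F R, parityPow F d (parityPow F e a) = parityPow F e (parityPow F d a) :=
    fun a => by unfold parityPow; split_ifs <;> rfl
  refine LinearMap.ext fun a => ?_
  simp only [opParityPow_apply, hc]

theorem opParityPow_mem {m : ℕ} {D : FormEnd F R} (hD : D ∈ diffOpLT F m) (k : ℕ) :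
    opParityPow (k : ℤ) D ∈ diffOpLT F m := by
  rw [← opParity_pow]; exact opParity_pow_mem hD k

theorem gcomm_mul (k : ℕ) (a : Form F R) (P D : FormEnd F R) :
    gcomm k a (P * D) = P * gcomm k a D + gcomm k a P * opParityPow k D := by
  simp only [gcomm_eq, opParityPow_mul, mul_sub, sub_mul, mul_assoc]; abel

theorem mulLeft_mul_comm {k : ℕ} {a : Form F R} (ha : a ∈ formDeg F R k) (b : Form F R) :
    (LinearMap.mulLeft ℂ b : FormEnd F R) * LinearMap.mulLeft ℂ a
      = LinearMap.mulLeft ℂ a * LinearMap.mulLeft ℂ (parityPow F k b) :=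
  LinearMap.ext fun c => by
    change b * (a * c) = a * (parityPow F k b * c)
    rw [← mul_assoc, mul_comm_of_mem k ha, mul_assoc]

theorem gcomm_mulLeft {k : ℕ} {a : Form F R} (ha : a ∈ formDeg F R k) (b : Form F R) :
    gcomm k a (LinearMap.mulLeft ℂ b) = 0 := by
  rw [gcomm_eq, opParityPow_mulLeft, mulLeft_mul_comm ha, sub_self]

theorem gcomm_mulLeft_mul {k : ℕ} {a : Form F R} (ha : a ∈ formDeg F R k) (b : Form F R)
    (D : FormEnd F R) :
    gcomm k a (LinearMap.mulLeft ℂ b * D) = LinearMap.mulLeft ℂ b * gcomm k a D := by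
  rw [gcomm_mul, gcomm_mulLeft ha, zero_mul, add_zero]

theorem gcomm_gcomm {k m : ℕ} {a b : Form F R} (ha : a ∈ formDeg F R k) (hb : b ∈ formDeg F R m)
    (D : FormEnd F R) :
    gcomm k a (gcomm m b D) = sgn ((k : ℤ) * m) • gcomm m b (gcomm k a D) := by
  have h1 : (LinearMap.mulLeft ℂ a : FormEnd F R) * LinearMap.mulLeft ℂ b
      = sgn ((k : ℤ) * m) • (LinearMap.mulLeft ℂ b * LinearMap.mulLeft ℂ a) :=
    LinearMap.ext fun c => by
      change a * (b * c) = sgn _ • (b * (a * c))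
      rw [← mul_assoc, Form.mul_comm_of_mem ha hb, smul_mul_assoc, mul_assoc]
  have h2 : opParityPow (k : ℤ) (LinearMap.mulLeft ℂ b : FormEnd F R)
      = sgn ((k : ℤ) * m) • LinearMap.mulLeft ℂ b := by
    rw [opParityPow_mulLeft, parityPow_of_mem _ hb]
    exact map_zsmul (LinearMap.mul ℂ (Form F R)) _ _
  have h3 : opParityPow (m : ℤ) (LinearMap.mulLeft ℂ a : FormEnd F R)
      = sgn ((k : ℤ) * m) • LinearMap.mulLeft ℂ a := by
    rw [opParityPow_mulLeft, parityPow_of_mem _ ha, mul_comm (m : ℤ)]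
    exact map_zsmul (LinearMap.mul ℂ (Form F R)) _ _
  simp only [gcomm_eq, opParityPow_sub, opParityPow_mul, h2, h3, mul_sub, sub_mul, smul_sub,
    smul_mul_assoc, mul_smul_comm, mul_assoc, opParityPow_comm (m : ℤ) k]
  rw [← mul_assoc (LinearMap.mulLeft ℂ a) (LinearMap.mulLeft ℂ b), h1]
  simp only [smul_mul_assoc, mul_smul_comm, sgn_smul_sgn_smul, mul_assoc]
  abel

variable (F) in
/-- The span of the products of less than `m` vector fields. -/
def symLT (m : ℕ) : Submodule ℂ (SymVF F) :=
  Submodule.span ℂ {s | ∃ (a : Form F R) (l : List (Homog (vfDeg F))),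
    l.length < m ∧ s = SymVF.ofFun (F := F) a * symProd l}

theorem ofFun_mul_symProd_mem {m : ℕ} (a : Form F R) {l : List (Homog (vfDeg F))}
    (hl : l.length < m) : SymVF.ofFun (F := F) a * symProd l ∈ symLT F m :=
  Submodule.subset_span ⟨a, l, hl, rfl⟩

theorem symLT_mono {m m' : ℕ} (h : m ≤ m') : symLT F m ≤ symLT F m' :=
  Submodule.span_mono fun _ ⟨a, l, hl, hs⟩ => ⟨a, l, hl.trans_le h, hs⟩

theorem ofFun_mul_mem {m : ℕ} (a : Form F R) {s : SymVF F} (hs : s ∈ symLT F m) :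
    SymVF.ofFun (F := F) a * s ∈ symLT F m := by
  induction hs using Submodule.span_induction with
  | mem s hs =>
    obtain ⟨b, l, hl, rfl⟩ := hs
    rw [← mul_assoc, ← SymVF.ofFun_mul]; exact ofFun_mul_symProd_mem _ hl
  | zero => rw [mul_zero]; exact Submodule.zero_mem _
  | add s t _ _ hs ht => rw [mul_add]; exact Submodule.add_mem _ hs ht
  | smul c s _ hs => rw [mul_smul_comm]; exact Submodule.smul_mem _ c hs

namespace Frame

include φ in
theorem exists_mem_symLT (s : SymVF F) : ∃ m, s ∈ symLT F m :=
  SymVF.span_induction φ (p := fun s => ∃ m, s ∈ symLT F m) ⟨0, Submodule.zero_mem _⟩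
    (fun _ _ ⟨m, hm⟩ ⟨m', hm'⟩ => ⟨max m m', Submodule.add_mem _ (symLT_mono (le_max_left _ _) hm)
      (symLT_mono (le_max_right _ _) hm')⟩)
    (fun a l => ⟨l.length + 1, ofFun_mul_symProd_mem a (Nat.lt_succ_self _)⟩) s

/-- The image of the products of less than `m` vector fields. -/
def opLT (m : ℕ) : Submodule ℂ (FormEnd F R) := (symLT F m).map (φ.pbw C)

theorem opLT_mono {m m' : ℕ} (h : m ≤ m') : φ.opLT C m ≤ φ.opLT C m' :=
  Submodule.map_mono (symLT_mono h)

theorem mulLeft_mul_mem_opLT {m : ℕ} (a : Form F R) {D : FormEnd F R}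
    (hD : D ∈ φ.opLT C m) : LinearMap.mulLeft ℂ a * D ∈ φ.opLT C m := by
  obtain ⟨s, hs, rfl⟩ := hD
  exact ⟨_, ofFun_mul_mem a hs, φ.pbw_ofFun_mul C a s⟩

theorem pbwProd_mem_opLT {m : ℕ} {l : List (Homog (vfDeg F))} (hl : l.length < m) :
    φ.pbwProd C l ∈ φ.opLT C m := by
  have := ofFun_mul_symProd_mem (F := F) 1 hl
  rw [SymVF.ofFun_one, one_mul] at this
  exact ⟨_, this, rfl⟩

theorem gcomm_pbwProd {k : ℕ} {f : Form F R} (hf : f ∈ formDeg F R k)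
    (l : List (Homog (vfDeg F))) :
    gcomm k f (φ.pbwProd C l) - opParityPow k (φ.pbw C
      ((DerData.contraction hf).toLin φ (symProd l))) ∈ φ.opLT C (l.length - 1) := by
  have h1 : φ.pbwProd C l * LinearMap.mulLeft ℂ f = unshuffleSum Homog.deg l fun S T =>
      sgn (k * (T.map Homog.deg).sum) •
        (LinearMap.mulLeft ℂ (φ.pbwProd C S f) * φ.pbwProd C T) := by
    refine LinearMap.ext fun g => (φ.pbwProd_mul C hf g l).trans ?_
    change _ = LinearMap.applyₗ (R := ℂ) g _
    rw [map_unshuffleSum]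
    rfl
  have h2 : LinearMap.mulLeft ℂ f * opParityPow k (φ.pbwProd C l)
      = unshuffleSum Homog.deg l fun S T => if S = [] then
        sgn (k * (T.map Homog.deg).sum) •
          (LinearMap.mulLeft ℂ (φ.pbwProd C S f) * φ.pbwProd C T) else 0 := by
    rw [unshuffleSum_eq_right _ _ _ fun S T hS => if_neg hS, if_pos rfl, pbwProd_nil,
      φ.opParityPow_of_hasDegree (φ.pbwProd_hasDegree C l), mul_smul_comm, mul_comm (k : ℤ)]
    rfl
  have h3 : opParityPow k (φ.pbw C ((DerData.contraction hf).toLin φ (symProd l)))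
      = pickSum Homog.deg l fun y t => unshuffleSum Homog.deg t fun S' T =>
        if S' = [] then sgn (k * (T.map Homog.deg).sum) •
          (LinearMap.mulLeft ℂ (φ.pbwProd C [y] f) * φ.pbwProd C T) else 0 := by
    rw [contraction_symProd, map_pickSum]
    have : ∀ D, opParityPow (k : ℤ) D = (opParity F ^ k).toLinearMap D := fun D =>
      (opParity_pow k D).symm
    rw [this, map_pickSum]
    refine pickSum_congr _ fun y t _ _ => ?_
    rw [unshuffleSum_eq_right _ _ _ fun S T hS => if_neg hS, if_pos rfl, pbwProd_singleton,
      ← this, pbw_ofFun_mul, show φ.pbw C (symProd t) = φ.pbwProd C t from rfl, opParityPow_mulLeft_mul, parityPow_parityPow,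
      φ.opParityPow_of_hasDegree (φ.pbwProd_hasDegree C t), mul_smul_comm, mul_comm (k : ℤ)]
  rw [gcomm_eq, h1, h2, h3, pickSum_unshuffleSum_left, ← unshuffleSum_sub, ← unshuffleSum_sub]
  refine unshuffleSum_mem (H := (φ.opLT C (l.length - 1)).toAddSubgroup) fun S T hST _ => ?_
  have hz : ∀ S : List (Homog (vfDeg F)), 2 ≤ S.length → ∀ G : Homog (vfDeg F) →
      FormEnd F R, pickSum Homog.deg S (fun y S' => if S' = [] then G y else 0) = 0 := by
    intro S hS G
    have := pickSum_mem (deg := Homog.deg) (H := (⊥ : AddSubgroup (FormEnd F R)))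
      (l := S) (G := fun y S' => if S' = [] then G y else 0) fun y t ht _ => by
        have : t ≠ [] := fun h => by rw [h] at ht; simp at ht; omega
        rw [if_neg this]; exact AddSubgroup.zero_mem _
    simpa using this
  match S, hST with
  | [], _ =>
    rw [if_pos rfl, sub_self]
    exact (sub_zero (0 : FormEnd F R)).symm ▸ AddSubgroup.zero_mem _
  | [y], _ =>
    rw [if_neg (by simp), pickSum_cons, if_pos rfl]
    change _ - 0 - (_ + 0) ∈ _
    rw [sub_zero, add_zero, sub_self]; exact AddSubgroup.zero_mem _
  | y :: z :: S, hST =>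
    rw [if_neg (by simp), hz _ (by simp), sub_zero, sub_zero]
    refine AddSubgroup.zsmul_mem _ (φ.mulLeft_mul_mem_opLT C _ (φ.pbwProd_mem_opLT C ?_)) _
    simp only [List.length_cons] at hST
    omega

theorem contraction_mem {k m : ℕ} {f : Form F R} (hf : f ∈ formDeg F R k) {s : SymVF F}
    (hs : s ∈ symLT F (m + 1)) : (DerData.contraction hf).toLin φ s ∈ symLT F m := by
  induction hs using Submodule.span_induction with
  | mem s hs =>
    obtain ⟨b, l, hl, rfl⟩ := hs
    rw [DerData.toLin_ofFun_mul]
    have : SymVF.ofFun (F := F) ((DerData.contraction hf).u b) = 0 := map_zero (SymVF.ofFun (F := F))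
    rw [this, zero_mul, zero_add, contraction_symProd]
    refine ofFun_mul_mem _ (pickSum_mem (H := (symLT F m).toAddSubgroup) fun y t ht _ => ?_)
    exact ofFun_mul_symProd_mem _ (by omega)
  | zero => rw [map_zero]; exact Submodule.zero_mem _
  | add s t _ _ hs ht => rw [map_add]; exact Submodule.add_mem _ hs ht
  | smul c s _ hs => rw [map_smul]; exact Submodule.smul_mem _ c hs

theorem gcomm_pbw {k m : ℕ} {f : Form F R} (hf : f ∈ formDeg F R k) {s : SymVF F}
    (hs : s ∈ symLT F (m + 1)) :
    gcomm k f (φ.pbw C s) - opParityPow k (φ.pbw C ((DerData.contraction hf).toLin φ s))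
      ∈ φ.opLT C (m - 1) := by
  have hlin : ∀ D, opParityPow (k : ℤ) D = (opParity F ^ k).toLinearMap D := fun D =>
    (opParity_pow k D).symm
  induction hs using Submodule.span_induction with
  | mem s hs =>
    obtain ⟨b, l, hl, rfl⟩ := hs
    rw [DerData.toLin_ofFun_mul]
    have : SymVF.ofFun (F := F) ((DerData.contraction hf).u b) = 0 := map_zero (SymVF.ofFun (F := F))
    rw [this, zero_mul, zero_add, pbw_ofFun_mul, pbw_ofFun_mul, opParityPow_mulLeft_mul,
      parityPow_parityPow, gcomm_mulLeft_mul hf, ← mul_sub]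
    exact φ.mulLeft_mul_mem_opLT C b (φ.opLT_mono C (by omega) (φ.gcomm_pbwProd C hf l))
  | zero =>
    rw [hlin, map_zero, map_zero, map_zero, map_zero, map_zero, sub_zero]
    exact Submodule.zero_mem _
  | add s t _ _ hs ht =>
    rw [hlin] at hs ht ⊢
    rw [map_add, map_add, map_add, map_add, map_add, add_sub_add_comm]
    exact Submodule.add_mem _ hs ht
  | smul c s _ hs =>
    rw [hlin] at hs ⊢
    rw [map_smul, map_smul, map_smul, map_smul, map_smul, ← smul_sub]
    exact Submodule.smul_mem _ c hs

theorem opParityPow_mem_opLT {m : ℕ} (k : ℕ) {D : FormEnd F R}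
    (hD : D ∈ φ.opLT C m) : opParityPow (k : ℤ) D ∈ φ.opLT C m := by
  have hlin : ∀ D, opParityPow (k : ℤ) D = (opParity F ^ k).toLinearMap D := fun D =>
    (opParity_pow k D).symm
  obtain ⟨s, hs, rfl⟩ := hD
  induction hs using Submodule.span_induction with
  | mem s hs =>
    obtain ⟨b, l, hl, rfl⟩ := hs
    rw [pbw_ofFun_mul, show φ.pbw C (symProd l) = φ.pbwProd C l from rfl, opParityPow_mulLeft_mul,
      φ.opParityPow_of_hasDegree (φ.pbwProd_hasDegree C l)]
    exact φ.mulLeft_mul_mem_opLT C _ (zsmul_mem (φ.pbwProd_mem_opLT C hl) _)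
  | zero => rw [map_zero, hlin, map_zero]; exact Submodule.zero_mem _
  | add s t _ _ hs ht =>
    rw [hlin] at hs ht ⊢; rw [map_add, map_add]; exact Submodule.add_mem _ hs ht
  | smul c s _ hs => rw [hlin] at hs ⊢; rw [map_smul, map_smul]; exact Submodule.smul_mem _ c hs

theorem opLT_le (m : ℕ) : φ.opLT C m ≤ diffOpLT F m := by
  induction m with
  | zero =>
    rintro _ ⟨s, hs, rfl⟩
    have h0 : symLT F 0 = ⊥ := by
      refine Submodule.span_eq_bot.mpr fun s ⟨a, l, hl, _⟩ => absurd hl (Nat.not_lt_zero _)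
    have : s = 0 := by simpa [h0] using hs
    rw [this, map_zero]; exact Submodule.zero_mem _
  | succ m ih =>
    rintro _ ⟨s, hs, rfl⟩
    rw [mem_diffOpLT_succ]
    intro k f hf
    have h1 := φ.gcomm_pbw C hf hs
    have h2 := φ.opParityPow_mem_opLT C k (Submodule.mem_map_of_mem (f := φ.pbw C)
      (φ.contraction_mem hf hs))
    have := Submodule.add_mem _ (φ.opLT_mono C (Nat.sub_le m 1) h1) h2
    rw [sub_add_cancel] at this
    exact ih this

/-- Euler's formula for the symmetric algebra. -/
theorem sum_ofVF_mul_jac {m : ℕ} {s : SymVF F} (hs : s ∈ symLT F (m + 1)) :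
    ∑ j, SymVF.ofVF (F := F) (φ.partialVF j) * φ.jac j s - m • s ∈ symLT F m := by
  induction hs using Submodule.span_induction with
  | mem s hs =>
    obtain ⟨b, l, hl, rfl⟩ := hs
    have hmove : ∀ j (c : Form F R) (s : SymVF F), SymVF.ofVF (F := F) (φ.partialVF j) *
        (SymVF.ofFun (F := F) (parityPow F (cdeg n j) c) * s)
        = SymVF.ofFun (F := F) c * (SymVF.ofVF (F := F) (φ.partialVF j) * s) := by
      intro j c s
      refine φ.form_induction (p := fun c => SymVF.ofVF (F := F) (φ.partialVF j) *
        (SymVF.ofFun (F := F) (parityPow F (cdeg n j) c) * s)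
        = SymVF.ofFun (F := F) c * (SymVF.ofVF (F := F) (φ.partialVF j) * s))
        (by simp only [map_zero, zero_mul, mul_zero])
        (fun a b ha hb => by simp only [map_add, add_mul, mul_add, ha, hb]) (fun k a ha => ?_) c
      rw [parityPow_of_mem _ ha, map_zsmul, smul_mul_assoc, mul_smul_comm, ← mul_assoc,
        SymVF.ofVF_mul_ofFun (φ.partialVF_mem j) ha, smul_mul_assoc, sgn_smul_smul, mul_assoc,
        show sgn ((cdeg n j : ℤ) * k + -(cdeg n j : ℤ) * k) = 1 by rw [← sgn_zero]; congr 1; ring,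
        one_smul]
    have hE : ∑ j, SymVF.ofVF (F := F) (φ.partialVF j) * φ.jac j (symProd l)
        = l.length • symProd l := by
      simp only [jac_symProd, mul_pickSum, hmove]
      rw [← pickSum_finsetSum]
      have h1 : ∀ (y : Homog (vfDeg F)) (t : List (Homog (vfDeg F))),
          ∑ j, SymVF.ofFun (F := F) ((y.val : FormEnd F R) (φ.coord j)) *
            (SymVF.ofVF (F := F) (φ.partialVF j) * symProd t) = symProd (y :: t) := by
        intro y t
        simp only [← mul_assoc, SymVF.ofFun_mul_ofVF]
        rw [← Finset.sum_mul, ← map_sum, ← φ.vf_eq_sum, symProd_cons]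
      simp only [h1]
      refine pickSum_const _ fun l₁ y l₂ hl => ?_
      rw [hl]
      clear hl
      induction l₁ with
      | nil => simp [sgn_zero]
      | cons x l₁ ih =>
        have h2 := symProd_swap [] y x (l₁ ++ l₂)
        simp only [List.nil_append] at h2
        rw [List.cons_append, h2, List.cons_append, symProd_cons, symProd_cons, ← symProd_cons y,
          ih, mul_smul_comm, sgn_smul_smul, ← symProd_cons]
        exact congrArg (· • _) (sgn_congr 0 (by simp only [List.map_cons, List.sum_cons]; ring))
    simp only [jac_ofFun_mul, hmove]
    rw [← Finset.mul_sum, hE, mul_smul_comm]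
    rcases Nat.lt_succ_iff_lt_or_eq.mp hl with h | h
    · have := ofFun_mul_symProd_mem (F := F) b h
      exact Submodule.sub_mem _ (Submodule.smul_of_tower_mem _ _ this)
        (Submodule.smul_of_tower_mem _ _ this)
    · rw [h, sub_self]; exact Submodule.zero_mem _
  | zero => simp
  | add s t _ _ hs ht =>
    simp only [map_add, mul_add, Finset.sum_add_distrib, smul_add, add_sub_add_comm]
    exact Submodule.add_mem _ hs ht
  | smul c s _ hs =>
    simp only [map_smul, mul_smul_comm, ← Finset.smul_sum]
    rw [smul_comm m c, ← smul_sub]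
    exact Submodule.smul_mem _ c hs

theorem ofVF_mul_mem (j : Fin n ⊕ Fin n) {m : ℕ} {s : SymVF F} (hs : s ∈ symLT F m) :
    SymVF.ofVF (F := F) (φ.partialVF j) * s ∈ symLT F (m + 1) := by
  induction hs using Submodule.span_induction with
  | mem s hs =>
    obtain ⟨b, l, hl, rfl⟩ := hs
    refine φ.form_induction (p := fun b => SymVF.ofVF (F := F) (φ.partialVF j) *
        (SymVF.ofFun (F := F) b * symProd l) ∈ symLT F (m + 1))
        (by simp only [map_zero, zero_mul, mul_zero]; exact Submodule.zero_mem _)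
        (fun a b ha hb => by
          simp only [map_add, add_mul, mul_add]; exact Submodule.add_mem _ ha hb)
        (fun k a ha => ?_) b
    rw [← mul_assoc, SymVF.ofVF_mul_ofFun (φ.partialVF_mem j) ha, smul_mul_assoc, mul_assoc]
    exact zsmul_mem (ofFun_mul_symProd_mem (F := F) a
      (l := Homog.mk (φ.partialVF_mem j) :: l) (by simpa using hl)) _
  | zero => rw [mul_zero]; exact Submodule.zero_mem _
  | add s t _ _ hs ht => rw [mul_add]; exact Submodule.add_mem _ hs ht
  | smul c s _ hs => rw [mul_smul_comm]; exact Submodule.smul_mem _ c hs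

theorem exists_ofFun_of_mem {s : SymVF F} (hs : s ∈ symLT F 1) :
    ∃ a : Form F R, s = SymVF.ofFun (F := F) a := by
  have : symLT F 1 ≤ LinearMap.range (SymVF.ofFun (F := F)) := by
    refine Submodule.span_le.mpr ?_
    rintro s ⟨b, l, hl, rfl⟩
    rw [List.length_eq_zero_iff.mp (by omega : l.length = 0), symProd_nil, mul_one]
    exact ⟨b, rfl⟩
  obtain ⟨a, ha⟩ := this hs
  exact ⟨a, ha.symm⟩

theorem mem_symLT_of_pbw_mem {m : ℕ} {s : SymVF F} (hs : s ∈ symLT F (m + 1))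
    (h : φ.pbw C s ∈ diffOpLT F m) : s ∈ symLT F m := by
  induction m generalizing s with
  | zero =>
    obtain ⟨a, rfl⟩ := exists_ofFun_of_mem hs
    have h1 : φ.pbw C (SymVF.ofFun (F := F) a) = 0 := h
    rw [← mul_one (SymVF.ofFun (F := F) a), pbw_ofFun_mul, pbw_one, mul_one] at h1
    have h2 := congrArg (fun D : FormEnd F R => D 1) h1
    simp only [LinearMap.mulLeft_apply, mul_one, LinearMap.zero_apply] at h2
    rw [h2, map_zero]
    exact Submodule.zero_mem _
  | succ m ih =>
    have hj : ∀ j, φ.jac j s ∈ symLT F m := fun j => by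
      refine ih (φ.contraction_mem (φ.coord_mem j) hs) ?_
      have h1 := mem_diffOpLT_succ.mp h _ _ (φ.coord_mem j)
      have h2 := φ.opLT_le C _ (φ.gcomm_pbw C (φ.coord_mem j) hs)
      have h3 := opParityPow_mem (Submodule.sub_mem _ h1 h2) (cdeg n j)
      rw [sub_sub_cancel, opParityPow_opParityPow] at h3
      exact h3
    have h1 := φ.sum_ofVF_mul_jac hs
    have h2 : ∑ j, SymVF.ofVF (F := F) (φ.partialVF j) * φ.jac j s ∈ symLT F (m + 1) :=
      Submodule.sum_mem _ fun j _ => φ.ofVF_mul_mem j (hj j)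
    refine mem_of_nsmul_mem m.succ_ne_zero ?_
    have := Submodule.sub_mem _ h2 h1
    rwa [sub_sub_cancel] at this

theorem pbw_injective : Function.Injective (φ.pbw C) := by
  refine (injective_iff_map_eq_zero _).mpr fun s hs => ?_
  obtain ⟨m, hm⟩ := φ.exists_mem_symLT s
  induction m with
  | zero =>
    have h0 : symLT F 0 = ⊥ := by
      refine Submodule.span_eq_bot.mpr fun s ⟨a, l, hl, _⟩ => absurd hl (Nat.not_lt_zero _)
    simpa [h0] using hm
  | succ m ih => exact ih (φ.mem_symLT_of_pbw_mem C hm (hs ▸ Submodule.zero_mem _))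

/-! #### Surjectivity -/

include φ in
theorem eq_mulLeft_of_mem {D : FormEnd F R} (hD : D ∈ diffOpLT F 1) :
    D = LinearMap.mulLeft ℂ (D 1) := by
  refine φ.op_ext fun k a ha => ?_
  have h : gcomm k a D = 0 := mem_diffOpLT_succ.mp hD k a ha
  rw [gcomm_eq, sub_eq_zero] at h
  have := congrArg (fun D => D 1) h
  simp only [Module.End.mul_apply, LinearMap.mulLeft_apply, mul_one, opParityPow_apply,
    parityPow_one] at this
  rw [this, LinearMap.mulLeft_apply, mul_comm_of_mem k ha]

include φ in
theorem isGrDer_of_mem {D : FormEnd F R} (hD : D ∈ diffOpLT F 2) :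
    IsGrDer (D - LinearMap.mulLeft ℂ (D 1)) := by
  intro k a ha b
  have h := φ.eq_mulLeft_of_mem (mem_diffOpLT_succ.mp hD k a ha)
  have h1 := congrArg (fun D => D b) h
  simp only [gcomm_eq, LinearMap.sub_apply, Module.End.mul_apply, LinearMap.mulLeft_apply, mul_one,
    opParityPow_apply, parityPow_one] at h1
  rw [opParityPow_sub, opParityPow_mulLeft]
  simp only [LinearMap.sub_apply, LinearMap.mulLeft_apply, opParityPow_apply, mul_sub, sub_mul] at *
  rw [sub_eq_iff_eq_add.mp h1, ← mul_assoc a (parityPow F k (D 1)), ← mul_assoc,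
    ← mul_comm_of_mem k ha]
  abel

/-- The chain rule for the symbol of a differential operator. -/
theorem sum_gcomm_mulLeft {m : ℕ} {D : FormEnd F R} (hD : D ∈ diffOpLT F (m + 2))
    {k : ℕ} {f : Form F R} (hf : f ∈ formDeg F R k) :
    ∑ j, gcomm (cdeg n j) (φ.coord j) D * LinearMap.mulLeft ℂ (φ.partialOp j f) - gcomm k f D
      ∈ diffOpLT F m := by
  induction m generalizing D k f with
  | zero =>
    have hX := φ.isGrDer_of_mem hD
    set X := D - LinearMap.mulLeft ℂ (D 1) with hXdef
    have hg : ∀ {k : ℕ} {f : Form F R}, f ∈ formDeg F R k →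
        gcomm k f D = LinearMap.mulLeft ℂ (X f) := by
      intro k f hf
      have h1 : gcomm k f D = gcomm k f X := by
        rw [hXdef, map_sub, gcomm_mulLeft hf, sub_zero]
      rw [h1, gcomm_eq]
      refine LinearMap.ext fun b => ?_
      change X (f * b) - f * opParityPow k X b = X f * b
      rw [hX k f hf, add_sub_cancel_right]
    rw [hg hf, Finset.sum_congr rfl fun j _ => by
      rw [hg (φ.coord_mem j), show LinearMap.mulLeft ℂ (X (φ.coord j)) *
        LinearMap.mulLeft ℂ (φ.partialOp j f) = LinearMap.mulLeft ℂ (X (φ.coord j) *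
          φ.partialOp j f) from LinearMap.ext fun _ => (mul_assoc _ _ _).symm]]
    have : ∑ j, LinearMap.mulLeft ℂ (X (φ.coord j) * φ.partialOp j f)
        = LinearMap.mulLeft ℂ (X f) := by
      conv_rhs => rw [φ.eq_sum_partialOp hX, LinearMap.sum_apply]
      exact (map_sum (LinearMap.mul ℂ (Form F R)) _ _).symm
    rw [this, sub_self]; exact Submodule.zero_mem _
  | succ m ih =>
    rw [mem_diffOpLT_succ]
    intro i g hg
    have h1 := ih (mem_diffOpLT_succ.mp hD i g hg) hf
    have h2 : gcomm i g (∑ j, gcomm (cdeg n j) (φ.coord j) D *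
        LinearMap.mulLeft ℂ (φ.partialOp j f) - gcomm k f D)
        = sgn ((i : ℤ) * k) • (∑ j, gcomm (cdeg n j) (φ.coord j) (gcomm i g D) *
        LinearMap.mulLeft ℂ (φ.partialOp j f) - gcomm k f (gcomm i g D)) := by
      rw [map_sub, map_sum, gcomm_gcomm hg hf, smul_sub, Finset.smul_sum]
      refine congrArg (· - _) (Finset.sum_congr rfl fun j _ => ?_)
      rw [gcomm_mul, gcomm_mulLeft hg, mul_zero, zero_add, opParityPow_mulLeft,
        gcomm_gcomm hg (φ.coord_mem j), parityPow_of_mem _ ((φ.partialOp_mem_derDeg j).1 k f hf),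
        show ∀ (r : ℤ) (c : Form F R), LinearMap.mulLeft ℂ (r • c) = r • LinearMap.mulLeft ℂ c from
          fun r c => map_zsmul (LinearMap.mul ℂ (Form F R)) r c, smul_mul_assoc, mul_smul_comm, sgn_smul_smul]
      exact congrArg (· • _) (sgn_congr 0 (by ring))
    rw [h2]
    exact zsmul_mem h1 _

/-- Euler's formula for the symbol of a differential operator. -/
theorem nsmul_sub_sum_gcomm {m : ℕ} {D : FormEnd F R} (hD : D ∈ diffOpLT F (m + 1)) :
    m • D - ∑ j, gcomm (cdeg n j) (φ.coord j) D * φ.partialOp j ∈ diffOpLT F m := by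
  induction m generalizing D with
  | zero =>
    rw [zero_smul, zero_sub]
    refine Submodule.neg_mem _ (Submodule.sum_mem _ fun j _ => ?_)
    rw [show gcomm (cdeg n j) (φ.coord j) D = 0 from
      mem_diffOpLT_succ.mp hD _ _ (φ.coord_mem j), zero_mul]
    exact Submodule.zero_mem _
  | succ m ih =>
    rw [mem_diffOpLT_succ]
    intro i g hg
    have h1 := ih (mem_diffOpLT_succ.mp hD i g hg)
    have h2 := φ.sum_gcomm_mulLeft hD hg
    have h3 : gcomm i g ((m + 1) • D - ∑ j, gcomm (cdeg n j) (φ.coord j) D * φ.partialOp j)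
        = (m • gcomm i g D - ∑ j, gcomm (cdeg n j) (φ.coord j) (gcomm i g D) * φ.partialOp j)
          - (∑ j, gcomm (cdeg n j) (φ.coord j) D * LinearMap.mulLeft ℂ (φ.partialOp j g)
            - gcomm i g D) := by
      have h4 : ∀ j, gcomm i g (gcomm (cdeg n j) (φ.coord j) D * φ.partialOp j)
          = gcomm (cdeg n j) (φ.coord j) D * LinearMap.mulLeft ℂ (φ.partialOp j g)
            + gcomm (cdeg n j) (φ.coord j) (gcomm i g D) * φ.partialOp j := by
        intro j
        have h5 : gcomm i g (φ.partialOp j) = LinearMap.mulLeft ℂ (φ.partialOp j g) := by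
          rw [gcomm_eq]
          refine LinearMap.ext fun b => ?_
          change φ.partialOp j (g * b) - g * opParityPow i (φ.partialOp j) b = φ.partialOp j g * b
          have h6 := φ.isGrDer (φ.partialVF j) i g hg b
          change φ.partialOp j (g * b) = φ.partialOp j g * b + g * opParityPow i (φ.partialOp j) b
            at h6
          rw [h6, add_sub_cancel_right]
        rw [gcomm_mul, h5, gcomm_gcomm hg (φ.coord_mem j),
          φ.opParityPow_of_hasDegree (φ.partialOp_mem_derDeg j).1, smul_mul_assoc, mul_smul_comm,
          sgn_smul_smul, show sgn ((i : ℤ) * (cdeg n j : ℕ) + -(cdeg n j : ℤ) * i) = 1 by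
            rw [← sgn_zero]; congr 1; ring, one_smul]
      rw [map_sub, map_nsmul, map_sum, Finset.sum_congr rfl fun j _ => h4 j,
        Finset.sum_add_distrib, succ_nsmul]
      abel
    rw [h3]
    exact Submodule.sub_mem _ h1 h2

end Frame

/-- The graded commutator of homogeneous vector fields. -/
theorem Frame.commutator_mem (φ : Frame F B n) {d e : ℤ} {X Y : FormEnd F R}
    (hX : X ∈ derDeg F d) (hY : Y ∈ derDeg F e) : X * Y - sgn (d * e) • (Y * X) ∈ derDeg F (d + e) := by
  have hdeg : HasDegree (d + e) (X * Y - sgn (d * e) • (Y * X)) :=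
    HasDegree.sub (HasDegree.mul hX.1 hY.1) (HasDegree.zsmul (add_comm e d ▸
      HasDegree.mul hY.1 hX.1) _)
  refine φ.mem_derDeg hdeg fun k a ha b => ?_
  rw [φ.opParityPow_of_hasDegree hdeg]
  have h : ∀ {d e : ℤ} {X Y : FormEnd F R}, X ∈ derDeg F d → Y ∈ derDeg F e →
      (X * Y) (a * b) = X (Y a) * b + sgn (d * (e + k)) • (Y a * X b)
        + sgn (e * k) • (X a * Y b) + sgn ((d + e) * k) • (a * X (Y b)) := by
    intro d e X Y hX hY
    rw [Module.End.mul_apply, hY.2, parityPow_of_mem e ha, smul_mul_assoc, map_add, map_zsmul,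
      hX.2, hX.2, parityPow_of_mem d (hY.1 k a ha), parityPow_of_mem d ha, smul_mul_assoc,
      smul_mul_assoc, smul_add, sgn_smul_smul, show e * k + d * k = (d + e) * k by ring]
    abel
  rw [LinearMap.sub_apply, LinearMap.smul_apply, h hX hY, h hY hX]
  simp only [LinearMap.sub_apply, LinearMap.smul_apply, Module.End.mul_apply, sub_mul, smul_add,
    smul_mul_assoc, mul_smul_comm, mul_sub, smul_sub, sgn_smul_smul]
  rw [show sgn (d * e + e * (d + k)) = sgn (e * k) from sgn_congr (d * e) (by ring),
    show sgn (d * e + d * k) = sgn (d * (e + k)) from sgn_congr 0 (by ring),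
    show sgn (d * e + (e + d) * k) = sgn ((d + e) * k + d * e) from sgn_congr 0 (by ring)]
  abel

namespace Frame

/-- Composition with vector fields agrees with the symmetric product up to lower order. -/
theorem vf_mul_pbwProd_sub_mem (y : Homog (vfDeg F)) (t : List (Homog (vfDeg F))) :
    (y.val : FormEnd F R) * φ.pbwProd C t - φ.pbwProd C (y :: t)
      ∈ φ.opLT C (t.length + 1) := by
  induction hm : t.length using Nat.strong_induction_on generalizing y t with
  | _ m ih =>
  subst hm
  have hmul : ∀ (y : Homog (vfDeg F)) {i : ℕ}, i ≤ t.length → ∀ {D : FormEnd F R},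
      D ∈ φ.opLT C i → (y.val : FormEnd F R) * D ∈ φ.opLT C (i + 1) := by
    rintro y i hi _ ⟨s, hs, rfl⟩
    induction hs using Submodule.span_induction with
    | mem s hs =>
      obtain ⟨b, l, hl, rfl⟩ := hs
      have h1 : (y.val : FormEnd F R) * φ.pbwProd C l ∈ φ.opLT C (i + 1) := by
        have := Submodule.add_mem _ (φ.opLT_mono C (by omega)
          (ih l.length (by omega) y l rfl)) (φ.pbwProd_mem_opLT C (l := y :: l) (m := i + 1)
            (by simpa using hl))
        rwa [sub_add_cancel] at this
      have h2 : (y.val : FormEnd F R) * LinearMap.mulLeft ℂ b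
          = LinearMap.mulLeft ℂ ((y.val : FormEnd F R) b)
            + LinearMap.mulLeft ℂ (parityPow F y.deg b) * y.val :=
        LinearMap.ext fun c => vf_mul y.val_mem b c
      rw [pbw_ofFun_mul, ← mul_assoc, h2, add_mul, mul_assoc]
      exact Submodule.add_mem _ (φ.mulLeft_mul_mem_opLT C _ (φ.pbwProd_mem_opLT C (by omega)))
        (φ.mulLeft_mul_mem_opLT C _ h1)
    | zero => rw [map_zero, mul_zero]; exact Submodule.zero_mem _
    | add s t _ _ hs ht => rw [map_add, mul_add]; exact Submodule.add_mem _ hs ht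
    | smul c s _ hs => rw [map_smul, mul_smul_comm]; exact Submodule.smul_mem _ c hs
  have hsymm : ∀ (l₁ : List (Homog (vfDeg F))) (z : Homog (vfDeg F)) (l₂ : List (Homog (vfDeg F))),
      φ.pbwProd C (l₁ ++ z :: l₂)
        = sgn (z.deg * (l₁.map Homog.deg).sum) • φ.pbwProd C (z :: (l₁ ++ l₂)) := by
    intro l₁ z l₂
    have : symProd (l₁ ++ z :: l₂)
        = sgn (z.deg * (l₁.map Homog.deg).sum) • symProd (z :: (l₁ ++ l₂)) := by
      induction l₁ with
      | nil => simp [sgn_zero]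
      | cons x l₁ ih =>
        have h2 := symProd_swap [] x z (l₁ ++ l₂)
        simp only [List.nil_append] at h2
        rw [List.cons_append, symProd_cons, ih, mul_smul_comm, ← symProd_cons, h2, sgn_smul_smul]
        exact congrArg (· • _) (sgn_congr 0 (by simp only [List.map_cons, List.sum_cons]; ring))
    rw [pbwProd, this, map_zsmul]; rfl
  have hswap : ∀ l₁ (z : Homog (vfDeg F)) l₂, t = l₁ ++ z :: l₂ →
      (z.val : FormEnd F R) * φ.pbwProd C (y :: (l₁ ++ l₂))
        - sgn (z.deg * (y.deg + (l₁.map Homog.deg).sum)) •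
          ((y.val : FormEnd F R) * φ.pbwProd C t) ∈ φ.opLT C (t.length + 1) := by
    intro l₁ z l₂ ht
    have hlen : (l₁ ++ l₂).length + 1 = t.length := by rw [ht]; simp; omega
    have h1 := hmul z (i := (l₁ ++ l₂).length + 1) (by omega)
      (ih (l₁ ++ l₂).length (by omega) y _ rfl)
    have h2 := hmul y (i := (l₁ ++ l₂).length + 1) (by omega)
      (ih (l₁ ++ l₂).length (by omega) z _ rfl)
    have h3 : ((z.val : FormEnd F R) * y.val
        - sgn (z.deg * y.deg) • ((y.val : FormEnd F R) * z.val)) *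
          φ.pbwProd C (l₁ ++ l₂) ∈ φ.opLT C (t.length + 1) := by
      have hc := φ.commutator_mem z.val_mem y.val_mem
      have hV : (⟨_, Submodule.subset_span ⟨_, hc⟩⟩ : VF F) ∈ vfDeg F (z.deg + y.deg) := hc
      have := Submodule.add_mem _ (φ.opLT_mono C (by omega : _ ≤ t.length + 1)
        (ih (l₁ ++ l₂).length (by omega) (Homog.mk hV) _ rfl))
        (φ.pbwProd_mem_opLT C (l := Homog.mk hV :: (l₁ ++ l₂)) (m := t.length + 1)
          (by rw [List.length_cons]; omega))
      rwa [sub_add_cancel] at this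
    rw [hlen] at h1 h2
    have h4 := Submodule.sub_mem _ (Submodule.add_mem _ h3 (zsmul_mem h2 (sgn (z.deg * y.deg)))) h1
    rw [ht, hsymm, mul_smul_comm, sgn_smul_smul, ← ht,
      show sgn (z.deg * (y.deg + (l₁.map Homog.deg).sum) + z.deg * (l₁.map Homog.deg).sum)
        = sgn (z.deg * y.deg) from sgn_congr (z.deg * (l₁.map Homog.deg).sum) (by ring)]
    convert h4 using 1
    simp only [sub_mul, mul_sub, smul_sub, smul_mul_assoc, mul_assoc]
    abel
  have hrec := φ.pbwProd_recursion C (y :: t)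
  have hG : ∀ l₁ (z : Homog (vfDeg F)) l₂, y :: t = l₁ ++ z :: l₂ →
      ((z.val : FormEnd F R) * φ.pbwProd C (l₁ ++ l₂)
        - derSum Homog.deg z.deg (C.homNabla z) (l₁ ++ l₂) (φ.pbwProd C))
        - sgn (z.deg * (l₁.map Homog.deg).sum) • ((y.val : FormEnd F R) *
          φ.pbwProd C t) ∈ φ.opLT C (t.length + 1) := by
    intro l₁ z l₂ hl
    have hlen : (l₁ ++ l₂).length = t.length := by
      have := congrArg List.length hl; simp at this; simp; omega
    have hder : derSum Homog.deg z.deg (C.homNabla z) (l₁ ++ l₂) (φ.pbwProd C)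
        ∈ φ.opLT C (t.length + 1) :=
      derSum_mem (H := (φ.opLT C (t.length + 1)).toAddSubgroup) (C.homNabla_deg z)
        fun t' ht' _ => φ.pbwProd_mem_opLT C (by omega)
    rw [sub_right_comm]
    refine Submodule.sub_mem _ ?_ hder
    cases l₁ with
    | nil =>
      obtain ⟨rfl, rfl⟩ := List.cons.inj hl
      simp [sgn_zero]
    | cons x l₁ =>
      obtain ⟨rfl, ht⟩ := List.cons.inj hl
      exact hswap l₁ z l₂ ht
  have hq := congrArg ((φ.opLT C (t.length + 1)).mkQ) hrec
  rw [map_pickSum, pickSum_const (w := (φ.opLT C (t.length + 1)).mkQ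
    ((y.val : FormEnd F R) * φ.pbwProd C t)) _ fun l₁ z l₂ hl => by
      rw [← map_zsmul]
      exact (Submodule.Quotient.eq _).mpr (hG l₁ z l₂ hl), ← map_nsmul] at hq
  have := (Submodule.Quotient.eq _).mp hq.symm
  rw [← smul_sub] at this
  exact mem_of_nsmul_mem (by simp) this

theorem vf_mul_mem_opLT (y : Homog (vfDeg F)) {m : ℕ} {D : FormEnd F R}
    (hD : D ∈ φ.opLT C m) : (y.val : FormEnd F R) * D ∈ φ.opLT C (m + 1) := by
  obtain ⟨s, hs, rfl⟩ := hD
  induction hs using Submodule.span_induction with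
  | mem s hs =>
    obtain ⟨b, l, hl, rfl⟩ := hs
    have h1 : (y.val : FormEnd F R) * φ.pbwProd C l ∈ φ.opLT C (m + 1) := by
      have := Submodule.add_mem _ (φ.opLT_mono C (by omega : l.length + 1 ≤ m + 1)
        (φ.vf_mul_pbwProd_sub_mem C y l)) (φ.pbwProd_mem_opLT C (l := y :: l) (m := m + 1)
          (by simpa using hl))
      rwa [sub_add_cancel] at this
    have h2 : (y.val : FormEnd F R) * LinearMap.mulLeft ℂ b
        = LinearMap.mulLeft ℂ ((y.val : FormEnd F R) b)
          + LinearMap.mulLeft ℂ (parityPow F y.deg b) * y.val :=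
      LinearMap.ext fun c => vf_mul y.val_mem b c
    rw [pbw_ofFun_mul, ← mul_assoc, h2, add_mul, mul_assoc]
    exact Submodule.add_mem _ (φ.mulLeft_mul_mem_opLT C _ (φ.pbwProd_mem_opLT C (by omega)))
      (φ.mulLeft_mul_mem_opLT C _ h1)
  | zero => rw [map_zero, mul_zero]; exact Submodule.zero_mem _
  | add s t _ _ hs ht => rw [map_add, mul_add]; exact Submodule.add_mem _ hs ht
  | smul c s _ hs => rw [map_smul, mul_smul_comm]; exact Submodule.smul_mem _ c hs

/-- Compositions of vector fields. -/
theorem comp_mem_opLT (l : List (Homog (vfDeg F))) :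
    (l.map fun X => (X.val : FormEnd F R)).prod ∈ φ.opLT C (l.length + 1) := by
  induction l with
  | nil => rw [List.map_nil, List.prod_nil, ← φ.pbwProd_nil C]; exact φ.pbwProd_mem_opLT C (by simp)
  | cons X l ih => rw [List.map_cons, List.prod_cons]; exact φ.vf_mul_mem_opLT C X ih

variable (F) in
/-- The span of the compositions of less than `m` vector fields. -/
def _root_.KapranovDolbeault.compLT (m : ℕ) : Submodule ℂ (FormEnd F R) :=
  Submodule.span ℂ {D | ∃ (a : Form F R) (l : List (Homog (vfDeg F))), l.length < m ∧
    D = LinearMap.mulLeft ℂ a * (l.map fun X => (X.val : FormEnd F R)).prod}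

include φ in
theorem le_compLT (m : ℕ) : diffOpLT F m ≤ compLT F m := by
  induction m with
  | zero => exact bot_le
  | succ m ih =>
    intro D hD
    rcases Nat.eq_zero_or_pos m with rfl | hm
    · rw [φ.eq_mulLeft_of_mem hD]
      exact Submodule.subset_span ⟨D 1, [], by simp, by simp⟩
    · refine mem_of_nsmul_mem hm.ne' ?_
      have h1 := φ.nsmul_sub_sum_gcomm hD
      have hmono : compLT F m ≤ compLT F (m + 1) :=
        Submodule.span_mono fun D ⟨a, l, hl, h⟩ => ⟨a, l, by omega, h⟩
      have h2 : ∑ j, gcomm (cdeg n j) (φ.coord j) D * φ.partialOp j ∈ compLT F (m + 1) := by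
        refine Submodule.sum_mem _ fun j _ => ?_
        have h3 := ih (mem_diffOpLT_succ.mp hD _ _ (φ.coord_mem j))
        generalize gcomm (cdeg n j) (φ.coord j) D = E at h3
        induction h3 using Submodule.span_induction with
        | mem E hE =>
          obtain ⟨a, l, hl, rfl⟩ := hE
          refine Submodule.subset_span ⟨a, l ++ [Homog.mk (φ.partialVF_mem j)], by simpa using hl, ?_⟩
          rw [List.map_append, List.prod_append, mul_assoc, List.map_singleton, List.prod_singleton]
          rfl
        | zero => rw [zero_mul]; exact Submodule.zero_mem _
        | add s t _ _ hs ht => rw [add_mul]; exact Submodule.add_mem _ hs ht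
        | smul c s _ hs => rw [smul_mul_assoc]; exact Submodule.smul_mem _ c hs
      have := Submodule.add_mem _ (hmono (ih h1)) h2
      rwa [sub_add_cancel] at this

theorem diffOpLT_eq (m : ℕ) : diffOpLT F m = φ.opLT C m := by
  refine le_antisymm ((φ.le_compLT m).trans (Submodule.span_le.mpr ?_)) (φ.opLT_le C m)
  rintro _ ⟨a, l, hl, rfl⟩
  exact φ.mulLeft_mul_mem_opLT C a (φ.opLT_mono C (by omega) (φ.comp_mem_opLT C l))

/-- The Poincaré–Birkhoff–Witt isomorphism. -/
def pbwEquiv : SymVF F ≃ₗ[ℂ] GrDiffOp F :=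
  LinearEquiv.ofBijective ((φ.pbw C).codRestrict (GrDiffOp F) fun s => by
      obtain ⟨m, hm⟩ := φ.exists_mem_symLT s
      exact mem_grDiffOp.mpr ⟨m, φ.opLT_le C m ⟨s, hm, rfl⟩⟩)
    ⟨fun s t h => φ.pbw_injective C (congrArg Subtype.val h), fun D => by
      obtain ⟨m, hm⟩ := mem_grDiffOp.mp D.2
      rw [φ.diffOpLT_eq C] at hm
      obtain ⟨s, _, hs⟩ := hm
      exact ⟨s, Subtype.ext hs⟩⟩

theorem pbwEquiv_val (s : SymVF F) :
    (φ.pbwEquiv C s : FormEnd F R) = φ.pbw C s := rfl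

theorem isPBW : IsPBW C (φ.pbwEquiv C) where
  one := φ.pbw_one C
  fun_mul a s := φ.pbw_ofFun_mul C a s
  recursion l := (φ.pbw_recursion C l).trans (sum_fin_eq_pickSum Homog.deg l fun y t =>
    (y.val : FormEnd F R) * φ.pbw C (symProd t) - φ.pbw C (C.nablaProd y t)).symm

end Frame

end Bijectivity

/-! ### The Kapranov `L∞[1]` algebra -/

section KapranovAlgebra

theorem multilinear_ev {V W 𝒜 : Type*} [AddCommGroup V] [Module ℂ V] [AddCommGroup W] [Module ℂ W]
    [Ring 𝒜] [Algebra ℂ 𝒜] (j : V →ₗ[ℂ] 𝒜) (L : 𝒜 →ₗ[ℂ] W) (l : List V) :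
    Brackets.ev (fun k => L.compMultilinearMap
      ((MultilinearMap.mkPiAlgebraFin ℂ k 𝒜).compLinearMap fun _ => j)) l = L (l.map j).prod := by
  change L (List.ofFn fun i => j (l.get i)).prod = _
  rw [show (fun i => j (l.get i)) = j ∘ l.get from rfl, ← List.map_ofFn, List.ofFn_get]

variable {R : Type*} [CommRing R] [Algebra ℂ R]
  {F : LieRinehartSubalgebra R (Derivation ℂ R R)}
  {B : Submodule R (Derivation ℂ R R)} {n : ℕ} (φ : Frame F B n) (C : AffineConnection F)

theorem kapranovBrackets_ev (p : SymVF F ≃ₗ[ℂ] GrDiffOp F) (l : List (VF F)) :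
    (kapranovBrackets p).ev l
      = SymVF.pr (kapranovDelta p (l.map (SymVF.ofVF (F := F))).prod) :=
  multilinear_ev (SymVF.ofVF (F := F)) (SymVF.pr (F := F) ∘ₗ kapranovDelta p) l

theorem kapranovBrackets_ev_val (p : SymVF F ≃ₗ[ℂ] GrDiffOp F) (l : List (Homog (vfDeg F))) :
    (kapranovBrackets p).ev (l.map Homog.val) = SymVF.pr (kapranovDelta p (symProd l)) := by
  rw [kapranovBrackets_ev, List.map_map]; rfl

theorem adQ_val (D : GrDiffOp F) : (adQ D : FormEnd F R)
    = dF F * (D : FormEnd F R) - opParity F D * dF F := rfl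

theorem adQ_adQ (D : GrDiffOp F) : adQ (adQ D) = 0 := by
  refine Subtype.ext ?_
  have h : dF F * dF F = 0 := LinearMap.ext dF_dF
  rw [adQ_val, adQ_val, map_sub, map_mul, map_mul, opParity_dF, opParity_opParity]
  simp only [mul_sub, sub_mul, neg_mul, mul_neg, ← mul_assoc, h, zero_mul]
  simp only [mul_assoc, h, mul_zero]
  simp

theorem kapranovDelta_kapranovDelta (p : SymVF F ≃ₗ[ℂ] GrDiffOp F) (s : SymVF F) :
    kapranovDelta p (kapranovDelta p s) = 0 := by
  simp [kapranovDelta, adQ_adQ]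

namespace Frame

include φ in
theorem vf_induction {p : VF F → Prop} (h0 : p 0) (hadd : ∀ X Y, p X → p Y → p (X + Y))
    (h : ∀ (d : ℤ), ∀ X ∈ vfDeg F d, p X) (X : VF F) : p X := by
  rw [φ.vf_eq_sum X]
  refine Finset.sum_induction _ p hadd h0 fun j _ => ?_
  refine φ.form_induction (p := fun a : Form F R => p (a • φ.partialVF j))
    (by
      rw [show (0 : Form F R) • φ.partialVF j = 0 from zero_smul (Form F R) (φ.partialVF j)]
      exact h0) (fun a b ha hb => by
      rw [show (a + b) • φ.partialVF j = a • φ.partialVF j + b • φ.partialVF j from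
        add_smul a b (φ.partialVF j)]
      exact hadd _ _ ha hb)
    (fun k a ha => h _ _ (smul_mem_vfDeg ha (φ.partialVF_mem j))) _

include φ in
theorem isInternal_vfDeg : DirectSum.IsInternal (vfDeg F) := by
  classical
  rw [DirectSum.isInternal_submodule_iff_iSupIndep_and_iSup_eq_top]
  constructor
  · rw [iSupIndep_def]
    intro d
    rw [Submodule.disjoint_def]
    intro X h1 h2
    refine Subtype.ext (φ.op_ext fun k a ha => Form.ext fun l => ?_)
    by_cases hl : (l.length : ℤ) = d + k
    · have : ∀ Y ∈ ⨆ j, ⨆ (_ : j ≠ d), vfDeg F j, (Y : FormEnd F R) a l = 0 := by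
        intro Y hY
        induction hY using Submodule.iSup_induction' with
        | mem j Y hY =>
          by_cases hj : j = d
          · simp [hj] at hY; rw [hY]; rfl
          · simp only [ne_eq, hj, not_false_eq_true, iSup_pos] at hY
            exact vf_apply_mem hY ha l (by rw [hl]; omega)
        | zero => rfl
        | add x y _ _ hx hy =>
          change (x : FormEnd F R) a l + (y : FormEnd F R) a l = 0
          rw [hx, hy, add_zero]
      exact this X h2
    · exact vf_apply_mem h1 ha l hl
  · rw [eq_top_iff]
    rintro X -
    exact φ.vf_induction (p := fun X => X ∈ ⨆ k, vfDeg F k) (Submodule.zero_mem _)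
      (fun a b => Submodule.add_mem _) (fun k a ha => Submodule.mem_iSup_of_mem (k : ℤ) ha) X

/-- The commutator of `Q` with the image of a product of vector fields. -/
def adProd (l : List (Homog (vfDeg F))) : FormEnd F R :=
  dF F * φ.pbwProd C l - sgn (l.map Homog.deg).sum • (φ.pbwProd C l * dF F)

theorem adQ_pbwEquiv (l : List (Homog (vfDeg F))) :
    (adQ (φ.pbwEquiv C (symProd l)) : FormEnd F R) = φ.adProd C l := by
  rw [adQ_val, pbwEquiv_val, show φ.pbw C (symProd l) = φ.pbwProd C l from rfl,
    opParity_eq_opParityPow, φ.opParityPow_of_hasDegree (φ.pbwProd_hasDegree C l), mul_one,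
    smul_mul_assoc]
  rfl

theorem adProd_hasDegree (l : List (Homog (vfDeg F))) :
    HasDegree (1 + (l.map Homog.deg).sum) (φ.adProd C l) := by
  refine HasDegree.sub (HasDegree.mul dF_hasDegree (φ.pbwProd_hasDegree C l)) (HasDegree.zsmul ?_ _)
  rw [add_comm]
  exact HasDegree.mul (φ.pbwProd_hasDegree C l) dF_hasDegree

theorem adProd_nil : φ.adProd C [] = 0 := by
  simp [adProd, pbwProd_nil, sgn_zero]

theorem adProd_mul {k : ℕ} {a : Form F R} (ha : a ∈ formDeg F R k) (b : Form F R)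
    (l : List (Homog (vfDeg F))) :
    φ.adProd C l (a * b) = unshuffleSum Homog.deg l fun S T =>
      sgn (k * (T.map Homog.deg).sum) • (φ.adProd C S a * φ.pbwProd C T b)
      + sgn (k * (1 + (T.map Homog.deg).sum) + (S.map Homog.deg).sum) •
        (φ.pbwProd C S a * φ.adProd C T b) := by
  have hd : dF F a ∈ formDeg F R (1 + (k : ℤ)) := dF_hasDegree k a ha
  simp only [adProd, LinearMap.sub_apply, Module.End.mul_apply, LinearMap.smul_apply, dF_mul,
    map_add, φ.pbwProd_mul C hd, φ.pbwProd_mul C ha, parity_of_mem ha, smul_mul_assoc, map_zsmul,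
    map_unshuffleSum, ← unshuffleSum_zsmul, ← unshuffleSum_add, ← unshuffleSum_sub]
  refine unshuffleSum_congr _ fun S T _ hST => ?_
  rw [parity_of_mem (φ.pbwProd_hasDegree C S k a ha), smul_mul_assoc, ← hST]
  simp only [sub_mul, mul_sub, smul_sub, smul_add, smul_mul_assoc, mul_smul_comm, sgn_smul_smul]
  rw [show sgn ((S.map Homog.deg).sum + (T.map Homog.deg).sum
        + (1 + (k : ℤ)) * (T.map Homog.deg).sum)
      = sgn (k * (T.map Homog.deg).sum + (S.map Homog.deg).sum) from
        sgn_congr (T.map Homog.deg).sum (by ring),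
    show sgn (k * (T.map Homog.deg).sum + ((S.map Homog.deg).sum + k))
      = sgn (k * (1 + (T.map Homog.deg).sum) + (S.map Homog.deg).sum) from
        sgn_congr 0 (by ring),
    show sgn ((S.map Homog.deg).sum + (T.map Homog.deg).sum + (k + k * (T.map Homog.deg).sum))
      = sgn (k * (1 + (T.map Homog.deg).sum) + (S.map Homog.deg).sum + (T.map Homog.deg).sum) from
        sgn_congr 0 (by ring)]
  abel

theorem kapranovBrackets_mem_and_adProd (l : List (Homog (vfDeg F))) :
    (kapranovBrackets (φ.pbwEquiv C)).ev (l.map Homog.val)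
        ∈ vfDeg F (1 + (l.map Homog.deg).sum) ∧
      φ.adProd C l = unshuffleSum Homog.deg l fun S T =>
        φ.pbw C (SymVF.ofVF (F := F) ((kapranovBrackets (φ.pbwEquiv C)).ev (S.map Homog.val)) *
          symProd T) := by
  classical
  set lam : List (Homog (vfDeg F)) → VF F := fun S =>
    (kapranovBrackets (φ.pbwEquiv C)).ev (S.map Homog.val) with hlam
  induction hN : l.length using Nat.strong_induction_on generalizing l with
  | _ N ih =>
  let lam' : List (Homog (vfDeg F)) → Homog (vfDeg F) := fun S =>
    if h : S.length < N then Homog.mk (ih S.length h S rfl).1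
    else Homog.mk (Submodule.zero_mem (vfDeg F (1 + (S.map Homog.deg).sum)))
  have hdeg : ∀ S, (lam' S).deg = 1 + (S.map Homog.deg).sum := fun S => by
    simp only [lam']; split_ifs <;> rfl
  have hlt : ∀ S, S.length < N → (lam' S).val = lam S := fun S h => by
    simp only [lam', dif_pos h]; rfl
  have hge : ∀ S, ¬ S.length < N → (lam' S).val = 0 := fun S h => by
    simp only [lam', dif_neg h]; rfl
  let M' : List (Homog (vfDeg F)) → FormEnd F R := fun l =>
    unshuffleSum Homog.deg l fun S T => φ.pbwProd C (lam' S :: T)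
  have hM' : ∀ S, S.length < N → φ.adProd C S = M' S := fun S h => by
    rw [(ih S.length h S rfl).2]
    refine unshuffleSum_congr _ fun S₁ S₂ hS _ => ?_
    rw [pbwProd, symProd_cons, hlt S₁ (by omega)]
  have hMdeg : HasDegree (1 + (l.map Homog.deg).sum) (M' l) := by
    refine unshuffleSum_mem (H := (degreeOps F (1 + (l.map Homog.deg).sum)).toAddSubgroup)
      fun S T _ hST => ?_
    have := φ.pbwProd_hasDegree C (lam' S :: T)
    rw [List.map_cons, List.sum_cons, hdeg, add_assoc, hST] at this
    exact this
  have hMmul : ∀ (k : ℕ), ∀ a ∈ formDeg F R k, ∀ b l, M' l (a * b)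
      = unshuffleSum Homog.deg l fun S T =>
        sgn (k * (T.map Homog.deg).sum) • (M' S a * φ.pbwProd C T b)
        + sgn (k * (1 + (T.map Homog.deg).sum) + (S.map Homog.deg).sum) •
          (φ.pbwProd C S a * M' T b) := by
    intro k a ha b l
    have hap : ∀ (c : Form F R) l, M' l c
        = unshuffleSum Homog.deg l fun S T => φ.pbwProd C (lam' S :: T) c := fun c l =>
      map_unshuffleSum _ (LinearMap.applyₗ (R := ℂ) c) l _
    simp only [hap]
    exact unshuffleSum_insert (κ := k) (p := fun l => φ.pbwProd C l a)
      (q := fun l => φ.pbwProd C l b) (r := fun l => φ.pbwProd C l (a * b)) (lam := lam') hdeg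
      (fun l => φ.pbwProd_mul C ha b l) l
  have hE : φ.adProd C l - M' l ∈ derDeg F (1 + (l.map Homog.deg).sum) := by
    have hEdeg := HasDegree.sub (φ.adProd_hasDegree C l) hMdeg
    refine φ.mem_derDeg hEdeg fun k a ha b => ?_
    rw [φ.opParityPow_of_hasDegree hEdeg]
    by_cases hl : l = []
    · subst hl
      have : φ.adProd C [] - M' [] = 0 := by
        have : M' [] = φ.pbw C (SymVF.ofVF (F := F) (lam' []).val * symProd []) := by
          rw [← symProd_cons]; rfl
        rw [adProd_nil, this, hge [] (by simp at hN; omega), map_zero, zero_mul, map_zero, sub_zero]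
      simp [this]
    rw [LinearMap.sub_apply, φ.adProd_mul C ha, hMmul k a ha, ← unshuffleSum_sub]
    have h1 : (unshuffleSum Homog.deg l fun S T => if T = [] then
        (φ.adProd C S - M' S) a * φ.pbwProd C T b else 0)
        = (φ.adProd C l - M' l) a * b := by
      rw [unshuffleSum_eq_left _ _ _ fun S T hT => if_neg hT, if_pos rfl, pbwProd_nil]; rfl
    have h2 : (unshuffleSum Homog.deg l fun S T => if S = [] then
        sgn (k * (1 + (T.map Homog.deg).sum)) • (φ.pbwProd C S a * (φ.adProd C T - M' T) b) else 0)
        = a * (sgn ((1 + (l.map Homog.deg).sum) * k) • (φ.adProd C l - M' l)) b := by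
      rw [unshuffleSum_eq_right _ _ _ fun S T hS => if_neg hS, if_pos rfl, pbwProd_nil,
        LinearMap.smul_apply, mul_smul_comm, mul_comm (k : ℤ)]; rfl
    rw [← h1, ← h2, ← unshuffleSum_add]
    refine unshuffleSum_congr _ fun S T hST _ => ?_
    rw [add_sub_add_comm, ← smul_sub, ← smul_sub, ← sub_mul, ← mul_sub, ← LinearMap.sub_apply,
      ← LinearMap.sub_apply]
    congr 1
    · split_ifs with hT
      · rw [hT]; simp [sgn_zero]
      · have := List.length_pos_iff.mpr hT
        rw [hM' S (by omega), sub_self, LinearMap.zero_apply, zero_mul, smul_zero]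
    · split_ifs with hS
      · rw [hS]; simp
      · have := List.length_pos_iff.mpr hS
        rw [hM' T (by omega), sub_self, LinearMap.zero_apply, mul_zero, smul_zero]
  set E : VF F := ⟨_, Submodule.subset_span ⟨_, hE⟩⟩ with hEdef
  have hEmem : E ∈ vfDeg F (1 + (l.map Homog.deg).sum) := hE
  have hEval : φ.pbw C (SymVF.ofVF (F := F) E) = φ.adProd C l - M' l := by
    have := φ.pbwProd_singleton C (Homog.mk hEmem)
    rw [pbwProd, symProd_cons, symProd_nil, mul_one] at this
    exact this
  have hdelta : kapranovDelta (φ.pbwEquiv C) (symProd l) = SymVF.ofVF (F := F) E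
      + unshuffleSum Homog.deg l fun S T => SymVF.ofVF (F := F) (lam' S).val * symProd T := by
    refine (φ.pbwEquiv C).symm_apply_eq.mpr (Subtype.ext ?_)
    change (adQ (φ.pbwEquiv C (symProd l)) : FormEnd F R) = φ.pbw C _
    rw [adQ_pbwEquiv, map_add, hEval, map_unshuffleSum]
    exact (sub_add_cancel _ _).symm
  have hlamE : lam l = E := by
    change (kapranovBrackets (φ.pbwEquiv C)).ev (l.map Homog.val) = E
    rw [kapranovBrackets_ev_val, hdelta, map_add, SymVF.pr_ofVF, map_unshuffleSum,
      unshuffleSum_eq_left, symProd_nil, mul_one, SymVF.pr_ofVF, hge l (by omega), add_zero]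
    intro S T hT
    obtain ⟨x, T, rfl⟩ := List.exists_cons_of_ne_nil hT
    rw [symProd_cons, SymVF.pr_mul_mul]
  refine ⟨show lam l ∈ _ by rw [hlamE]; exact hEmem, ?_⟩
  have h3 : (unshuffleSum Homog.deg l fun S T => if T = [] then
      φ.pbw C (SymVF.ofVF (F := F) (lam S)) - φ.pbw C (SymVF.ofVF (F := F) (lam' S).val) else 0)
      = φ.adProd C l - M' l := by
    rw [unshuffleSum_eq_left _ _ _ fun S T hT => if_neg hT, if_pos rfl, hlamE,
      hge l (by omega), map_zero, map_zero, sub_zero, hEval]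
  rw [← sub_add_cancel (φ.adProd C l) (M' l), ← h3, ← unshuffleSum_add]
  refine unshuffleSum_congr _ fun S T hST _ => ?_
  rw [pbwProd, symProd_cons]
  split_ifs with hT
  · rw [hT, symProd_nil, mul_one, mul_one, sub_add_cancel]
  · have := List.length_pos_iff.mpr hT
    rw [hlt S (by omega), zero_add]

/-- The Kapranov bracket of homogeneous vector fields, as a homogeneous vector field. -/
def bracket (l : List (Homog (vfDeg F))) : Homog (vfDeg F) :=
  Homog.mk (φ.kapranovBrackets_mem_and_adProd C l).1

theorem bracket_val (l : List (Homog (vfDeg F))) :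
    (φ.bracket C l).val = (kapranovBrackets (φ.pbwEquiv C)).ev (l.map Homog.val) := rfl

theorem adProd_eq (l : List (Homog (vfDeg F))) :
    φ.adProd C l = unshuffleSum Homog.deg l fun S T => φ.pbwProd C (φ.bracket C S :: T) :=
  (φ.kapranovBrackets_mem_and_adProd C l).2

theorem kapranovDelta_symProd (l : List (Homog (vfDeg F))) :
    kapranovDelta (φ.pbwEquiv C) (symProd l)
      = unshuffleSum Homog.deg l fun S T => symProd (φ.bracket C S :: T) := by
  refine (φ.pbwEquiv C).symm_apply_eq.mpr (Subtype.ext ?_)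
  change (adQ (φ.pbwEquiv C (symProd l)) : FormEnd F R) = φ.pbw C _
  rw [adQ_pbwEquiv, adProd_eq, map_unshuffleSum]
  rfl

theorem kapranovBrackets_zero : kapranovBrackets (φ.pbwEquiv C) 0 = 0 := by
  refine MultilinearMap.ext fun m => ?_
  have h := kapranovBrackets_ev (φ.pbwEquiv C) []
  have h2 := φ.adQ_pbwEquiv C []
  rw [adProd_nil, symProd_nil] at h2
  have h3 : kapranovDelta (φ.pbwEquiv C) 1 = 0 :=
    (φ.pbwEquiv C).symm_apply_eq.mpr ((Subtype.ext h2).trans (map_zero (φ.pbwEquiv C)).symm)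
  rw [List.map_nil, List.prod_nil, h3, map_zero] at h
  rw [zero_apply, ← h, Subsingleton.elim m ([] : List (VF F)).get]
  rfl

theorem bracket_nil_val : (φ.bracket C []).val = 0 := by
  rw [bracket_val, List.map_nil, Brackets.ev]
  exact congrArg (fun f => f (([] : List (VF F)).get)) (φ.kapranovBrackets_zero C)

theorem kapranovBrackets_one (V : VF F) :
    ((kapranovBrackets (φ.pbwEquiv C)).ev [V] : FormEnd F R)
      = dF F * (V : FormEnd F R) - opParity F V * dF F := by
  have hev : ∀ V : VF F, (kapranovBrackets (φ.pbwEquiv C)).ev [V]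
      = SymVF.pr (kapranovDelta (φ.pbwEquiv C) (SymVF.ofVF (F := F) V)) := fun V => by
    rw [kapranovBrackets_ev]; simp
  refine φ.vf_induction (p := fun V => ((kapranovBrackets (φ.pbwEquiv C)).ev [V] :
    FormEnd F R) = dF F * (V : FormEnd F R) - opParity F V * dF F)
    ?_ (fun X Y hX hY => ?_) (fun d X hX => ?_) V
  · simp [hev]
  · rw [hev] at hX hY ⊢
    simp only [map_add, Submodule.coe_add, hX, hY, mul_add, add_mul]; abel
  · have h1 := φ.adQ_pbwEquiv C [Homog.mk hX]
    have h2 := φ.adProd_eq C [Homog.mk hX]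
    simp only [unshuffleSum_cons, unshuffleSum_nil, List.map_nil, List.sum_nil, mul_zero, sgn_zero,
      one_smul] at h2
    rw [adQ_val, pbwEquiv_val, show φ.pbw C (symProd [Homog.mk hX])
      = φ.pbwProd C [Homog.mk hX] from rfl, pbwProd_singleton, h2, pbwProd_singleton, pbwProd,
      symProd_cons, bracket_nil_val, map_zero, zero_mul, map_zero, add_zero] at h1
    exact h1.symm

theorem isLInfty_kapranov : IsLInfty (vfDeg F) (kapranovBrackets (φ.pbwEquiv C)) where
  internal := φ.isInternal_vfDeg
  zero := φ.kapranovBrackets_zero C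
  degree l := (φ.kapranovBrackets_mem_and_adProd C l).1
  symm l₁ x y l₂ := by
    rw [kapranovBrackets_ev_val, kapranovBrackets_ev_val, symProd_swap, map_zsmul, map_zsmul]
  jacobi l := by
    have h1 := congrArg (SymVF.pr (F := F)) (kapranovDelta_kapranovDelta (φ.pbwEquiv C) (symProd l))
    rw [kapranovDelta_symProd, map_unshuffleSum, map_unshuffleSum, map_zero] at h1
    rw [← h1]
    refine unshuffleSum_congr' _ fun S T => ?_
    rw [← kapranovBrackets_ev_val]
    rfl

end Frame

end KapranovAlgebra

/-! ### Derivations of the symmetric algebra of the base -/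

section BaseSymmetric

variable {R : Type*} [CommRing R] [Algebra ℂ R]

/-- The algebra of dual numbers over `S`, as an algebra over `R` via a derivation `d` of `R`. -/
def TwistedDual (S : Type*) (_d : Derivation ℂ R R) : Type _ := TrivSqZeroExt S S

instance (S : Type*) [CommRing S] (d : Derivation ℂ R R) : CommRing (TwistedDual S d) :=
  inferInstanceAs (CommRing (TrivSqZeroExt S S))

/-- The ring homomorphism `r ↦ r + ε d(r)`. -/
def twistedDualHom (S : Type*) [CommRing S] [Algebra R S] (d : Derivation ℂ R R) :
    R →+* TrivSqZeroExt S S where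
  toFun r := (algebraMap R S r, algebraMap R S (d r))
  map_one' := TrivSqZeroExt.ext (map_one _) (by simp)
  map_mul' a b := TrivSqZeroExt.ext (map_mul _ _ _) (by
    change algebraMap R S (d (a * b)) = algebraMap R S a * algebraMap R S (d b)
      + algebraMap R S (d a) * algebraMap R S b
    rw [Derivation.leibniz, smul_eq_mul, smul_eq_mul, map_add, map_mul, map_mul, mul_comm (algebraMap R S b)])
  map_zero' := TrivSqZeroExt.ext (map_zero _) (by simp)
  map_add' a b := TrivSqZeroExt.ext (map_add _ _ _) (by
    change algebraMap R S (d (a + b)) = algebraMap R S (d a) + algebraMap R S (d b)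
    rw [map_add, map_add])

instance (S : Type*) [CommRing S] [Algebra R S] (d : Derivation ℂ R R) :
    Algebra R (TwistedDual S d) := (twistedDualHom S d).toAlgebra

variable {B : Submodule R (Derivation ℂ R R)}

/-- The data of a derivation of the symmetric algebra of `B`, on functions and on `B`. -/
structure BaseDer (B : Submodule R (Derivation ℂ R R)) where
  d : Derivation ℂ R R
  w : B → SymmetricAlgebra R B
  add : ∀ b c, w (b + c) = w b + w c
  smul : ∀ (f : R) b, w (f • b) = algebraMap R _ (d f) * SymmetricAlgebra.ι R B b
    + algebraMap R _ f * w b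

namespace BaseDer

variable (δ : BaseDer B)

/-- The homomorphism to the dual numbers whose second component is the derivation. -/
def dualHom : SymmetricAlgebra R B →ₐ[R] TwistedDual (SymmetricAlgebra R B) δ.d :=
  SymmetricAlgebra.lift
    { toFun := fun b => ((SymmetricAlgebra.ι R B b, δ.w b) : TrivSqZeroExt _ _)
      map_add' := fun b c => TrivSqZeroExt.ext (map_add _ _ _) (δ.add b c)
      map_smul' := fun f b => by
        refine TrivSqZeroExt.ext (((SymmetricAlgebra.ι R B).map_smul f b).trans
          (Algebra.smul_def _ _)) ?_
        change δ.w (f • b) = algebraMap R _ f * δ.w b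
          + algebraMap R _ (δ.d f) * SymmetricAlgebra.ι R B b
        rw [δ.smul, add_comm] }

theorem dualHom_ι (b : B) : δ.dualHom (SymmetricAlgebra.ι R B b)
    = ((SymmetricAlgebra.ι R B b, δ.w b) : TrivSqZeroExt _ _) :=
  SymmetricAlgebra.lift_ι_apply _ b

/-- The derivation of the symmetric algebra. -/
def toHom : SymmetricAlgebra R B →+ SymmetricAlgebra R B where
  toFun s := TrivSqZeroExt.snd (δ.dualHom s)
  map_zero' := by rw [map_zero]; rfl
  map_add' s t := by rw [map_add]; rfl

theorem fst_dualHom (s : SymmetricAlgebra R B) : TrivSqZeroExt.fst (δ.dualHom s) = s := by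
  induction s using SymmetricAlgebra.induction with
  | algebraMap r => rw [AlgHom.commutes]; rfl
  | ι b => rw [dualHom_ι]; rfl
  | mul s t hs ht =>
    rw [map_mul]
    exact (TrivSqZeroExt.fst_mul _ _).trans (by rw [hs, ht])
  | add s t hs ht =>
    rw [map_add]
    exact (TrivSqZeroExt.fst_add _ _).trans (by rw [hs, ht])

theorem toHom_algebraMap (r : R) :
    δ.toHom (algebraMap R _ r) = algebraMap R _ (δ.d r) := by
  change TrivSqZeroExt.snd (δ.dualHom (algebraMap R _ r)) = _
  rw [AlgHom.commutes]; rfl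

theorem toHom_ι (b : B) : δ.toHom (SymmetricAlgebra.ι R B b) = δ.w b := by
  change TrivSqZeroExt.snd (δ.dualHom _) = _
  rw [dualHom_ι]; rfl

theorem toHom_mul (s t : SymmetricAlgebra R B) :
    δ.toHom (s * t) = δ.toHom s * t + s * δ.toHom t := by
  change TrivSqZeroExt.snd (δ.dualHom (s * t)) = TrivSqZeroExt.snd (δ.dualHom s) * t
    + s * TrivSqZeroExt.snd (δ.dualHom t)
  rw [map_mul]
  refine (TrivSqZeroExt.snd_mul _ _).trans ?_
  rw [fst_dualHom, fst_dualHom, MulOpposite.smul_eq_mul_unop, smul_eq_mul, add_comm]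
  rfl

theorem toHom_one : δ.toHom 1 = 0 := by
  rw [← map_one (algebraMap R (SymmetricAlgebra R B)), toHom_algebraMap, Derivation.map_one_eq_zero,
    map_zero]

variable (B) in
/-- Contraction with the differential of a function. -/
def contraction (f : R) : BaseDer B where
  d := 0
  w b := algebraMap R _ ((b : Derivation ℂ R R) f)
  add b c := by rw [← map_add]; rfl
  smul g b := by
    rw [← map_mul, Derivation.zero_apply, map_zero, zero_mul, zero_add]; rfl

/-- The covariant derivative. -/
def covariant (C : BaseConnection B) (c : B) : BaseDer B where
  d := c
  w b := SymmetricAlgebra.ι R B (C.nabla c b)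
  add b b' := by rw [C.add_right, map_add]
  smul f b := by
    rw [C.leibniz, map_add, map_smul, map_smul, Algebra.smul_def, Algebra.smul_def]

end BaseDer

theorem baseProd_nil : baseProd ([] : List B) = 1 := rfl

theorem baseProd_cons (b : B) (l : List B) :
    baseProd (b :: l) = SymmetricAlgebra.ι R B b * baseProd l := List.prod_cons

theorem baseProd_append (l l' : List B) : baseProd (l ++ l') = baseProd l * baseProd l' := by
  rw [baseProd, List.map_append, List.prod_append]; rfl

theorem baseProd_insert (l₁ : List B) (b : B) (l₂ : List B) :
    baseProd (l₁ ++ b :: l₂) = baseProd (b :: (l₁ ++ l₂)) := by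
  rw [baseProd_append, baseProd_cons, baseProd_cons, baseProd_append, mul_left_comm]

variable (B) in
/-- The span of the products of less than `m` factors. -/
def baseLT (m : ℕ) : Submodule R (SymmetricAlgebra R B) :=
  Submodule.span R {s | ∃ l : List B, l.length < m ∧ s = baseProd l}

theorem baseProd_mem {m : ℕ} {l : List B} (hl : l.length < m) : baseProd l ∈ baseLT B m :=
  Submodule.subset_span ⟨l, hl, rfl⟩

theorem baseLT_mono {m m' : ℕ} (h : m ≤ m') : baseLT B m ≤ baseLT B m' :=
  Submodule.span_mono fun _ ⟨l, hl, hs⟩ => ⟨l, hl.trans_le h, hs⟩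

theorem baseLT_zero : baseLT B 0 = ⊥ :=
  Submodule.span_eq_bot.mpr fun _ ⟨_, hl, _⟩ => absurd hl (Nat.not_lt_zero _)

theorem baseLT_mul {m m' : ℕ} {s t : SymmetricAlgebra R B} (hs : s ∈ baseLT B (m + 1))
    (ht : t ∈ baseLT B (m' + 1)) : s * t ∈ baseLT B (m + m' + 1) := by
  have := Submodule.mul_mem_mul hs ht
  rw [baseLT, baseLT, Submodule.span_mul_span] at this
  refine Submodule.span_mono ?_ this
  rintro _ ⟨_, ⟨l, hl, rfl⟩, _, ⟨l', hl', rfl⟩, rfl⟩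
  exact ⟨l ++ l', by rw [List.length_append]; omega, (baseProd_append l l').symm⟩

theorem exists_mem_baseLT (s : SymmetricAlgebra R B) : ∃ m, s ∈ baseLT B (m + 1) := by
  induction s using SymmetricAlgebra.induction with
  | algebraMap r =>
    refine ⟨0, ?_⟩
    rw [Algebra.algebraMap_eq_smul_one]
    exact Submodule.smul_mem _ _ (baseProd_mem (l := []) (by simp))
  | ι b =>
    refine ⟨1, ?_⟩
    have := baseProd_mem (m := 2) (l := [b]) (by simp)
    rwa [baseProd_cons, baseProd_nil, mul_one] at this
  | mul s t hs ht =>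
    obtain ⟨m, hm⟩ := hs
    obtain ⟨m', hm'⟩ := ht
    exact ⟨m + m', baseLT_mul hm hm'⟩
  | add s t hs ht =>
    obtain ⟨m, hm⟩ := hs
    obtain ⟨m', hm'⟩ := ht
    exact ⟨max m m', Submodule.add_mem _ (baseLT_mono (by omega) hm) (baseLT_mono (by omega) hm')⟩

theorem base_span_induction {p : SymmetricAlgebra R B → Prop} (h0 : p 0)
    (hadd : ∀ s t, p s → p t → p (s + t)) (h : ∀ (f : R) l, p (f • baseProd l))
    (s : SymmetricAlgebra R B) : p s := by
  obtain ⟨m, hm⟩ := exists_mem_baseLT s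
  suffices ∀ f : R, p (f • s) by simpa using this 1
  induction hm using Submodule.span_induction with
  | mem s hs => obtain ⟨l, _, rfl⟩ := hs; exact fun f => h f l
  | zero => intro f; rwa [smul_zero]
  | add s t _ _ hs ht => intro f; rw [smul_add]; exact hadd _ _ (hs f) (ht f)
  | smul g s _ hs => intro f; rw [smul_smul]; exact hs _

variable (B) in
/-- Contraction with the differential of a function, on the symmetric algebra. -/
def baseJac (f : R) : SymmetricAlgebra R B →ₗ[R] SymmetricAlgebra R B where
  toFun := (BaseDer.contraction B f).toHom
  map_add' := map_add _
  map_smul' g s := by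
    have : (BaseDer.contraction B f).d g = 0 := rfl
    rw [RingHom.id_apply, Algebra.smul_def, BaseDer.toHom_mul, BaseDer.toHom_algebraMap, this,
      map_zero, zero_mul, zero_add, Algebra.smul_def]

theorem baseJac_one (f : R) : baseJac B f 1 = 0 := (BaseDer.contraction B f).toHom_one

theorem baseJac_ι_mul (f : R) (b : B) (s : SymmetricAlgebra R B) :
    baseJac B f (SymmetricAlgebra.ι R B b * s)
      = (b : Derivation ℂ R R) f • s + SymmetricAlgebra.ι R B b * baseJac B f s := by
  refine ((BaseDer.contraction B f).toHom_mul _ _).trans ?_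
  rw [BaseDer.toHom_ι, Algebra.smul_def]; rfl

theorem baseJac_baseProd (f : R) (l : List B) :
    baseJac B f (baseProd l) = pickSum (fun _ => 0) l fun y t =>
      (y : Derivation ℂ R R) f • baseProd t := by
  induction l with
  | nil => exact baseJac_one f
  | cons b l ih =>
    rw [baseProd_cons, baseJac_ι_mul, pickSum_cons, ih, mul_pickSum]
    refine congrArg _ (pickSum_congr _ fun y t _ _ => ?_)
    rw [mul_zero, sgn_zero, one_smul, baseProd_cons, mul_smul_comm]

theorem baseJac_mem {m : ℕ} (f : R) {s : SymmetricAlgebra R B} (hs : s ∈ baseLT B (m + 1)) :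
    baseJac B f s ∈ baseLT B m := by
  induction hs using Submodule.span_induction with
  | mem s hs =>
    obtain ⟨l, hl, rfl⟩ := hs
    rw [baseJac_baseProd]
    exact pickSum_mem (H := (baseLT B m).toAddSubgroup) fun y t ht _ =>
      Submodule.smul_mem _ _ (baseProd_mem (by omega))
  | zero => rw [map_zero]; exact Submodule.zero_mem _
  | add s t _ _ hs ht => rw [map_add]; exact Submodule.add_mem _ hs ht
  | smul g s _ hs => rw [map_smul]; exact Submodule.smul_mem _ g hs

theorem BaseConnection.nablaProd_eq (C : BaseConnection B) (X : B) (l : List B) :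
    C.nablaProd X l = derSum (fun _ => 0) 0 (C.nabla X) l baseProd := by
  induction l with
  | nil => rfl
  | cons Y l ih =>
    rw [BaseConnection.nablaProd, derSum_cons, ih, mul_derSum, mul_zero, sgn_zero, one_smul]
    rfl

theorem BaseConnection.nablaProd_eq_toHom (C : BaseConnection B) (X : B) (l : List B) :
    C.nablaProd X l = (BaseDer.covariant C X).toHom (baseProd l) := by
  induction l with
  | nil => exact (BaseDer.toHom_one _).symm
  | cons Y l ih =>
    rw [BaseConnection.nablaProd, baseProd_cons, BaseDer.toHom_mul, BaseDer.toHom_ι, ih]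
    rfl

theorem BaseConnection.nablaProd_add (C : BaseConnection B) (X Y : B) (l : List B) :
    C.nablaProd (X + Y) l = C.nablaProd X l + C.nablaProd Y l := by
  induction l with
  | nil => exact (add_zero _).symm
  | cons Z l ih =>
    simp only [BaseConnection.nablaProd, ih, C.add_left, map_add, add_mul, mul_add]; abel

theorem BaseConnection.nablaProd_smul (C : BaseConnection B) (f : R) (X : B) (l : List B) :
    C.nablaProd (f • X) l = f • C.nablaProd X l := by
  induction l with
  | nil => exact (smul_zero _).symm
  | cons Z l ih =>
    simp only [BaseConnection.nablaProd, ih, C.smul_left, map_smul, smul_mul_assoc, mul_smul_comm,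
      smul_add]

/-- The covariant derivative as a linear function of its direction. -/
def BaseConnection.nablaLin (C : BaseConnection B) (l : List B) : B →ₗ[R] SymmetricAlgebra R B where
  toFun X := C.nablaProd X l
  map_add' X Y := C.nablaProd_add X Y l
  map_smul' f X := C.nablaProd_smul f X l

variable (B) in
/-- The grading of the symmetric algebra. -/
def baseGrade : SymmetricAlgebra R B →ₐ[R] Polynomial (SymmetricAlgebra R B) :=
  SymmetricAlgebra.lift
    ((Polynomial.monomial 1).restrictScalars R ∘ₗ SymmetricAlgebra.ι R B)

theorem baseGrade_baseProd (l : List B) :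
    baseGrade B (baseProd l) = Polynomial.monomial l.length (baseProd l) := by
  induction l with
  | nil => exact map_one _
  | cons b l ih =>
    have : baseGrade B (SymmetricAlgebra.ι R B b)
        = Polynomial.monomial 1 (SymmetricAlgebra.ι R B b) := SymmetricAlgebra.lift_ι_apply _ b
    rw [baseProd_cons, map_mul, ih, this, Polynomial.monomial_mul_monomial, List.length_cons,
      add_comm]

theorem baseGrade_smul {s : SymmetricAlgebra R B} {m : ℕ}
    (h : baseGrade B s = Polynomial.monomial m s) (f : R) :
    baseGrade B (f • s) = Polynomial.monomial m (f • s) := by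
  rw [map_smul, h, Polynomial.smul_monomial]

theorem baseGrade_nablaProd (C : BaseConnection B) (X : B) (l : List B) :
    baseGrade B (C.nablaProd X l) = Polynomial.monomial l.length (C.nablaProd X l) := by
  rw [C.nablaProd_eq, map_derSum, map_derSum]
  exact derSum_congr (deg := fun _ => 0) (D := C.nabla X) (fun _ => (add_zero _).symm)
    fun t ht _ => by rw [baseGrade_baseProd, ht]

end BaseSymmetric

/-! ### The Poincaré–Birkhoff–Witt map of the base -/

section BasePBW

variable {R : Type*} [CommRing R] [Algebra ℂ R]
  {F : LieRinehartSubalgebra R (Derivation ℂ R R)}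
  {B : Submodule R (Derivation ℂ R R)} {n : ℕ} (φ : Frame F B n) (C : BaseConnection B)

namespace Frame

/-- The Poincaré–Birkhoff–Witt map on the symmetric powers. -/
def baseAux : ℕ → SymmetricAlgebra R B →+ Module.End ℂ R
  | 0 => (LinearMap.toAddMonoidHom (LinearMap.mul ℂ R)).comp
      (SymmetricAlgebra.algebraMapInv : SymmetricAlgebra R B →ₐ[R] R).toRingHom.toAddMonoidHom
  | m + 1 => (DistribSMul.toAddMonoidHom _ (((m + 1 : ℕ) : ℂ)⁻¹)).comp (∑ i,
      ((AddMonoidHom.mulLeft (((φ.b i : Derivation ℂ R R) : R →ₗ[ℂ] R) : Module.End ℂ R)).comp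
          (baseAux m)
        - (baseAux m).comp (BaseDer.covariant C (φ.b i)).toHom).comp
          (baseJac B (φ.x i)).toAddMonoidHom)

theorem baseAux_succ (m : ℕ) (s : SymmetricAlgebra R B) :
    (m + 1) • φ.baseAux C (m + 1) s = ∑ i,
      ((((φ.b i : Derivation ℂ R R) : R →ₗ[ℂ] R) : Module.End ℂ R) *
          φ.baseAux C m (baseJac B (φ.x i) s)
        - φ.baseAux C m ((BaseDer.covariant C (φ.b i)).toHom (baseJac B (φ.x i) s))) := by
  rw [baseAux, AddMonoidHom.comp_apply, DistribSMul.toAddMonoidHom_apply,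
    ← Nat.cast_smul_eq_nsmul ℂ, smul_smul,
    mul_inv_cancel₀ (Nat.cast_ne_zero.mpr m.succ_ne_zero), one_smul, AddMonoidHom.finsetSum_apply]
  rfl

theorem base_step_smul {q : SymmetricAlgebra R B →+ Module.End ℂ R}
    (hq : ∀ (f : R) s, q (f • s) = f • q s) (c : B) (f : R) (s : SymmetricAlgebra R B) :
    (((c : Derivation ℂ R R) : R →ₗ[ℂ] R) : Module.End ℂ R) * q (f • s)
        - q ((BaseDer.covariant C c).toHom (f • s))
      = f • ((((c : Derivation ℂ R R) : R →ₗ[ℂ] R) : Module.End ℂ R) * q s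
        - q ((BaseDer.covariant C c).toHom s)) := by
  have h1 : (BaseDer.covariant C c).toHom (f • s)
      = (c : Derivation ℂ R R) f • s + f • (BaseDer.covariant C c).toHom s := by
    rw [Algebra.smul_def, BaseDer.toHom_mul, BaseDer.toHom_algebraMap, Algebra.smul_def,
      Algebra.smul_def]
    rfl
  rw [h1, map_add, hq, hq, hq]
  refine LinearMap.ext fun g => ?_
  change (c : Derivation ℂ R R) (f * q s g) - ((c : Derivation ℂ R R) f * q s g
    + f * q ((BaseDer.covariant C c).toHom s) g) = f * ((c : Derivation ℂ R R) (q s g)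
    - q ((BaseDer.covariant C c).toHom s) g)
  rw [Derivation.leibniz, smul_eq_mul, smul_eq_mul]
  ring

theorem baseAux_smul (m : ℕ) (f : R) (s : SymmetricAlgebra R B) :
    φ.baseAux C m (f • s) = f • φ.baseAux C m s := by
  induction m generalizing f s with
  | zero =>
    refine LinearMap.ext fun g => ?_
    change SymmetricAlgebra.algebraMapInv (f • s) * g = f * (SymmetricAlgebra.algebraMapInv s * g)
    rw [map_smul, smul_eq_mul, mul_assoc]
  | succ m ih =>
    refine smul_right_injective (R := ℂ) _ (Nat.cast_ne_zero.mpr m.succ_ne_zero) ?_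
    change ((m + 1 : ℕ) : ℂ) • φ.baseAux C (m + 1) _ = ((m + 1 : ℕ) : ℂ) • _
    rw [Nat.cast_smul_eq_nsmul, Nat.cast_smul_eq_nsmul, baseAux_succ, ← smul_comm f (m + 1),
      baseAux_succ, Finset.smul_sum]
    refine Finset.sum_congr rfl fun j _ => ?_
    rw [map_smul, base_step_smul C ih]

/-- The sum of the maps on the symmetric powers. -/
def baseSum : SymmetricAlgebra R B →+ Module.End ℂ R :=
  (Polynomial.lsum (R := ℕ) fun m =>
    (φ.baseAux C m).toNatLinearMap).toAddMonoidHom.comp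
      (baseGrade B).toRingHom.toAddMonoidHom

theorem baseSum_of_grade {s : SymmetricAlgebra R B} {m : ℕ}
    (h : baseGrade B s = Polynomial.monomial m s) :
    φ.baseSum C s = φ.baseAux C m s := by
  change (baseGrade B s).sum _ = _
  rw [h]
  exact Polynomial.sum_monomial_index _ _ (map_zero _)

/-- The Poincaré–Birkhoff–Witt map of the base, with values in differential operators. -/
def basePbw : SymmetricAlgebra R B →ₗ[R] Module.End ℂ R where
  toFun := φ.baseSum C
  map_add' := map_add _
  map_smul' f s := by
    rw [RingHom.id_apply]
    induction s using base_span_induction with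
    | h0 => rw [smul_zero, map_zero, smul_zero]
    | hadd s t hs ht => rw [smul_add, map_add, hs, ht, map_add, smul_add]
    | h g l =>
      rw [smul_smul, φ.baseSum_of_grade C (baseGrade_smul (baseGrade_baseProd l) _),
        φ.baseSum_of_grade C (baseGrade_smul (baseGrade_baseProd l) _), baseAux_smul, baseAux_smul,
        smul_smul]

theorem basePbw_of_grade {s : SymmetricAlgebra R B} {m : ℕ}
    (h : baseGrade B s = Polynomial.monomial m s) :
    φ.basePbw C s = φ.baseAux C m s := φ.baseSum_of_grade C h

theorem basePbw_one : φ.basePbw C 1 = 1 := by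
  rw [φ.basePbw_of_grade C (m := 0) (map_one _)]
  change LinearMap.mulLeft ℂ (SymmetricAlgebra.algebraMapInv (1 : SymmetricAlgebra R B) : R) = 1
  rw [map_one, LinearMap.mulLeft_one]
  rfl

theorem basePbw_recursion (l : List B) :
    l.length • φ.basePbw C (baseProd l) = pickSum (fun _ => 0) l fun y t =>
      (((y : Derivation ℂ R R) : R →ₗ[ℂ] R) : Module.End ℂ R) * φ.basePbw C (baseProd t)
        - φ.basePbw C (C.nablaProd y t) := by
  rw [φ.basePbw_of_grade C (baseGrade_baseProd l)]
  cases hl : l.length with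
  | zero =>
    rw [List.length_eq_zero_iff.mp hl, zero_smul]; rfl
  | succ m =>
    rw [baseAux_succ]
    simp only [baseJac_baseProd, map_pickSum, mul_pickSum, ← pickSum_sub]
    rw [← pickSum_finsetSum]
    refine pickSum_congr _ fun y t ht _ => ?_
    have ht' : t.length = m := by omega
    simp only [base_step_smul C (φ.baseAux_smul C m), ← C.nablaProd_eq_toHom, smul_sub,
      Finset.sum_sub_distrib, ← baseAux_smul]
    rw [← map_sum, φ.basePbw_of_grade C (baseGrade_baseProd t),
      φ.basePbw_of_grade C (baseGrade_nablaProd C y t), ht']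
    congr 1
    · conv_rhs => rw [φ.expand_right y]
      refine LinearMap.ext fun g => ?_
      simp only [LinearMap.sum_apply]
      change ∑ i, (y : Derivation ℂ R R) (φ.x i) * (φ.b i : Derivation ℂ R R) (φ.baseAux C m (baseProd t) g)
        = ((∑ i, (y : Derivation ℂ R R) (φ.x i) • φ.b i : B) : Derivation ℂ R R) (φ.baseAux C m (baseProd t) g)
      rw [Submodule.coe_sum, derivation_sum_apply]
      rfl
    · conv_rhs => rw [φ.expand_right y]
      have := map_sum (C.nablaLin t) (fun i => (y : Derivation ℂ R R) (φ.x i) • φ.b i) Finset.univ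
      simp only [map_smul] at this
      exact congrArg _ this.symm

end Frame
end BasePBW

/-! ### Differential operators on the base -/

section BaseOperatorTheory

variable {R : Type*} [CommRing R] [Algebra ℂ R]

/-- A derivation as an operator. -/
abbrev derOp (X : Derivation ℂ R R) : Module.End ℂ R := (X : R →ₗ[ℂ] R)

theorem commFun_mul (f : R) (P D : Module.End ℂ R) :
    commFun f (P * D) = P * commFun f D + commFun f P * D := by
  refine LinearMap.ext fun g => ?_
  change P (D (f * g)) - f * P (D g) = P (D (f * g) - f * D g) + (P (f * D g) - f * P (D g))
  rw [map_sub]; ring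

theorem commFun_comm (f g : R) (D : Module.End ℂ R) :
    commFun f (commFun g D) = commFun g (commFun f D) := by
  refine LinearMap.ext fun h => ?_
  change D (g * (f * h)) - g * D (f * h) - f * (D (g * h) - g * D h)
    = D (f * (g * h)) - f * D (g * h) - g * (D (f * h) - f * D h)
  rw [mul_left_comm g f h]; ring

theorem commFun_smul_one (f g : R) : commFun f (g • (1 : Module.End ℂ R)) = 0 := by
  refine LinearMap.ext fun h => ?_
  change g * (f * h) - f * (g * h) = 0
  ring

theorem commFun_derOp (f : R) (X : Derivation ℂ R R) :
    commFun f (derOp X) = X f • (1 : Module.End ℂ R) := by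
  refine LinearMap.ext fun h => ?_
  change X (f * h) - f * X h = X f * h
  rw [Derivation.leibniz, smul_eq_mul, smul_eq_mul]; ring

theorem eq_smul_one_of_mem {D : Module.End ℂ R} (hD : D ∈ baseDiffOpLT R 1) :
    D = D 1 • (1 : Module.End ℂ R) := by
  refine LinearMap.ext fun f => ?_
  have h : commFun f D = 0 := mem_baseDiffOpLT_succ.mp hD f
  have := congrArg (fun P : Module.End ℂ R => P 1) h
  simp only [commFun_apply, mul_one, LinearMap.zero_apply] at this
  rw [sub_eq_zero.mp this]
  exact mul_comm _ _

/-- An operator of order at most one is a derivation up to multiplication by a function. -/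
def derOfMem {D : Module.End ℂ R} (hD : D ∈ baseDiffOpLT R 2) : Derivation ℂ R R :=
  Derivation.mk' (D - D 1 • (1 : Module.End ℂ R)) fun f g => by
    have h := eq_smul_one_of_mem (mem_baseDiffOpLT_succ.mp hD f)
    have h1 := congrArg (fun P : Module.End ℂ R => P g) h
    change D (f * g) - f * D g = (D (f * 1) - f * D 1) * g at h1
    change D (f * g) - D 1 * (f * g) = f * (D g - D 1 * g) + g * (D f - D 1 * f)
    rw [sub_eq_iff_eq_add.mp h1, mul_one]; ring

theorem commFun_eq_of_mem {D : Module.End ℂ R} (hD : D ∈ baseDiffOpLT R 2) (f : R) :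
    commFun f D = derOfMem hD f • (1 : Module.End ℂ R) := by
  refine (eq_smul_one_of_mem (mem_baseDiffOpLT_succ.mp hD f)).trans (congrArg (· • _) ?_)
  change D (f * 1) - f * D 1 = D f - D 1 * f
  rw [mul_one, mul_comm]

/-- Compositions of less than `m` vector fields. -/
def baseCompLT (R : Type*) [CommRing R] [Algebra ℂ R] (m : ℕ) : Submodule R (Module.End ℂ R) :=
  Submodule.span R {D | ∃ l : List (Derivation ℂ R R), l.length < m ∧ D = (l.map derOp).prod}

theorem baseCompLT_mono {m m' : ℕ} (h : m ≤ m') : baseCompLT R m ≤ baseCompLT R m' :=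
  Submodule.span_mono fun _ ⟨l, hl, hs⟩ => ⟨l, hl.trans_le h, hs⟩

variable {F : LieRinehartSubalgebra R (Derivation ℂ R R)}
  {B : Submodule R (Derivation ℂ R R)} {n : ℕ} (φ : Frame F B n)

namespace Frame

/-- The vector fields dual to the coordinates. -/
def partialDer (i : Fin n) : Derivation ℂ R R := (φ.e i : Derivation ℂ R R) + φ.b i

theorem sum_partialDer (X : Derivation ℂ R R) (f : R) :
    ∑ i, X (φ.x i) * φ.partialDer i f = X f := by
  conv_rhs => rw [φ.expand X, derivation_sum_apply]
  rfl

theorem sum_commFun {m : ℕ} {D : Module.End ℂ R} (hD : D ∈ baseDiffOpLT R (m + 2)) (f : R) :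
    ∑ i, φ.partialDer i f • commFun (φ.x i) D - commFun f D ∈ baseDiffOpLT R m := by
  induction m generalizing D with
  | zero =>
    have : ∑ i, φ.partialDer i f • commFun (φ.x i) D = commFun f D := by
      simp only [commFun_eq_of_mem hD, smul_smul]
      rw [← Finset.sum_smul, ← φ.sum_partialDer (derOfMem hD) f]
      simp only [mul_comm]
    rw [this, sub_self]; exact Submodule.zero_mem _
  | succ m ih =>
    rw [mem_baseDiffOpLT_succ]
    intro g
    have h1 := ih (mem_baseDiffOpLT_succ.mp hD g)
    rw [map_sub, map_sum, commFun_comm g f]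
    simp only [map_smul, commFun_comm g (φ.x _)]
    exact h1

/-- Euler's formula for the symbol of a differential operator. -/
theorem nsmul_sub_sum_commFun {m : ℕ} {D : Module.End ℂ R} (hD : D ∈ baseDiffOpLT R (m + 1)) :
    m • D - ∑ i, commFun (φ.x i) D * derOp (φ.partialDer i) ∈ baseDiffOpLT R m := by
  induction m generalizing D with
  | zero =>
    rw [zero_smul, zero_sub]
    refine Submodule.neg_mem _ (Submodule.sum_mem _ fun j _ => ?_)
    rw [show commFun (φ.x j) D = 0 from mem_baseDiffOpLT_succ.mp hD _, zero_mul]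
    exact Submodule.zero_mem _
  | succ m ih =>
    rw [mem_baseDiffOpLT_succ]
    intro g
    have h1 := ih (mem_baseDiffOpLT_succ.mp hD g)
    have h2 : ∑ i, commFun (φ.x i) D * (φ.partialDer i g • (1 : Module.End ℂ R))
        - commFun g D ∈ baseDiffOpLT R m := by
      have h3 : ∑ i, commFun (φ.x i) D * (φ.partialDer i g • (1 : Module.End ℂ R))
          = ∑ i, φ.partialDer i g • commFun (φ.x i) D
            + ∑ i, commFun (φ.partialDer i g) (commFun (φ.x i) D) := by
        rw [← Finset.sum_add_distrib]
        refine Finset.sum_congr rfl fun i _ => LinearMap.ext fun h => ?_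
        change commFun (φ.x i) D (φ.partialDer i g * h) = φ.partialDer i g * commFun (φ.x i) D h
          + (commFun (φ.x i) D (φ.partialDer i g * h) - φ.partialDer i g * commFun (φ.x i) D h)
        ring
      rw [h3, add_sub_right_comm]
      refine Submodule.add_mem _ (φ.sum_commFun hD g) (Submodule.sum_mem _ fun i _ => ?_)
      exact mem_baseDiffOpLT_succ.mp (mem_baseDiffOpLT_succ.mp hD _) _
    have h4 : commFun g ((m + 1) • D - ∑ i, commFun (φ.x i) D * derOp (φ.partialDer i))
        = (m • commFun g D - ∑ i, commFun (φ.x i) (commFun g D) * derOp (φ.partialDer i))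
          - (∑ i, commFun (φ.x i) D * (φ.partialDer i g • (1 : Module.End ℂ R))
            - commFun g D) := by
      rw [map_sub, map_nsmul, map_sum]
      simp only [commFun_mul, commFun_derOp, Finset.sum_add_distrib, succ_nsmul,
        commFun_comm g (φ.x _)]
      abel
    rw [h4]
    exact Submodule.sub_mem _ h1 h2

include φ in
theorem baseDiffOpLT_le (m : ℕ) : baseDiffOpLT R m ≤ baseCompLT R m := by
  induction m with
  | zero => exact bot_le
  | succ m ih =>
    intro D hD
    rcases Nat.eq_zero_or_pos m with rfl | hm
    · rw [eq_smul_one_of_mem hD]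
      exact Submodule.smul_mem _ _ (Submodule.subset_span ⟨[], by simp, by simp⟩)
    · refine mem_of_nsmul_mem (H := (baseCompLT R (m + 1)).restrictScalars ℂ) hm.ne' ?_
      change m • D ∈ baseCompLT R (m + 1)
      have h1 := φ.nsmul_sub_sum_commFun hD
      have h2 : ∑ i, commFun (φ.x i) D * derOp (φ.partialDer i) ∈ baseCompLT R (m + 1) := by
        refine Submodule.sum_mem _ fun i _ => ?_
        have h3 := ih (mem_baseDiffOpLT_succ.mp hD (φ.x i))
        generalize commFun (φ.x i) D = E at h3
        induction h3 using Submodule.span_induction with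
        | mem E hE =>
          obtain ⟨l, hl, rfl⟩ := hE
          refine Submodule.subset_span ⟨l ++ [φ.partialDer i], by simpa using hl, ?_⟩
          rw [List.map_append, List.prod_append, List.map_singleton, List.prod_singleton]
        | zero => rw [zero_mul]; exact Submodule.zero_mem _
        | add s t _ _ hs ht => rw [add_mul]; exact Submodule.add_mem _ hs ht
        | smul c s _ hs => rw [smul_mul_assoc]; exact Submodule.smul_mem _ c hs
      have := Submodule.add_mem _ (baseCompLT_mono (Nat.le_succ m) (ih h1)) h2
      rwa [sub_add_cancel] at this

end Frame

/-! #### The action of vector fields on transversal differential operators -/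

theorem derMul_add (X : Derivation ℂ R R) (D D' : baseDiffOp R) :
    derMul X (D + D') = derMul X D + derMul X D' := Subtype.ext (mul_add _ _ _)

theorem derMul_smul (X : Derivation ℂ R R) (f : R) (D : baseDiffOp R) :
    derMul X (f • D) = X f • D + f • derMul X D := by
  refine Subtype.ext (LinearMap.ext fun x => ?_)
  change X (f * (D : Module.End ℂ R) x)
    = X f * (D : Module.End ℂ R) x + f * X ((D : Module.End ℂ R) x)
  rw [Derivation.leibniz, smul_eq_mul, smul_eq_mul]; ring

/-- The action of a vector field on transversal differential operators as a homomorphism. -/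
def transHom (X : Derivation ℂ R R) : TransDiffOp F →+ TransDiffOp F where
  toFun := transAct X
  map_zero' := by
    have : derMul X (0 : baseDiffOp R) = 0 := Subtype.ext (mul_zero _)
    exact congrArg (leafIdeal F).mkQ this
  map_add' m m' := by
    induction m using Submodule.Quotient.induction_on with | _ D
    induction m' using Submodule.Quotient.induction_on with | _ D'
    exact congrArg (leafIdeal F).mkQ (derMul_add X D D')

theorem transHom_mk (X : Derivation ℂ R R) (D : baseDiffOp R) :
    transHom X ((leafIdeal F).mkQ D) = (leafIdeal F).mkQ (derMul X D) := rfl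

theorem transHom_leibniz (X : Derivation ℂ R R) (f : R) (m : TransDiffOp F) :
    transHom X (f • m) = X f • m + f • transHom X m := by
  induction m using Submodule.Quotient.induction_on with | _ D
  exact congrArg (leafIdeal F).mkQ (derMul_smul X f D)

theorem add_transHom (X Y : Derivation ℂ R R) (m : TransDiffOp F) :
    transHom (X + Y) m = transHom X m + transHom Y m := by
  induction m using Submodule.Quotient.induction_on with | _ D
  exact congrArg (leafIdeal F).mkQ (Subtype.ext (add_mul _ _ _))

theorem lie_transHom (X Y : Derivation ℂ R R) (m : TransDiffOp F) :
    transHom ⁅X, Y⁆ m = transHom X (transHom Y m) - transHom Y (transHom X m) := by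
  induction m using Submodule.Quotient.induction_on with | _ D
  refine congrArg (leafIdeal F).mkQ (Subtype.ext (LinearMap.ext fun x => ?_))
  exact Derivation.commutator_apply _

variable (C : BaseConnection B)

theorem isAddTorsionFree_of_algebra (R M : Type*) [CommRing R] [Algebra ℂ R] [AddCommGroup M]
    [Module R M] : IsAddTorsionFree M :=
  letI : Module ℂ M := Module.compHom _ (algebraMap ℂ R)
  isAddTorsionFree_of_module M

theorem mem_of_nsmul_mem_of_algebra {M : Type*} [AddCommGroup M] [Module R M]
    {H : Submodule R M} {m : ℕ} (hm : m ≠ 0) {v : M} (h : m • v ∈ H) : v ∈ H := by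
  have := H.smul_mem (algebraMap ℂ R (m : ℂ)⁻¹) h
  rw [← Nat.cast_smul_eq_nsmul R, smul_smul, show ((m : R)) = algebraMap ℂ R (m : ℂ) by simp,
    ← map_mul, inv_mul_cancel₀ (Nat.cast_ne_zero.mpr hm), map_one, one_smul] at this
  exact this

namespace Frame

theorem basePbw_baseProd_recursion (l : List B) :
    l.length • φ.basePbw C (baseProd l) = pickSum (fun _ => 0) l fun y t =>
      derOp (y : Derivation ℂ R R) * φ.basePbw C (baseProd t)
        - derSum (fun _ => 0) 0 (C.nabla y) t fun t => φ.basePbw C (baseProd t) := by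
  rw [basePbw_recursion]
  refine pickSum_congr _ fun y t _ _ => ?_
  rw [C.nablaProd_eq, map_derSum]

theorem basePbw_baseProd_mem (l : List B) :
    φ.basePbw C (baseProd l) ∈ baseDiffOpLT R (l.length + 1) := by
  induction hl : l.length using Nat.strong_induction_on generalizing l with
  | _ N ih =>
  rcases Nat.eq_zero_or_pos N with rfl | hN
  · rw [List.length_eq_zero_iff.mp hl, baseProd_nil, basePbw_one, mem_baseDiffOpLT_succ]
    intro f
    rw [← one_smul R (1 : Module.End ℂ R), commFun_smul_one]
    exact Submodule.zero_mem _
  · refine mem_of_nsmul_mem_of_algebra (m := l.length) (by omega) ?_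
    rw [basePbw_baseProd_recursion]
    refine pickSum_mem (H := (baseDiffOpLT R (N + 1)).toAddSubgroup) fun y t ht _ => ?_
    have h1 := derivation_mul_mem (y : Derivation ℂ R R) (ih t.length (by omega) t rfl)
    refine AddSubgroup.sub_mem _ (baseDiffOpLT_mono (by omega) h1) ?_
    refine derSum_mem (deg := fun _ => 0) (D := C.nabla y)
      (H := (baseDiffOpLT R (N + 1)).toAddSubgroup) (fun _ => (add_zero _).symm) fun t' ht' _ => ?_
    exact baseDiffOpLT_mono (by omega) (ih t'.length (by omega) t' rfl)

theorem basePbw_mem {m : ℕ} {s : SymmetricAlgebra R B} (hs : s ∈ baseLT B m) :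
    φ.basePbw C s ∈ baseDiffOpLT R m := by
  induction hs using Submodule.span_induction with
  | mem s hs =>
    obtain ⟨l, hl, rfl⟩ := hs
    exact baseDiffOpLT_mono hl (φ.basePbw_baseProd_mem C l)
  | zero => rw [map_zero]; exact Submodule.zero_mem _
  | add s t _ _ hs ht => rw [map_add]; exact Submodule.add_mem _ hs ht
  | smul f s _ hs => rw [map_smul]; exact Submodule.smul_mem _ f hs

/-- The Poincaré–Birkhoff–Witt map of the base. -/
def baseLift : SymmetricAlgebra R B →ₗ[R] baseDiffOp R :=
  (φ.basePbw C).codRestrict (baseDiffOp R) fun s => by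
    obtain ⟨m, hm⟩ := exists_mem_baseLT s
    exact mem_baseDiffOp.mpr ⟨_, φ.basePbw_mem C hm⟩

/-- The Poincaré–Birkhoff–Witt map with values in transversal differential operators. -/
def transPbw : SymmetricAlgebra R B →ₗ[R] TransDiffOp F := (leafIdeal F).mkQ ∘ₗ φ.baseLift C

theorem transPbw_one : φ.transPbw C 1 = (leafIdeal F).mkQ ⟨1, one_mem_baseDiffOp⟩ :=
  congrArg (leafIdeal F).mkQ (Subtype.ext (φ.basePbw_one C))

theorem transPbw_recursion (l : List B) :
    l.length • φ.transPbw C (baseProd l) = pickSum (fun _ => 0) l fun y t =>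
      transHom (y : Derivation ℂ R R) (φ.transPbw C (baseProd t))
        - φ.transPbw C (C.nablaProd y t) := by
  have h : l.length • φ.baseLift C (baseProd l) = pickSum (fun _ => 0) l fun y t =>
      derMul (y : Derivation ℂ R R) (φ.baseLift C (baseProd t))
        - φ.baseLift C (C.nablaProd y t) := by
    refine Subtype.ext ?_
    refine Eq.trans ?_ (map_pickSum _ (baseDiffOp R).subtype l _).symm
    exact φ.basePbw_recursion C l
  have := congrArg (leafIdeal F).mkQ h
  rw [map_nsmul, map_pickSum] at this
  exact this

/-- The image of the products of less than `m` factors. -/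
def transLT (m : ℕ) : Submodule R (TransDiffOp F) := (baseLT B m).map (φ.transPbw C)

theorem transLT_mono {m m' : ℕ} (h : m ≤ m') : φ.transLT C m ≤ φ.transLT C m' :=
  Submodule.map_mono (baseLT_mono h)

theorem transPbw_mem {m : ℕ} {l : List B} (hl : l.length < m) :
    φ.transPbw C (baseProd l) ∈ φ.transLT C m := ⟨_, baseProd_mem hl, rfl⟩

theorem transHom_mem_of {X : Derivation ℂ R R} {m m' : ℕ} (hm : m ≤ m')
    (h : ∀ l : List B, l.length < m → transHom X (φ.transPbw C (baseProd l)) ∈ φ.transLT C m')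
    {D : TransDiffOp F} (hD : D ∈ φ.transLT C m) : transHom X D ∈ φ.transLT C m' := by
  obtain ⟨s, hs, rfl⟩ := hD
  induction hs using Submodule.span_induction with
  | mem s hs => obtain ⟨l, hl, rfl⟩ := hs; exact h l hl
  | zero => rw [map_zero, map_zero]; exact Submodule.zero_mem _
  | add s t _ _ hs ht => rw [map_add, map_add]; exact Submodule.add_mem _ hs ht
  | smul f s hs' hs =>
    rw [map_smul, transHom_leibniz]
    exact Submodule.add_mem _ (Submodule.smul_mem _ _ (φ.transLT_mono C hm ⟨s, hs', rfl⟩))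
      (Submodule.smul_mem _ _ hs)

include φ in
theorem exists_decomposition (X : Derivation ℂ R R) : ∃ (v : F) (b : B),
    X = (v : Derivation ℂ R R) + b := by
  refine ⟨∑ i, X (φ.x i) • φ.e i, ∑ i, X (φ.x i) • φ.b i, ?_⟩
  conv_lhs => rw [φ.expand X]
  simp only [smul_add, Finset.sum_add_distrib]
  congr 1
  · exact (map_sum F.toSubmodule.subtype (fun i => X (φ.x i) • φ.e i) Finset.univ).symm
  · exact (map_sum B.subtype (fun i => X (φ.x i) • φ.b i) Finset.univ).symm

theorem transHom_one (v : F) :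
    transHom (v : Derivation ℂ R R) (φ.transPbw C (baseProd [])) = 0 := by
  rw [baseProd_nil, transPbw_one, transHom_mk]
  refine (Submodule.Quotient.mk_eq_zero _).mpr (Submodule.subset_span ⟨1, one_mem_baseDiffOp, v, ?_⟩)
  change derOp _ * 1 = 1 * _
  rw [mul_one, one_mul]

theorem transHom_baseProd (l : List B) :
    (∀ y : B, transHom (y : Derivation ℂ R R) (φ.transPbw C (baseProd l))
      - φ.transPbw C (baseProd (y :: l)) ∈ φ.transLT C (l.length + 1)) ∧
    ∀ v : F, transHom (v : Derivation ℂ R R) (φ.transPbw C (baseProd l))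
      ∈ φ.transLT C (l.length + 1) := by
  induction hN : l.length using Nat.strong_induction_on generalizing l with
  | _ N ih =>
  subst hN
  have hB : ∀ (y : B) (t : List B), t.length < l.length →
      transHom (y : Derivation ℂ R R) (φ.transPbw C (baseProd t))
        ∈ φ.transLT C (t.length + 2) := fun y t ht => by
    have := Submodule.add_mem _ (φ.transLT_mono C (Nat.le_succ _) ((ih t.length ht t rfl).1 y))
      (φ.transPbw_mem C (l := y :: t) (m := t.length + 2) (by simp))
    rwa [sub_add_cancel] at this
  have hB' : ∀ (y : B) {m : ℕ}, m ≤ l.length → ∀ {D : TransDiffOp F}, D ∈ φ.transLT C m →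
      transHom (y : Derivation ℂ R R) D ∈ φ.transLT C (m + 1) := fun y m hm D hD =>
    φ.transHom_mem_of C (Nat.le_succ m)
      (fun t ht => φ.transLT_mono C (by omega) (hB y t (by omega))) hD
  have hF' : ∀ (v : F) {m : ℕ}, m ≤ l.length → ∀ {D : TransDiffOp F}, D ∈ φ.transLT C m →
      transHom (v : Derivation ℂ R R) D ∈ φ.transLT C m := fun v m hm D hD =>
    φ.transHom_mem_of C le_rfl
      (fun t ht => φ.transLT_mono C (by omega) ((ih t.length (by omega) t rfl).2 v)) hD
  have hX : ∀ (X : Derivation ℂ R R) {m : ℕ}, m ≤ l.length → ∀ {D : TransDiffOp F},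
      D ∈ φ.transLT C m → transHom X D ∈ φ.transLT C (m + 1) := by
    intro X m hm D hD
    obtain ⟨v, b, rfl⟩ := φ.exists_decomposition X
    rw [add_transHom]
    exact Submodule.add_mem _ (φ.transLT_mono C (Nat.le_succ m) (hF' v hm hD)) (hB' b hm hD)
  constructor
  · intro y
    have hswap : ∀ l₁ (z : B) l₂, l = l₁ ++ z :: l₂ →
        transHom (z : Derivation ℂ R R) (φ.transPbw C (baseProd (y :: (l₁ ++ l₂))))
          - transHom (y : Derivation ℂ R R) (φ.transPbw C (baseProd l))
            ∈ φ.transLT C (l.length + 1) := by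
      intro l₁ z l₂ hl
      have hlen : (l₁ ++ l₂).length + 1 = l.length := by rw [hl]; simp; omega
      have h1 := hB' z (by omega) ((ih (l₁ ++ l₂).length (by omega) _ rfl).1 y)
      have h2 := hB' y (by omega) ((ih (l₁ ++ l₂).length (by omega) _ rfl).1 z)
      have h3 := hX ⁅(z : Derivation ℂ R R), (y : Derivation ℂ R R)⁆ (m := l.length) le_rfl
        (φ.transPbw_mem C (l := l₁ ++ l₂) (by omega))
      rw [hlen] at h1 h2
      have h4 := Submodule.add_mem _ (Submodule.sub_mem _ h3 h1) h2
      rw [lie_transHom, map_sub, map_sub, ← baseProd_insert l₁ z, ← hl] at h4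
      convert h4 using 1
      abel
    have hrec := φ.transPbw_recursion C (y :: l)
    have hq := congrArg (φ.transLT C (l.length + 1)).mkQ hrec
    rw [map_pickSum, pickSum_const (w := (φ.transLT C (l.length + 1)).mkQ
      (transHom (y : Derivation ℂ R R) (φ.transPbw C (baseProd l)))) _ fun l₁ z l₂ hl => by
        rw [zero_mul, sgn_zero, one_smul]
        refine (Submodule.Quotient.eq _).mpr ?_
        have hlen : (l₁ ++ l₂).length = l.length := by
          have := congrArg List.length hl; simp at this; simp; omega
        rw [sub_right_comm]
        refine Submodule.sub_mem _ ?_ ?_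
        · cases l₁ with
          | nil =>
            obtain ⟨rfl, rfl⟩ := List.cons.inj hl
            rw [List.nil_append, sub_self]; exact Submodule.zero_mem _
          | cons x l₁ =>
            obtain ⟨rfl, ht⟩ := List.cons.inj hl
            exact hswap l₁ z l₂ ht
        · rw [C.nablaProd_eq, map_derSum]
          exact derSum_mem (deg := fun _ => 0) (D := C.nabla z)
            (H := (φ.transLT C (l.length + 1)).toAddSubgroup) (fun _ => (add_zero _).symm)
            fun t ht _ => φ.transPbw_mem C (by omega)] at hq
    have := (Submodule.Quotient.eq _).mp ((map_nsmul ((φ.transLT C (l.length + 1)).mkQ) _ _).trans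
      hq.symm)
    rw [← smul_sub] at this
    exact mem_of_nsmul_mem_of_algebra (by simp) this
  · intro v
    cases l with
    | nil => rw [transHom_one]; exact Submodule.zero_mem _
    | cons z t =>
      have h0 : φ.transPbw C (baseProd (z :: t)) = transHom (z : Derivation ℂ R R)
          (φ.transPbw C (baseProd t)) - (transHom (z : Derivation ℂ R R)
          (φ.transPbw C (baseProd t)) - φ.transPbw C (baseProd (z :: t))) := (sub_sub_cancel _ _).symm
      rw [h0, map_sub]
      have h1 := (ih t.length (by simp) t rfl).1 z
      refine Submodule.sub_mem _ ?_ (φ.transLT_mono C (by simp) (hF' v (by simp) h1))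
      have h2 := lie_transHom (v : Derivation ℂ R R) z (φ.transPbw C (baseProd t))
      rw [eq_sub_iff_add_eq] at h2
      rw [← h2, List.length_cons]
      refine Submodule.add_mem _ (hX _ (by simp) (φ.transPbw_mem C (Nat.lt_succ_self _))) ?_
      exact hB' z (by simp) ((ih t.length (by simp) t rfl).2 v)

theorem transHom_mem (X : Derivation ℂ R R) {m : ℕ} {D : TransDiffOp F}
    (hD : D ∈ φ.transLT C m) : transHom X D ∈ φ.transLT C (m + 1) := by
  obtain ⟨v, b, rfl⟩ := φ.exists_decomposition X
  refine φ.transHom_mem_of C (Nat.le_succ m) (fun l hl => ?_) hD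
  rw [add_transHom]
  refine Submodule.add_mem _ (φ.transLT_mono C (by omega) ((φ.transHom_baseProd C l).2 v)) ?_
  have := Submodule.add_mem _ (φ.transLT_mono C (by omega : _ ≤ m + 1)
    ((φ.transHom_baseProd C l).1 b)) (φ.transPbw_mem C (l := b :: l) (m := m + 1) (by simpa using hl))
  rwa [sub_add_cancel] at this

theorem transPbw_surjective : Function.Surjective (φ.transPbw C) := by
  intro D
  obtain ⟨⟨D, hD⟩, rfl⟩ := (leafIdeal F).mkQ_surjective D
  obtain ⟨m, hm⟩ := mem_baseDiffOp.mp hD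
  have h1 : D ∈ ((LinearMap.range (φ.transPbw C)).comap (leafIdeal F).mkQ).map
      (baseDiffOp R).subtype := by
    refine Submodule.span_le.mpr ?_ (φ.baseDiffOpLT_le m hm)
    rintro _ ⟨l, hl, rfl⟩
    clear hl
    suffices ∃ m, ∃ D : baseDiffOp R, (D : Module.End ℂ R) = (l.map derOp).prod ∧
        (leafIdeal F).mkQ D ∈ φ.transLT C m by
      obtain ⟨m, D, hD, s, _, hs⟩ := this
      exact ⟨D, ⟨s, hs⟩, hD⟩
    induction l with
    | nil => exact ⟨1, ⟨1, one_mem_baseDiffOp⟩, rfl, 1, baseProd_mem (l := []) (by simp),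
        φ.transPbw_one C⟩
    | cons X l ih =>
      obtain ⟨m, D, hD, h⟩ := ih
      refine ⟨m + 1, derMul X D, ?_, φ.transHom_mem C X h⟩
      rw [List.map_cons, List.prod_cons, ← hD]; rfl
  obtain ⟨D', ⟨s, hs⟩, hD'⟩ := h1
  exact ⟨s, hs.trans (congrArg _ (Subtype.ext hD'))⟩

end Frame

end BaseOperatorTheory

/-! ### Detecting transversal differential operators at points -/

section UnshuffleSplit

variable {ι W : Type*} [AddCommGroup W] (deg : ι → ℤ) {H : AddSubgroup W}

theorem unshuffleSum_sub_nil_mem {l : List ι} {G : List ι → List ι → W}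
    (h : ∀ S T, S ≠ [] → S.length + T.length = l.length → G S T ∈ H) :
    unshuffleSum deg l G - G [] l ∈ H := by
  induction l generalizing G with
  | nil => rw [unshuffleSum_nil, sub_self]; exact H.zero_mem
  | cons x l ih =>
    have h1 := ih (G := fun S T => sgn (deg x * (S.map deg).sum) • G S (x :: T))
      fun S T hS hl => H.zsmul_mem (h S (x :: T) hS (by simp; omega)) _
    simp only [List.map_nil, List.sum_nil, mul_zero, sgn_zero, one_smul] at h1
    rw [unshuffleSum_cons, add_sub_assoc]
    exact H.add_mem (unshuffleSum_mem fun S T hl _ => h _ _ (by simp) (by simp; omega)) h1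

theorem unshuffleSum_sub_pickSum_mem {l : List ι} {G : List ι → List ι → W}
    (h : ∀ S T, 2 ≤ S.length → S.length + T.length = l.length → G S T ∈ H) :
    unshuffleSum deg l G - G [] l - pickSum deg l (fun y t => G [y] t) ∈ H := by
  induction l generalizing G with
  | nil => rw [unshuffleSum_nil, sub_self, zero_sub]; exact H.neg_mem H.zero_mem
  | cons x l ih =>
    have h1 := ih (G := fun S T => sgn (deg x * (S.map deg).sum) • G S (x :: T))
      fun S T hS hl => H.zsmul_mem (h S (x :: T) hS (by simp; omega)) _
    have h2 := unshuffleSum_sub_nil_mem deg (H := H) (l := l) (G := fun S T => G (x :: S) T)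
      fun S T hS hl => h _ _ (by have := List.length_pos_iff.mpr hS; simp; omega) (by simp; omega)
    simp only [List.map_nil, List.sum_nil, mul_zero, sgn_zero, one_smul, List.map_cons,
      List.sum_cons, add_zero] at h1
    rw [unshuffleSum_cons, pickSum_cons]
    convert H.add_mem h2 h1 using 1
    abel

end UnshuffleSplit

section LeafPoints

variable {R : Type*} [CommRing R] [Algebra ℂ R]

/-- A point, together with a monoid of functions constant along the leaves of `F` near this point,
which contains enough functions to realize the covectors conormal to `F`. -/
structure LeafPoint (F : LieRinehartSubalgebra R (Derivation ℂ R R))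
    (B : Submodule R (Derivation ℂ R R)) where
  ev : R →+* ℂ
  basic : Submonoid R
  leaf : ∀ w ∈ baseDiffOp R, ∀ v : F, ∀ ψ ∈ basic, ev (w ((v : Derivation ℂ R R) ψ)) = 0
  lift : ∀ f, ∃ ψ ∈ basic, ev ψ = 0 ∧ ∀ b ∈ B, ev (b ψ) = ev (b f)

variable {F : LieRinehartSubalgebra R (Derivation ℂ R R)} {B : Submodule R (Derivation ℂ R R)}

theorem LeafPoint.leafIdeal_apply (p : LeafPoint F B) {D : baseDiffOp R} (hD : D ∈ leafIdeal F)
    {ψ : R} (hψ : ψ ∈ p.basic) : p.ev ((D : Module.End ℂ R) ψ) = 0 := by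
  induction hD using Submodule.span_induction with
  | mem D hD => obtain ⟨w, hw, v, h⟩ := hD; rw [h]; exact p.leaf w hw v ψ hψ
  | zero => exact map_zero _
  | add D D' _ _ h h' => exact (map_add p.ev _ _).trans (by rw [h, h', add_zero])
  | smul f D _ h => exact (map_mul p.ev _ _).trans (by rw [h, mul_zero])

variable (B) in
/-- Iterated contraction of an element of the symmetric algebra with differentials. -/
def baseEval : List R → SymmetricAlgebra R B →ₗ[R] R
  | [] => (SymmetricAlgebra.algebraMapInv : SymmetricAlgebra R B →ₐ[R] R).toLinearMap
  | f :: fs => baseEval fs ∘ₗ baseJac B f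

theorem baseEval_nil_one : baseEval B [] 1 = 1 :=
  map_one (SymmetricAlgebra.algebraMapInv : SymmetricAlgebra R B →ₐ[R] R)

theorem baseEval_congr (e : R →+* ℂ) {fs gs : List R}
    (h : List.Forall₂ (fun f g => ∀ b ∈ B, e (b f) = e (b g)) fs gs)
    (s : SymmetricAlgebra R B) : e (baseEval B fs s) = e (baseEval B gs s) := by
  have key : ∀ l : List B, e (baseEval B fs (baseProd l)) = e (baseEval B gs (baseProd l)) := by
    induction h with
    | nil => exact fun _ => rfl
    | cons h1 _ ih =>
      intro l
      simp only [baseEval, LinearMap.comp_apply, baseJac_baseProd, map_pickSum, map_smul,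
        smul_eq_mul, map_mul, ih, h1 _ (Subtype.prop _)]
  refine base_span_induction (p := fun s => e (baseEval B fs s) = e (baseEval B gs s)) (by simp)
    (fun s t hs ht => by rw [map_add, map_add, map_add, map_add, hs, ht]) (fun f l => ?_) s
  rw [(baseEval B fs).map_smul, (baseEval B gs).map_smul, smul_eq_mul, smul_eq_mul, map_mul,
    map_mul, key]

variable {n : ℕ} (φ : Frame F B n) (C : BaseConnection B)

/-- An operator of order less than `m` annihilates products of `m` functions vanishing at a
point. -/
theorem apply_prod_eq_zero {e : R →+* ℂ} {m : ℕ} {D : Module.End ℂ R} (hD : D ∈ baseDiffOpLT R m)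
    {fs : List R} (hm : m ≤ fs.length) (hfs : ∀ f ∈ fs, e f = 0) (g : R) :
    e (D (fs.prod * g)) = 0 := by
  induction fs generalizing m D with
  | nil =>
    obtain rfl : m = 0 := by simpa using hm
    rw [show D = 0 from hD]; exact map_zero e
  | cons f fs ih =>
    rcases m with _ | m
    · rw [show D = 0 from hD]; exact map_zero e
    · have h1 := ih (mem_baseDiffOpLT_succ.mp hD f) (by simpa using hm) fun g hg => hfs g (by simp [hg])
      rw [commFun_apply, map_sub, map_mul e, hfs f (by simp), zero_mul, sub_zero] at h1
      rwa [List.prod_cons, mul_assoc]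

namespace Frame

include φ in
theorem mem_baseLT_of_baseEval {m : ℕ} {s : SymmetricAlgebra R B} (hs : s ∈ baseLT B (m + 1))
    (h : ∀ fs : List R, fs.length = m → baseEval B fs s = 0) : s ∈ baseLT B m := by
  induction m generalizing s with
  | zero =>
    have h1 : ∀ t ∈ baseLT B 1, t = baseEval B [] t • 1 := by
      intro t ht
      induction ht using Submodule.span_induction with
      | mem t ht =>
        obtain ⟨l, hl, rfl⟩ := ht
        obtain rfl : l = [] := List.length_eq_zero_iff.mp (by omega)
        rw [baseProd_nil, baseEval_nil_one, one_smul]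
      | zero => rw [map_zero, zero_smul]
      | add s t _ _ hs ht => rw [map_add, add_smul, ← hs, ← ht]
      | smul f s _ hs => rw [map_smul, smul_assoc, ← hs]
    rw [h1 s hs, h [] rfl, zero_smul]; exact Submodule.zero_mem _
  | succ m ih =>
    have h1 : ∀ t ∈ baseLT B (m + 2), (m + 1) • t
        - ∑ i, SymmetricAlgebra.ι R B (φ.b i) * baseJac B (φ.x i) t ∈ baseLT B (m + 1) := by
      intro t ht
      induction ht using Submodule.span_induction with
      | mem t ht =>
        obtain ⟨l, hl, rfl⟩ := ht
        have h2 : ∑ i, SymmetricAlgebra.ι R B (φ.b i) * baseJac B (φ.x i) (baseProd l)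
            = l.length • baseProd l := by
          have h3 : ∀ y : B, SymmetricAlgebra.ι R B y
              = ∑ i, (y : Derivation ℂ R R) (φ.x i) • SymmetricAlgebra.ι R B (φ.b i) := fun y => by
            conv_lhs => rw [φ.expand_right y, map_sum]
            simp only [map_smul]
          have h4 : ∀ (y : B) (t : List B), SymmetricAlgebra.ι R B y * baseProd t
              = ∑ i, SymmetricAlgebra.ι R B (φ.b i) *
                  ((y : Derivation ℂ R R) (φ.x i) • baseProd t) := fun y t => by
            conv_lhs => rw [h3 y, Finset.sum_mul]
            exact Finset.sum_congr rfl fun i _ => by rw [smul_mul_assoc, mul_smul_comm]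
          have h5 : ∑ i, SymmetricAlgebra.ι R B (φ.b i) * baseJac B (φ.x i) (baseProd l)
              = pickSum (fun _ => 0) l fun y t => SymmetricAlgebra.ι R B y * baseProd t := by
            simp only [h4, baseJac_baseProd, mul_pickSum]
            induction (Finset.univ : Finset (Fin n)) using Finset.cons_induction with
            | empty => exact (map_pickSum _ (0 : SymmetricAlgebra R B →+ SymmetricAlgebra R B) l
                (fun y t => 0)).symm ▸ rfl
            | cons i s hi ih => simp only [Finset.sum_cons, ih, pickSum_add]
          rw [h5]
          refine pickSum_const _ fun l₁ z l₂ hl => ?_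
          rw [zero_mul, sgn_zero, one_smul, hl, baseProd_insert, baseProd_cons]
        rw [h2]
        rcases (Nat.lt_succ_iff.mp hl).eq_or_lt with h | h
        · rw [h, sub_self]; exact Submodule.zero_mem _
        · rw [← natCast_zsmul, ← natCast_zsmul, ← sub_smul]
          exact zsmul_mem (baseProd_mem h) _
      | zero => simp
      | add s t _ _ hs ht =>
        simp only [map_add, mul_add, smul_add, Finset.sum_add_distrib]
        rw [add_sub_add_comm]; exact Submodule.add_mem _ hs ht
      | smul f s _ hs =>
        simp only [map_smul, mul_smul_comm, ← Finset.smul_sum]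
        rw [smul_comm _ f, ← smul_sub]; exact Submodule.smul_mem _ f hs
    have h2 : ∑ i, SymmetricAlgebra.ι R B (φ.b i) * baseJac B (φ.x i) s ∈ baseLT B (m + 1) := by
      refine Submodule.sum_mem _ fun i _ => ?_
      have h3 := ih (baseJac_mem (φ.x i) hs) fun fs hfs => h (φ.x i :: fs) (by simp [hfs])
      rcases m with _ | m
      · rw [baseLT_zero] at h3
        rw [(Submodule.mem_bot R).mp h3, mul_zero]; exact Submodule.zero_mem _
      · have h4 := baseProd_mem (m := 2) (l := [φ.b i]) (by simp)
        rw [baseProd_cons, baseProd_nil, mul_one] at h4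
        rw [show m + 1 + 1 = 1 + m + 1 by ring]
        exact baseLT_mul h4 h3
    have := Submodule.add_mem _ (h1 s hs) h2
    rw [sub_add_cancel] at this
    exact mem_of_nsmul_mem_of_algebra (Nat.succ_ne_zero m) this

/-- The Poincaré–Birkhoff–Witt map of the base is a homomorphism of coalgebras. -/
theorem basePbw_mul (l : List B) (f g : R) : φ.basePbw C (baseProd l) (f * g)
    = unshuffleSum (fun _ => 0) l fun S T =>
      φ.basePbw C (baseProd S) f * φ.basePbw C (baseProd T) g := by
  have := isAddTorsionFree_of_algebra R R
  have hrec : ∀ (h : R) (l : List B), l.length • φ.basePbw C (baseProd l) h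
      = pickSum (fun _ => 0) l fun y t =>
        (y : Derivation ℂ R R).toLinearMap.toAddMonoidHom (φ.basePbw C (baseProd t) h)
          - derSum (fun _ => 0) 0 (C.nabla y) t fun t => φ.basePbw C (baseProd t) h := by
    intro h l
    have h1 := congrArg (LinearMap.applyₗ (R := ℂ) h) (φ.basePbw_baseProd_recursion C l)
    rw [map_nsmul, map_pickSum] at h1
    refine h1.trans (pickSum_congr _ fun y t _ _ => ?_)
    rw [map_sub, map_derSum]; rfl
  refine (unshuffleSum_mul_of_recursion (deg := fun _ => 0) (κ := 0)
    (act := fun y : B => (y : Derivation ℂ R R).toLinearMap.toAddMonoidHom)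
    (D := fun y => C.nabla y) (fun _ _ => rfl) (p := fun l => φ.basePbw C (baseProd l) f)
    (q := fun l => φ.basePbw C (baseProd l) g) (r := fun l => φ.basePbw C (baseProd l) (f * g))
    (fun y S b => ?_) (hrec f) (hrec g) (hrec (f * g)) ?_ l).trans ?_
  · rw [zero_mul, sgn_zero, one_smul]
    change (y : Derivation ℂ R R) _ = (y : Derivation ℂ R R) _ * b + _ * (y : Derivation ℂ R R) b
    rw [Derivation.leibniz, smul_eq_mul, smul_eq_mul, add_comm, mul_comm b]
  · simp only [baseProd_nil, basePbw_one]; rfl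
  · exact unshuffleSum_congr' _ fun S T => by rw [zero_mul, sgn_zero, one_smul]

theorem commFun_basePbw_mem {m : ℕ} {s : SymmetricAlgebra R B} (hs : s ∈ baseLT B (m + 2)) (f : R) :
    commFun f (φ.basePbw C s) - φ.basePbw C (baseJac B f s) ∈ baseDiffOpLT R m := by
  induction hs using Submodule.span_induction with
  | mem s hs =>
    obtain ⟨l, hl, rfl⟩ := hs
    have h1 := unshuffleSum_sub_pickSum_mem (fun _ : B => 0)
      (H := (baseDiffOpLT R m).toAddSubgroup) (l := l)
      (G := fun S T => φ.basePbw C (baseProd S) f • φ.basePbw C (baseProd T))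
      fun S T hS hl' => Submodule.smul_mem _ _
        (baseDiffOpLT_mono (by omega) (φ.basePbw_baseProd_mem C T))
    have h2 : commFun f (φ.basePbw C (baseProd l)) = unshuffleSum (fun _ => 0) l (fun S T =>
        φ.basePbw C (baseProd S) f • φ.basePbw C (baseProd T))
          - φ.basePbw C (baseProd []) f • φ.basePbw C (baseProd l) := by
      refine LinearMap.ext fun g => ?_
      rw [commFun_apply, basePbw_mul, baseProd_nil, basePbw_one]
      exact congrArg (· - _) (map_unshuffleSum (fun _ => 0) (LinearMap.applyₗ (R := ℂ) g) l
        fun S T => φ.basePbw C (baseProd S) f • φ.basePbw C (baseProd T)).symm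
    have h3 : φ.basePbw C (baseJac B f (baseProd l)) = pickSum (fun _ => 0) l (fun y t =>
        φ.basePbw C (baseProd [y]) f • φ.basePbw C (baseProd t)) := by
      rw [baseJac_baseProd, map_pickSum]
      refine pickSum_congr _ fun y t _ _ => ?_
      have h4 := φ.basePbw_recursion C [y]
      rw [pickSum_cons, baseProd_nil, basePbw_one, BaseConnection.nablaProd, map_zero, sub_zero,
        List.length_singleton, one_smul, mul_one] at h4
      rw [map_smul, h4]
      exact congrArg (· • _) (add_zero _).symm
    rw [h2, h3]
    exact h1
  | zero => simp
  | add s t _ _ hs ht =>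
    rw [map_add, map_add, map_add, map_add, add_sub_add_comm]; exact Submodule.add_mem _ hs ht
  | smul g s _ hs =>
    simp only [map_smul]
    convert Submodule.smul_mem _ g hs using 1
    exact (smul_sub g _ _).symm

theorem basePbw_apply_prod {e : R →+* ℂ} {fs : List R} (hfs : ∀ f ∈ fs, e f = 0)
    {s : SymmetricAlgebra R B} (hs : s ∈ baseLT B (fs.length + 1)) (g : R) :
    e (φ.basePbw C s (fs.prod * g)) = e (baseEval B fs s) * e g := by
  induction fs generalizing s with
  | nil =>
    induction hs using Submodule.span_induction with
    | mem s hs =>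
      obtain ⟨l, hl, rfl⟩ := hs
      rw [List.length_eq_zero_iff.mp (show l.length = 0 by simpa using hl), baseProd_nil,
        basePbw_one, baseEval_nil_one, map_one, List.prod_nil]
      simp
    | zero => simp
    | add s t _ _ hs ht =>
      rw [map_add, LinearMap.add_apply, map_add, hs, ht, map_add, map_add, add_mul]
    | smul r s _ hs =>
      rw [map_smul, map_smul]
      refine (map_mul e _ _).trans ?_
      rw [hs, smul_eq_mul, map_mul, mul_assoc]
  | cons f fs ih =>
    have h1 := apply_prod_eq_zero (e := e) (φ.commFun_basePbw_mem C hs f) (fs := fs) le_rfl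
      (fun g hg => hfs g (by simp [hg])) g
    rw [LinearMap.sub_apply, commFun_apply, map_sub, map_sub, map_mul e, hfs f (by simp), zero_mul,
      sub_zero, ih (fun g hg => hfs g (by simp [hg])) (baseJac_mem f hs), sub_eq_zero] at h1
    rw [List.prod_cons, mul_assoc, h1]; rfl

/-- If the operator corresponding to `s` annihilates products of basic functions vanishing at
points, then the leading part of `s` vanishes. -/
theorem mem_baseLT_of_apply (hsep : ∀ f : R, (∀ p : LeafPoint F B, p.ev f = 0) → f = 0) {m : ℕ}
    {s : SymmetricAlgebra R B} (hs : s ∈ baseLT B (m + 1))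
    (h : ∀ (p : LeafPoint F B) (ψs : List R), ψs.length = m →
      (∀ ψ ∈ ψs, ψ ∈ p.basic ∧ p.ev ψ = 0) → p.ev (φ.basePbw C s ψs.prod) = 0) :
    s ∈ baseLT B m := by
  refine φ.mem_baseLT_of_baseEval hs fun fs hfs => hsep _ fun p => ?_
  have h1 : ∃ ψs : List R, (∀ ψ ∈ ψs, ψ ∈ p.basic ∧ p.ev ψ = 0) ∧
      List.Forall₂ (fun f g => ∀ b ∈ B, p.ev (b f) = p.ev (b g)) fs ψs := by
    clear hfs
    induction fs with
    | nil => exact ⟨[], by simp, .nil⟩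
    | cons f fs ih =>
      obtain ⟨ψs, h1, h2⟩ := ih
      obtain ⟨ψ, h3, h4, h5⟩ := p.lift f
      exact ⟨ψ :: ψs, by simpa using ⟨⟨h3, h4⟩, h1⟩, .cons (fun b hb => (h5 b hb).symm) h2⟩
  obtain ⟨ψs, h1, h2⟩ := h1
  have hl : ψs.length = m := h2.length_eq.symm.trans hfs
  have h3 := φ.basePbw_apply_prod C (e := p.ev) (fs := ψs) (fun f hf => (h1 f hf).2)
    (s := s) (by rwa [hl]) 1
  rw [mul_one, map_one, mul_one, h p ψs hl h1] at h3
  rw [baseEval_congr p.ev h2, ← h3]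

theorem transPbw_injective (hsep : ∀ f : R, (∀ p : LeafPoint F B, p.ev f = 0) → f = 0) :
    Function.Injective (φ.transPbw C) := by
  rw [injective_iff_map_eq_zero]
  intro s hs
  have h1 : φ.baseLift C s ∈ leafIdeal F := (Submodule.Quotient.mk_eq_zero _).mp hs
  obtain ⟨m, hm⟩ := exists_mem_baseLT s
  have h2 : ∀ k, s ∈ baseLT B k → s ∈ baseLT B 0 := by
    intro k hk
    induction k with
    | zero => exact hk
    | succ k ih =>
      refine ih (φ.mem_baseLT_of_apply C hsep hk fun p ψs _ hψ => ?_)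
      exact p.leafIdeal_apply h1 (p.basic.list_prod_mem fun ψ h => (hψ ψ h).1)
  simpa [baseLT_zero] using h2 _ hm

/-- The Poincaré–Birkhoff–Witt isomorphism onto the transversal differential operators. -/
def transPbwEquiv (hsep : ∀ f : R, (∀ p : LeafPoint F B, p.ev f = 0) → f = 0) :
    SymmetricAlgebra R B ≃ₗ[R] TransDiffOp F :=
  LinearEquiv.ofBijective (φ.transPbw C) ⟨φ.transPbw_injective C hsep, φ.transPbw_surjective C⟩

variable (hsep : ∀ f : R, (∀ p : LeafPoint F B, p.ev f = 0) → f = 0)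

theorem isBasePBW : IsBasePBW C (φ.transPbwEquiv C hsep) where
  one := φ.transPbw_one C
  recursion l := by
    refine (φ.transPbw_recursion C l).trans ?_
    rw [← sum_fin_eq_pickSum]
    refine Finset.sum_congr rfl fun k _ => ?_
    rw [zero_mul, sgn_zero, one_smul]
    rfl

theorem eq_algebraMap_add_ι {s : SymmetricAlgebra R B} (hs : s ∈ baseLT B 2) :
    s = algebraMap R _ (φ.basePbw C s 1) + SymmetricAlgebra.ι R B (basePr B s) := by
  induction hs using Submodule.span_induction with
  | mem s hs =>
    obtain ⟨l, hl, rfl⟩ := hs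
    match l, hl with
    | [], _ => rw [baseProd_nil, basePbw_one, basePr_one]; simp
    | [y], _ =>
      have h4 := φ.basePbw_recursion C [y]
      rw [pickSum_cons, baseProd_nil, basePbw_one, BaseConnection.nablaProd, map_zero, sub_zero,
        List.length_singleton, one_smul, mul_one] at h4
      rw [h4, baseProd_cons, baseProd_nil, mul_one, basePr_ι]
      have : (derOp (y : Derivation ℂ R R) + pickSum (fun _ : B => (0 : ℤ)) []
          fun z t => sgn (0 * 0) • (derOp (z : Derivation ℂ R R) * φ.basePbw C (baseProd (y :: t))
            - φ.basePbw C (C.nablaProd z (y :: t)))) 1 = 0 := by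
        change (y : Derivation ℂ R R) 1 + 0 = 0
        rw [Derivation.map_one_eq_zero, add_zero]
      rw [this, map_zero, zero_add]
  | zero => simp
  | add s t _ _ hs ht =>
    rw [map_add, LinearMap.add_apply, map_add, map_add, map_add, add_add_add_comm, ← hs, ← ht]
  | smul r s _ hs =>
    conv_lhs => rw [hs]
    rw [smul_add, map_smul, map_smul, map_smul, LinearMap.smul_apply, smul_eq_mul, map_mul,
      Algebra.smul_def]

/-- An operator which acts on basic functions as a derivation at every point corresponds to a
section of `B`. -/
theorem transPbwEquiv_symm_of_primitive (D : baseDiffOp R)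
    (h : ∀ p : LeafPoint F B, ∀ ψ ∈ p.basic, ∀ χ ∈ p.basic,
      p.ev ((D : Module.End ℂ R) (ψ * χ)) = p.ev ((D : Module.End ℂ R) ψ) * p.ev χ
        + p.ev ψ * p.ev ((D : Module.End ℂ R) χ)) :
    (φ.transPbwEquiv C hsep).symm ((leafIdeal F).mkQ D) = SymmetricAlgebra.ι R B
      (basePr B ((φ.transPbwEquiv C hsep).symm ((leafIdeal F).mkQ D))) := by
  set s := (φ.transPbwEquiv C hsep).symm ((leafIdeal F).mkQ D) with hs
  have h1 : φ.baseLift C s - D ∈ leafIdeal F :=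
    (Submodule.Quotient.eq _).mp ((φ.transPbwEquiv C hsep).apply_symm_apply _)
  have h2 : ∀ p : LeafPoint F B, ∀ ψ ∈ p.basic,
      p.ev (φ.basePbw C s ψ) = p.ev ((D : Module.End ℂ R) ψ) := fun p ψ hψ =>
    sub_eq_zero.mp ((map_sub p.ev _ _).symm.trans (p.leafIdeal_apply h1 hψ))
  have h3 : ∀ k, s ∈ baseLT B (k + 2) → s ∈ baseLT B 2 := by
    intro k hk
    induction k with
    | zero => exact hk
    | succ k ih =>
      refine ih (φ.mem_baseLT_of_apply C hsep hk fun p ψs hl hψ => ?_)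
      obtain ⟨ψ, χ, ψs, rfl⟩ : ∃ ψ χ t, ψs = ψ :: χ :: t := by
        match ψs, hl with
        | ψ :: χ :: t, _ => exact ⟨ψ, χ, t, rfl⟩
      simp only [List.mem_cons, forall_eq_or_imp] at hψ
      have hm : χ * ψs.prod ∈ p.basic :=
        mul_mem hψ.2.1.1 (p.basic.list_prod_mem fun ψ h => (hψ.2.2 ψ h).1)
      rw [List.prod_cons, List.prod_cons, h2 p _ (mul_mem hψ.1.1 hm), h p _ hψ.1.1 _ hm, map_mul,
        hψ.1.2, hψ.2.1.2]
      simp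
  obtain ⟨m, hm⟩ := exists_mem_baseLT s
  have h4 := φ.eq_algebraMap_add_ι C (h3 m (baseLT_mono (Nat.le_succ _) hm))
  have h5 : φ.basePbw C s 1 = 0 := by
    refine hsep _ fun p => ?_
    rw [h2 p 1 p.basic.one_mem]
    have := h p 1 p.basic.one_mem 1 p.basic.one_mem
    rw [mul_one, map_one p.ev, mul_one, one_mul] at this
    simpa using this
  rw [h5, map_zero, zero_add] at h4
  exact h4

end Frame

end LeafPoints

/-! ### The `L∞[1]` algebra on the Dolbeault complex -/

section FormCoalgebra

open scoped TensorProduct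

variable {R : Type*} [CommRing R] [Algebra ℂ R]
  {F : LieRinehartSubalgebra R (Derivation ℂ R R)} {B : Submodule R (Derivation ℂ R R)}

theorem wedge_eq_zero {M₁ M₂ M₃ : Type*} [AddCommGroup M₁] [Module R M₁] [AddCommGroup M₂]
    [Module R M₂] [AddCommGroup M₃] [Module R M₃] (b : M₁ →ₗ[R] M₂ →ₗ[R] M₃) {α : List F → M₁}
    {β : List F → M₂} (h : ∀ l l', b (α l) (β l') = 0) (l : List F) : wedge b α β l = 0 := by
  induction l generalizing α β with
  | nil => exact h _ _
  | cons v l ih =>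
    rw [wedge, ih (α := contract v α) fun _ _ => h _ _, zero_add]
    refine ih (α := parity α) (β := contract v β) fun l l' => ?_
    change b ((-1 : ℤ) ^ l.length • α l) _ = 0
    rw [map_zsmul, LinearMap.smul_apply]
    exact (congrArg _ (h _ _)).trans (smul_zero _)

theorem FModule.d_const {M : Type*} [AddCommGroup M] [Module R M] (ρ : FModule F M) {m : M}
    (h : ∀ v, ρ.act v m = 0) : ρ.d (Form.const m) = 0 := by
  refine Form.ext fun l => ?_
  match l with
  | [] => rfl
  | [v] => exact (sub_zero _).trans (h v)
  | v :: w :: l =>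
    change lieDer ρ v (const m) (w :: l) - ceDiff ρ (contract v (const m)) (w :: l) = 0
    rw [lieDer, contract_const, contract_const, lieDer_zero, ceDiff_zero]
    change (0 : M) - 0 - 0 = 0
    simp

theorem map_basePr_mul_mul (τ η : Form F B) (W : Form F (SymmetricAlgebra R B)) :
    Form.map (basePr B) (Form.map (SymmetricAlgebra.ι R B) τ *
      (Form.map (SymmetricAlgebra.ι R B) η * W)) = 0 := by
  let g : SymmetricAlgebra R B →ₐ[R] TrivSqZeroExt R B :=
    SymmetricAlgebra.lift (TrivSqZeroExt.inrHom R B)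
  have h : Form.mapRingHom g (Form.map (SymmetricAlgebra.ι R B) τ *
      (Form.map (SymmetricAlgebra.ι R B) η * W)) = 0 := by
    have h1 : Form.mapRingHom g (Form.map (SymmetricAlgebra.ι R B) τ)
        * Form.mapRingHom g (Form.map (SymmetricAlgebra.ι R B) η) = 0 :=
      Form.ext fun l => wedge_eq_zero _ (fun l l' => by
        change g (SymmetricAlgebra.ι R B _) * g (SymmetricAlgebra.ι R B _) = 0
        simp [g]) l
    rw [map_mul, map_mul, ← mul_assoc, h1, zero_mul]
  exact congrArg (Form.map (TrivSqZeroExt.sndHom R B)) h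

/-- The product of sections of `B` with coefficients in forms. -/
def formProd (l : List (Homog (formDeg F B))) : Form F (SymmetricAlgebra R B) :=
  (l.map fun τ => Form.map (SymmetricAlgebra.ι R B) τ.val).prod

theorem formProd_nil : formProd ([] : List (Homog (formDeg F B))) = 1 := rfl

theorem formProd_cons (τ : Homog (formDeg F B)) (l : List (Homog (formDeg F B))) :
    formProd (τ :: l) = Form.map (SymmetricAlgebra.ι R B) τ.val * formProd l := rfl

theorem formProd_mem (l : List (Homog (formDeg F B))) :
    formProd l ∈ formDeg F (SymmetricAlgebra R B) (l.map Homog.deg).sum := by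
  induction l with
  | nil => exact Form.one_mem
  | cons τ l ih => exact Form.mul_mem (Form.map_mem _ τ.val_mem) ih

theorem formProd_swap (l₁ : List (Homog (formDeg F B))) (x y : Homog (formDeg F B))
    (l₂ : List (Homog (formDeg F B))) :
    formProd (l₁ ++ x :: y :: l₂) = sgn (x.deg * y.deg) • formProd (l₁ ++ y :: x :: l₂) := by
  induction l₁ with
  | nil =>
    simp only [List.nil_append, formProd_cons, ← mul_assoc]
    rw [Form.mul_comm_of_mem (Form.map_mem _ x.val_mem) (Form.map_mem _ y.val_mem), smul_mul_assoc]
  | cons z l₁ ih =>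
    rw [List.cons_append, List.cons_append, formProd_cons, formProd_cons, ih, mul_smul_comm]

/-- The value of differential operators at a function. -/
def evalAt (f : R) : baseDiffOp R →ₗ[R] R where
  toFun D := (D : Module.End ℂ R) f
  map_add' _ _ := rfl
  map_smul' _ _ := rfl

variable (F) in
/-- The action of `F` on differential operators by composition from the left. -/
def FModule.base : FModule F (baseDiffOp R) where
  act v := derMul v
  act_add v D D' := Subtype.ext (mul_add _ _ _)
  add_act v w D := Subtype.ext (add_mul _ _ _)
  smul_act f v D := Subtype.ext (LinearMap.ext fun x => rfl)
  leibniz v f D := derMul_smul _ f D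
  flat v w D := Subtype.ext (LinearMap.ext fun x => Derivation.commutator_apply _)

theorem map_evalAt_d (f : R) (D : Form F (baseDiffOp R)) :
    Form.map (evalAt f) ((FModule.base F).d D) = dF F (Form.map (evalAt f) D) :=
  (FModule.d_map (ρ' := .functions F) (evalAt f) (fun _ _ => rfl) D).symm

theorem trans_d_map_mkQ (D : Form F (baseDiffOp R)) :
    (FModule.trans F).d (Form.map (leafIdeal F).mkQ D)
      = Form.map (leafIdeal F).mkQ ((FModule.base F).d D) :=
  FModule.d_map (leafIdeal F).mkQ (fun _ _ => rfl) D

/-- The residue field at a point. -/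
def LeafPoint.Fiber (_p : LeafPoint F B) : Type := ℂ

instance (p : LeafPoint F B) : CommRing p.Fiber := inferInstanceAs (CommRing ℂ)
instance (p : LeafPoint F B) : Algebra R p.Fiber := p.ev.toAlgebra

/-- The values of forms at a point. -/
def LeafPoint.restrict (p : LeafPoint F B) : Form F R →+* Form F p.Fiber :=
  Form.mapRingHom (Algebra.ofId R p.Fiber)

theorem LeafPoint.restrict_congr (p : LeafPoint F B) {D D' : Form F (baseDiffOp R)}
    (h : Form.map (leafIdeal F).mkQ D = Form.map (leafIdeal F).mkQ D') {ψ : R}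
    (hψ : ψ ∈ p.basic) :
    p.restrict (Form.map (evalAt ψ) D) = p.restrict (Form.map (evalAt ψ) D') := by
  refine Form.ext fun l => ?_
  have h1 : D l - D' l ∈ leafIdeal F := (Submodule.Quotient.eq _).mp (congrArg (fun τ => τ l) h)
  exact sub_eq_zero.mp ((map_sub p.ev _ _).symm.trans (p.leafIdeal_apply h1 hψ))

variable (B) in
/-- The coproduct of the symmetric algebra. -/
def baseComul : SymmetricAlgebra R B →ₐ[R] SymmetricAlgebra R B ⊗[R] SymmetricAlgebra R B :=
  SymmetricAlgebra.lift
    ((Algebra.TensorProduct.includeLeft (S := R) (A := SymmetricAlgebra R B)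
        (B := SymmetricAlgebra R B)).toLinearMap ∘ₗ SymmetricAlgebra.ι R B
      + (Algebra.TensorProduct.includeRight (A := SymmetricAlgebra R B)
        (B := SymmetricAlgebra R B)).toLinearMap ∘ₗ SymmetricAlgebra.ι R B)

theorem baseComul_ι (b : B) : baseComul B (SymmetricAlgebra.ι R B b)
    = SymmetricAlgebra.ι R B b ⊗ₜ 1 + 1 ⊗ₜ SymmetricAlgebra.ι R B b :=
  SymmetricAlgebra.lift_ι_apply _ _

theorem baseComul_baseProd (l : List B) : baseComul B (baseProd l)
    = unshuffleSum (fun _ => 0) l fun S T => baseProd S ⊗ₜ baseProd T := by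
  have h := unshuffleSum_prod_add (deg := fun _ : B => 0)
    (u := fun b => SymmetricAlgebra.ι R B b ⊗ₜ[R] (1 : SymmetricAlgebra R B))
    (w := fun b => (1 : SymmetricAlgebra R B) ⊗ₜ[R] SymmetricAlgebra.ι R B b)
    (fun x y => by rw [mul_zero, sgn_zero, one_smul, mul_comm]) l
  rw [baseProd, map_list_prod, List.map_map]
  refine (congrArg List.prod (List.map_congr_left fun b _ => baseComul_ι b)).trans (h.trans ?_)
  have h1 : ∀ S : List B, (S.map fun b => SymmetricAlgebra.ι R B b ⊗ₜ[R]
      (1 : SymmetricAlgebra R B)).prod = baseProd S ⊗ₜ 1 := fun S => by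
    induction S with
    | nil => rfl
    | cons b S ih =>
      rw [List.map_cons, List.prod_cons, ih, Algebra.TensorProduct.tmul_mul_tmul, mul_one]; rfl
  have h2 : ∀ S : List B, (S.map fun b => (1 : SymmetricAlgebra R B) ⊗ₜ[R]
      SymmetricAlgebra.ι R B b).prod = 1 ⊗ₜ baseProd S := fun S => by
    induction S with
    | nil => rfl
    | cons b S ih =>
      rw [List.map_cons, List.prod_cons, ih, Algebra.TensorProduct.tmul_mul_tmul, mul_one]; rfl
  refine unshuffleSum_congr' _ fun S T => ?_
  rw [h1, h2, Algebra.TensorProduct.tmul_mul_tmul, mul_one, one_mul]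

variable (F B) in
/-- The inclusion of forms into the first factor of the tensor square. -/
def formLeft : Form F (SymmetricAlgebra R B) →+*
    Form F (SymmetricAlgebra R B ⊗[R] SymmetricAlgebra R B) :=
  Form.mapRingHom (Algebra.TensorProduct.includeLeft (S := R))

variable (F B) in
/-- The inclusion into the second factor of the tensor square. -/
def formRight : Form F (SymmetricAlgebra R B) →+*
    Form F (SymmetricAlgebra R B ⊗[R] SymmetricAlgebra R B) :=
  Form.mapRingHom Algebra.TensorProduct.includeRight

theorem formLeft_mul_formRight {k m : ℤ} {a b : Form F (SymmetricAlgebra R B)}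
    (ha : a ∈ formDeg F _ k) (hb : b ∈ formDeg F _ m) :
    formLeft F B a * formRight F B b = sgn (k * m) • (formRight F B b * formLeft F B a) :=
  Form.mul_comm_of_mem (Form.map_mem _ ha) (Form.map_mem _ hb)

theorem mapRingHom_baseComul_ι (τ : Form F B) :
    Form.mapRingHom (baseComul B) (Form.map (SymmetricAlgebra.ι R B) τ)
      = formLeft F B (Form.map (SymmetricAlgebra.ι R B) τ)
        + formRight F B (Form.map (SymmetricAlgebra.ι R B) τ) :=
  Form.ext fun l => baseComul_ι (τ l)

namespace Frame

variable {n : ℕ} (φ : Frame F B n) (C : BaseConnection B)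

/-- The values of the operators corresponding to elements of the symmetric algebra. -/
def evalLin (f : R) : SymmetricAlgebra R B →ₗ[R] R := evalAt f ∘ₗ φ.baseLift C

/-- The product of values of the operators corresponding to elements of the symmetric algebra. -/
def evalPair (f g : R) : SymmetricAlgebra R B ⊗[R] SymmetricAlgebra R B →ₗ[R] R :=
  TensorProduct.lift ((LinearMap.mul R R).compl₁₂ (φ.evalLin C f) (φ.evalLin C g))

theorem evalLin_mul (f g : R) (s : SymmetricAlgebra R B) :
    φ.evalLin C (f * g) s = φ.evalPair C f g (baseComul B s) := by
  refine base_span_induction (p := fun s => φ.evalLin C (f * g) s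
    = φ.evalPair C f g (baseComul B s)) (by simp) (fun s t hs ht => by simp only [map_add, hs, ht])
    (fun r l => ?_) s
  rw [map_smul, map_smul, map_smul, baseComul_baseProd, map_unshuffleSum]
  exact congrArg _ (φ.basePbw_mul C l f g)

/-- The values of the operators corresponding to forms with values in the symmetric algebra. -/
def formEval (f : R) : Form F (SymmetricAlgebra R B) →ₗ[ℂ] Form F R := Form.map (φ.evalLin C f)

theorem formEval_one (f : R) : φ.formEval C f (1 : Form F (SymmetricAlgebra R B)) = pullback F f := by
  refine Form.ext fun l => ?_
  cases l with
  | nil => exact LinearMap.congr_fun (φ.basePbw_one C) f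
  | cons => exact map_zero _

theorem formEval_mem (f : R) {k : ℤ} {W : Form F (SymmetricAlgebra R B)} (hW : W ∈ formDeg F _ k) :
    φ.formEval C f W ∈ formDeg F R k := Form.map_mem _ hW

theorem formEval_mul (f g : R) (W : Form F (SymmetricAlgebra R B)) : φ.formEval C (f * g) W
    = Form.map (φ.evalPair C f g) (Form.mapRingHom (baseComul B) W) :=
  Form.ext fun l => φ.evalLin_mul C f g (W l)

theorem map_evalPair (f g : R) (a b : Form F (SymmetricAlgebra R B)) :
    Form.map (φ.evalPair C f g) (formLeft F B a * formRight F B b)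
      = φ.formEval C f a * φ.formEval C g b := by
  have h1 : ∀ l, wedge (LinearMap.mul R _) (formLeft F B a) (formRight F B b) l
      = wedge (TensorProduct.mk R _ _) (a : List F → SymmetricAlgebra R B) b l := fun l =>
    map_wedge (B := TensorProduct.mk R (SymmetricAlgebra R B) (SymmetricAlgebra R B))
      (B' := LinearMap.mul R (SymmetricAlgebra R B ⊗[R] SymmetricAlgebra R B))
      (g₁ := fun s => s ⊗ₜ 1) (g₂ := fun s => 1 ⊗ₜ s) (AddMonoidHom.id _)
      (fun m s => (TensorProduct.smul_tmul' m s 1).symm)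
      (fun x y => by
        change x ⊗ₜ[R] 1 * 1 ⊗ₜ[R] y = x ⊗ₜ[R] y
        rw [Algebra.TensorProduct.tmul_mul_tmul, mul_one, one_mul]) a b l
  refine Form.ext fun l => (congrArg (φ.evalPair C f g) (h1 l)).trans ?_
  exact (map_wedge (B := TensorProduct.mk R (SymmetricAlgebra R B) (SymmetricAlgebra R B))
    (B' := LinearMap.mul R R) (φ.evalPair C f g).toAddMonoidHom
    (fun m s => map_zsmul (φ.evalLin C f) m s) (fun x y => rfl) a b l).symm

theorem formEval_formProd (f g : R) (l : List (Homog (formDeg F B))) :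
    φ.formEval C (f * g) (formProd l) = unshuffleSum Homog.deg l fun S T =>
      φ.formEval C f (formProd S) * φ.formEval C g (formProd T) := by
  have h := unshuffleSum_prod_add (deg := Homog.deg (𝒱 := formDeg F B))
    (u := fun τ => formLeft F B (Form.map (SymmetricAlgebra.ι R B) τ.val))
    (w := fun τ => formRight F B (Form.map (SymmetricAlgebra.ι R B) τ.val))
    (fun x y => formLeft_mul_formRight (Form.map_mem _ x.val_mem) (Form.map_mem _ y.val_mem)) l
  have h1 : Form.mapRingHom (baseComul B) (formProd l) = (l.map fun τ =>
      formLeft F B (Form.map (SymmetricAlgebra.ι R B) τ.val)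
        + formRight F B (Form.map (SymmetricAlgebra.ι R B) τ.val)).prod := by
    rw [formProd, map_list_prod, List.map_map]
    exact congrArg List.prod (List.map_congr_left fun τ _ => mapRingHom_baseComul_ι τ.val)
  have hS : ∀ (g : Form F (SymmetricAlgebra R B) →+*
      Form F (SymmetricAlgebra R B ⊗[R] SymmetricAlgebra R B)) (S : List (Homog (formDeg F B))),
      (S.map fun τ => g (Form.map (SymmetricAlgebra.ι R B) τ.val)).prod = g (formProd S) :=
    fun g S => by rw [formProd, map_list_prod, List.map_map]; rfl
  rw [formEval_mul, h1, h, map_unshuffleSum]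
  refine unshuffleSum_congr' _ fun S T => ?_
  exact (congrArg₂ (fun a b => Form.map (φ.evalPair C f g) (a * b)) (hS (formLeft F B) S)
    (hS (formRight F B) T)).trans (φ.map_evalPair C f g _ _)

end Frame

end FormCoalgebra

section DolbeaultAlgebra

variable {R : Type*} [CommRing R] [Algebra ℂ R]
  {F : LieRinehartSubalgebra R (Derivation ℂ R R)} {B : Submodule R (Derivation ℂ R R)}

theorem dolbeaultBrackets_ev (q : SymmetricAlgebra R B ≃ₗ[R] TransDiffOp F)
    (l : List (Form F B)) : (dolbeaultBrackets q).ev l = Form.map (basePr B)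
      (dolbeaultDelta q (l.map (Form.map (SymmetricAlgebra.ι R B))).prod) :=
  multilinear_ev (Form.map (SymmetricAlgebra.ι R B)) (Form.map (basePr B) ∘ₗ dolbeaultDelta q) l

theorem dolbeaultBrackets_ev_val (q : SymmetricAlgebra R B ≃ₗ[R] TransDiffOp F)
    (l : List (Homog (formDeg F B))) : (dolbeaultBrackets q).ev (l.map Homog.val)
      = Form.map (basePr B) (dolbeaultDelta q (formProd l)) := by
  rw [dolbeaultBrackets_ev, List.map_map]; rfl

theorem dolbeaultDelta_apply (q : SymmetricAlgebra R B ≃ₗ[R] TransDiffOp F)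
    (W : Form F (SymmetricAlgebra R B)) : dolbeaultDelta q W
      = Form.map q.symm.toLinearMap ((FModule.trans F).d (Form.map q.toLinearMap W)) := rfl

theorem map_map_symm (q : SymmetricAlgebra R B ≃ₗ[R] TransDiffOp F) (D : Form F (TransDiffOp F)) :
    Form.map q.toLinearMap (Form.map q.symm.toLinearMap D) = D :=
  Form.ext fun l => q.apply_symm_apply (D l)

theorem map_symm_map (q : SymmetricAlgebra R B ≃ₗ[R] TransDiffOp F)
    (W : Form F (SymmetricAlgebra R B)) :
    Form.map q.symm.toLinearMap (Form.map q.toLinearMap W) = W :=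
  Form.ext fun l => q.symm_apply_apply (W l)

theorem dolbeaultDelta_dolbeaultDelta (q : SymmetricAlgebra R B ≃ₗ[R] TransDiffOp F)
    (W : Form F (SymmetricAlgebra R B)) : dolbeaultDelta q (dolbeaultDelta q W) = 0 := by
  rw [dolbeaultDelta_apply, dolbeaultDelta_apply, map_map_symm, FModule.d_d, map_zero]

theorem dolbeaultDelta_mem (q : SymmetricAlgebra R B ≃ₗ[R] TransDiffOp F) {k : ℤ}
    {W : Form F (SymmetricAlgebra R B)} (hW : W ∈ formDeg F _ k) :
    dolbeaultDelta q W ∈ formDeg F _ (1 + k) :=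
  Form.map_mem _ (FModule.d_mem _ (Form.map_mem _ hW))

/-- The bracket of homogeneous forms, as a homogeneous form. -/
def formBracket (q : SymmetricAlgebra R B ≃ₗ[R] TransDiffOp F) (l : List (Homog (formDeg F B))) :
    Homog (formDeg F B) :=
  Homog.mk (x := (dolbeaultBrackets q).ev (l.map Homog.val)) (d := 1 + (l.map Homog.deg).sum)
    (by rw [dolbeaultBrackets_ev_val]; exact Form.map_mem _ (dolbeaultDelta_mem q (formProd_mem l)))

namespace Frame

variable {n : ℕ} (φ : Frame F B n) (C : BaseConnection B)
  (hsep : ∀ f : R, (∀ p : LeafPoint F B, p.ev f = 0) → f = 0)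

theorem map_transPbwEquiv (W : Form F (SymmetricAlgebra R B)) :
    Form.map (φ.transPbwEquiv C hsep).toLinearMap W
      = Form.map (leafIdeal F).mkQ (Form.map (φ.baseLift C) W) := rfl

theorem map_symm_of_primitive (D : Form F (baseDiffOp R))
    (h : ∀ p : LeafPoint F B, ∀ ψ ∈ p.basic, ∀ χ ∈ p.basic,
      p.restrict (Form.map (evalAt (ψ * χ)) D)
        = p.restrict (Form.map (evalAt ψ) D) * p.restrict (pullback F χ)
          + p.restrict (pullback F ψ) * p.restrict (Form.map (evalAt χ) D)) :
    Form.map (φ.transPbwEquiv C hsep).symm.toLinearMap (Form.map (leafIdeal F).mkQ D)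
      = Form.map (SymmetricAlgebra.ι R B) (Form.map (basePr B)
        (Form.map (φ.transPbwEquiv C hsep).symm.toLinearMap (Form.map (leafIdeal F).mkQ D))) := by
  refine Form.ext fun l => φ.transPbwEquiv_symm_of_primitive C hsep (D l) fun p ψ hψ χ hχ => ?_
  have h1 := congrArg (fun τ : Form F p.Fiber => τ l) (h p ψ hψ χ hχ)
  rw [← map_mul, ← map_mul, ← map_add] at h1
  have h2 : (Form.map (evalAt ψ) D * pullback F χ) l = (D l : Module.End ℂ R) ψ * χ :=
    wedge_const_right (LinearMap.mul R R) _ χ l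
  have h3 : p.ev (((D l : Module.End ℂ R)) (ψ * χ)) = p.ev ((Form.map (evalAt ψ) D * pullback F χ) l
    + (pullback F ψ * Form.map (evalAt χ) D) l) := h1
  rw [h2, pullback_mul, map_add p.ev, map_mul p.ev, map_mul p.ev] at h3
  exact h3

/-- The differential of the operators corresponding to a product of sections of `B`. -/
def deltaProd (l : List (Homog (formDeg F B))) : Form F (baseDiffOp R) :=
  (FModule.base F).d (Form.map (φ.baseLift C) (formProd l))

theorem evalAt_deltaProd (f : R) (l : List (Homog (formDeg F B))) :
    Form.map (evalAt f) (φ.deltaProd C l) = dF F (φ.formEval C f (formProd l)) :=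
  map_evalAt_d f _

theorem dF_formEval_mul (f g : R) (l : List (Homog (formDeg F B))) :
    dF F (φ.formEval C (f * g) (formProd l)) = unshuffleSum Homog.deg l fun S T =>
      dF F (φ.formEval C f (formProd S)) * φ.formEval C g (formProd T)
      + sgn (S.map Homog.deg).sum •
        (φ.formEval C f (formProd S) * dF F (φ.formEval C g (formProd T))) := by
  rw [formEval_formProd, map_unshuffleSum]
  refine unshuffleSum_congr' _ fun S T => ?_
  rw [dF_mul, parity_of_mem (φ.formEval_mem C f (formProd_mem S)), smul_mul_assoc]

set_option maxHeartbeats 1000000 in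
theorem dolbeaultDelta_formProd (l : List (Homog (formDeg F B))) :
    dolbeaultDelta (φ.transPbwEquiv C hsep) (formProd l) = unshuffleSum Homog.deg l fun S T =>
      formProd (formBracket (φ.transPbwEquiv C hsep) S :: T) := by
  classical
  induction hN : l.length using Nat.strong_induction_on generalizing l with
  | _ N ih =>
  set q := φ.transPbwEquiv C hsep with hq
  let lam' : List (Homog (formDeg F B)) → Homog (formDeg F B) := fun S =>
    if S.length < N then formBracket q S
    else Homog.mk (Submodule.zero_mem (formDeg F B (1 + (S.map Homog.deg).sum)))
  have hdeg : ∀ S, (lam' S).deg = 1 + (S.map Homog.deg).sum := fun S => by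
    simp only [lam']; split_ifs <;> rfl
  have hlt : ∀ S, S.length < N → lam' S = formBracket q S := fun S h => if_pos h
  have hge : ∀ S, ¬ S.length < N → (lam' S).val = 0 := fun S h => by
    simp only [lam', if_neg h]; rfl
  obtain ⟨M', hMdef⟩ : ∃ M' : List (Homog (formDeg F B)) → Form F (SymmetricAlgebra R B),
      ∀ l, M' l = unshuffleSum Homog.deg l fun S T => formProd (lam' S :: T) := ⟨_, fun _ => rfl⟩
  have hdelta : ∀ S, Form.map q.toLinearMap (dolbeaultDelta q (formProd S))
      = Form.map (leafIdeal F).mkQ (φ.deltaProd C S) := fun S => by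
    rw [dolbeaultDelta_apply, map_map_symm, hq, map_transPbwEquiv, trans_d_map_mkQ]; rfl
  have hM' : ∀ S, S.length < N → dolbeaultDelta q (formProd S) = M' S := fun S h => by
    rw [ih S.length h S rfl, hMdef]
    exact unshuffleSum_congr _ fun S₁ S₂ hS _ => by rw [hlt S₁ (by omega)]
  obtain ⟨E, hEdef⟩ : ∃ E : Form F (baseDiffOp R),
      E = φ.deltaProd C l - Form.map (φ.baseLift C) (M' l) := ⟨_, rfl⟩
  have hE : Form.map q.symm.toLinearMap (Form.map (leafIdeal F).mkQ E)
      = dolbeaultDelta q (formProd l) - M' l := by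
    rw [hEdef, map_sub, map_sub, ← hdelta, map_symm_map, ← φ.map_transPbwEquiv C hsep, ← hq,
      map_symm_map]
  have hprim := φ.map_symm_of_primitive C hsep E ?_
  swap
  · intro p ψ hψ χ hχ
    have hval : ∀ f, p.restrict (Form.map (evalAt f) E)
        = p.restrict (dF F (φ.formEval C f (formProd l)))
          - p.restrict (φ.formEval C f (M' l)) := fun f => by
      rw [hEdef, ← evalAt_deltaProd, ← map_sub, map_sub]; rfl
    have hMf : ∀ f l, φ.formEval C f (M' l)
        = unshuffleSum Homog.deg l fun S T => φ.formEval C f (formProd (lam' S :: T)) :=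
      fun f l => by rw [hMdef, map_unshuffleSum]
    have hMmul : φ.formEval C (ψ * χ) (M' l) = unshuffleSum Homog.deg l fun S T =>
        φ.formEval C ψ (M' S) * φ.formEval C χ (formProd T)
        + sgn (S.map Homog.deg).sum •
          (φ.formEval C ψ (formProd S) * φ.formEval C χ (M' T)) := by
      simp only [hMf]
      refine (unshuffleSum_insert (κ := 0) (p := fun l => φ.formEval C ψ (formProd l))
        (q := fun l => φ.formEval C χ (formProd l)) (r := fun l => φ.formEval C (ψ * χ) (formProd l))
        (lam := lam') hdeg (fun l => ?_) l).trans (unshuffleSum_congr' _ fun S T => ?_)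
      · simp only [zero_mul, sgn_zero, one_smul, formEval_formProd]
      · simp only [zero_mul, sgn_zero, one_smul, zero_add]
    have hlow : ∀ f ∈ p.basic, ∀ S, S.length < N → p.restrict (dF F (φ.formEval C f (formProd S)))
        = p.restrict (φ.formEval C f (M' S)) := fun f hf S hS => by
      rw [← evalAt_deltaProd]
      refine p.restrict_congr (D' := Form.map (φ.baseLift C) (M' S)) ?_ hf
      rw [← hdelta, hM' S hS]; rfl
    have h1 : (unshuffleSum Homog.deg l fun S T => if T = [] then
        (p.restrict (dF F (φ.formEval C ψ (formProd S))) - p.restrict (φ.formEval C ψ (M' S)))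
          * p.restrict (φ.formEval C χ (formProd T)) else 0)
        = p.restrict (Form.map (evalAt ψ) E) * p.restrict (pullback F χ) := by
      rw [unshuffleSum_eq_left _ _ _ fun S T hT => if_neg hT, if_pos rfl, formProd_nil,
        formEval_one, hval]
    have h2 : (unshuffleSum Homog.deg l fun S T => if S = [] then
        p.restrict (φ.formEval C ψ (formProd S))
          * (p.restrict (dF F (φ.formEval C χ (formProd T))) - p.restrict (φ.formEval C χ (M' T)))
          else 0)
        = p.restrict (pullback F ψ) * p.restrict (Form.map (evalAt χ) E) := by
      rw [unshuffleSum_eq_right _ _ _ fun S T hS => if_neg hS, if_pos rfl, formProd_nil,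
        formEval_one, hval]
    rw [hval, dF_formEval_mul, hMmul, ← h1, ← h2, ← map_sub, ← unshuffleSum_sub, map_unshuffleSum,
      ← unshuffleSum_add]
    refine unshuffleSum_congr _ fun S T hST _ => ?_
    rw [add_sub_add_comm, ← smul_sub, ← sub_mul, ← mul_sub, map_add, map_zsmul, map_mul, map_mul,
      map_sub, map_sub]
    congr 1
    · split_ifs with hT
      · rfl
      · have := List.length_pos_iff.mpr hT
        rw [hlow ψ hψ S (by omega), sub_self, zero_mul]
    · split_ifs with hS
      · rw [hS, List.map_nil, List.sum_nil, sgn_zero, one_smul]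
      · have := List.length_pos_iff.mpr hS
        rw [hlow χ hχ T (by omega), sub_self, mul_zero, smul_zero]
  have hpr : Form.map (basePr B) (M' l) = 0 := by
    rw [hMdef, map_unshuffleSum, unshuffleSum_eq_left]
    · rw [formProd_cons, hge l (by omega), map_zero, zero_mul, map_zero]
    · intro S T hT
      obtain ⟨x, T, rfl⟩ := List.exists_cons_of_ne_nil hT
      rw [formProd_cons, formProd_cons, map_basePr_mul_mul]
  have hb : dolbeaultDelta q (formProd l) - M' l
      = Form.map (SymmetricAlgebra.ι R B) (formBracket q l).val := by
    rw [← hq, hE, map_sub, hpr, sub_zero, ← dolbeaultBrackets_ev_val] at hprim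
    exact hprim
  have h3 : (unshuffleSum Homog.deg l fun S T => if T = [] then
      Form.map (SymmetricAlgebra.ι R B) (formBracket q S).val
        - Form.map (SymmetricAlgebra.ι R B) (lam' S).val else 0)
      = dolbeaultDelta q (formProd l) - M' l := by
    rw [unshuffleSum_eq_left _ _ _ fun S T hT => if_neg hT, if_pos rfl, hge l (by omega), map_zero,
      sub_zero, hb]
  rw [← sub_add_cancel (dolbeaultDelta q (formProd l)) (M' l), ← h3, hMdef,
    ← unshuffleSum_add]
  refine unshuffleSum_congr _ fun S T hST _ => ?_
  rw [formProd_cons, formProd_cons]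
  split_ifs with hT
  · rw [hT, formProd_nil, mul_one, mul_one, sub_add_cancel]
  · have := List.length_pos_iff.mpr hT
    rw [hlt S (by omega), zero_add]

theorem dolbeaultDelta_one : dolbeaultDelta (φ.transPbwEquiv C hsep) 1 = 0 := by
  have h : Form.map (φ.transPbwEquiv C hsep).toLinearMap (1 : Form F (SymmetricAlgebra R B))
      = Form.const (φ.transPbwEquiv C hsep 1) := Form.ext fun l => by
    cases l with
    | nil => rfl
    | cons => exact map_zero _
  rw [dolbeaultDelta_apply, h, FModule.d_const _ fun v => φ.transHom_one C v, map_zero]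

theorem dolbeaultBrackets_zero : dolbeaultBrackets (φ.transPbwEquiv C hsep) 0 = 0 := by
  refine MultilinearMap.ext fun m => ?_
  have h := dolbeaultBrackets_ev (φ.transPbwEquiv C hsep) []
  rw [List.map_nil, List.prod_nil, dolbeaultDelta_one, map_zero] at h
  rw [zero_apply, ← h, Subsingleton.elim m ([] : List (Form F B)).get]
  rfl

theorem isLInfty_dolbeault :
    IsLInfty (formDeg F B) (dolbeaultBrackets (φ.transPbwEquiv C hsep)) where
  internal := φ.isInternal_formDeg
  zero := φ.dolbeaultBrackets_zero C hsep
  degree l := (formBracket (φ.transPbwEquiv C hsep) l).val_mem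
  symm l₁ x y l₂ := by
    rw [dolbeaultBrackets_ev_val, dolbeaultBrackets_ev_val, formProd_swap, map_zsmul, map_zsmul]
  jacobi l := by
    have h1 := congrArg (Form.map (basePr B))
      (dolbeaultDelta_dolbeaultDelta (φ.transPbwEquiv C hsep) (formProd l))
    rw [dolbeaultDelta_formProd, map_unshuffleSum, map_unshuffleSum, map_zero] at h1
    rw [← h1]
    refine unshuffleSum_congr' _ fun S T => ?_
    rw [← dolbeaultBrackets_ev_val]
    rfl

variable (F) in
/-- The natural map from the normal bundle to transversal differential operators. -/
def _root_.KapranovDolbeault.normalOp : NormalBundle F →ₗ[R] TransDiffOp F :=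
  F.toSubmodule.liftQ
    ((leafIdeal F).mkQ ∘ₗ
      { toFun := fun X => derMul X ⟨1, one_mem_baseDiffOp⟩
        map_add' := fun X Y => Subtype.ext (add_mul _ _ _)
        map_smul' := fun f X => Subtype.ext (LinearMap.ext fun x => rfl) })
    fun X hX => (Submodule.Quotient.mk_eq_zero _).mpr <| Submodule.subset_span
      ⟨1, one_mem_baseDiffOp, ⟨X, hX⟩, (mul_one (derOp X)).trans (one_mul (derOp X)).symm⟩

theorem transPbwEquiv_ι (b : B) : φ.transPbwEquiv C hsep (SymmetricAlgebra.ι R B b)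
    = normalOp F (F.toSubmodule.mkQ b) := by
  have h := φ.transPbw_recursion C [b]
  rw [pickSum_cons, baseProd_nil, BaseConnection.nablaProd, map_zero, sub_zero, transPbw_one,
    List.length_singleton, one_smul, baseProd_cons, baseProd_nil, mul_one] at h
  exact h.trans (add_zero _)

theorem normalOp_bott (v : F) (m : NormalBundle F) :
    normalOp F ((FModule.bott F).act v m) = (FModule.trans F).act v (normalOp F m) := by
  induction m using Submodule.Quotient.induction_on with | _ X
  refine (Submodule.Quotient.eq _).mpr ?_
  refine (leafIdeal F).neg_mem_iff.mp (Submodule.subset_span ⟨derOp X, ?_, v, ?_⟩)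
  · have := (derMul X ⟨1, one_mem_baseDiffOp⟩).2
    rwa [show ((derMul X ⟨1, one_mem_baseDiffOp⟩ : baseDiffOp R) : Module.End ℂ R)
      = derOp X from mul_one (derOp X)] at this
  · refine LinearMap.ext fun f => ?_
    change -(⁅(v : Derivation ℂ R R), X⁆ f - (v : Derivation ℂ R R) (X f)) = X _
    rw [Derivation.commutator_apply]; abel

theorem mkQ_basePr_symm_normalOp (m : NormalBundle F) : F.toSubmodule.mkQ
    (basePr B ((φ.transPbwEquiv C hsep).symm (normalOp F m))) = m := by
  obtain ⟨X, rfl⟩ := F.toSubmodule.mkQ_surjective m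
  obtain ⟨v, b, rfl⟩ := φ.exists_decomposition X
  rw [map_add, show F.toSubmodule.mkQ (v : Derivation ℂ R R) = 0 from
    (Submodule.Quotient.mk_eq_zero _).mpr v.2, zero_add, ← φ.transPbwEquiv_ι C hsep,
    LinearEquiv.symm_apply_apply, basePr_ι]

/-- The linear bracket on the Dolbeault complex is the Chevalley–Eilenberg differential of the
Bott connection. -/
theorem dolbeaultBrackets_one (η : Form F B) :
    Form.map (F.toSubmodule.mkQ ∘ₗ B.subtype) ((dolbeaultBrackets (φ.transPbwEquiv C hsep)).ev [η])
      = (FModule.bott F).d (Form.map (F.toSubmodule.mkQ ∘ₗ B.subtype) η) := by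
  have h1 : Form.map (φ.transPbwEquiv C hsep).toLinearMap (Form.map (SymmetricAlgebra.ι R B) η)
      = Form.map (normalOp F) (Form.map (F.toSubmodule.mkQ ∘ₗ B.subtype) η) :=
    Form.ext fun l => φ.transPbwEquiv_ι C hsep (η l)
  rw [dolbeaultBrackets_ev, List.map_singleton, List.prod_singleton, dolbeaultDelta_apply, h1,
    FModule.d_map (ρ := FModule.bott F) (normalOp F) normalOp_bott]
  exact Form.ext fun l => φ.mkQ_basePr_symm_normalOp C hsep _

end Frame

end DolbeaultAlgebra

/-! ### The comparison map -/

section Comparison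

variable {R : Type*} [CommRing R] [Algebra ℂ R]
  {F : LieRinehartSubalgebra R (Derivation ℂ R R)} {B : Submodule R (Derivation ℂ R R)}

theorem convExp_congr {ι 𝒜 : Type*} [Ring 𝒜] {deg : ι → ℤ} {u w : List ι → 𝒜} {N : ℕ}
    (h : ∀ S : List ι, S.length < N → u S = w S) (l : List ι) (hl : l.length < N) :
    convExp deg u l = convExp deg w l := by
  induction hn : l.length using Nat.strong_induction_on generalizing l with
  | _ n ih =>
  cases l with
  | nil => rw [convExp_nil, convExp_nil]
  | cons x l =>
    rw [List.length_cons] at hl hn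
    rw [convExp_cons, convExp_cons]
    refine unshuffleSum_congr _ fun S T hST _ => ?_
    rw [h _ (by rw [List.length_cons]; omega), ih T.length (by omega) T (by omega) rfl]

theorem pushforward_mem {k : ℤ} {D : GrDiffOp F} (hD : HasDegree k (D : FormEnd F R)) :
    pushforward D ∈ formDeg F (baseDiffOp R) k := fun l hl => by
  refine Subtype.ext (LinearMap.ext fun f => ?_)
  exact hD 0 _ (by simpa using pullback_mem (F := F) f) l (by simpa using hl)

theorem comparison_apply (p : SymVF F ≃ₗ[ℂ] GrDiffOp F) (q : SymmetricAlgebra R B ≃ₗ[R] TransDiffOp F)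
    (s : SymVF F) : comparison p q s
      = Form.map q.symm.toLinearMap (Form.map (leafIdeal F).mkQ (pushforward (p s))) := rfl

theorem comparisonMaps_ev (p : SymVF F ≃ₗ[ℂ] GrDiffOp F)
    (q : SymmetricAlgebra R B ≃ₗ[R] TransDiffOp F) (l : List (VF F)) : (comparisonMaps p q).ev l
      = Form.map (basePr B) (comparison p q (l.map (SymVF.ofVF (F := F))).prod) :=
  multilinear_ev (SymVF.ofVF (F := F)) (Form.map (basePr B) ∘ₗ comparison p q) l

theorem comparisonMaps_ev_val (p : SymVF F ≃ₗ[ℂ] GrDiffOp F)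
    (q : SymmetricAlgebra R B ≃ₗ[R] TransDiffOp F) (l : List (Homog (vfDeg F))) :
    (comparisonMaps p q).ev (l.map Homog.val)
      = Form.map (basePr B) (comparison p q (symProd l)) := by
  rw [comparisonMaps_ev, List.map_map]; rfl

theorem pushforwardVF_apply (V : VF F) (l : List F) (f : R) :
    pushforwardVF V l f = (V : FormEnd F R) (pullback F f) l := rfl

namespace Frame

variable {n : ℕ} (φ : Frame F B n) (A : AffineConnection F) (C : BaseConnection B)
  (hsep : ∀ f : R, (∀ p : LeafPoint F B, p.ev f = 0) → f = 0)

theorem comparison_mem (q : SymmetricAlgebra R B ≃ₗ[R] TransDiffOp F)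
    (l : List (Homog (vfDeg F))) : comparison (φ.pbwEquiv A) q (symProd l)
      ∈ formDeg F (SymmetricAlgebra R B) (l.map Homog.deg).sum :=
  Form.map_mem _ (Form.map_mem _ (pushforward_mem (φ.pbwProd_hasDegree A l)))

theorem comparisonMaps_mem (q : SymmetricAlgebra R B ≃ₗ[R] TransDiffOp F)
    (l : List (Homog (vfDeg F))) : (comparisonMaps (φ.pbwEquiv A) q).ev (l.map Homog.val)
      ∈ formDeg F B (l.map Homog.deg).sum := by
  rw [comparisonMaps_ev_val]; exact Form.map_mem _ (φ.comparison_mem A q l)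

theorem comparison_one :
    comparison (φ.pbwEquiv A) (φ.transPbwEquiv C hsep) (symProd []) = 1 := by
  rw [comparison_apply]
  have h : Form.map (leafIdeal F).mkQ (pushforward (φ.pbwEquiv A (symProd [])))
      = Form.map (φ.transPbwEquiv C hsep).toLinearMap 1 := by
    rw [map_transPbwEquiv]
    refine congrArg (Form.map (leafIdeal F).mkQ) (Form.ext fun l =>
      Subtype.ext (LinearMap.ext fun f => ?_))
    change φ.pbwProd A [] (pullback F f) l = φ.formEval C f 1 l
    rw [pbwProd_nil, formEval_one]; rfl
  rw [h, map_symm_map]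

theorem formEval_convExp {ι : Type*} {deg : ι → ℤ} {u : List ι → Form F B}
    (hu : ∀ S, u S ∈ formDeg F B (S.map deg).sum) (f g : R) (l : List ι) :
    φ.formEval C (f * g) (convExp deg (fun S => Form.map (SymmetricAlgebra.ι R B) (u S)) l)
      = unshuffleSum deg l fun S T =>
        φ.formEval C f (convExp deg (fun S => Form.map (SymmetricAlgebra.ι R B) (u S)) S)
        * φ.formEval C g (convExp deg (fun S => Form.map (SymmetricAlgebra.ι R B) (u S)) T) := by
  have h := convExp_add (deg := deg)
    (u := fun S => formLeft F B (Form.map (SymmetricAlgebra.ι R B) (u S)))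
    (w := fun S => formRight F B (Form.map (SymmetricAlgebra.ι R B) (u S)))
    (fun S T => formLeft_mul_formRight (Form.map_mem _ (hu S)) (Form.map_mem _ (hu T))) l
  rw [formEval_mul, map_convExp]
  simp only [mapRingHom_baseComul_ι]
  rw [h, map_unshuffleSum]
  refine unshuffleSum_congr' _ fun S T => ?_
  rw [← map_convExp (formLeft F B), ← map_convExp (formRight F B), map_evalPair]

set_option maxHeartbeats 1000000 in
theorem comparison_symProd (l : List (Homog (vfDeg F))) :
    comparison (φ.pbwEquiv A) (φ.transPbwEquiv C hsep) (symProd l)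
      = convExp Homog.deg (fun S => Form.map (SymmetricAlgebra.ι R B)
        ((comparisonMaps (φ.pbwEquiv A) (φ.transPbwEquiv C hsep)).ev (S.map Homog.val))) l := by
  classical
  induction hN : l.length using Nat.strong_induction_on generalizing l with
  | _ N ih =>
  by_cases hl0 : l = []
  · rw [hl0, convExp_nil, comparison_one]
  set q := φ.transPbwEquiv C hsep with hq
  set u : List (Homog (vfDeg F)) → Form F B := fun S =>
    (comparisonMaps (φ.pbwEquiv A) q).ev (S.map Homog.val) with hu
  let u' : List (Homog (vfDeg F)) → Form F B := fun S => if S.length < N then u S else 0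
  have hmem : ∀ S, u' S ∈ formDeg F B (S.map Homog.deg).sum := fun S => by
    simp only [u']
    split_ifs
    · exact φ.comparisonMaps_mem A q S
    · exact Submodule.zero_mem _
  have hlt : ∀ S : List (Homog (vfDeg F)), S.length < N → u' S = u S := fun S h => if_pos h
  have hge : ∀ S : List (Homog (vfDeg F)), ¬ S.length < N → u' S = 0 := fun S h => if_neg h
  obtain ⟨W, hW⟩ : ∃ W : List (Homog (vfDeg F)) → Form F (SymmetricAlgebra R B), W = convExp
      Homog.deg (fun S => Form.map (SymmetricAlgebra.ι R B) (u' S)) := ⟨_, rfl⟩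
  have hWlt : ∀ S, S.length < N → W S = comparison (φ.pbwEquiv A) q (symProd S) := fun S h => by
    rw [hW, ih S.length h S rfl]
    exact convExp_congr (N := N) (fun S h => by rw [hlt S h]) S h
  obtain ⟨E, hE⟩ : ∃ E : Form F (baseDiffOp R), E = pushforward (φ.pbwEquiv A (symProd l))
      - Form.map (φ.baseLift C) (W l) := ⟨_, rfl⟩
  have hEq : Form.map q.symm.toLinearMap (Form.map (leafIdeal F).mkQ E)
      = comparison (φ.pbwEquiv A) q (symProd l) - W l := by
    rw [hE, map_sub, map_sub, ← φ.map_transPbwEquiv C hsep, ← hq, map_symm_map]; rfl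
  have hprim := φ.map_symm_of_primitive C hsep E ?_
  swap
  · intro p ψ hψ χ hχ
    have hval : ∀ f, p.restrict (Form.map (evalAt f) E) = p.restrict (φ.pbwProd A l (pullback F f))
        - p.restrict (φ.formEval C f (W l)) := fun f => by
      rw [hE, map_sub, map_sub]; rfl
    have hlow : ∀ f ∈ p.basic, ∀ S, S.length < N → p.restrict (φ.pbwProd A S (pullback F f))
        = p.restrict (φ.formEval C f (W S)) := fun f hf S hS => by
      refine p.restrict_congr (D := pushforward (φ.pbwEquiv A (symProd S)))
        (D' := Form.map (φ.baseLift C) (W S)) ?_ hf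
      rw [← φ.map_transPbwEquiv C hsep, hWlt S hS, comparison_apply, map_map_symm]
    have hW0 : W [] = 1 := by rw [hW, convExp_nil]
    have h1 : (unshuffleSum Homog.deg l fun S T => if T = [] then
        (p.restrict (φ.pbwProd A S (pullback F ψ)) - p.restrict (φ.formEval C ψ (W S)))
          * p.restrict (pullback F χ) else 0)
        = p.restrict (Form.map (evalAt ψ) E) * p.restrict (pullback F χ) := by
      rw [unshuffleSum_eq_left _ _ _ fun S T hT => if_neg hT, if_pos rfl, hval]
    have h2 : (unshuffleSum Homog.deg l fun S T => if S = [] then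
        p.restrict (pullback F ψ)
          * (p.restrict (φ.pbwProd A T (pullback F χ)) - p.restrict (φ.formEval C χ (W T)))
          else 0)
        = p.restrict (pullback F ψ) * p.restrict (Form.map (evalAt χ) E) := by
      rw [unshuffleSum_eq_right _ _ _ fun S T hS => if_neg hS, if_pos rfl, hval]
    have h3 : φ.formEval C (ψ * χ) (W l) = unshuffleSum Homog.deg l fun S T =>
        φ.formEval C ψ (W S) * φ.formEval C χ (W T) := by
      rw [hW]; exact φ.formEval_convExp C hmem ψ χ l
    rw [hval, pullback_mul_pullback, φ.pbwProd_mul A (by simpa using pullback_mem (F := F) ψ :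
      pullback F ψ ∈ formDeg F R (0 : ℤ)), h3, ← h1, ← h2, ← map_sub, ← unshuffleSum_sub,
      map_unshuffleSum, ← unshuffleSum_add]
    refine unshuffleSum_congr _ fun S T hST _ => ?_
    rw [zero_mul, sgn_zero, one_smul, map_sub, map_mul, map_mul]
    by_cases hT : T = []
    · have hS : S ≠ [] := by
        rintro rfl
        rw [hT] at hST
        exact hl0 (List.length_eq_zero_iff.mp hST.symm)
      rw [if_pos hT, if_neg hS, hT, hW0, pbwProd_nil, formEval_one, add_zero, sub_mul]; rfl
    · have h4 := List.length_pos_iff.mpr hT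
      rw [if_neg hT, hlow ψ hψ S (by omega)]
      by_cases hS : S = []
      · rw [if_pos hS, hS, hW0, formEval_one, zero_add, mul_sub]
      · have h5 := List.length_pos_iff.mpr hS
        rw [if_neg hS, hlow χ hχ T (by omega), sub_self, zero_add]
  obtain ⟨x, t, rfl⟩ := List.exists_cons_of_ne_nil hl0
  rw [List.length_cons] at hN
  have hpr : Form.map (basePr B) (W (x :: t)) = 0 := by
    rw [hW, convExp_cons, map_unshuffleSum, unshuffleSum_eq_left]
    · rw [hge _ (by rw [List.length_cons]; omega), map_zero, zero_mul, map_zero]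
    · intro S T hT
      obtain ⟨y, T, rfl⟩ := List.exists_cons_of_ne_nil hT
      rw [convExp_cons, mul_unshuffleSum, map_unshuffleSum, ← unshuffleSum_zero Homog.deg T]
      exact unshuffleSum_congr' _ fun S' T' => map_basePr_mul_mul _ _ _
  have hb : comparison (φ.pbwEquiv A) q (symProd (x :: t)) - W (x :: t)
      = Form.map (SymmetricAlgebra.ι R B) (u (x :: t)) := by
    rw [← hq, hEq, map_sub, hpr, sub_zero, ← comparisonMaps_ev_val] at hprim
    exact hprim
  have h3 : (unshuffleSum Homog.deg t fun S T => if T = [] then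
      Form.map (SymmetricAlgebra.ι R B) (u (x :: S))
        - Form.map (SymmetricAlgebra.ι R B) (u' (x :: S)) else 0)
      = Form.map (SymmetricAlgebra.ι R B) (u (x :: t)) := by
    rw [unshuffleSum_eq_left _ _ _ fun S T hT => if_neg hT, if_pos rfl,
      hge _ (by rw [List.length_cons]; omega), map_zero, sub_zero]
  rw [← sub_add_cancel (comparison (φ.pbwEquiv A) q (symProd (x :: t))) (W (x :: t)), hb, ← h3, hW,
    convExp_cons, convExp_cons, ← unshuffleSum_add]
  refine unshuffleSum_congr _ fun S T hST _ => ?_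
  have hT' := convExp_congr (deg := Homog.deg) (N := N)
    (u := fun S => Form.map (SymmetricAlgebra.ι R B) (u' S))
    (w := fun S => Form.map (SymmetricAlgebra.ι R B) (u S)) (fun S h => by rw [hlt S h]) T (by omega)
  rw [hT']
  split_ifs with hT
  · rw [hT, convExp_nil, mul_one, mul_one, sub_add_cancel]
  · have := List.length_pos_iff.mpr hT
    rw [hlt _ (by rw [List.length_cons]; omega), zero_add]

end Frame

end Comparison

section QuasiIsomorphism

variable {R : Type*} [CommRing R] [Algebra ℂ R]
  {F : LieRinehartSubalgebra R (Derivation ℂ R R)} {B : Submodule R (Derivation ℂ R R)}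

theorem act_evalAt (a : Form F R) (D : Form F (baseDiffOp R)) (f : R) :
    Form.map (evalAt f) (Form.act a D) = a * Form.map (evalAt f) D :=
  Form.map_act (evalAt f) a D

theorem pushforward_mulLeft {a : Form F R} {D D' : GrDiffOp F}
    (h : (D' : FormEnd F R) = LinearMap.mulLeft ℂ a * (D : FormEnd F R)) :
    pushforward D' = Form.act a (pushforward D) := by
  refine Form.ext fun l => Subtype.ext (LinearMap.ext fun f => ?_)
  have h1 := congrArg (fun τ : Form F R => τ l) (act_evalAt a (pushforward D) f)
  refine Eq.trans ?_ h1.symm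
  change (D' : FormEnd F R) (pullback F f) l = _
  rw [h]; rfl

namespace Frame

variable {n : ℕ} (φ : Frame F B n) (A : AffineConnection F) (C : BaseConnection B)
  (hsep : ∀ f : R, (∀ p : LeafPoint F B, p.ev f = 0) → f = 0)

include φ in
/-- Composition with `Q` from the right vanishes along the leaves. -/
theorem mkQ_pushforward_mul_dF {D D' : GrDiffOp F} (h : (D' : FormEnd F R)
    = (D : FormEnd F R) * dF F) :
    Form.map (leafIdeal F).mkQ (pushforward D') = 0 := by
  refine Form.ext fun l => (Submodule.Quotient.mk_eq_zero _).mpr ?_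
  obtain ⟨m, hm⟩ := mem_grDiffOp.mp D.2
  have hw : ∀ i, evalOp l ((D : FormEnd F R) * LinearMap.mulLeft ℂ (φ.theta i))
      ∈ baseDiffOp R := fun i =>
    mem_baseDiffOp.mpr ⟨_, evalOp_mem (diffOpLT_mul hm (mulLeft_mem (φ.theta i))) l⟩
  have hc : ∀ i, derOp (φ.e i : Derivation ℂ R R) ∈ baseDiffOp R := fun i => by
    have := (derMul (φ.e i : Derivation ℂ R R) ⟨1, one_mem_baseDiffOp⟩).2
    rwa [show ((derMul (φ.e i : Derivation ℂ R R) ⟨1, one_mem_baseDiffOp⟩ : baseDiffOp R) :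
      Module.End ℂ R) = derOp (φ.e i : Derivation ℂ R R) from mul_one _] at this
  have hmul : ∀ i, evalOp l ((D : FormEnd F R) * LinearMap.mulLeft ℂ (φ.theta i))
      * derOp (φ.e i : Derivation ℂ R R) ∈ baseDiffOp R := fun i => by
    obtain ⟨k, hk⟩ := mem_baseDiffOp.mp (hw i)
    generalize evalOp l _ = w at hk
    have key : ∀ k, ∀ w ∈ baseDiffOpLT R k,
        w * derOp (φ.e i : Derivation ℂ R R) ∈ baseDiffOpLT R (k + 1) := by
      intro k
      induction k with
      | zero => intro w hw; rw [show w = 0 from hw, zero_mul]; exact Submodule.zero_mem _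
      | succ k ih =>
        intro w hw
        rw [mem_baseDiffOpLT_succ]
        intro f
        rw [commFun_mul, commFun_derOp, show w * ((φ.e i : Derivation ℂ R R) f • 1)
          = (φ.e i : Derivation ℂ R R) f • w + commFun ((φ.e i : Derivation ℂ R R) f) w from
            LinearMap.ext fun g => by
              change w ((φ.e i : Derivation ℂ R R) f * g) = (φ.e i : Derivation ℂ R R) f * w g
                + (w ((φ.e i : Derivation ℂ R R) f * g) - (φ.e i : Derivation ℂ R R) f * w g)
              ring]
        exact Submodule.add_mem _ (Submodule.add_mem _ (Submodule.smul_mem _ _ hw)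
          (baseDiffOpLT_mono (Nat.le_succ k) (mem_baseDiffOpLT_succ.mp hw _)))
          (ih _ (mem_baseDiffOpLT_succ.mp hw f))
    exact mem_baseDiffOp.mpr ⟨_, key k w hk⟩
  have hsum : pushforward D' l = ∑ i, (⟨_, hmul i⟩ : baseDiffOp R) := by
    refine Subtype.ext (LinearMap.ext fun f => ?_)
    rw [Submodule.coe_sum, LinearMap.sum_apply]
    change (D' : FormEnd F R) (pullback F f) l = _
    rw [h, Module.End.mul_apply, φ.dF_pullback, map_sum, Form.sum_apply]
    rfl
  rw [hsum]
  exact Submodule.sum_mem _ fun i _ => Submodule.subset_span ⟨_, hw i, φ.e i, rfl⟩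

include φ in
theorem comparison_kapranovDelta (p : SymVF F ≃ₗ[ℂ] GrDiffOp F)
    (q : SymmetricAlgebra R B ≃ₗ[R] TransDiffOp F) (s : SymVF F) :
    comparison p q (kapranovDelta p s) = dolbeaultDelta q (comparison p q s) := by
  rw [dolbeaultDelta_apply, comparison_apply, comparison_apply, map_map_symm, trans_d_map_mkQ]
  refine congrArg _ ?_
  have h1 : p (kapranovDelta p s) = adQ (p s) := p.apply_symm_apply _
  rw [h1]
  obtain ⟨m, hm⟩ := mem_grDiffOp.mp (p s).2
  have h2 : (opParity F (p s) * dF F : FormEnd F R) ∈ GrDiffOp F :=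
    mem_grDiffOp.mpr ⟨_, diffOpLT_mul (opParity_mem hm) dF_mem⟩
  have h3 := φ.mkQ_pushforward_mul_dF (D := ⟨_, mem_grDiffOp.mpr ⟨_, opParity_mem hm⟩⟩)
    (D' := ⟨_, h2⟩) rfl
  have h4 : pushforward (adQ (p s)) = (FModule.base F).d (pushforward (p s))
      - pushforward ⟨_, h2⟩ := by
    refine Form.ext fun l => Subtype.ext (LinearMap.ext fun f => ?_)
    have h5 := congrArg (fun τ : Form F R => τ l) (map_evalAt_d f (pushforward (p s)))
    change dF F ((p s : FormEnd F R) (pullback F f)) l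
      - (opParity F (p s)) (dF F (pullback F f)) l
      = Form.map (evalAt f) ((FModule.base F).d (pushforward (p s))) l
        - (opParity F (p s)) (dF F (pullback F f)) l
    exact congrArg (· - _) h5.symm
  rw [h4, map_sub, h3, sub_zero]

theorem isLInftyHom_comparison : IsLInftyHom (vfDeg F) (formDeg F B)
    (kapranovBrackets (φ.pbwEquiv A)) (dolbeaultBrackets (φ.transPbwEquiv C hsep))
    (comparisonMaps (φ.pbwEquiv A) (φ.transPbwEquiv C hsep)) where
  zero := by
    refine MultilinearMap.ext fun m => ?_
    have h := comparisonMaps_ev (φ.pbwEquiv A) (φ.transPbwEquiv C hsep) []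
    rw [List.map_nil, List.prod_nil, ← symProd_nil, comparison_one] at h
    have h2 : Form.map (basePr B) (1 : Form F (SymmetricAlgebra R B)) = 0 := Form.ext fun l => by
      cases l with
      | nil => exact basePr_one
      | cons => exact map_zero _
    rw [h2] at h
    rw [zero_apply, ← h, Subsingleton.elim m ([] : List (VF F)).get]
    rfl
  degree l := by rw [zero_add]; exact φ.comparisonMaps_mem A _ l
  symm l₁ x y l₂ := by
    rw [comparisonMaps_ev_val, comparisonMaps_ev_val, symProd_swap, map_zsmul, map_zsmul]
  hom l := by
    set q := φ.transPbwEquiv C hsep with hq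
    set u : List (Homog (vfDeg F)) → Form F B := fun S =>
      (comparisonMaps (φ.pbwEquiv A) q).ev (S.map Homog.val) with hu
    have h1 : (unshuffleSum Homog.deg l fun S T => (comparisonMaps (φ.pbwEquiv A) q).ev
        ((kapranovBrackets (φ.pbwEquiv A)).ev (S.map Homog.val) :: T.map Homog.val))
        = Form.map (basePr B) (dolbeaultDelta q (comparison (φ.pbwEquiv A) q (symProd l))) := by
      rw [← φ.comparison_kapranovDelta, kapranovDelta_symProd, map_unshuffleSum, map_unshuffleSum]
      refine unshuffleSum_congr' _ fun S T => ?_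
      rw [← comparisonMaps_ev_val]; rfl
    have hmem : ∀ S, u S ∈ formDeg F B (S.map Homog.deg).sum := fun S =>
      φ.comparisonMaps_mem A q S
    have hu0 : Form.map (SymmetricAlgebra.ι R B) (u []) = 0 := by
      have h0 := φ.comparison_one A C hsep
      rw [hu]; dsimp only
      rw [comparisonMaps_ev_val, h0]
      refine Form.ext fun l => ?_
      cases l with
      | nil => exact (congrArg _ basePr_one).trans (map_zero _)
      | cons => exact (congrArg _ (map_zero (basePr B))).trans (map_zero _)
    rw [h1, φ.comparison_symProd A C hsep, ← sum_convPow (deg := Homog.deg) hu0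
      (fun S T => Form.mul_comm_of_mem (Form.map_mem _ (hmem S)) (Form.map_mem _ (hmem T)))
      l.length l le_rfl, map_sum, map_sum]
    refine Finset.sum_congr rfl fun m _ => ?_
    rw [map_smul, map_smul]
    refine congrArg _ ?_
    exact (blockSum_eq_convPow u (Form.map (SymmetricAlgebra.ι R B)) (dolbeaultBrackets q).ev
      (Form.map (basePr B) ∘ₗ dolbeaultDelta q).toAddMonoidHom
      (fun ws => dolbeaultBrackets_ev q ws) m l).symm

theorem isFormMultilinear_comparison : IsFormMultilinear
    (comparisonMaps (φ.pbwEquiv A) (φ.transPbwEquiv C hsep)) := by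
  intro k a ha l₁ X l₂
  set q := φ.transPbwEquiv C hsep
  have hact : ∀ s, comparison (φ.pbwEquiv A) q (SymVF.ofFun (F := F) a * s)
      = Form.act a (comparison (φ.pbwEquiv A) q s) := fun s => by
    rw [comparison_apply, comparison_apply, pushforward_mulLeft
      (D := φ.pbwEquiv A s) (D' := φ.pbwEquiv A (SymVF.ofFun (F := F) a * s))
      (φ.pbw_ofFun_mul A a s),
      Form.map_act, Form.map_act]
  have hl : ((l₁.map Homog.val).map (SymVF.ofVF (F := F))).prod = symProd l₁ := by
    rw [List.map_map]; rfl
  rw [comparisonMaps_ev, comparisonMaps_ev, List.map_append, List.map_append, List.map_cons,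
    List.map_cons, List.prod_append, List.prod_append, List.prod_cons, List.prod_cons, hl,
    ← SymVF.ofFun_mul_ofVF, mul_assoc (SymVF.ofFun (F := F) a), ← mul_assoc (symProd l₁),
    symProd_mul_ofFun ha, smul_mul_assoc, map_zsmul, map_zsmul, mul_assoc, hact, Form.map_act,
    mul_comm k]

/-- The linear part of the comparison map is the push-forward of vector fields. -/
theorem comparisonMaps_one (V : VF F) :
    Form.map (F.toSubmodule.mkQ ∘ₗ B.subtype)
      ((comparisonMaps (φ.pbwEquiv A) (φ.transPbwEquiv C hsep)).ev [V])
      = Form.map F.toSubmodule.mkQ (pushforwardVF V) := by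
  have h1 : (φ.pbwEquiv A (SymVF.ofVF (F := F) V) : FormEnd F R) = V := by
    refine φ.vf_induction (p := fun V => (φ.pbwEquiv A (SymVF.ofVF (F := F) V) :
      FormEnd F R) = V) (by simp) (fun X Y hX hY => ?_) (fun d X hX => ?_) V
    · rw [map_add, map_add, Submodule.coe_add, hX, hY]; rfl
    · have := φ.pbwProd_singleton A (Homog.mk hX)
      rw [pbwProd, symProd_cons, symProd_nil, mul_one] at this
      exact this
  have h2 : Form.map (leafIdeal F).mkQ (pushforward (φ.pbwEquiv A (SymVF.ofVF (F := F) V)))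
      = Form.map (normalOp F) (Form.map F.toSubmodule.mkQ (pushforwardVF V)) := by
    refine Form.ext fun l => congrArg (leafIdeal F).mkQ (Subtype.ext (LinearMap.ext fun f => ?_))
    change (φ.pbwEquiv A (SymVF.ofVF (F := F) V) : FormEnd F R) (pullback F f) l = _
    rw [h1]; rfl
  rw [comparisonMaps_ev, List.map_singleton, List.prod_singleton, comparison_apply, h2]
  exact Form.ext fun l => φ.mkQ_basePr_symm_normalOp C hsep _

include φ in
theorem map_normal_injective : Function.Injective
    (Form.map (F.toSubmodule.mkQ ∘ₗ B.subtype) : Form F B →ₗ[ℂ] Form F (NormalBundle F)) := by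
  rw [injective_iff_map_eq_zero]
  intro τ h
  refine Form.ext fun l => Subtype.ext (φ.disjoint _ ?_ (τ l).2)
  exact (Submodule.Quotient.mk_eq_zero _).mp (congrArg (fun η => η l) h)

theorem comparisonMaps_sub (V W : VF F) :
    (comparisonMaps (φ.pbwEquiv A) (φ.transPbwEquiv C hsep)).ev [V - W]
      = (comparisonMaps (φ.pbwEquiv A) (φ.transPbwEquiv C hsep)).ev [V]
        - (comparisonMaps (φ.pbwEquiv A) (φ.transPbwEquiv C hsep)).ev [W] := by
  simp only [comparisonMaps_ev, List.map_singleton, List.prod_singleton, map_sub]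

theorem kapranovBrackets_sub (V W : VF F) : (kapranovBrackets (φ.pbwEquiv A)).ev [V - W]
    = (kapranovBrackets (φ.pbwEquiv A)).ev [V] - (kapranovBrackets (φ.pbwEquiv A)).ev [W] := by
  simp only [kapranovBrackets_ev, List.map_singleton, List.prod_singleton, map_sub]

theorem kapranovBrackets_kapranovBrackets (V : VF F) :
    (kapranovBrackets (φ.pbwEquiv A)).ev [(kapranovBrackets (φ.pbwEquiv A)).ev [V]] = 0 := by
  refine Subtype.ext ?_
  have h : dF F * dF F = 0 := LinearMap.ext dF_dF
  rw [kapranovBrackets_one, kapranovBrackets_one, map_sub, map_mul, map_mul, opParity_dF,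
    opParity_opParity]
  simp only [mul_sub, sub_mul, neg_mul, mul_neg, ← mul_assoc, h, zero_mul]
  simp only [mul_assoc, h, mul_zero]
  simp

/-- The linear part of the comparison map is a morphism of complexes. -/
theorem comparisonMaps_kapranovBrackets (V : VF F) :
    (comparisonMaps (φ.pbwEquiv A) (φ.transPbwEquiv C hsep)).ev
      [(kapranovBrackets (φ.pbwEquiv A)).ev [V]]
      = (dolbeaultBrackets (φ.transPbwEquiv C hsep)).ev
        [(comparisonMaps (φ.pbwEquiv A) (φ.transPbwEquiv C hsep)).ev [V]] := by
  set q := φ.transPbwEquiv C hsep with hq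
  have hl : ∀ V, (comparisonMaps (φ.pbwEquiv A) q).ev [V]
      = Form.map (basePr B) (comparison (φ.pbwEquiv A) q (SymVF.ofVF (F := F) V)) := fun V => by
    simp only [comparisonMaps_ev, List.map_singleton, List.prod_singleton]
  have hk : ∀ V, (kapranovBrackets (φ.pbwEquiv A)).ev [V]
      = SymVF.pr (kapranovDelta (φ.pbwEquiv A) (SymVF.ofVF (F := F) V)) := fun V => by
    simp only [kapranovBrackets_ev, List.map_singleton, List.prod_singleton]
  have hd : ∀ τ, (dolbeaultBrackets q).ev [τ] = Form.map (basePr B) (dolbeaultDelta q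
      (Form.map (SymmetricAlgebra.ι R B) τ)) := fun τ => by
    simp only [dolbeaultBrackets_ev, List.map_singleton, List.prod_singleton]
  refine φ.vf_induction (p := fun V => (comparisonMaps (φ.pbwEquiv A) q).ev
    [(kapranovBrackets (φ.pbwEquiv A)).ev [V]]
    = (dolbeaultBrackets q).ev [(comparisonMaps (φ.pbwEquiv A) q).ev [V]]) (by simp [hl, hk, hd])
    (fun X Y hX hY => ?_) (fun d X hX => ?_) V
  · simp only [hl, hk, hd, map_add] at hX hY ⊢
    rw [hX, hY]
  · have h1 := φ.comparison_symProd A C hsep [Homog.mk hX]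
    rw [convExp_cons, unshuffleSum_nil, convExp_nil, mul_one, symProd_cons, symProd_nil,
      mul_one] at h1
    have h2 := φ.kapranovDelta_symProd A [Homog.mk hX]
    simp only [unshuffleSum_cons, unshuffleSum_nil, List.map_nil, List.sum_nil, mul_zero, sgn_zero,
      one_smul, symProd_cons, symProd_nil, mul_one, bracket_nil_val, map_zero, zero_mul,
      add_zero] at h2
    have h3 := φ.comparison_kapranovDelta (φ.pbwEquiv A) q (SymVF.ofVF (F := F) X)
    rw [Homog.mk_val] at h2 h1
    rw [h2, h1] at h3
    rw [hl, hd]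
    exact congrArg (Form.map (basePr B)) h3

theorem comparisonMaps_surjective (τ : Form F B) :
    ∃ V, (comparisonMaps (φ.pbwEquiv A) (φ.transPbwEquiv C hsep)).ev [V] = τ := by
  let L : B → VF F := fun b => ⟨φ.lift b, Submodule.subset_span ⟨_, φ.lift_mem_derDeg b⟩⟩
  let c : Fin n → Form F R := fun i => Form.map
    { toFun := fun b : B => (b : Derivation ℂ R R) (φ.x i), map_add' := fun _ _ => rfl,
      map_smul' := fun _ _ => rfl } τ
  refine ⟨∑ i, c i • L (φ.b i), φ.map_normal_injective ?_⟩
  rw [comparisonMaps_one]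
  refine Form.ext fun l => congrArg F.toSubmodule.mkQ (Derivation.ext fun f => ?_)
  rw [pushforwardVF_apply, Submodule.coe_sum, LinearMap.sum_apply, Form.sum_apply]
  have h1 : ∀ i, ((c i • L (φ.b i) : VF F) : FormEnd F R) (pullback F f) l
      = (τ l : Derivation ℂ R R) (φ.x i) * (φ.b i : Derivation ℂ R R) f := fun i => by
    change (c i * φ.lift (φ.b i) (pullback F f)) l = _
    rw [lift_pullback]
    exact wedge_const_right (LinearMap.mul R R) _ _ l
  simp only [h1]
  change _ = (τ l : Derivation ℂ R R) f
  conv_rhs => rw [φ.expand_right (τ l)]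
  rw [Submodule.coe_sum, derivation_sum_apply]
  rfl

/-- The kernel of the linear part of the comparison map is contractible. -/
theorem exists_homotopy {V : VF F}
    (h1 : (comparisonMaps (φ.pbwEquiv A) (φ.transPbwEquiv C hsep)).ev [V] = 0)
    (h2 : (kapranovBrackets (φ.pbwEquiv A)).ev [V] = 0) :
    ∃ W, (kapranovBrackets (φ.pbwEquiv A)).ev [W] = V ∧
      (comparisonMaps (φ.pbwEquiv A) (φ.transPbwEquiv C hsep)).ev [W] = 0 := by
  have hV : ∀ l, pushforwardVF V l ∈ F := fun l => by
    have := φ.comparisonMaps_one A C hsep V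
    rw [h1, map_zero] at this
    exact (Submodule.Quotient.mk_eq_zero _).mp (congrArg (fun η => η l) this).symm
  have hpull : ∀ f, (V : FormEnd F R) (pullback F f) = ∑ i,
      (V : FormEnd F R) (pullback F (φ.x i)) *
        pullback F ((φ.e i : Derivation ℂ R R) f) := fun f => by
    refine Form.ext fun l => ?_
    rw [Form.sum_apply, ← pushforwardVF_apply]
    have h3 := congrArg (fun v : F => (v : Derivation ℂ R R) f) (φ.expand_left ⟨_, hV l⟩)
    refine h3.trans ?_
    have h4 : ((∑ i, pushforwardVF V l (φ.x i) • φ.e i : F) : Derivation ℂ R R)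
        = ∑ i, pushforwardVF V l (φ.x i) • (φ.e i : Derivation ℂ R R) :=
      map_sum F.toSubmodule.subtype (fun i => pushforwardVF V l (φ.x i) • φ.e i) Finset.univ
    change ((∑ i, pushforwardVF V l (φ.x i) • φ.e i : F) : Derivation ℂ R R) f = _
    rw [h4, derivation_sum_apply]
    exact Finset.sum_congr rfl fun i _ => (wedge_const_right (LinearMap.mul R R) _ _ l).symm
  let c : Fin n → Form F R := fun i =>
    Form.parity ((V : FormEnd F R) (pullback F (φ.x i)))
  let W : VF F := ∑ i, c i • φ.partialVF (Sum.inr i)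
  have hW : ∀ a, (W : FormEnd F R) a = ∑ i, c i * iota (φ.e i) a := fun a => by
    rw [Submodule.coe_sum, LinearMap.sum_apply]; rfl
  have hW0 : ∀ f, (W : FormEnd F R) (pullback F f) = 0 := fun f => by
    rw [hW]
    refine Finset.sum_eq_zero fun i _ => ?_
    rw [show iota (φ.e i) (pullback F f) = 0 from rfl, mul_zero]
  have hodd : ∀ f, Form.parity (dF F (pullback F f)) = -dF F (pullback F f) := fun f => by
    rw [parity_of_mem (dF_pullback_mem f)]; simp [sgn]
  have hQW : ∀ f, ((kapranovBrackets (φ.pbwEquiv A)).ev [W] : FormEnd F R) (pullback F f)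
      = (V : FormEnd F R) (pullback F f) := fun f => by
    rw [kapranovBrackets_one, LinearMap.sub_apply, Module.End.mul_apply, Module.End.mul_apply, hW0,
      map_zero, zero_sub, opParity_apply, Module.End.mul_apply, Module.End.mul_apply, hodd, map_neg,
      map_neg, neg_neg, hW, map_sum, hpull]
    refine Finset.sum_congr rfl fun i _ => ?_
    rw [parity_mul, parity_parity_form, iota_dF_pullback]
    exact congrArg _ (Subtype.ext (parity_const _))
  refine ⟨W, (sub_eq_zero.mp ?_).symm, φ.map_normal_injective ?_⟩
  · set Z := V - (kapranovBrackets (φ.pbwEquiv A)).ev [W] with hZ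
    have hZ0 : ∀ f, (Z : FormEnd F R) (pullback F f) = 0 := fun f =>
      sub_eq_zero.mpr (hQW f).symm
    have hcl : (kapranovBrackets (φ.pbwEquiv A)).ev [Z] = 0 := by
      rw [hZ, kapranovBrackets_sub, h2, kapranovBrackets_kapranovBrackets, sub_zero]
    have hZ1 : ∀ i, (Z : FormEnd F R) (φ.theta i) = 0 := fun i => by
      have h3 : ((kapranovBrackets (φ.pbwEquiv A)).ev [Z] : FormEnd F R)
          (pullback F (φ.x i)) = 0 := by rw [hcl]; rfl
      rw [kapranovBrackets_one, LinearMap.sub_apply, Module.End.mul_apply, hZ0, map_zero, zero_sub,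
        Module.End.mul_apply, opParity_apply, Module.End.mul_apply, Module.End.mul_apply, hodd,
        map_neg, map_neg, neg_neg] at h3
      rw [← parity_parity_form ((Z : FormEnd F R) (φ.theta i))]
      exact (congrArg Form.parity h3).trans (map_zero _)
    rw [φ.vf_eq_sum Z]
    refine Finset.sum_eq_zero fun j _ => ?_
    have h4 : (Z : FormEnd F R) (φ.coord j) = 0 := by
      cases j with
      | inl i => exact hZ0 _
      | inr i => exact hZ1 i
    rw [h4]
    exact zero_smul (Form F R) (φ.partialVF j)
  · rw [comparisonMaps_one, map_zero]
    refine Form.ext fun l => ?_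
    have h5 : pushforwardVF W l = 0 := Derivation.ext fun f => by
      rw [pushforwardVF_apply, hW0]; rfl
    rw [Form.map_apply, h5, map_zero]
    rfl

theorem isQuasiIso_comparison : IsQuasiIso (kapranovBrackets (φ.pbwEquiv A))
    (dolbeaultBrackets (φ.transPbwEquiv C hsep))
    (comparisonMaps (φ.pbwEquiv A) (φ.transPbwEquiv C hsep)) where
  injective V hV := by
    rintro ⟨τ, hτ⟩
    obtain ⟨U, rfl⟩ := φ.comparisonMaps_surjective A C hsep τ
    obtain ⟨W, hW, -⟩ := φ.exists_homotopy A C hsep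
      (V := V - (kapranovBrackets (φ.pbwEquiv A)).ev [U])
      (by rw [comparisonMaps_sub, hτ, comparisonMaps_kapranovBrackets, sub_self])
      (by rw [kapranovBrackets_sub, hV, kapranovBrackets_kapranovBrackets, sub_zero])
    refine ⟨W - -U, ?_⟩
    rw [kapranovBrackets_sub, hW, ← zero_sub U, kapranovBrackets_sub]
    simp [kapranovBrackets_ev]
  surjective τ hτ := by
    obtain ⟨U, rfl⟩ := φ.comparisonMaps_surjective A C hsep τ
    obtain ⟨W, hW, hW0⟩ := φ.exists_homotopy A C hsep
      (V := (kapranovBrackets (φ.pbwEquiv A)).ev [U])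
      (by rw [comparisonMaps_kapranovBrackets, hτ]) (φ.kapranovBrackets_kapranovBrackets A U)
    refine ⟨U - W, by rw [kapranovBrackets_sub, hW, sub_self], 0, ?_⟩
    rw [comparisonMaps_sub, hW0, sub_zero, sub_self]
    simp [dolbeaultBrackets_ev]

end Frame

end QuasiIsomorphism

/-! ### Two facts from analysis -/

section Analysis

open MeasureTheory Module Set Topology

/-- A generic choice of constants `A l` avoids the zeros of `∑ u_l A_l + g` when the target has
larger dimension than the domain and the `u_l` have no common zero. -/
theorem exists_forall_sum_smul_add_ne_zero {P V κ : Type*} [NormedAddCommGroup P]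
    [NormedSpace ℝ P] [FiniteDimensional ℝ P] [NormedAddCommGroup V] [NormedSpace ℝ V]
    [FiniteDimensional ℝ V] [Fintype κ] (hdim : finrank ℝ P < finrank ℝ V)
    (s : Set P) (u : κ → P → ℝ) (g : P → V) (hu : ∀ l, ∀ p ∈ s, ContDiffAt ℝ 1 (u l) p)
    (hg : ∀ p ∈ s, ContDiffAt ℝ 1 g p) (hne : ∀ p ∈ s, ∃ l, u l p ≠ 0) :
    ∃ A : κ → V, ∀ p ∈ s, ∑ l, u l p • A l + g p ≠ 0 := by
  classical
  rcases isEmpty_or_nonempty κ with hκ | ⟨⟨l₀⟩⟩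
  · exact ⟨fun _ => 0, fun p hp => hκ.elim (hne p hp).choose⟩
  let Φ (l : κ) (q : P × ({j : κ // j ≠ l} → V)) : κ → V := fun j =>
    if h : j = l then -(u l q.1)⁻¹ • (∑ i : {j : κ // j ≠ l}, u i q.1 • q.2 i + g q.1) else q.2 ⟨j, h⟩
  let t (l : κ) : Set (P × ({j : κ // j ≠ l} → V)) := {q | q.1 ∈ s ∧ u l q.1 ≠ 0}
  have hΦ : ∀ l, ∀ q ∈ t l, ContDiffAt ℝ 1 (Φ l) q := by
    rintro l q ⟨hq, hq0⟩
    have hfst : ContDiffAt ℝ 1 (Prod.fst : P × ({j : κ // j ≠ l} → V) → P) q := contDiffAt_fst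
    have hcomp : ∀ j, ContDiffAt ℝ 1 (fun q : P × ({j : κ // j ≠ l} → V) => u j q.1) q := fun j =>
      ContDiffAt.comp q (hu j q.1 hq) hfst
    refine contDiffAt_pi.mpr fun j => ?_
    by_cases h : j = l
    · simp only [Φ, dif_pos h]
      refine ((hcomp l).inv hq0).neg.smul (ContDiffAt.add ?_ (ContDiffAt.comp q (hg q.1 hq) hfst))
      refine ContDiffAt.sum fun i _ => (hcomp i).smul ?_
      exact contDiffAt_pi.mp contDiffAt_snd i
    · simp only [Φ, dif_neg h]
      exact contDiffAt_pi.mp contDiffAt_snd _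
  have hdimΦ : dimH (⋃ l, Φ l '' t l) < finrank ℝ (κ → V) := by
    rw [dimH_iUnion]
    have hlt : ∀ l, finrank ℝ (P × ({j : κ // j ≠ l} → V)) + 1 ≤ finrank ℝ (κ → V) := fun l => by
      have h1 : finrank ℝ (P × ({j : κ // j ≠ l} → V)) = finrank ℝ P + finrank ℝ ({j : κ // j ≠ l} → V) :=
        Module.finrank_prod
      have h2 : finrank ℝ ({j : κ // j ≠ l} → V) = Fintype.card {j : κ // j ≠ l} * finrank ℝ V := by
        rw [finrank_pi_fintype ℝ, Finset.sum_const, Finset.card_univ, smul_eq_mul]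
      rw [h1, h2, finrank_pi_fintype ℝ, Finset.sum_const, Finset.card_univ, smul_eq_mul,
        Fintype.card_subtype_compl, Fintype.card_subtype_eq]
      obtain ⟨c, hc⟩ := Nat.exists_eq_succ_of_ne_zero (Fintype.card_pos_iff.mpr ⟨l⟩).ne'
      rw [hc, Nat.succ_sub_one, Nat.succ_mul]
      omega
    refine lt_of_le_of_lt (b := ((finrank ℝ (κ → V) - 1 : ℕ) : ENNReal)) (iSup_le fun l => ?_) ?_
    · refine (dimH_image_le_of_locally_lipschitzOn fun q hq => ?_).trans ?_
      · obtain ⟨C, v, hv, hL⟩ := (hΦ l q hq).exists_lipschitzOnWith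
        exact ⟨C, v, mem_nhdsWithin_of_mem_nhds hv, hL⟩
      · refine (dimH_mono (subset_univ _)).trans ?_
        rw [Real.dimH_univ_eq_finrank]
        exact Nat.cast_le.mpr (by have := hlt l; omega)
    · exact Nat.cast_lt.mpr (by have := hlt l₀; omega)
  obtain ⟨A, hA⟩ := (dense_compl_of_dimH_lt_finrank hdimΦ).nonempty
  refine ⟨A, fun p hp h0 => hA ?_⟩
  obtain ⟨l, hl⟩ := hne p hp
  refine mem_iUnion.mpr ⟨l, (p, fun i => A i), ⟨hp, hl⟩, funext fun j => ?_⟩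
  by_cases h : j = l
  · subst h
    have hsum : ∑ i : {i // i ≠ j}, u i p • A i + u j p • A j = ∑ l, u l p • A l := by
      rw [← Finset.sum_erase_add _ _ (Finset.mem_univ j)]
      congr 1
      exact (Finset.sum_subtype _ (fun x => by simp) fun i => u i p • A i).symm
    have h1 : ∑ i : {i // i ≠ j}, u i p • A i + g p = -(u j p • A j) := by
      rw [eq_neg_iff_add_eq_zero, ← h0, ← hsum]; abel
    simp only [Φ, dif_pos]
    rw [h1, smul_neg, neg_smul, neg_neg, smul_smul, inv_mul_cancel₀ hl, one_smul]
  · simp only [Φ, dif_neg h]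

/-- Hadamard's lemma. -/
theorem exists_eq_add_apply {E V : Type*} [NormedAddCommGroup E] [NormedSpace ℝ E]
    [NormedAddCommGroup V] [NormedSpace ℝ V] [CompleteSpace V] {F : E → V}
    (hF : ContDiff ℝ ∞ F) :
    ∃ H : E → E →L[ℝ] V, ContDiff ℝ ∞ H ∧ (∀ y, F y = F 0 + H y y) ∧ H 0 = fderiv ℝ F 0 := by
  let b : ContDiffBump (0 : ℝ) := ⟨1, 2, one_pos, one_lt_two⟩
  have hF' : ContDiff ℝ ∞ (fderiv ℝ F) := hF.fderiv_right (by simp)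
  let G : E → ℝ → E →L[ℝ] V := fun y s => b s • fderiv ℝ F (-s • y)
  have hG : ContDiff ℝ ∞ (Function.uncurry G) := by
    refine (b.contDiff.comp contDiff_snd).smul (hF'.comp ?_)
    exact contDiff_snd.neg.smul contDiff_fst
  have hconv := contDiffOn_convolution_right_with_param_comp (μ := volume) (n := ⊤)
    (ContinuousLinearMap.lsmul ℝ ℝ : ℝ →L[ℝ] (E →L[ℝ] V) →L[ℝ] _) (s := univ)
    (v := fun _ : E => (0 : ℝ)) contDiffOn_const (f := indicator (Icc (0 : ℝ) 1) fun _ => (1 : ℝ))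
    (g := G) (k := Metric.closedBall 0 2) isOpen_univ (isCompact_closedBall _ _)
    (fun y s _ hs => by
      have : b s = 0 := b.zero_of_le_dist (by
        simpa using (not_le.mp (by simpa using hs : ¬ |s| ≤ 2)).le)
      simp [G, this])
    ((integrable_indicator_iff measurableSet_Icc).mpr
      (integrableOn_const (by simp))).locallyIntegrable hG.contDiffOn
  have hint : ∀ y, (convolution (indicator (Icc (0 : ℝ) 1) fun _ => (1 : ℝ)) (G y)
      (ContinuousLinearMap.lsmul ℝ ℝ : ℝ →L[ℝ] (E →L[ℝ] V) →L[ℝ] _) volume) 0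
      = ∫ s in (0 : ℝ)..1, fderiv ℝ F (s • y) := by
    intro y
    rw [convolution, intervalIntegral.integral_of_le zero_le_one, ← integral_Icc_eq_integral_Ioc,
      ← integral_indicator measurableSet_Icc]
    refine integral_congr_ae (ae_of_all _ fun s => ?_)
    by_cases hs : s ∈ Icc (0 : ℝ) 1
    · have : b (0 - s) = 1 := b.one_of_mem_closedBall (by
        rw [zero_sub, mem_closedBall_zero_iff, norm_neg, Real.norm_eq_abs, abs_le]
        exact ⟨by linarith [hs.1], hs.2⟩)
      rw [zero_sub] at this
      simp [G, this, hs]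
    · simp [hs]
  refine ⟨fun y => ∫ s in (0 : ℝ)..1, fderiv ℝ F (s • y), ?_, fun y => ?_, by simp⟩
  · simpa only [hint] using contDiffOn_univ.mp hconv
  · have hline : ∀ s : ℝ, HasDerivAt (fun s : ℝ => F (s • y)) (fderiv ℝ F (s • y) y) s := fun s => by
      have h1 := ((hasDerivAt_id s).smul_const y)
      rw [one_smul] at h1
      exact ((hF.differentiable (by simp)) (s • y)).hasFDerivAt.comp_hasDerivAt s h1
    have hcont : Continuous fun s : ℝ => fderiv ℝ F (s • y) :=
      hF'.continuous.comp (continuous_id.smul continuous_const)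
    beta_reduce
    rw [ContinuousLinearMap.intervalIntegral_apply (hcont.intervalIntegrable _ _),
      intervalIntegral.integral_eq_sub_of_hasDerivAt (fun s _ => hline s)
        ((hcont.clm_apply continuous_const).intervalIntegrable _ _)]
    simp

end Analysis

/-! ### Derivatives in charts -/

section ChartDeriv

open Module Set Topology Filter

variable {E : Type*} [NormedAddCommGroup E] [NormedSpace ℂ E]
  {X : Type*} [TopologicalSpace X] [ChartedSpace E X]

theorem isManifold_real [IsManifold 𝓘(ℂ, E) ω X] : IsManifold 𝓘(ℝ, E) ∞ X := by
  refine isManifold_of_contDiffOn _ _ _ fun e e' he he' => ?_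
  have h := HasGroupoid.compatible (G := contDiffGroupoid ω 𝓘(ℂ, E)) he he'
  rw [contDiffGroupoid, mem_groupoid_of_pregroupoid] at h
  exact (ContDiffOn.restrict_scalars ℝ h.1).of_le (by simp)

variable {V W : Type*} [NormedAddCommGroup V] [NormedSpace ℝ V] [NormedAddCommGroup W]
  [NormedSpace ℝ W]

/-- The derivative at `x` of a function on `X`, read in the chart at `c`. -/
def chartDeriv (c : X) (f : X → V) (x : X) : E →L[ℝ] V :=
  fderiv ℝ (f ∘ (chartAt E c).symm) (chartAt E c x)

theorem eventuallyEq_comp_chart_symm {c x : X} (hx : x ∈ (chartAt E c).source) {α : Type*}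
    {f g : X → α} (h : f =ᶠ[𝓝 x] g) :
    f ∘ (chartAt E c).symm =ᶠ[𝓝 (chartAt E c x)] g ∘ (chartAt E c).symm := by
  have h1 := (chartAt E c).continuousAt_symm ((chartAt E c).map_source hx)
  rw [ContinuousAt, (chartAt E c).left_inv hx] at h1
  exact h1.eventually h

theorem chartDeriv_congr {c x : X} (hx : x ∈ (chartAt E c).source) {f g : X → V}
    (h : f =ᶠ[𝓝 x] g) : chartDeriv (E := E) c f x = chartDeriv c g x :=
  (eventuallyEq_comp_chart_symm hx h).fderiv_eq

theorem chartDeriv_const (c : X) (a : V) (x : X) : chartDeriv (E := E) c (fun _ => a) x = 0 :=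
  fderiv_const_apply a

theorem chartDeriv_comp_chart {c x : X} (hx : x ∈ (chartAt E c).source) (h : E → V) :
    chartDeriv (E := E) c (fun y => h (chartAt E c y)) x = fderiv ℝ h (chartAt E c x) := by
  refine Filter.EventuallyEq.fderiv_eq ?_
  filter_upwards [(chartAt E c).open_target.mem_nhds ((chartAt E c).map_source hx)] with y hy
  simp [(chartAt E c).right_inv hy]

variable [IsManifold 𝓘(ℝ, E) ∞ X]

theorem contDiffOn_comp_chart_symm (c : X) {f : X → V} (hf : ContMDiff 𝓘(ℝ, E) 𝓘(ℝ, V) ∞ f) :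
    ContDiffOn ℝ ∞ (f ∘ (chartAt E c).symm) (chartAt E c).target :=
  (hf.comp_contMDiffOn contMDiffOn_chart_symm).contDiffOn

theorem contMDiffOn_chartDeriv (c : X) {f : X → V} (hf : ContMDiff 𝓘(ℝ, E) 𝓘(ℝ, V) ∞ f) :
    ContMDiffOn 𝓘(ℝ, E) 𝓘(ℝ, E →L[ℝ] V) ∞ (chartDeriv (E := E) c f) (chartAt E c).source :=
  ((contDiffOn_comp_chart_symm c hf).fderiv_of_isOpen (chartAt E c).open_target
    (by simp)).contMDiffOn.comp contMDiffOn_chart fun _ hx => (chartAt E c).map_source hx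

theorem contDiffAt_fderiv_comp_chart_symm {c : X} {f : X → V}
    (hf : ContMDiff 𝓘(ℝ, E) 𝓘(ℝ, V) ∞ f) (p : E × E) (hp : p.1 ∈ (chartAt E c).target) :
    ContDiffAt ℝ 1 (fun p : E × E => fderiv ℝ (f ∘ (chartAt E c).symm) p.1 p.2) p := by
  have h := (((contDiffOn_comp_chart_symm c hf).fderiv_of_isOpen (m := ∞)
    (chartAt E c).open_target (by simp)).contDiffAt
      ((chartAt E c).open_target.mem_nhds hp)).of_le (m := 1) (by simp)
  exact (h.comp p contDiffAt_fst).clm_apply contDiffAt_snd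

theorem differentiableAt_comp_chart_symm {c x : X} (hx : x ∈ (chartAt E c).source) {f : X → V}
    (hf : ContMDiff 𝓘(ℝ, E) 𝓘(ℝ, V) ∞ f) :
    DifferentiableAt ℝ (f ∘ (chartAt E c).symm) (chartAt E c x) :=
  ((contDiffOn_comp_chart_symm c hf).contDiffAt ((chartAt E c).open_target.mem_nhds
    ((chartAt E c).map_source hx))).differentiableAt (by simp)

theorem chartDeriv_add {c x : X} (hx : x ∈ (chartAt E c).source) {f g : X → V}
    (hf : ContMDiff 𝓘(ℝ, E) 𝓘(ℝ, V) ∞ f) (hg : ContMDiff 𝓘(ℝ, E) 𝓘(ℝ, V) ∞ g) :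
    chartDeriv (E := E) c (f + g) x = chartDeriv c f x + chartDeriv c g x :=
  fderiv_add (differentiableAt_comp_chart_symm hx hf) (differentiableAt_comp_chart_symm hx hg)

theorem chartDeriv_sub {c x : X} (hx : x ∈ (chartAt E c).source) {f g : X → V}
    (hf : ContMDiff 𝓘(ℝ, E) 𝓘(ℝ, V) ∞ f) (hg : ContMDiff 𝓘(ℝ, E) 𝓘(ℝ, V) ∞ g) :
    chartDeriv (E := E) c (f - g) x = chartDeriv c f x - chartDeriv c g x :=
  fderiv_sub (differentiableAt_comp_chart_symm hx hf) (differentiableAt_comp_chart_symm hx hg)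

theorem chartDeriv_mul {A : Type*} [NormedCommRing A] [NormedAlgebra ℝ A] {c x : X}
    (hx : x ∈ (chartAt E c).source) {f g : X → A}
    (hf : ContMDiff 𝓘(ℝ, E) 𝓘(ℝ, A) ∞ f) (hg : ContMDiff 𝓘(ℝ, E) 𝓘(ℝ, A) ∞ g) :
    chartDeriv (E := E) c (f * g) x = f x • chartDeriv c g x + g x • chartDeriv c f x := by
  have := fderiv_mul (differentiableAt_comp_chart_symm hx hf) (differentiableAt_comp_chart_symm hx hg)
  simp only [Function.comp_apply, (chartAt E c).left_inv hx] at this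
  exact this

theorem chartDeriv_clm_comp {c x : X} (hx : x ∈ (chartAt E c).source) {f : X → V}
    (hf : ContMDiff 𝓘(ℝ, E) 𝓘(ℝ, V) ∞ f) (L : V →L[ℝ] W) :
    chartDeriv (E := E) c (fun y => L (f y)) x = L.comp (chartDeriv c f x) := by
  have := fderiv_comp (chartAt E c x) L.differentiableAt (differentiableAt_comp_chart_symm hx hf)
  rwa [L.fderiv] at this

theorem chartDeriv_sum {c x : X} (hx : x ∈ (chartAt E c).source) {ι : Type*} (s : Finset ι)
    {f : ι → X → V} (hf : ∀ i, ContMDiff 𝓘(ℝ, E) 𝓘(ℝ, V) ∞ (f i)) :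
    chartDeriv (E := E) c (fun y => ∑ i ∈ s, f i y) x = ∑ i ∈ s, chartDeriv c (f i) x :=
  fderiv_fun_sum fun i _ => differentiableAt_comp_chart_symm hx (hf i)

theorem chartDeriv_finsum {c x : X} (hx : x ∈ (chartAt E c).source) {ι : Type*}
    {f : ι → X → V} (hf : ∀ i, ContMDiff 𝓘(ℝ, E) 𝓘(ℝ, V) ∞ (f i))
    (hlf : LocallyFinite fun i => Function.support (f i)) (v : E) :
    chartDeriv (E := E) c (fun y => ∑ᶠ i, f i y) x v = ∑ᶠ i, chartDeriv c (f i) x v := by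
  obtain ⟨s, hs⟩ := hlf.exists_finset_support x
  have h1 : (fun y => ∑ᶠ i, f i y) =ᶠ[𝓝 x] fun y => ∑ i ∈ s, f i y := by
    filter_upwards [hs] with y hy
    exact finsum_eq_sum_of_support_subset _ hy
  rw [chartDeriv_congr hx h1, chartDeriv_sum hx s hf, ContinuousLinearMap.sum_apply]
  refine (finsum_eq_sum_of_support_subset _ fun i hi => ?_).symm
  by_contra h
  have h2 : f i =ᶠ[𝓝 x] fun _ => 0 := by
    filter_upwards [hs] with y hy
    exact by_contra fun h3 => h (hy h3)
  exact hi (by beta_reduce; rw [chartDeriv_congr hx h2, chartDeriv_const]; rfl)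

/-- Change of charts. -/
theorem chartDeriv_eq_comp {c c' x : X} (hx : x ∈ (chartAt E c).source)
    (hx' : x ∈ (chartAt E c').source) {f : X → V} (hf : ContMDiff 𝓘(ℝ, E) 𝓘(ℝ, V) ∞ f) :
    chartDeriv (E := E) c f x
      = (chartDeriv (E := E) c' f x).comp (chartDeriv (E := E) c (chartAt E c') x) := by
  have h1 : f ∘ (chartAt E c).symm =ᶠ[𝓝 (chartAt E c x)]
      (f ∘ (chartAt E c').symm) ∘ (chartAt E c' ∘ (chartAt E c).symm) := by
    refine eventuallyEq_comp_chart_symm (g := (f ∘ (chartAt E c').symm) ∘ chartAt E c') hx ?_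
    filter_upwards [(chartAt E c').open_source.mem_nhds hx'] with y hy
    simp [(chartAt E c').left_inv hy]
  have h2 : ContDiffOn ℝ ∞ (chartAt E c' ∘ (chartAt E c).symm)
      ((chartAt E c).target ∩ (chartAt E c).symm ⁻¹' (chartAt E c').source) :=
    ((contMDiffOn_chart (I := 𝓘(ℝ, E)) (n := ∞) (x := c')).comp'
      (contMDiffOn_chart_symm (I := 𝓘(ℝ, E)) (n := ∞) (x := c))).contDiffOn
  have h3 : (chartAt E c).target ∩ (chartAt E c).symm ⁻¹' (chartAt E c').source
      ∈ 𝓝 (chartAt E c x) :=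
    ((chartAt E c).isOpen_inter_preimage_symm (chartAt E c').open_source).mem_nhds
      ⟨(chartAt E c).map_source hx, by simpa [(chartAt E c).left_inv hx] using hx'⟩
  have h4 : (chartAt E c' ∘ (chartAt E c).symm) (chartAt E c x) = chartAt E c' x := by
    simp [(chartAt E c).left_inv hx]
  rw [chartDeriv, h1.fderiv_eq, fderiv_comp _ (by
    rw [h4]; exact differentiableAt_comp_chart_symm hx' hf)
    ((h2.contDiffAt h3).differentiableAt (by simp)), h4]
  rfl

end ChartDeriv

/-! ### Finitely many functions whose differentials span the cotangent spaces -/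

section Immersion

open Module Set Topology Filter

variable {E : Type*} [NormedAddCommGroup E] [NormedSpace ℂ E] [FiniteDimensional ℂ E]
  {X : Type*} [TopologicalSpace X] [ChartedSpace E X] [T2Space X] [IsManifold 𝓘(ℝ, E) ∞ X]

/-- The affine coordinates of `E`: the constant function `1` and the coordinates in a basis. -/
def affineCoord : Option (Fin (finrank ℝ E)) → E → ℝ
  | none => fun _ => 1
  | some j => (finBasis ℝ E).coord j

theorem contDiff_affineCoord (l : Option (Fin (finrank ℝ E))) :
    ContDiff ℝ ∞ (affineCoord (E := E) l) := by
  cases l with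
  | none => exact contDiff_const
  | some j => exact ((finBasis ℝ E).coord j).toContinuousLinearMap.contDiff

/-- A bump function around `c` times an affine coordinate of the chart at `c`. -/
def bumpCoord {c : X} (χ : SmoothBumpFunction 𝓘(ℝ, E) c) (l : Option (Fin (finrank ℝ E))) :
    X → ℝ := fun x => χ x • affineCoord l (chartAt E c x)

variable {c : X} (χ : SmoothBumpFunction 𝓘(ℝ, E) c)

theorem contMDiff_bumpCoord (l : Option (Fin (finrank ℝ E))) :
    ContMDiff 𝓘(ℝ, E) 𝓘(ℝ, ℝ) ∞ (bumpCoord χ l) :=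
  χ.contMDiff_smul ((contDiff_affineCoord l).contMDiff.comp_contMDiffOn contMDiffOn_chart)

theorem chartDeriv_bump_mul_of_eq_zero {d x : X} (hx : x ∈ (chartAt E d).source) (h : χ x = 0)
    (l : Option (Fin (finrank ℝ E))) : chartDeriv (E := E) d (⇑χ * bumpCoord χ l) x = 0 := by
  rw [chartDeriv_mul hx χ.contMDiff (contMDiff_bumpCoord χ l), bumpCoord, h]
  simp

theorem exists_chartDeriv_bump_mul_ne_zero {x : X} (h : χ x ≠ 0) {v : E} (hv : v ≠ 0) :
    ∃ l, chartDeriv (E := E) c (⇑χ * bumpCoord χ l) x v ≠ 0 := by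
  by_contra! h0
  have hx : x ∈ (chartAt E c).source := χ.support_subset_source h
  have hcoord : ∀ l, chartDeriv c (bumpCoord χ l) x
      = χ x • fderiv ℝ (affineCoord l) (chartAt E c x)
        + affineCoord l (chartAt E c x) • chartDeriv c χ x := fun l => by
    have h1 := fderiv_mul (differentiableAt_comp_chart_symm hx χ.contMDiff)
      ((contDiff_affineCoord l).differentiable (by simp) (chartAt E c x))
    simp only [Function.comp_apply, (chartAt E c).left_inv hx] at h1
    rw [chartDeriv, chartDeriv, ← h1]
    refine Filter.EventuallyEq.fderiv_eq ?_
    filter_upwards [(chartAt E c).open_target.mem_nhds ((chartAt E c).map_source hx)] with y hy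
    simp [bumpCoord, (chartAt E c).right_inv hy]
  have hall : ∀ l, χ x * fderiv ℝ (affineCoord l) (chartAt E c x) v
      + 2 * affineCoord l (chartAt E c x) * chartDeriv c χ x v = 0 := fun l => by
    have h1 := h0 l
    rw [chartDeriv_mul hx χ.contMDiff (contMDiff_bumpCoord χ l), hcoord, bumpCoord] at h1
    simp only [ContinuousLinearMap.add_apply, ContinuousLinearMap.smul_apply, smul_eq_mul] at h1
    refine mul_left_cancel₀ h ?_
    rw [mul_zero, ← h1]; ring
  have hχ : chartDeriv (E := E) c χ x v = 0 := by
    have h1 := hall none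
    have h2 : fderiv ℝ (affineCoord (E := E) none) (chartAt E c x) = 0 := fderiv_const_apply _
    rw [h2] at h1
    simpa [affineCoord] using h1
  refine hv ((finBasis ℝ E).ext_elem fun j => ?_)
  have h1 := hall (some j)
  have h2 : fderiv ℝ (affineCoord (E := E) (some j)) (chartAt E c x)
      = ((finBasis ℝ E).coord j).toContinuousLinearMap :=
    ContinuousLinearMap.fderiv (((finBasis ℝ E).coord j).toContinuousLinearMap)
  rw [hχ, h2, mul_zero, add_zero] at h1
  simpa using (mul_eq_zero.mp h1).resolve_left h

theorem exists_forall_chartDeriv_ne_zero {V : Type*} [NormedAddCommGroup V] [NormedSpace ℝ V]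
    [FiniteDimensional ℝ V] (hV : 2 * finrank ℝ E < finrank ℝ V) {g : X → V}
    (hg : ContMDiff 𝓘(ℝ, E) 𝓘(ℝ, V) ∞ g) :
    ∃ A : Option (Fin (finrank ℝ E)) → V, ∀ x, χ x ≠ 0 → ∀ v : E, v ≠ 0 →
      ∑ l, chartDeriv c (⇑χ * bumpCoord χ l) x v • A l + chartDeriv c g x v ≠ 0 := by
  obtain ⟨A, hA⟩ := exists_forall_sum_smul_add_ne_zero (P := E × E) (V := V)
    (by rw [finrank_prod]; omega)
    {p | p.1 ∈ (chartAt E c).target ∧ χ ((chartAt E c).symm p.1) ≠ 0 ∧ p.2 ≠ 0}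
    (fun l p => fderiv ℝ ((⇑χ * bumpCoord χ l) ∘ (chartAt E c).symm) p.1 p.2)
    (fun p => fderiv ℝ (g ∘ (chartAt E c).symm) p.1 p.2)
    (fun l p hp => contDiffAt_fderiv_comp_chart_symm (χ.contMDiff.mul (contMDiff_bumpCoord χ l)) p hp.1)
    (fun p hp => contDiffAt_fderiv_comp_chart_symm hg p hp.1)
    (fun p hp => by
      obtain ⟨l, hl⟩ := exists_chartDeriv_bump_mul_ne_zero χ hp.2.1 hp.2.2
      rw [chartDeriv, (chartAt E c).right_inv hp.1] at hl
      exact ⟨l, hl⟩)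
  refine ⟨A, fun x hx v hv => hA (chartAt E c x, v) ?_⟩
  have hs := χ.support_subset_source hx
  exact ⟨(chartAt E c).map_source hs, by rwa [(chartAt E c).left_inv hs], hv⟩

variable (E X) in
/-- Finitely many smooth functions whose differentials span every cotangent space. -/
theorem exists_immersion [SigmaCompactSpace X] : ∃ (n : ℕ) (t : X → Fin n → ℝ),
    ContMDiff 𝓘(ℝ, E) 𝓘(ℝ, Fin n → ℝ) ∞ t ∧ ∀ x, ∃ c, x ∈ (chartAt E c).source ∧
      ∀ v, chartDeriv (E := E) c t x v = 0 → v = 0 := by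
  classical
  obtain ⟨ι, f, -⟩ := SmoothBumpCovering.exists_isSubordinate 𝓘(ℝ, E) (s := (univ : Set X))
    isClosed_univ (U := fun _ => univ) fun _ _ => univ_mem
  obtain ⟨_, _⟩ := exists_wellOrder ι
  set n := 2 * finrank ℝ E + 1
  let term (k : ι) (A : Option (Fin (finrank ℝ E)) → Fin n → ℝ) : X → Fin n → ℝ :=
    fun x => ∑ l, (⇑(f k) * bumpCoord (f k) l) x • A l
  have hterm : ∀ k A, ContMDiff 𝓘(ℝ, E) 𝓘(ℝ, Fin n → ℝ) ∞ (term k A) := fun k A =>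
    contMDiff_finsetSum fun l _ => ((f k).contMDiff.mul (contMDiff_bumpCoord (f k) l)).smul contMDiff_const
  have hlf : ∀ A : ι → _, LocallyFinite fun k => Function.support (term k (A k)) := fun A =>
    f.locallyFinite.subset fun k x hx (h0 : f k x = 0) => hx (Finset.sum_eq_zero fun l _ => by
      rw [Pi.mul_apply, h0, zero_mul, zero_smul])
  have hsum : ∀ A : ι → _, ContMDiff 𝓘(ℝ, E) 𝓘(ℝ, Fin n → ℝ) ∞ fun x => ∑ᶠ k, term k (A k) x :=
    fun A => contMDiff_finsum (fun k => hterm k (A k)) (hlf A)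
  have hpick := fun (k : ι) (A : ι → Option (Fin (finrank ℝ E)) → Fin n → ℝ) =>
    exists_forall_chartDeriv_ne_zero (f k) (V := Fin n → ℝ) (by simp [n]) (hsum A)
  choose pick hpick using hpick
  let A : ι → Option (Fin (finrank ℝ E)) → Fin n → ℝ := (wellFounded_lt (α := ι)).fix
    fun k A => pick k fun j => if h : j < k then A j h else 0
  have hA : ∀ k, A k = pick k fun j => if j < k then A j else 0 := fun k =>
    (wellFounded_lt (α := ι)).fix_eq _ k
  have hdterm : ∀ k A (c x : X), x ∈ (chartAt E c).source → chartDeriv (E := E) c (term k A) x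
      = ∑ l, (chartDeriv c (⇑(f k) * bumpCoord (f k) l) x).smulRight (A l) := by
    intro k A c x hx
    refine (chartDeriv_sum hx _ fun l => ((f k).contMDiff.mul
      (contMDiff_bumpCoord (f k) l)).smul contMDiff_const).trans ?_
    refine Finset.sum_congr rfl fun l _ => ?_
    exact chartDeriv_clm_comp hx ((f k).contMDiff.mul (contMDiff_bumpCoord (f k) l))
      ((ContinuousLinearMap.id ℝ ℝ).smulRight (A l))
  refine ⟨n, fun x => ∑ᶠ k, term k (A k) x, hsum A, fun x => ?_⟩
  have hfin : {k | f k x ≠ 0}.Finite := f.locallyFinite.point_finite x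
  obtain ⟨k, hk, hmax⟩ := hfin.toFinset.exists_max_image id
    ⟨f.ind x (mem_univ x), by simpa using f.mem_support_ind x (mem_univ x)⟩
  have hk' : f k x ≠ 0 := by simpa using hk
  have hx := (f k).support_subset_source hk'
  refine ⟨f.c k, hx, fun v hv => by_contra fun hv0 => ?_⟩
  have h1 := hpick k (fun j => if j < k then A j else 0) x hk' v hv0
  rw [← hA k] at h1
  refine h1 (Eq.trans ?_ hv)
  have h0 : ∀ j B, f j x = 0 → chartDeriv (E := E) (f.c k) (term j B) x = 0 := fun j B h => by
    rw [hdterm j B _ x hx]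
    exact Finset.sum_eq_zero fun l _ => by
      rw [chartDeriv_bump_mul_of_eq_zero _ hx h]; ext; simp
  rw [chartDeriv_finsum hx (fun j => hterm j _) (hlf _),
    chartDeriv_finsum hx (fun j => hterm j _) (hlf _)]
  have hsupp : ∀ B : ι → _, (Function.support fun j => chartDeriv (E := E) (f.c k) (term j (B j)) x v)
      ⊆ hfin.toFinset := fun B j hj => by
    by_contra h
    exact hj (by beta_reduce; rw [h0 j _ (by simpa using h)]; rfl)
  rw [finsum_eq_sum_of_support_subset _ (hsupp _), finsum_eq_sum_of_support_subset _ (hsupp _),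
    ← Finset.add_sum_erase _ _ hk, ← Finset.add_sum_erase _ _ hk, if_neg (lt_irrefl k), ← add_assoc]
  have hz : chartDeriv (E := E) (f.c k) (term k 0) x v = 0 := by
    rw [hdterm _ _ _ x hx]; simp
  rw [hz, add_zero, hdterm _ _ _ x hx]
  congr 1
  · simp
  · refine Finset.sum_congr rfl fun j hj => ?_
    rw [Finset.mem_erase] at hj
    rw [if_pos (show j < k from lt_of_le_of_ne (hmax j hj.2) hj.1)]

end Immersion

/-! ### Derivations of the algebra of smooth functions -/

section SmoothDerivations

open Module Set Topology Filter

variable {E : Type*} [NormedAddCommGroup E] [NormedSpace ℂ E]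
  {X : Type*} [TopologicalSpace X] [ChartedSpace E X]

namespace SmoothFun

theorem contMDiff (f : SmoothFun E X) : ContMDiff 𝓘(ℝ, E) 𝓘(ℝ, ℂ) ∞ (f : X → ℂ) := f.2

variable (E) in
/-- Evaluation of smooth functions at a point. -/
def evalHom (x : X) : SmoothFun E X →+* ℂ :=
  (Pi.evalRingHom (fun _ => ℂ) x).comp (smoothSubalgebra E X).val.toRingHom

@[ext] theorem ext {f g : SmoothFun E X} (h : ∀ x, f x = g x) : f = g := Subtype.ext (funext h)

theorem sum_apply {ι : Type*} (s : Finset ι) (f : ι → SmoothFun E X) (x : X) :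
    (∑ i ∈ s, f i) x = ∑ i ∈ s, f i x :=
  map_sum (evalHom E x) f s

variable [FiniteDimensional ℂ E] [T2Space X] [IsManifold 𝓘(ℝ, E) ∞ X]

theorem chartDeriv_sub {c x : X} (hx : x ∈ (chartAt E c).source) (f g : SmoothFun E X) :
    chartDeriv (E := E) c (f - g : SmoothFun E X) x = chartDeriv c f x - chartDeriv c g x :=
  KapranovDolbeault.chartDeriv_sub hx f.contMDiff g.contMDiff

/-- The product of a bump function with a function of the coordinates. -/
def bump {c : X} (χ : SmoothBumpFunction 𝓘(ℝ, E) c) (h : E → ℂ) (hh : ContDiff ℝ ∞ h) :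
    SmoothFun E X :=
  ⟨fun x => χ x • h (chartAt E c x),
    χ.contMDiff_smul (hh.contMDiff.comp_contMDiffOn contMDiffOn_chart)⟩

variable {c : X} (χ : SmoothBumpFunction 𝓘(ℝ, E) c) {h : E → ℂ} (hh : ContDiff ℝ ∞ h)

theorem bump_apply (x : X) : bump χ h hh x = χ x • h (chartAt E c x) := rfl

theorem bump_apply_self : bump χ h hh c = h (chartAt E c c) := by
  rw [bump_apply, χ.eq_one, one_smul]

theorem bump_eventuallyEq : (bump χ h hh : X → ℂ) =ᶠ[𝓝 c] fun x => h (chartAt E c x) := by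
  filter_upwards [χ.eventuallyEq_one] with x hx
  rw [bump_apply, hx, Pi.one_apply, one_smul]

theorem chartDeriv_bump : chartDeriv (E := E) c (bump χ h hh) c = fderiv ℝ h (chartAt E c c) := by
  rw [chartDeriv_congr (mem_chart_source E c) (bump_eventuallyEq χ hh),
    chartDeriv_comp_chart (mem_chart_source E c)]

end SmoothFun

variable [FiniteDimensional ℂ E] [T2Space X] [IsManifold 𝓘(ℝ, E) ∞ X]

/-- A function vanishing near `x` is unchanged by multiplication with some function that vanishes
at `x`. -/
theorem exists_mul_eq_self {u : SmoothFun E X} {x : X} (hu : ∀ᶠ y in 𝓝 x, u y = 0) :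
    ∃ g : SmoothFun E X, g x = 0 ∧ g * u = u := by
  obtain ⟨χ, -, hχ⟩ := (SmoothBumpFunction.nhds_basis_support (I := 𝓘(ℝ, E)) hu).mem_iff.mp hu
  refine ⟨1 - SmoothFun.bump χ (fun _ => 1) contDiff_const, ?_, SmoothFun.ext fun y => ?_⟩
  · change 1 - SmoothFun.bump χ (fun _ => 1) contDiff_const x = 0
    rw [SmoothFun.bump_apply_self, sub_self]
  · change (1 - χ y • (1 : ℂ)) * u y = u y
    by_cases hy : χ y = 0
    · rw [hy, zero_smul, sub_zero, one_mul]
    · rw [show u y = 0 from hχ hy, mul_zero]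

/-- Differential operators are local. -/
theorem apply_eq_zero_of_eventually_eq_zero {w : Module.End ℂ (SmoothFun E X)}
    (hw : w ∈ baseDiffOp (SmoothFun E X)) {u : SmoothFun E X} {x : X}
    (hu : ∀ᶠ y in 𝓝 x, u y = 0) : (w u) x = 0 := by
  obtain ⟨n, hn⟩ := mem_baseDiffOp.mp hw
  obtain ⟨g, hg, hgu⟩ := exists_mul_eq_self hu
  clear hw
  induction n generalizing w with
  | zero =>
    rw [(Submodule.mem_bot _).mp hn]; rfl
  | succ n ih =>
    have h1 := ih (mem_baseDiffOpLT_succ.mp hn g)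
    have h2 : w u = commFun g w u + g * w u := by rw [commFun_apply, hgu, sub_add_cancel]
    rw [h2]
    change (commFun g w u) x + g x * (w u) x = 0
    rw [h1, hg, zero_mul, add_zero]

theorem derivation_apply_eq_zero_of_eventually_eq_zero
    (D : Derivation ℂ (SmoothFun E X) (SmoothFun E X)) {u : SmoothFun E X} {x : X}
    (hu : ∀ᶠ y in 𝓝 x, u y = 0) : (D u) x = 0 := by
  obtain ⟨g, hg, hgu⟩ := exists_mul_eq_self hu
  rw [← hgu, D.leibniz]
  change g x * (D u) x + u x * (D g) x = 0
  rw [hg, hu.self_of_nhds, zero_mul, zero_mul, add_zero]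

/-- A derivation at `x` depends only on the differential at `x`. -/
theorem derivation_apply_eq_zero_of_chartDeriv
    (D : Derivation ℂ (SmoothFun E X) (SmoothFun E X)) {g : SmoothFun E X} {x : X}
    (hg : chartDeriv (E := E) x g x = 0) : (D g) x = 0 := by
  set y₀ := chartAt E x x with hy₀
  let χ : SmoothBumpFunction 𝓘(ℝ, E) x := Classical.arbitrary _
  have htarget : tsupport χ.toContDiffBump ⊆ (chartAt E x).target := by
    rw [χ.toContDiffBump.tsupport_eq]
    have := χ.closedBall_subset
    simpa using this
  have hF₀ : ContDiff ℝ ∞ fun y => χ.toContDiffBump y • g ((chartAt E x).symm y) := by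
    refine contDiff_iff_contDiffAt.mpr fun y => ?_
    by_cases hy : y ∈ tsupport χ.toContDiffBump
    · exact χ.toContDiffBump.contDiffAt.smul
        ((contDiffOn_comp_chart_symm x g.contMDiff).contDiffAt
          ((chartAt E x).open_target.mem_nhds (htarget hy)))
    · refine (contDiffAt_const (c := (0 : ℂ))).congr_of_eventuallyEq ?_
      filter_upwards [notMem_tsupport_iff_eventuallyEq.mp hy] with z hz
      rw [hz, Pi.zero_apply, zero_smul]
  have hF : ContDiff ℝ ∞ fun y => χ.toContDiffBump (y + y₀) • g ((chartAt E x).symm (y + y₀)) :=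
    hF₀.comp (contDiff_id.add contDiff_const)
  obtain ⟨H, hH, hFH, hH0⟩ := exists_eq_add_apply hF
  have hH0 : H 0 = 0 := by
    rw [hH0, ← hg, chartDeriv, fderiv_comp_add_right
      (f := fun y => χ.toContDiffBump y • g ((chartAt E x).symm y)), zero_add]
    refine Filter.EventuallyEq.fderiv_eq ?_
    filter_upwards [χ.toContDiffBump.eventuallyEq_one] with y hy
    rw [hy, Pi.one_apply, one_smul]; rfl
  let β := finBasis ℝ E
  have ha : ∀ j, ContDiff ℝ ∞ fun y => ((β.coord j (y - y₀) : ℝ) : ℂ) := fun j =>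
    Complex.ofRealCLM.contDiff.comp ((β.coord j).toContinuousLinearMap.contDiff.comp
      (contDiff_id.sub contDiff_const))
  have hb : ∀ j, ContDiff ℝ ∞ fun y => H (y - y₀) (β j) := fun j =>
    (hH.comp (contDiff_id.sub contDiff_const)).clm_apply contDiff_const
  let a j := SmoothFun.bump χ _ (ha j)
  let b j := SmoothFun.bump χ _ (hb j)
  have ha0 : ∀ j, a j x = 0 := fun j => by
    rw [SmoothFun.bump_apply_self, sub_self, map_zero, Complex.ofReal_zero]
  have hb0 : ∀ j, b j x = 0 := fun j => by
    rw [SmoothFun.bump_apply_self, sub_self, hH0]; rfl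
  have hloc : ∀ᶠ y in 𝓝 x, (g - algebraMap ℂ (SmoothFun E X) (g x) - ∑ j, a j * b j) y = 0 := by
    filter_upwards [χ.eventuallyEq_one, (chartAt E x).open_source.mem_nhds (mem_chart_source E x)]
      with y hy hys
    have h1 := hFH (chartAt E x y - y₀)
    simp only [sub_add_cancel, zero_add, (chartAt E x).left_inv hys] at h1
    have h2 : χ.toContDiffBump (chartAt E x y) = 1 := by
      rw [χ.eqOn_source hys] at hy
      exact hy
    rw [h2, one_smul, hy₀, (chartAt E x).left_inv (mem_chart_source E x), ← hy₀,
      show χ.toContDiffBump y₀ = 1 from χ.toContDiffBump.eventuallyEq_one.self_of_nhds,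
      one_smul] at h1
    change g y - g x - (∑ j, a j * b j) y = 0
    rw [SmoothFun.sum_apply, h1, add_sub_cancel_left]
    have h3 : H (chartAt E x y - y₀) (chartAt E x y - y₀)
        = ∑ j, β.coord j (chartAt E x y - y₀) • H (chartAt E x y - y₀) (β j) := by
      conv_lhs => arg 2; rw [← β.sum_repr (chartAt E x y - y₀)]
      rw [map_sum]
      exact Finset.sum_congr rfl fun j _ => map_smul _ _ _
    rw [h3, ← Finset.sum_sub_distrib]
    refine Finset.sum_eq_zero fun j _ => sub_eq_zero.mpr ?_
    change _ = (χ y • ((β.coord j (chartAt E x y - y₀) : ℝ) : ℂ)) * (χ y • _)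
    rw [hy, Pi.one_apply, one_smul, one_smul, Complex.real_smul]
  have h3 := derivation_apply_eq_zero_of_eventually_eq_zero D hloc
  have h4 : D (g - algebraMap ℂ (SmoothFun E X) (g x) - ∑ j, a j * b j)
      = D g - ∑ j, (a j * D (b j) + b j * D (a j)) := by
    rw [map_sub, map_sub, D.map_algebraMap, sub_zero, map_sum]
    simp only [D.leibniz, smul_eq_mul]
  rw [h4] at h3
  change (D g) x - (∑ j, (a j * D (b j) + b j * D (a j))) x = 0 at h3
  rw [SmoothFun.sum_apply, Finset.sum_eq_zero, sub_zero] at h3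
  · exact h3
  · intro j _
    change a j x * (D (b j)) x + b j x * (D (a j)) x = 0
    rw [ha0, hb0, zero_mul, zero_mul, add_zero]

theorem holomorphicNear_of_eventuallyEq [IsManifold 𝓘(ℂ, E) ω X] {M : E →L[ℝ] ℂ}
    (hM : ∀ v, M (Complex.I • v) = Complex.I * M v) {u : X → ℂ} {x : X} {y₀ : E}
    (hu : u =ᶠ[𝓝 x] fun y => M (chartAt E x y - y₀)) : HolomorphicNear (E := E) u x := by
  have : IsManifold 𝓘(ℂ, E) 1 X := IsManifold.of_le (n := ω) (by simp)
  let M' : E →ₗ[ℂ] ℂ :=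
    { toFun := M
      map_add' := map_add M
      map_smul' := fun a v => by
        have h1 : a • v = a.re • v + a.im • (Complex.I • v) := by
          conv_lhs => rw [← Complex.re_add_im a, add_smul, mul_smul]
          rfl
        rw [h1, map_add, map_smul, map_smul, hM, RingHom.id_apply, Complex.real_smul,
          Complex.real_smul, smul_eq_mul]
        conv_rhs => rw [← Complex.re_add_im a]
        ring }
  filter_upwards [eventually_eventually_nhds.mpr hu,
    (chartAt E x).open_source.mem_nhds (mem_chart_source E x)] with y hy hys
  refine MDifferentiableAt.congr_of_eventuallyEq ?_ hy
  have h1 : DifferentiableAt ℂ (fun z => M'.toContinuousLinearMap (z - y₀)) (chartAt E x y) :=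
    M'.toContinuousLinearMap.differentiableAt.comp _ (differentiableAt_id.sub_const y₀)
  exact h1.mdifferentiableAt.comp y (mdifferentiableAt_atlas (chart_mem_atlas E x) hys)

/-- In a chart, the derivative of a holomorphic function is complex linear. -/
theorem chartDeriv_I_smul [IsManifold 𝓘(ℂ, E) ω X] {c x : X} (hx : x ∈ (chartAt E c).source)
    {u : X → ℂ} (hu : HolomorphicNear (E := E) u x) (v : E) :
    chartDeriv (E := E) c u x (Complex.I • v) = Complex.I * chartDeriv c u x v := by
  have : IsManifold 𝓘(ℂ, E) 1 X := IsManifold.of_le (n := ω) (by simp)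
  have h1 := (mdifferentiableAt_iff_source_of_mem_source hx).mp hu.self_of_nhds
  simp only [mfld_simps, mdifferentiableWithinAt_univ] at h1
  have h2 := h1.differentiableAt
  rw [chartDeriv, h2.fderiv_restrictScalars ℝ]
  change fderiv ℂ _ _ (Complex.I • v) = Complex.I * fderiv ℂ _ _ v
  rw [map_smul, smul_eq_mul]

/-- To first order, a smooth function is the sum of a holomorphic and an antiholomorphic one. -/
theorem exists_holomorphic_antiholomorphic [IsManifold 𝓘(ℂ, E) ω X] (f : SmoothFun E X) (x : X) :
    ∃ ψ ψ' : SmoothFun E X, HolomorphicNear (E := E) ψ x ∧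
      HolomorphicNear (E := E) (fun y => starRingEnd ℂ (ψ' y)) x ∧ ψ x = 0 ∧
      ∀ D : Derivation ℂ (SmoothFun E X) (SmoothFun E X), (D f) x = (D ψ) x + (D ψ') x := by
  set y₀ := chartAt E x x with hy₀
  let χ : SmoothBumpFunction 𝓘(ℝ, E) x := Classical.arbitrary _
  set L := chartDeriv (E := E) x f x with hL
  let J : E →L[ℝ] E := (Complex.I • ContinuousLinearMap.id ℂ E).restrictScalars ℝ
  let P : E →L[ℝ] ℂ := (2⁻¹ : ℂ) • (L - Complex.I • L.comp J)
  let Q : E →L[ℝ] ℂ := (2⁻¹ : ℂ) • (L + Complex.I • L.comp J)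
  have hP : ∀ v, P v = 2⁻¹ * (L v - Complex.I * L (Complex.I • v)) := fun v => rfl
  have hQ : ∀ v, Q v = 2⁻¹ * (L v + Complex.I * L (Complex.I • v)) := fun v => rfl
  have hII : ∀ v : E, Complex.I • Complex.I • v = -v := fun v => by
    rw [smul_smul, Complex.I_mul_I, neg_one_smul]
  have hsmooth : ∀ M : E →L[ℝ] ℂ, ContDiff ℝ ∞ fun y => M (y - y₀) := fun M =>
    M.contDiff.comp (contDiff_id.sub contDiff_const)
  have hfd : ∀ M : E →L[ℝ] ℂ, fderiv ℝ (fun y => M (y - y₀)) y₀ = M := fun M => by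
    exact (M.hasFDerivAt.comp y₀ ((hasFDerivAt_id y₀).sub_const y₀)).fderiv
  refine ⟨SmoothFun.bump χ _ (hsmooth P), SmoothFun.bump χ _ (hsmooth Q),
    holomorphicNear_of_eventuallyEq (M := P) (fun v => ?_) (SmoothFun.bump_eventuallyEq χ _),
    holomorphicNear_of_eventuallyEq (M := Complex.conjCLE.toContinuousLinearMap.comp Q)
      (y₀ := y₀) (fun v => ?_) ((SmoothFun.bump_eventuallyEq χ (hsmooth Q)).fun_comp _), ?_,
    fun D => ?_⟩
  · rw [hP, hP, hII, map_neg]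
    linear_combination (2⁻¹ * L (Complex.I • v)) * Complex.I_mul_I
  · change starRingEnd ℂ (Q (Complex.I • v)) = Complex.I * starRingEnd ℂ (Q v)
    have h : Q (Complex.I • v) = -Complex.I * Q v := by
      rw [hQ, hQ, hII, map_neg]
      linear_combination (2⁻¹ * L (Complex.I • v)) * Complex.I_mul_I
    rw [h, map_mul, map_neg, Complex.conj_I, neg_neg]
  · rw [SmoothFun.bump_apply_self, sub_self, map_zero]
  · rw [← sub_eq_zero, ← sub_sub]
    change (D f - D (SmoothFun.bump χ _ (hsmooth P)) - D (SmoothFun.bump χ _ (hsmooth Q))) x = 0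
    rw [← map_sub, ← map_sub]
    refine derivation_apply_eq_zero_of_chartDeriv D ?_
    rw [SmoothFun.chartDeriv_sub (mem_chart_source E x),
      SmoothFun.chartDeriv_sub (mem_chart_source E x), SmoothFun.chartDeriv_bump,
      SmoothFun.chartDeriv_bump, hfd, hfd]
    ext v
    change L v - P v - Q v = 0
    rw [hP, hQ]; ring

end SmoothDerivations

/-! ### Frames on complex manifolds -/

section ComplexManifold

open Module Set Topology Filter

variable (E : Type*) [NormedAddCommGroup E] [NormedSpace ℂ E] [FiniteDimensional ℂ E]
  (X : Type*) [TopologicalSpace X] [ChartedSpace E X]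

/-- Finitely many real functions together with local left inverses of their differential and a
subordinate partition of unity. -/
structure CotangentFrame (n : ℕ) where
  t : X → Fin n → ℝ
  contMDiff_t : ContMDiff 𝓘(ℝ, E) 𝓘(ℝ, Fin n → ℝ) ∞ t
  c : X → X
  U : X → Set X
  isOpen : ∀ k, IsOpen (U k)
  subset_source : ∀ k, U k ⊆ (chartAt E (c k)).source
  w : X → X → (Fin n → ℝ) →L[ℝ] E
  contMDiffOn_w : ∀ k, ContMDiffOn 𝓘(ℝ, E) 𝓘(ℝ, (Fin n → ℝ) →L[ℝ] E) ∞ (w k) (U k)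
  left_inv : ∀ k, ∀ x ∈ U k, ∀ v, w k x (chartDeriv (E := E) (c k) t x v) = v
  ρ : SmoothPartitionOfUnity X 𝓘(ℝ, E) X
  subordinate : ρ.IsSubordinate U

theorem exists_cotangentFrame [T2Space X] [SigmaCompactSpace X] [IsManifold 𝓘(ℝ, E) ∞ X] :
    ∃ n, Nonempty (CotangentFrame E X n) := by
  obtain ⟨n, t, ht, himm⟩ := exists_immersion E X
  choose c hc hinj using himm
  have hS : ∀ k, ∃ S : (Fin n → ℝ) →L[ℝ] E,
      S.comp (chartDeriv (E := E) (c k) t k) = ContinuousLinearMap.id ℝ E := fun k => by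
    obtain ⟨S, hS⟩ := LinearMap.exists_leftInverse_of_injective
      (chartDeriv (E := E) (c k) t k : E →ₗ[ℝ] Fin n → ℝ)
      (LinearMap.ker_eq_bot'.mpr fun v hv => hinj k v hv)
    exact ⟨S.toContinuousLinearMap, ContinuousLinearMap.ext fun v => LinearMap.congr_fun hS v⟩
  choose S hS using hS
  have : CompleteSpace E := FiniteDimensional.complete ℂ E
  let T (k x : X) : E →L[ℝ] E := (S k).comp (chartDeriv (E := E) (c k) t x)
  have hT : ∀ k, ContMDiffOn 𝓘(ℝ, E) 𝓘(ℝ, E →L[ℝ] E) ∞ (T k) (chartAt E (c k)).source :=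
    fun k => contMDiffOn_const.clm_comp (contMDiffOn_chartDeriv (c k) ht)
  let U (k : X) : Set X := (chartAt E (c k)).source ∩ T k ⁻¹' {A | IsUnit A}
  have hU : ∀ k, IsOpen (U k) := fun k =>
    (hT k).continuousOn.isOpen_inter_preimage (chartAt E (c k)).open_source Units.isOpen
  have hkU : ∀ k, k ∈ U k := fun k => ⟨hc k, by
    change IsUnit (T k k)
    rw [show T k k = 1 from hS k]
    exact isUnit_one⟩
  obtain ⟨ρ, hρ⟩ := SmoothPartitionOfUnity.exists_isSubordinate 𝓘(ℝ, E) isClosed_univ U hU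
    fun x _ => mem_iUnion.mpr ⟨x, hkU x⟩
  refine ⟨n, ⟨{
    t, contMDiff_t := ht, c, U, isOpen := hU, subset_source := fun k => inter_subset_left
    w := fun k x => (Ring.inverse (T k x)).comp (S k)
    contMDiffOn_w := fun k x hx => ?_
    left_inv := fun k x hx v => ?_
    ρ, subordinate := hρ }⟩⟩
  · obtain ⟨A, hA⟩ := hx.2
    have h1 : ContDiffAt ℝ ∞ Ring.inverse (T k x) := hA ▸ contDiffAt_ringInverse ℝ A
    exact ((h1.contMDiffAt.comp_contMDiffWithinAt x
      ((hT k).mono inter_subset_left x hx)).clm_comp contMDiffWithinAt_const)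
  · exact DFunLike.congr_fun (Ring.inverse_mul_cancel _ hx.2) v

namespace CotangentFrame

variable {E X} {n : ℕ} (σ : CotangentFrame E X n)

theorem mem_U {k x : X} (hk : k ∈ σ.ρ.finsupport x) : x ∈ σ.U k :=
  σ.subordinate k (subset_closure ((SmoothPartitionOfUnity.mem_finsupport _ _).mp hk))

theorem mem_source {k x : X} (hk : k ∈ σ.ρ.finsupport x) : x ∈ (chartAt E (σ.c k)).source :=
  σ.subset_source k (σ.mem_U hk)

/-- The component of a given type of the local vector field dual to the `i`-th function. -/
def localDeriv (a : ℂ) (i : Fin n) (k : X) (f : X → ℂ) (x : X) : ℂ :=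
  2⁻¹ * (chartDeriv (E := E) (σ.c k) f x (σ.w k x (Pi.single i 1))
    + a * chartDeriv (E := E) (σ.c k) f x (Complex.I • σ.w k x (Pi.single i 1)))

variable [T2Space X] [IsManifold 𝓘(ℝ, E) ∞ X]

theorem localDeriv_add (a : ℂ) (i : Fin n) {k x : X} (hk : k ∈ σ.ρ.finsupport x)
    (f g : SmoothFun E X) : σ.localDeriv a i k (⇑f + ⇑g) x
      = σ.localDeriv a i k f x + σ.localDeriv a i k g x := by
  rw [localDeriv, chartDeriv_add (σ.mem_source hk) f.contMDiff g.contMDiff,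
    ContinuousLinearMap.add_apply, ContinuousLinearMap.add_apply, localDeriv, localDeriv]
  ring

theorem localDeriv_const (a : ℂ) (i : Fin n) (k x : X) (b : ℂ) :
    σ.localDeriv a i k (fun _ => b) x = 0 := by
  rw [localDeriv, chartDeriv_const]; simp

theorem localDeriv_mul (a : ℂ) (i : Fin n) {k x : X} (hk : k ∈ σ.ρ.finsupport x)
    (f g : SmoothFun E X) : σ.localDeriv a i k (⇑f * ⇑g) x
      = f x * σ.localDeriv a i k g x + g x * σ.localDeriv a i k f x := by
  rw [localDeriv, chartDeriv_mul (σ.mem_source hk) f.contMDiff g.contMDiff,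
    ContinuousLinearMap.add_apply, ContinuousLinearMap.add_apply, localDeriv, localDeriv]
  simp only [ContinuousLinearMap.smul_apply, smul_eq_mul]
  ring

theorem finsum_localDeriv (a : ℂ) (i : Fin n) (f : X → ℂ) (x : X) :
    ∑ᶠ k, σ.ρ k x • σ.localDeriv a i k f x
      = ∑ k ∈ σ.ρ.finsupport x, σ.ρ k x • σ.localDeriv a i k f x :=
  (σ.ρ.sum_finsupport_smul_eq_finsum x fun k x => σ.localDeriv a i k f x).symm

theorem contMDiff_finsum_localDeriv (a : ℂ) (i : Fin n) (f : SmoothFun E X) :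
    ContMDiff 𝓘(ℝ, E) 𝓘(ℝ, ℂ) ∞ fun x => ∑ᶠ k, σ.ρ k x • σ.localDeriv a i k f x := by
  refine σ.subordinate.contMDiff_finsum_smul σ.isOpen fun k => ?_
  have h1 := (contMDiffOn_chartDeriv (σ.c k) f.contMDiff).mono (σ.subset_source k)
  have h2 := (σ.contMDiffOn_w k).clm_apply (contMDiffOn_const (c := Pi.single i (1 : ℝ)))
  have h3 : ContMDiffOn 𝓘(ℝ, E) 𝓘(ℝ, E) ∞
      (fun x => Complex.I • σ.w k x (Pi.single i 1)) (σ.U k) :=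
    ((Complex.I • ContinuousLinearMap.id ℂ E).restrictScalars ℝ).contMDiff.comp_contMDiffOn h2
  exact (ContinuousLinearMap.mul ℝ ℂ 2⁻¹).contMDiff.comp_contMDiffOn ((h1.clm_apply h2).add
    ((ContinuousLinearMap.mul ℝ ℂ a).contMDiff.comp_contMDiffOn (h1.clm_apply h3)))

/-- The vector fields dual to the functions of the frame, projected to one type. -/
def deriv (a : ℂ) (i : Fin n) : Derivation ℂ (SmoothFun E X) (SmoothFun E X) :=
  have hmul (f g : SmoothFun E X) (x : X) : ∑ᶠ k, σ.ρ k x • σ.localDeriv a i k (⇑f * ⇑g) x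
      = f x * (∑ᶠ k, σ.ρ k x • σ.localDeriv a i k g x)
        + g x * ∑ᶠ k, σ.ρ k x • σ.localDeriv a i k f x := by
    rw [finsum_localDeriv, finsum_localDeriv, finsum_localDeriv, Finset.mul_sum, Finset.mul_sum,
      ← Finset.sum_add_distrib]
    refine Finset.sum_congr rfl fun k hk => ?_
    rw [σ.localDeriv_mul a i hk, mul_smul_comm, mul_smul_comm, smul_add]
  Derivation.mk'
    { toFun := fun f => ⟨_, σ.contMDiff_finsum_localDeriv a i f⟩
      map_add' := fun f g => SmoothFun.ext fun x => by
        change ∑ᶠ k, σ.ρ k x • σ.localDeriv a i k (⇑f + ⇑g) x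
          = (∑ᶠ k, σ.ρ k x • σ.localDeriv a i k f x) + ∑ᶠ k, σ.ρ k x • σ.localDeriv a i k g x
        rw [finsum_localDeriv, finsum_localDeriv, finsum_localDeriv, ← Finset.sum_add_distrib]
        refine Finset.sum_congr rfl fun k hk => ?_
        rw [σ.localDeriv_add a i hk, smul_add]
      map_smul' := fun b f => SmoothFun.ext fun x => by
        refine (hmul (algebraMap ℂ _ b) f x).trans ?_
        have h : ∑ᶠ k, σ.ρ k x • σ.localDeriv a i k (algebraMap ℂ (SmoothFun E X) b) x = 0 := by
          rw [finsum_localDeriv]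
          exact Finset.sum_eq_zero fun k _ => by
            rw [show σ.localDeriv a i k (algebraMap ℂ (SmoothFun E X) b) x = 0 from
              σ.localDeriv_const a i k x b, smul_zero]
        rw [h, mul_zero, add_zero]
        rfl }
    fun f g => SmoothFun.ext fun x => hmul f g x

theorem deriv_apply (a : ℂ) (i : Fin n) (f : SmoothFun E X) (x : X) : (σ.deriv a i f) x
    = ∑ k ∈ σ.ρ.finsupport x, σ.ρ k x • σ.localDeriv a i k f x :=
  σ.finsum_localDeriv a i f x

/-- The functions of the frame, as complex valued functions. -/
def coordFun (i : Fin n) : SmoothFun E X :=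
  ⟨fun x => (σ.t x i : ℂ), (Complex.ofRealCLM.comp
    (ContinuousLinearMap.proj (R := ℝ) (φ := fun _ : Fin n => ℝ) i)).contMDiff.comp σ.contMDiff_t⟩

theorem deriv_mem_T01 [IsManifold 𝓘(ℂ, E) ω X] (i : Fin n) : σ.deriv Complex.I i ∈ T01 E X := by
  intro f x hf
  rw [deriv_apply]
  refine Finset.sum_eq_zero fun k hk => ?_
  rw [localDeriv, chartDeriv_I_smul (σ.mem_source hk) hf, ← mul_assoc, Complex.I_mul_I]
  simp

theorem deriv_mem_T10 [IsManifold 𝓘(ℂ, E) ω X] (i : Fin n) :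
    σ.deriv (-Complex.I) i ∈ T10 E X := by
  intro f x hf
  rw [deriv_apply]
  refine Finset.sum_eq_zero fun k hk => ?_
  have h1 : ∀ v, chartDeriv (E := E) (σ.c k) f x (Complex.I • v)
      = -Complex.I * chartDeriv (E := E) (σ.c k) f x v := fun v => by
    have h2 := chartDeriv_I_smul (σ.mem_source hk) hf v
    have h3 := chartDeriv_clm_comp (σ.mem_source hk) f.contMDiff
      Complex.conjCLE.toContinuousLinearMap
    have h4 : (fun y => starRingEnd ℂ (f y))
      = fun y => Complex.conjCLE.toContinuousLinearMap (f y) := rfl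
    rw [h4, h3] at h2
    change starRingEnd ℂ (chartDeriv (E := E) (σ.c k) f x (Complex.I • v))
      = Complex.I * starRingEnd ℂ (chartDeriv (E := E) (σ.c k) f x v) at h2
    apply (starRingEnd ℂ).injective
    rw [h2, map_mul, map_neg, Complex.conj_I, neg_neg]
  rw [localDeriv, h1, ← mul_assoc, neg_mul_neg, Complex.I_mul_I]
  simp

theorem deriv_add_deriv_apply (i : Fin n) (f : SmoothFun E X) (x : X) :
    (σ.deriv Complex.I i f) x + (σ.deriv (-Complex.I) i f) x = ∑ k ∈ σ.ρ.finsupport x,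
      σ.ρ k x • chartDeriv (E := E) (σ.c k) f x (σ.w k x (Pi.single i 1)) := by
  rw [deriv_apply, deriv_apply, ← Finset.sum_add_distrib]
  refine Finset.sum_congr rfl fun k _ => ?_
  rw [← smul_add, localDeriv, localDeriv]
  congr 1; ring

theorem derivation_apply (D : Derivation ℂ (SmoothFun E X) (SmoothFun E X))
    (f : SmoothFun E X) (x : X) : (D f) x = ∑ i, (D (σ.coordFun i)) x
      * ((σ.deriv Complex.I i f) x + (σ.deriv (-Complex.I) i f) x) := by
  set a : Fin n → ℂ := fun i => (σ.deriv Complex.I i f) x + (σ.deriv (-Complex.I) i f) x with ha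
  let Λ : (Fin n → ℝ) →L[ℝ] ℂ := ∑ i,
    (ContinuousLinearMap.proj (R := ℝ) (φ := fun _ : Fin n => ℝ) i).smulRight (a i)
  have hΛ : ∀ s, Λ s = ∑ i, s i • a i := fun s => by
    simp only [Λ, ContinuousLinearMap.sum_apply, ContinuousLinearMap.smulRight_apply,
      ContinuousLinearMap.proj_apply]
  have hfun : ((∑ i, a i • σ.coordFun i : SmoothFun E X) : X → ℂ) = fun y => Λ (σ.t y) := by
    funext y
    rw [SmoothFun.sum_apply, hΛ]
    refine Finset.sum_congr rfl fun i _ => ?_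
    change a i * (σ.t y i : ℂ) = _
    rw [Complex.real_smul, mul_comm]
  have hx := mem_chart_source E x
  have hd : chartDeriv (E := E) x (f - ∑ i, a i • σ.coordFun i : SmoothFun E X) x = 0 := by
    rw [SmoothFun.chartDeriv_sub hx, hfun, chartDeriv_clm_comp hx σ.contMDiff_t]
    ext v
    rw [ContinuousLinearMap.sub_apply, ContinuousLinearMap.comp_apply, hΛ,
      ContinuousLinearMap.zero_apply, sub_eq_zero]
    have h1 : ∀ k ∈ σ.ρ.finsupport x, ∑ i, chartDeriv (E := E) x σ.t x v i
        • chartDeriv (E := E) (σ.c k) f x (σ.w k x (Pi.single i 1))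
        = chartDeriv (E := E) x f x v := fun k hk => by
      have h2 : ∀ s : Fin n → ℝ, ∑ i, s i • chartDeriv (E := E) (σ.c k) f x
          (σ.w k x (Pi.single i 1)) = chartDeriv (E := E) (σ.c k) f x (σ.w k x s) := fun s => by
        conv_rhs => rw [pi_eq_sum_univ' s]
        simp only [map_sum, map_smul]
      rw [h2, chartDeriv_eq_comp hx (σ.mem_source hk) σ.contMDiff_t,
        chartDeriv_eq_comp hx (σ.mem_source hk) f.contMDiff, ContinuousLinearMap.comp_apply,
        σ.left_inv k x (σ.mem_U hk), ContinuousLinearMap.comp_apply]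
    have h3 : ∑ k ∈ σ.ρ.finsupport x, σ.ρ k x = 1 := σ.ρ.sum_finsupport x (mem_univ x)
    simp only [ha, deriv_add_deriv_apply, Finset.smul_sum]
    rw [Finset.sum_comm]
    simp only [smul_comm _ (σ.ρ _ x)]
    refine Eq.trans (b := (∑ k ∈ σ.ρ.finsupport x, σ.ρ k x) • chartDeriv (E := E) x f x v)
      (by rw [h3, one_smul]) ?_
    rw [Finset.sum_smul]
    refine Finset.sum_congr rfl fun k hk => ?_
    rw [← Finset.smul_sum, h1 k hk]
  have h0 := derivation_apply_eq_zero_of_chartDeriv D hd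
  rw [map_sub, map_sum] at h0
  change (D f) x - (∑ i, D (a i • σ.coordFun i)) x = 0 at h0
  rw [SmoothFun.sum_apply] at h0
  rw [sub_eq_zero.mp h0]
  refine Finset.sum_congr rfl fun i _ => ?_
  rw [D.map_smul]
  exact mul_comm _ _

end CotangentFrame

variable {E X} [T2Space X] [IsManifold 𝓘(ℝ, E) ∞ X] [IsManifold 𝓘(ℂ, E) ω X]

theorem eq_zero_of_mem_T01_of_mem_T10 {D : Derivation ℂ (SmoothFun E X) (SmoothFun E X)}
    (h01 : D ∈ T01 E X) (h10 : D ∈ T10 E X) : D = 0 :=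
  Derivation.ext fun f => SmoothFun.ext fun x => by
    obtain ⟨ψ, ψ', hψ, hψ', -, hD⟩ := exists_holomorphic_antiholomorphic f x
    rw [hD, h01 ψ x hψ, h10 ψ' x hψ', add_zero]; rfl

/-- A frame of the complexified tangent bundle, adapted to the types. -/
def CotangentFrame.toFrame {n : ℕ} (σ : CotangentFrame E X n) : Frame (T01 E X) (T10 E X) n :=
  have hsum : ∀ D : Derivation ℂ (SmoothFun E X) (SmoothFun E X),
      D = ∑ i, D (σ.coordFun i) • (σ.deriv Complex.I i + σ.deriv (-Complex.I) i) := fun D =>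
    Derivation.ext fun f => SmoothFun.ext fun x => by
      have h : (∑ i, D (σ.coordFun i) • (σ.deriv Complex.I i + σ.deriv (-Complex.I) i)) f
          = ∑ i, D (σ.coordFun i) * (σ.deriv Complex.I i f + σ.deriv (-Complex.I) i f) :=
        derivation_sum_apply _ _ _
      rw [σ.derivation_apply D f x, h, SmoothFun.sum_apply]
      rfl
  have hsplit : ∀ D : Derivation ℂ (SmoothFun E X) (SmoothFun E X),
      D - ∑ i, D (σ.coordFun i) • σ.deriv Complex.I i
        = ∑ i, D (σ.coordFun i) • σ.deriv (-Complex.I) i := fun D => by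
    conv_lhs => arg 1; rw [hsum D]
    simp only [smul_add, Finset.sum_add_distrib, add_sub_cancel_left]
  have hF : ∀ D : Derivation ℂ (SmoothFun E X) (SmoothFun E X),
      ∑ i, D (σ.coordFun i) • σ.deriv Complex.I i ∈ T01 E X := fun D =>
    Submodule.sum_mem (T01 E X).toSubmodule fun i _ =>
      Submodule.smul_mem _ _ (σ.deriv_mem_T01 i)
  have hB : ∀ D : Derivation ℂ (SmoothFun E X) (SmoothFun E X),
      ∑ i, D (σ.coordFun i) • σ.deriv (-Complex.I) i ∈ T10 E X := fun D =>
    Submodule.sum_mem _ fun i _ => Submodule.smul_mem _ _ (σ.deriv_mem_T10 i)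
  { x := σ.coordFun
    e := fun i => ⟨σ.deriv Complex.I i, σ.deriv_mem_T01 i⟩
    b := fun i => ⟨σ.deriv (-Complex.I) i, σ.deriv_mem_T10 i⟩
    expand := hsum
    expand_left := fun v => by
      have h : (v : Derivation ℂ (SmoothFun E X) (SmoothFun E X)) - _ = 0 :=
        eq_zero_of_mem_T01_of_mem_T10 (Submodule.sub_mem (T01 E X).toSubmodule v.2 (hF v))
          (hsplit v ▸ hB v)
      exact Subtype.ext ((sub_eq_zero.mp h).trans (map_sum (T01 E X).toSubmodule.subtype
        (fun i => v.1 (σ.coordFun i) • (⟨_, σ.deriv_mem_T01 i⟩ : T01 E X)) _).symm)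
    expand_right := fun v => by
      have h : (v : Derivation ℂ (SmoothFun E X) (SmoothFun E X)) - _ = 0 :=
        eq_zero_of_mem_T01_of_mem_T10 (by rw [sub_sub_cancel]; exact hF v)
          (Submodule.sub_mem _ v.2 (hsplit v ▸ hB v))
      exact Subtype.ext (((sub_eq_zero.mp h).trans (hsplit v)).trans (map_sum (T10 E X).subtype
        (fun i => v.1 (σ.coordFun i) • (⟨_, σ.deriv_mem_T10 i⟩ : T10 E X)) _).symm)
    disjoint := fun D h01 h10 => eq_zero_of_mem_T01_of_mem_T10 h01 h10 }

variable (E) in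
/-- The points of a complex manifold, as points of its space of leaves. -/
def leafPoint (x : X) : LeafPoint (T01 E X) (T10 E X) where
  ev := SmoothFun.evalHom E x
  basic :=
    { carrier := {ψ | HolomorphicNear (E := E) ψ x}
      mul_mem' := fun {ψ ψ'} h h' => by
        filter_upwards [h, h'] with y hy hy'
        exact hy.mul hy'
      one_mem' := Filter.Eventually.of_forall fun y => mdifferentiableAt_const }
  leaf := fun w hw v ψ hψ => apply_eq_zero_of_eventually_eq_zero hw <| by
    filter_upwards [eventually_eventually_nhds.mpr hψ] with y hy
    exact v.2 ψ y hy
  lift := fun f => by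
    obtain ⟨ψ, ψ', hψ, hψ', h0, hD⟩ := exists_holomorphic_antiholomorphic f x
    refine ⟨ψ, hψ, h0, fun b hb => ?_⟩
    change (b ψ) x = (b f) x
    rw [hD, hb ψ' x hψ', add_zero]

theorem eq_zero_of_leafPoint {f : SmoothFun E X}
    (hf : ∀ p : LeafPoint (T01 E X) (T10 E X), p.ev f = 0) : f = 0 :=
  SmoothFun.ext fun x => hf (leafPoint E x)

end ComplexManifold

end KapranovDolbeault

end

theorem corollary5p13
    {E : Type*} [NormedAddCommGroup E] [NormedSpace ℂ E] [FiniteDimensional ℂ E]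
    {X : Type*} [TopologicalSpace X] [T2Space X] [SigmaCompactSpace X]
    [ChartedSpace E X] [IsManifold 𝓘(ℂ, E) ω X]
    (nabla : AffineConnection (T01 E X)) (h_nabla : nabla.TorsionFree)
    (nabla10 : BaseConnection (T10 E X)) (h_nabla10 : nabla10.TorsionFree) :
    ∃ (pbw : SymVF (T01 E X) ≃ₗ[ℂ] GrDiffOp (T01 E X))
      (pbw10 : SymmetricAlgebra (SmoothFun E X) (T10 E X)
        ≃ₗ[SmoothFun E X] TransDiffOp (T01 E X)),
      IsPBW nabla pbw ∧ IsBasePBW nabla10 pbw10 ∧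
      Function.Bijective (toNormal E X) ∧
      -- the Kapranov `L∞[1]` algebra of `(T^{0,1}[1], ∂̄)`
      IsLInfty (vfDeg (T01 E X)) (kapranovBrackets pbw) ∧
      (∀ V : VF (T01 E X),
        ((kapranovBrackets pbw).ev [V] : Module.End ℂ (Form (T01 E X) (SmoothFun E X)))
          = dF (T01 E X) * (V : Module.End ℂ (Form (T01 E X) (SmoothFun E X)))
            - opParity (T01 E X) V * dF (T01 E X)) ∧
      -- the `L∞[1]` algebra on the Dolbeault complex `Ω^{0,•}(T^{1,0})`
      IsLInfty (formDeg (T01 E X) (T10 E X)) (dolbeaultBrackets pbw10) ∧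
      (∀ η : Form (T01 E X) (T10 E X),
        Form.map (toNormal E X) ((dolbeaultBrackets pbw10).ev [η])
          = (FModule.bott (T01 E X)).d (Form.map (toNormal E X) η)) ∧
      -- the quasi-isomorphism
      IsLInftyHom (vfDeg (T01 E X)) (formDeg (T01 E X) (T10 E X))
        (kapranovBrackets pbw) (dolbeaultBrackets pbw10) (comparisonMaps pbw pbw10) ∧
      IsQuasiIso (kapranovBrackets pbw) (dolbeaultBrackets pbw10) (comparisonMaps pbw pbw10) ∧
      IsFormMultilinear (comparisonMaps pbw pbw10) ∧
      (∀ V : VF (T01 E X),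
        Form.map (toNormal E X) ((comparisonMaps pbw pbw10).ev [V])
          = Form.map (T01 E X).toSubmodule.mkQ (pushforwardVF V)) := by
  have : IsManifold 𝓘(ℝ, E) ∞ X := isManifold_real
  obtain ⟨n, ⟨σ⟩⟩ := exists_cotangentFrame E X
  let φ := σ.toFrame
  have hsep : ∀ f : SmoothFun E X, (∀ p : LeafPoint (T01 E X) (T10 E X), p.ev f = 0) → f = 0 :=
    fun _ => eq_zero_of_leafPoint
  refine ⟨φ.pbwEquiv nabla, φ.transPbwEquiv nabla10 hsep, φ.isPBW nabla,
    φ.isBasePBW nabla10 hsep, ⟨?_, ?_⟩, φ.isLInfty_kapranov nabla, φ.kapranovBrackets_one nabla,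
    φ.isLInfty_dolbeault nabla10 hsep, φ.dolbeaultBrackets_one nabla10 hsep,
    φ.isLInftyHom_comparison nabla nabla10 hsep, φ.isQuasiIso_comparison nabla nabla10 hsep,
    φ.isFormMultilinear_comparison nabla nabla10 hsep, φ.comparisonMaps_one nabla nabla10 hsep⟩
  · rw [injective_iff_map_eq_zero]
    intro b hb
    exact Subtype.ext (φ.disjoint _ ((Submodule.Quotient.mk_eq_zero _).mp hb) b.2)
  · intro q
    obtain ⟨D, rfl⟩ := Submodule.Quotient.mk_surjective _ q
    obtain ⟨v, b, hD⟩ := φ.exists_decomposition D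
    refine ⟨b, (Submodule.Quotient.eq _).mpr ?_⟩
    have h : (b : Derivation ℂ (SmoothFun E X) (SmoothFun E X)) - D = -v := by rw [hD]; abel
    exact h ▸ Submodule.neg_mem (T01 E X).toSubmodule v.2
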